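/- Let $G=\{1,\tau\}$ be the group of order two and let $X$ be a paracompact Hausdorff space with a continuous involution (an action of $G$). Let $A^0$ be a unital $C^*$-algebra over $\mathbb R$ (a real Banach $*$-algebra that is $*$-isometrically isomorphic to a norm-closed algebra of bounded operators on a real Hilbert space), and let $\mathcal A^0$ be a locally trivial bundle of $*$-algebras on $X$ with fibre $A^0$ on which $G$ acts continuously by $*$-isomorphisms $\mathcal A^0_x\to\mathcal A^0_{\tau x}$; for example $\mathcal A^0=X\times A^0$ with $G$ acting trivially on $A^0$. For an algebra bundle $\mathcal B$ on $X$ with a $G$-action by algebra isomorphisms (a Real algebra bundle), a $G$-$\mathcal B$-bundle (or Real $\mathcal B$-bundle) is a locally trivial bundle $E$ of finitely generated projective left $\mathcal B$-modules with a continuous $G$-action covering that on $X$ such that $g(b\cdot e)=g(b)\cdot g(e)$. The Grothendieck group of the additive category of these bundles is denoted $K_G^{\mathcal B}(X)=KR^{\mathcal B}(X)$; for $\mathcal B=X\times A^0$ with $G$ acting trivially on $A^0$ it is the usual equivariant $K$-group $K_G^{A^0}(X)$ of $A^0$-linear $G$-bundles. If $\mathcal B$ carries a continuous $G$-equivariant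 $\mathbb R$-linear anti-involution $b\mapsto b^*$, a symmetric form on $E$ is an isomorphism $\psi:E\to E^*=\mathrm{Hom}_{\mathcal B}(E,\mathcal B)$ of Real $\mathcal B$-bundles such that $B(x,y)=\psi(x)y$ satisfies $B(y,x)=B(x,y)^*$, and $GR^{\mathcal B}(X)$ is the Grothendieck group of the category of symmetric forms $(E,\psi)$ under orthogonal sum. Put $\mathcal A^+=\mathcal A^0\otimes_{\mathbb R}M_2(\mathbb R)$, with $\tau$ acting by the given action on $\mathcal A^0$ and by conjugation with $\mathrm{diag}(1,-1)$ on $M_2(\mathbb R)$, and $\mathcal A=\mathcal A^0\otimes_{\mathbb R}\mathbb C$, with $\tau(a\otimes z)=\tau(a)\otimes\bar z$ and the anti-involution $a\otimes z\mapsto a^*\otimes z$. Then: (1) There is a canonical isomorphism $KR^{\mathcal A^+}(X)\cong K_G^{\mathcal A^0}(X)$. It sends the class of a Real $\mathcal A^+$-bundle $E$ to the class of the $G$-$\mathcal A^0$-bundle $e_{11}E$, where $e_{11}\in M_2(\mathbb R)$ is the matrix unit. (2) There is an isomorphism $GR^{\mathcal A}(X)\cong K_G^{\mathcal A^0}(X)$.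 It sends the class of $(E,\psi)$ to the class of any $G$-stable $\mathcal A^0$-subbundle $F\subset E$ with $E=F\oplus iF$ on which $B$ takes values in $\mathcal A^0$ and is positive, i.e. $B(v,v)=aa^*$ for some $a\in\mathcal A^0_x$ depending on $v\in F_x$; such an $F$ exists. (3) In particular $GR(X)\cong KO_G(X)$, where $GR(X)=GR^{\mathbb C}(X)$ is the Grothendieck-Witt group of symmetric forms on Real vector bundles (the bundle $X\times\mathbb C$ with complex conjugation and the identity as anti-involution), and $KO_G(X)=K_G^{\mathbb R}(X)$. -/

import Mathlib

open scoped TensorProduct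

noncomputable section

namespace TwistedK

universe u w

/-! ### Families of fibres and local trivializations -/

/-- The total space of a family of fibres over `X`. -/
abbrev Tot {X : Type w} (F : X → Type u) := Bundle.TotalSpace Unit F

/-- The fibrewise bijections `e x : F x ≃ M` (for `x ∈ V`) are a homeomorphism over `V` between the
part of the total space that lies over `V` and `V × M`. -/
def IsTrivializationOn {X : Type w} [TopologicalSpace X] {F : X → Type u}
    [TopologicalSpace (Tot F)] {M : Type u} [TopologicalSpace M] (V : Set X)
    (e : ∀ x : V, F x ≃ M) : Prop :=
  Continuous (fun p : {p : Tot F // p.proj ∈ V} =>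
    (((⟨p.1.proj, p.2⟩ : V), e ⟨p.1.proj, p.2⟩ p.1.snd) : V × M)) ∧
  Continuous (fun q : V × M => (⟨q.1.1, (e q.1).symm q.2⟩ : Tot F))

/-! ### `G`-algebra bundles -/

/-- A locally trivial bundle `𝒜` of topological `ℝ`-algebras with fibre `A` on a `G`-space `X`,
with a continuous action of `G` by algebra isomorphisms `𝒜_x → 𝒜_{gx}`. As part of the data, every
point `x₀` has a distinguished local trivialization (on the open set `dom x₀`). -/
structure GAlgBundle (G : Type) [Group G] [TopologicalSpace G] (X : Type w) [TopologicalSpace X]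
    [MulAction G X] (A : Type u) [Ring A] [Algebra ℝ A] [TopologicalSpace A] where
  Fib : X → Type u
  [ring : ∀ x, Ring (Fib x)]
  [algebra : ∀ x, Algebra ℝ (Fib x)]
  [top : TopologicalSpace (Tot Fib)]
  continuous_proj : Continuous (fun p : Tot Fib => p.proj)
  dom : X → Set X
  isOpen_dom : ∀ x₀, IsOpen (dom x₀)
  mem_dom : ∀ x₀, x₀ ∈ dom x₀
  chart : ∀ (x₀ : X) (x : dom x₀), Fib x ≃ₐ[ℝ] A
  chart_triv : ∀ x₀, IsTrivializationOn (dom x₀) (fun x => (chart x₀ x).toEquiv)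
  act : ∀ (g : G) (x : X), Fib x →ₐ[ℝ] Fib (g • x)
  act_one : ∀ (x : X) (a : Fib x), (⟨(1 : G) • x, act 1 x a⟩ : Tot Fib) = ⟨x, a⟩
  act_mul : ∀ (g h : G) (x : X) (a : Fib x),
    (⟨(g * h) • x, act (g * h) x a⟩ : Tot Fib) = ⟨g • h • x, act g (h • x) (act h x a)⟩
  continuous_act : Continuous
    (fun q : G × Tot Fib => (⟨q.1 • q.2.proj, act q.1 q.2.proj q.2.snd⟩ : Tot Fib))

attribute [instance] GAlgBundle.ring GAlgBundle.algebra GAlgBundle.top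

/-- The trivial algebra bundle `X × A`, for an action `ρ` of `G` on `A` by algebra automorphisms:
`g (x, a) = (g x, ρ g a)`. -/
def trivialBundle {G : Type} [Group G] [TopologicalSpace G] (X : Type w) [TopologicalSpace X]
    [MulAction G X] [ContinuousSMul G X] {A : Type u} [Ring A] [Algebra ℝ A] [TopologicalSpace A]
    (ρ : G →* (A ≃ₐ[ℝ] A)) (hρ : Continuous fun q : G × A => ρ q.1 q.2) : GAlgBundle G X A where
  Fib := fun _ => A
  top := TopologicalSpace.induced (fun p : Tot (fun _ : X => A) => (p.proj, p.snd)) inferInstance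
  continuous_proj := by
    let _ : TopologicalSpace (Tot (fun _ : X => A)) :=
      TopologicalSpace.induced (fun p : Tot (fun _ : X => A) => (p.proj, p.snd)) inferInstance
    have h : Continuous (fun p : Tot (fun _ : X => A) => (p.proj, p.snd)) := continuous_induced_dom
    exact continuous_fst.comp h
  dom := fun _ => Set.univ
  isOpen_dom := fun _ => isOpen_univ
  mem_dom := fun _ => Set.mem_univ _
  chart := fun _ _ => AlgEquiv.refl
  chart_triv := by
    intro x₀
    let _ : TopologicalSpace (Tot (fun _ : X => A)) :=
      TopologicalSpace.induced (fun p : Tot (fun _ : X => A) => (p.proj, p.snd)) inferInstance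
    have h : Continuous (fun p : Tot (fun _ : X => A) => (p.proj, p.snd)) := continuous_induced_dom
    refine ⟨?_, ?_⟩
    · exact ((continuous_fst.comp (h.comp continuous_subtype_val)).subtype_mk _).prodMk
        (continuous_snd.comp (h.comp continuous_subtype_val))
    · exact continuous_induced_rng.2
        ((continuous_subtype_val.comp continuous_fst).prodMk continuous_snd)
  act := fun g _ => (ρ g : A →ₐ[ℝ] A)
  act_one := by intro x a; simp
  act_mul := by intro g h x a; simp [mul_smul]
  continuous_act := by
    let _ : TopologicalSpace (Tot (fun _ : X => A)) :=
      TopologicalSpace.induced (fun p : Tot (fun _ : X => A) => (p.proj, p.snd)) inferInstance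
    have h : Continuous (fun p : Tot (fun _ : X => A) => (p.proj, p.snd)) := continuous_induced_dom
    refine continuous_induced_rng.2 ?_
    refine Continuous.prodMk ?_ ?_
    · exact continuous_fst.smul (continuous_fst.comp (h.comp continuous_snd))
    · exact hρ.comp (continuous_fst.prodMk (continuous_snd.comp (h.comp continuous_snd)))

/-- A continuous, `G`-equivariant, `ℝ`-linear anti-involution `a ↦ a^*` on an algebra bundle. -/
structure AntiInvolution {G : Type} [Group G] [TopologicalSpace G] {X : Type w}
    [TopologicalSpace X] [MulAction G X] {A : Type u} [Ring A] [Algebra ℝ A] [TopologicalSpace A]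
    (𝒜 : GAlgBundle G X A) where
  dag : ∀ x, 𝒜.Fib x →ₗ[ℝ] 𝒜.Fib x
  dag_dag : ∀ x a, dag x (dag x a) = a
  dag_mul : ∀ x a b, dag x (a * b) = dag x b * dag x a
  dag_act : ∀ g x a, dag (g • x) (𝒜.act g x a) = 𝒜.act g x (dag x a)
  continuous_dag : Continuous (fun p : Tot 𝒜.Fib => (⟨p.proj, dag p.proj p.snd⟩ : Tot 𝒜.Fib))

/-! ### Tensor product with a finite dimensional `G`-algebra -/

section Tensor

variable {A B A' B' : Type*} [Ring A] [Algebra ℝ A] [Ring B] [Algebra ℝ B]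
  [Ring A'] [Algebra ℝ A'] [Ring B'] [Algebra ℝ B']

/-- For a linear functional `f` on `B`, the map `A ⊗ B → A`, `a ⊗ b ↦ f(b) a`. -/
def slice (A : Type*) [Ring A] [Algebra ℝ A] {B : Type*} [Ring B] [Algebra ℝ B]
    (f : Module.Dual ℝ B) : A ⊗[ℝ] B →ₗ[ℝ] A :=
  (TensorProduct.rid ℝ A).toLinearMap ∘ₗ LinearMap.lTensor A f

/-- The topology of `A ⊗ B` (`B` finite dimensional): the coarsest one with continuous coordinates.
A basis of `B` identifies it with the product topology on `A^(dim B)`. -/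
instance tensorTopology [TopologicalSpace A] : TopologicalSpace (A ⊗[ℝ] B) :=
  ⨅ f : Module.Dual ℝ B, TopologicalSpace.induced (slice A f) inferInstance

theorem slice_map (f : Module.Dual ℝ B') (φ : A →ₗ[ℝ] A') (ψ : B →ₗ[ℝ] B') (t : A ⊗[ℝ] B) :
    slice A' f (TensorProduct.map φ ψ t) = φ (slice A (f ∘ₗ ψ) t) := by
  induction t using TensorProduct.induction_on with
  | zero => simp
  | tmul a b => simp [slice]
  | add s t hs ht => simp only [map_add, hs, ht]

end Tensor

section TensorBundle

variable {G : Type} [Group G] [TopologicalSpace G] {X : Type w}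
  [TopologicalSpace X] [MulAction G X] {A : Type u} [Ring A] [Algebra ℝ A] [TopologicalSpace A]

/-- The topology on the total space of `𝒜 ⊗ B`: the coarsest one with continuous coordinates. -/
instance tensorTotTopology (𝒜 : GAlgBundle G X A) (B : Type) [Ring B] [Algebra ℝ B] :
    TopologicalSpace (Tot fun x => 𝒜.Fib x ⊗[ℝ] B) :=
  ⨅ f : Module.Dual ℝ B, TopologicalSpace.induced
    (fun p => (⟨p.proj, slice (𝒜.Fib p.proj) f p.snd⟩ : Tot 𝒜.Fib)) inferInstance

theorem continuous_tensorTot_iff (𝒜 : GAlgBundle G X A) (B : Type) [Ring B] [Algebra ℝ B]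
    {Z : Type*} [TopologicalSpace Z] (φ : Z → Tot fun x => 𝒜.Fib x ⊗[ℝ] B) :
    Continuous φ ↔ ∀ f : Module.Dual ℝ B, Continuous
      (fun z => (⟨(φ z).proj, slice (𝒜.Fib (φ z).proj) f (φ z).snd⟩ : Tot 𝒜.Fib)) := by
  unfold tensorTotTopology
  rw [continuous_iInf_rng]
  exact forall_congr' fun f => continuous_induced_rng

theorem continuous_tensorTot_slice (𝒜 : GAlgBundle G X A) (B : Type) [Ring B] [Algebra ℝ B]
    (f : Module.Dual ℝ B) : Continuous
      (fun p : Tot (fun x => 𝒜.Fib x ⊗[ℝ] B) =>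
        (⟨p.proj, slice (𝒜.Fib p.proj) f p.snd⟩ : Tot 𝒜.Fib)) :=
  (continuous_tensorTot_iff 𝒜 B id).1 continuous_id f

/-- The algebra bundle `𝒜 ⊗ B`, for a finite dimensional algebra `B` with an action `β` of the
discrete group `G`; `G` acts diagonally. -/
def tensorBundle [DiscreteTopology G] (𝒜 : GAlgBundle G X A) (B : Type) [Ring B] [Algebra ℝ B] [Module.Finite ℝ B]
    (β : G →* (B ≃ₐ[ℝ] B)) : GAlgBundle G X (A ⊗[ℝ] B) where
  Fib := fun x => 𝒜.Fib x ⊗[ℝ] B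
  top := tensorTotTopology 𝒜 B
  continuous_proj := by
    exact 𝒜.continuous_proj.comp (continuous_tensorTot_slice 𝒜 B 0)
  dom := 𝒜.dom
  isOpen_dom := 𝒜.isOpen_dom
  mem_dom := 𝒜.mem_dom
  chart := fun x₀ x => Algebra.TensorProduct.congr (𝒜.chart x₀ x) AlgEquiv.refl
  chart_triv := by
    intro x₀
    have hsl : ∀ f : Module.Dual ℝ B, Continuous (slice A f) := fun f => by
      rw [continuous_iff_le_induced]; exact iInf_le _ f
    have hc : ∀ f : Module.Dual ℝ B, Continuous
        (fun p : {p : Tot (fun x => 𝒜.Fib x ⊗[ℝ] B) // p.proj ∈ 𝒜.dom x₀} =>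
          (((⟨p.1.proj, p.2⟩ : 𝒜.dom x₀),
            𝒜.chart x₀ ⟨p.1.proj, p.2⟩ (slice (𝒜.Fib p.1.proj) f p.1.snd)) : 𝒜.dom x₀ × A)) := by
      intro f
      exact (𝒜.chart_triv x₀).1.comp
        (((continuous_tensorTot_slice 𝒜 B f).comp continuous_subtype_val).subtype_mk
          (fun p => p.2))
    refine ⟨?_, ?_⟩
    · refine Continuous.prodMk (continuous_fst.comp (hc 0)) ?_
      refine continuous_iInf_rng.2 fun f => continuous_induced_rng.2 ?_
      refine (continuous_snd.comp (hc f)).congr fun p => ?_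
      exact (slice_map f (𝒜.chart x₀ ⟨p.1.proj, p.2⟩).toLinearMap LinearMap.id p.1.snd).symm
    · rw [continuous_tensorTot_iff]
      intro f
      refine ((𝒜.chart_triv x₀).2.comp
        (continuous_fst.prodMk ((hsl f).comp continuous_snd))).congr fun q => ?_
      exact congrArg (fun a => (⟨q.1.1, a⟩ : Tot 𝒜.Fib))
        (slice_map f (𝒜.chart x₀ q.1).symm.toLinearMap LinearMap.id q.2).symm
  act := fun g x => Algebra.TensorProduct.map (𝒜.act g x) (β g : B →ₐ[ℝ] B)
  act_one := by
    intro x t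
    have key : ∀ (y : X) (hy : y = x) (φ : 𝒜.Fib x →ₐ[ℝ] 𝒜.Fib y)
        (_ : ∀ a, (⟨y, φ a⟩ : Tot 𝒜.Fib) = ⟨x, a⟩),
        (⟨y, Algebra.TensorProduct.map φ (AlgHom.id ℝ B) t⟩ :
          Tot fun x => 𝒜.Fib x ⊗[ℝ] B) = ⟨x, t⟩ := by
      rintro y rfl φ hφ
      have : φ = AlgHom.id ℝ _ := AlgHom.ext fun a => Bundle.TotalSpace.mk_inj.1 (hφ a)
      rw [this, Algebra.TensorProduct.map_id]; rfl
    have hβ : ((β 1 : B ≃ₐ[ℝ] B) : B →ₐ[ℝ] B) = AlgHom.id ℝ B := by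
      rw [map_one]; rfl
    rw [hβ]
    exact key _ (one_smul G x) _ (𝒜.act_one x)
  act_mul := by
    intro g h x t
    have key : ∀ (y z : X) (_ : y = z) (φ : 𝒜.Fib x →ₐ[ℝ] 𝒜.Fib y) (ψ : 𝒜.Fib x →ₐ[ℝ] 𝒜.Fib z)
        (_ : ∀ a, (⟨y, φ a⟩ : Tot 𝒜.Fib) = ⟨z, ψ a⟩) (γ : B →ₐ[ℝ] B),
        (⟨y, Algebra.TensorProduct.map φ γ t⟩ : Tot fun x => 𝒜.Fib x ⊗[ℝ] B) =
          ⟨z, Algebra.TensorProduct.map ψ γ t⟩ := by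
      rintro y _ rfl φ ψ hφ γ
      have : φ = ψ := AlgHom.ext fun a => Bundle.TotalSpace.mk_inj.1 (hφ a)
      rw [this]
    have h1 := key _ _ (mul_smul g h x) (𝒜.act (g * h) x)
      ((𝒜.act g (h • x)).comp (𝒜.act h x)) (𝒜.act_mul g h x) (β (g * h) : B →ₐ[ℝ] B)
    rw [h1]
    have hβ : ((β (g * h) : B ≃ₐ[ℝ] B) : B →ₐ[ℝ] B) =
        ((β g : B ≃ₐ[ℝ] B) : B →ₐ[ℝ] B).comp ((β h : B ≃ₐ[ℝ] B) : B →ₐ[ℝ] B) := by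
      rw [map_mul]; rfl
    rw [hβ, Algebra.TensorProduct.map_comp]
    rfl
  continuous_act := by
    refine continuous_prod_of_discrete_left.2 fun g => ?_
    rw [continuous_tensorTot_iff]
    intro f
    refine (𝒜.continuous_act.comp (continuous_const.prodMk
      (continuous_tensorTot_slice 𝒜 B (f ∘ₗ (β g).toLinearMap)) :
        Continuous fun p => ((g, _) : G × Tot 𝒜.Fib))).congr fun p => ?_
    exact congrArg (fun a => (⟨g • p.proj, a⟩ : Tot 𝒜.Fib))
      (slice_map f (𝒜.act g p.proj).toLinearMap (β g).toLinearMap p.snd).symm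

/-- The anti-involution `a ⊗ z ↦ a^* ⊗ z` on `𝒜 ⊗ B`, for commutative `B`. -/
def AntiInvolution.tensor [DiscreteTopology G] {𝒜 : GAlgBundle G X A} (s : AntiInvolution 𝒜) (B : Type) [CommRing B]
    [Algebra ℝ B] [Module.Finite ℝ B] (β : G →* (B ≃ₐ[ℝ] B)) :
    AntiInvolution (tensorBundle 𝒜 B β) where
  dag := fun x => (LinearMap.rTensor B (s.dag x) : 𝒜.Fib x ⊗[ℝ] B →ₗ[ℝ] 𝒜.Fib x ⊗[ℝ] B)
  dag_dag := by
    intro x (t : 𝒜.Fib x ⊗[ℝ] B)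
    change LinearMap.rTensor B (s.dag x) (LinearMap.rTensor B (s.dag x) t) = t
    induction t using TensorProduct.induction_on with
    | zero => simp
    | tmul a b => simp [s.dag_dag]
    | add p q hp hq => simp only [map_add, hp, hq]
  dag_mul := by
    intro x (t : 𝒜.Fib x ⊗[ℝ] B) (t' : 𝒜.Fib x ⊗[ℝ] B)
    change LinearMap.rTensor B (s.dag x) (t * t') =
      LinearMap.rTensor B (s.dag x) t' * LinearMap.rTensor B (s.dag x) t
    induction t using TensorProduct.induction_on with
    | zero => simp
    | add p q hp hq => simp only [map_add, add_mul, mul_add, hp, hq]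
    | tmul a b =>
      induction t' using TensorProduct.induction_on with
      | zero => simp
      | add p q hp hq => simp only [map_add, add_mul, mul_add, hp, hq]
      | tmul a' b' => simp [s.dag_mul, mul_comm]
  dag_act := by
    intro g x (t : 𝒜.Fib x ⊗[ℝ] B)
    change LinearMap.rTensor B (s.dag (g • x))
        (Algebra.TensorProduct.map (𝒜.act g x) (β g : B →ₐ[ℝ] B) t) =
      Algebra.TensorProduct.map (𝒜.act g x) (β g : B →ₐ[ℝ] B) (LinearMap.rTensor B (s.dag x) t)
    induction t using TensorProduct.induction_on with
    | zero => simp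
    | tmul a b => simp [s.dag_act]
    | add p q hp hq => simp only [map_add, hp, hq]
  continuous_dag := by
    refine (continuous_tensorTot_iff 𝒜 B _).2 fun f => ?_
    refine (s.continuous_dag.comp (continuous_tensorTot_slice 𝒜 B f)).congr fun p => ?_
    exact congrArg (fun a => (⟨p.proj, a⟩ : Tot 𝒜.Fib))
      (slice_map f (s.dag p.proj) LinearMap.id p.snd).symm

end TensorBundle

/-! ### `G`-`𝒜`-bundles and their Grothendieck group -/

/-- The topological `A`-module `M` is a topological direct summand of some `A^n`, that is, a finitely
generated projective `A`-module with its canonical topology. -/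
def IsFGProjective (A : Type u) [Ring A] [TopologicalSpace A] (M : Type u) [AddCommGroup M]
    [Module A M] [TopologicalSpace M] : Prop :=
  ∃ (ι : Type) (_ : Finite ι) (i : M →L[A] (ι → A)) (r : (ι → A) →L[A] M), ∀ m, r (i m) = m

section Bundles

variable {G : Type} [Group G] [TopologicalSpace G] {X : Type w} [TopologicalSpace X]
  [MulAction G X] {A : Type u} [Ring A] [Algebra ℝ A] [TopologicalSpace A]

/-- A family `E` of modules over the algebra bundle `𝒜` is locally trivial with finitely generated
projective fibres: near each point `x₀`, where `𝒜` is identified with the product with `A` through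
its chart at `x₀`, `E` is isomorphic to the product with a finitely generated projective
`A`-module `M`. -/
def IsLocallyTrivial (𝒜 : GAlgBundle G X A) (E : X → Type u) [∀ x, AddCommGroup (E x)]
    [∀ x, Module (𝒜.Fib x) (E x)] [TopologicalSpace (Tot E)] : Prop :=
  ∀ x₀ : X, ∃ (V : Set X) (hV : V ⊆ 𝒜.dom x₀), IsOpen V ∧ x₀ ∈ V ∧
    ∃ (M : Type u) (_ : AddCommGroup M) (_ : Module A M) (_ : TopologicalSpace M),
      IsFGProjective A M ∧
      ∃ e : ∀ x : V, E x ≃+ M,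
        (∀ (x : V) (a : 𝒜.Fib x) (v : E x),
          e x (a • v) = 𝒜.chart x₀ ⟨x, hV x.2⟩ a • e x v) ∧
        IsTrivializationOn V (fun x => (e x).toEquiv)

/-- A `G`-`𝒜`-bundle: a locally trivial bundle of finitely generated projective left modules over
the algebra bundle `𝒜` with a continuous action of `G` such that `g (a v) = g(a) g(v)`. When `A` is
a topological ring, continuity of `𝒜 ×_X E → E` follows from local triviality. -/
structure GBundle (𝒜 : GAlgBundle G X A) where
  Fib : X → Type u
  [addCommGroup : ∀ x, AddCommGroup (Fib x)]
  [module : ∀ x, Module (𝒜.Fib x) (Fib x)]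
  [top : TopologicalSpace (Tot Fib)]
  continuous_proj : Continuous (fun p : Tot Fib => p.proj)
  locallyTrivial : IsLocallyTrivial 𝒜 Fib
  act : ∀ (g : G) (x : X), Fib x →+ Fib (g • x)
  act_smul : ∀ g x (a : 𝒜.Fib x) (v : Fib x), act g x (a • v) = 𝒜.act g x a • act g x v
  act_one : ∀ (x : X) (v : Fib x), (⟨(1 : G) • x, act 1 x v⟩ : Tot Fib) = ⟨x, v⟩
  act_mul : ∀ (g h : G) (x : X) (v : Fib x),
    (⟨(g * h) • x, act (g * h) x v⟩ : Tot Fib) = ⟨g • h • x, act g (h • x) (act h x v)⟩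
  continuous_act : Continuous
    (fun q : G × Tot Fib => (⟨q.1 • q.2.proj, act q.1 q.2.proj q.2.snd⟩ : Tot Fib))

attribute [instance] GBundle.addCommGroup GBundle.module GBundle.top

variable {𝒜 : GAlgBundle G X A}

/-- An isomorphism of `G`-`𝒜`-bundles. -/
structure GBundle.Iso (E F : GBundle 𝒜) where
  equiv : ∀ x, E.Fib x ≃ₗ[𝒜.Fib x] F.Fib x
  map_act : ∀ g x v, equiv (g • x) (E.act g x v) = F.act g x (equiv x v)
  continuous_toFun :
    Continuous (fun p : Tot E.Fib => (⟨p.proj, equiv p.proj p.snd⟩ : Tot F.Fib))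
  continuous_invFun :
    Continuous (fun p : Tot F.Fib => (⟨p.proj, (equiv p.proj).symm p.snd⟩ : Tot E.Fib))

namespace GBundle

def Iso.refl (E : GBundle 𝒜) : Iso E E where
  equiv := fun _ => LinearEquiv.refl _ _
  map_act := fun _ _ _ => rfl
  continuous_toFun := continuous_id
  continuous_invFun := continuous_id

def Iso.symm {E F : GBundle 𝒜} (φ : Iso E F) : Iso F E where
  equiv := fun x => (φ.equiv x).symm
  map_act := by
    intro g x v
    rw [LinearEquiv.symm_apply_eq, φ.map_act, LinearEquiv.apply_symm_apply]
  continuous_toFun := φ.continuous_invFun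
  continuous_invFun := φ.continuous_toFun

def Iso.trans {E F H : GBundle 𝒜} (φ : Iso E F) (ψ : Iso F H) : Iso E H where
  equiv := fun x => (φ.equiv x).trans (ψ.equiv x)
  map_act := by
    intro g x v
    simp only [LinearEquiv.trans_apply, φ.map_act, ψ.map_act]
  continuous_toFun := ψ.continuous_toFun.comp φ.continuous_toFun
  continuous_invFun := φ.continuous_invFun.comp ψ.continuous_invFun

/-- The zero bundle. -/
def zero (𝒜 : GAlgBundle G X A) [ContinuousSMul G X] : GBundle 𝒜 where
  Fib := fun _ => PUnit
  top := TopologicalSpace.induced (fun p : Tot (fun _ : X => PUnit.{u + 1}) => p.proj)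
    inferInstance
  continuous_proj := continuous_induced_dom
  locallyTrivial := by
    let _ : TopologicalSpace (Tot (fun _ : X => PUnit.{u + 1})) :=
      TopologicalSpace.induced (fun p => p.proj) inferInstance
    intro x₀
    refine ⟨𝒜.dom x₀, subset_rfl, 𝒜.isOpen_dom x₀, 𝒜.mem_dom x₀, PUnit, inferInstance,
      inferInstance, inferInstance, ⟨Empty, inferInstance, 0, 0, fun _ => rfl⟩,
      fun _ => AddEquiv.refl _, fun _ _ _ => rfl, ?_, ?_⟩
    · have h : Continuous (fun p : Tot (fun _ : X => PUnit.{u + 1}) => p.proj) :=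
        continuous_induced_dom
      exact ((h.comp continuous_subtype_val).subtype_mk _).prodMk
        (continuous_const (y := PUnit.unit))
    · exact continuous_induced_rng.2 (continuous_subtype_val.comp continuous_fst)
  act := fun _ _ => 0
  act_smul := fun _ _ _ _ => rfl
  act_one := by intro x v; simp
  act_mul := by intro g h x v; simp [mul_smul]
  continuous_act := by
    let _ : TopologicalSpace (Tot (fun _ : X => PUnit.{u + 1})) :=
      TopologicalSpace.induced (fun p => p.proj) inferInstance
    have h : Continuous (fun p : Tot (fun _ : X => PUnit.{u + 1}) => p.proj) :=
      continuous_induced_dom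
    exact continuous_induced_rng.2 (continuous_fst.smul (h.comp continuous_snd))

/-- The topology on the total space of `E ⊕ F`, as a subspace of the product. -/
instance prodTop (E F : GBundle 𝒜) : TopologicalSpace (Tot fun x => E.Fib x × F.Fib x) :=
  TopologicalSpace.induced
    (fun p => ((⟨p.proj, p.snd.1⟩, ⟨p.proj, p.snd.2⟩) : Tot E.Fib × Tot F.Fib)) inferInstance

theorem continuous_prodTop_fst (E F : GBundle 𝒜) : Continuous
    (fun p : Tot (fun x => E.Fib x × F.Fib x) => (⟨p.proj, p.snd.1⟩ : Tot E.Fib)) :=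
  continuous_fst.comp (continuous_induced_dom (f := fun p : Tot (fun x => E.Fib x × F.Fib x) =>
    ((⟨p.proj, p.snd.1⟩, ⟨p.proj, p.snd.2⟩) : Tot E.Fib × Tot F.Fib)))

theorem continuous_prodTop_snd (E F : GBundle 𝒜) : Continuous
    (fun p : Tot (fun x => E.Fib x × F.Fib x) => (⟨p.proj, p.snd.2⟩ : Tot F.Fib)) :=
  continuous_snd.comp (continuous_induced_dom (f := fun p : Tot (fun x => E.Fib x × F.Fib x) =>
    ((⟨p.proj, p.snd.1⟩, ⟨p.proj, p.snd.2⟩) : Tot E.Fib × Tot F.Fib)))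

theorem continuous_prodTop (E F : GBundle 𝒜) {Z : Type*} [TopologicalSpace Z]
    {φ : Z → Tot fun x => E.Fib x × F.Fib x}
    (h1 : Continuous fun z => (⟨(φ z).proj, (φ z).snd.1⟩ : Tot E.Fib))
    (h2 : Continuous fun z => (⟨(φ z).proj, (φ z).snd.2⟩ : Tot F.Fib)) :
    Continuous φ :=
  continuous_induced_rng.2 (h1.prodMk h2)

/-- The Whitney sum of two `G`-`𝒜`-bundles. -/
def prod (E F : GBundle 𝒜) : GBundle 𝒜 where
  Fib := fun x => E.Fib x × F.Fib x
  top := prodTop E F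
  continuous_proj :=
    E.continuous_proj.comp (continuous_prodTop_fst E F)
  locallyTrivial := by
    intro x₀
    obtain ⟨V, hV, hVo, hxV, M, _, _, _, ⟨ι, _, i, r, hir⟩, e, he, he1, he2⟩ :=
      E.locallyTrivial x₀
    obtain ⟨W, hW, hWo, hxW, N, _, _, _, ⟨κ, _, j, s, hjs⟩, f, hf, hf1, hf2⟩ :=
      F.locallyTrivial x₀
    refine ⟨V ∩ W, fun x hx => hV hx.1, hVo.inter hWo, ⟨hxV, hxW⟩, M × N, inferInstance,
      inferInstance, inferInstance, ⟨ι ⊕ κ, inferInstance, ?_⟩,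
      fun x => (e ⟨x, x.2.1⟩).prodCongr (f ⟨x, x.2.2⟩), ?_, ?_, ?_⟩
    · refine ⟨⟨(LinearEquiv.sumArrowLequivProdArrow ι κ A A).symm.toLinearMap ∘ₗ
          (i : M →ₗ[A] (ι → A)).prodMap (j : N →ₗ[A] (κ → A)), ?_⟩,
        ⟨(r : (ι → A) →ₗ[A] M).prodMap (s : (κ → A) →ₗ[A] N) ∘ₗ
          (LinearEquiv.sumArrowLequivProdArrow ι κ A A).toLinearMap, ?_⟩, ?_⟩
      · refine continuous_pi fun k => ?_
        rcases k with k | k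
        · exact (continuous_apply k).comp (i.continuous.comp continuous_fst)
        · exact (continuous_apply k).comp (j.continuous.comp continuous_snd)
      · refine Continuous.prodMk ?_ ?_
        · exact r.continuous.comp (continuous_pi fun k => continuous_apply (Sum.inl k))
        · exact s.continuous.comp (continuous_pi fun k => continuous_apply (Sum.inr k))
      · rintro ⟨m, n⟩
        exact Prod.ext (hir m) (hjs n)
    · rintro x a ⟨v, v'⟩
      exact Prod.ext (he ⟨x, x.2.1⟩ a v) (hf ⟨x, x.2.2⟩ a v')
    · have h1 := he1.comp (((continuous_prodTop_fst E F).comp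
        (continuous_subtype_val (p := fun p => p.proj ∈ V ∩ W))).subtype_mk (fun p => p.2.1))
      have h2 := hf1.comp (((continuous_prodTop_snd E F).comp
        (continuous_subtype_val (p := fun p => p.proj ∈ V ∩ W))).subtype_mk (fun p => p.2.2))
      refine Continuous.prodMk ?_ ((continuous_snd.comp h1).prodMk (continuous_snd.comp h2))
      exact (continuous_subtype_val.comp (continuous_fst.comp h1)).subtype_mk _
    · refine continuous_prodTop E F ?_ ?_
      · exact he2.comp (((continuous_subtype_val.comp continuous_fst).subtype_mk
          (fun q => q.1.2.1)).prodMk (continuous_fst.comp continuous_snd))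
      · exact hf2.comp (((continuous_subtype_val.comp continuous_fst).subtype_mk
          (fun q => q.1.2.2)).prodMk (continuous_snd.comp continuous_snd))
  act := fun g x => (E.act g x).prodMap (F.act g x)
  act_smul := fun g x a v => Prod.ext (E.act_smul g x a v.1) (F.act_smul g x a v.2)
  act_one := by
    rintro x ⟨v, v'⟩
    have key : ∀ (y : X) (_ : y = x) (p : E.Fib y) (q : F.Fib y)
        (_ : (⟨y, p⟩ : Tot E.Fib) = ⟨x, v⟩) (_ : (⟨y, q⟩ : Tot F.Fib) = ⟨x, v'⟩),
        (⟨y, (p, q)⟩ : Tot fun x => E.Fib x × F.Fib x) = ⟨x, (v, v')⟩ := by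
      rintro y rfl p q hp hq
      rw [Bundle.TotalSpace.mk_inj.1 hp, Bundle.TotalSpace.mk_inj.1 hq]
    exact key _ (one_smul G x) _ _ (E.act_one x v) (F.act_one x v')
  act_mul := by
    rintro g h x ⟨v, v'⟩
    have key : ∀ (y z : X) (_ : y = z) (p : E.Fib y) (q : F.Fib y) (p' : E.Fib z) (q' : F.Fib z)
        (_ : (⟨y, p⟩ : Tot E.Fib) = ⟨z, p'⟩) (_ : (⟨y, q⟩ : Tot F.Fib) = ⟨z, q'⟩),
        (⟨y, (p, q)⟩ : Tot fun x => E.Fib x × F.Fib x) = ⟨z, (p', q')⟩ := by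
      rintro y _ rfl p q p' q' hp hq
      rw [Bundle.TotalSpace.mk_inj.1 hp, Bundle.TotalSpace.mk_inj.1 hq]
    exact key _ _ (mul_smul g h x) _ _ _ _ (E.act_mul g h x v) (F.act_mul g h x v')
  continuous_act := by
    refine continuous_prodTop E F ?_ ?_
    · exact E.continuous_act.comp
        (continuous_fst.prodMk ((continuous_prodTop_fst E F).comp continuous_snd))
    · exact F.continuous_act.comp
        (continuous_fst.prodMk ((continuous_prodTop_snd E F).comp continuous_snd))

def Iso.prod {E E' F F' : GBundle 𝒜} (φ : Iso E E') (ψ : Iso F F') :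
    Iso (E.prod F) (E'.prod F') where
  equiv := fun x => (φ.equiv x).prodCongr (ψ.equiv x)
  map_act := fun g x v => Prod.ext (φ.map_act g x v.1) (ψ.map_act g x v.2)
  continuous_toFun := continuous_prodTop E' F'
    (φ.continuous_toFun.comp (continuous_prodTop_fst E F))
    (ψ.continuous_toFun.comp (continuous_prodTop_snd E F))
  continuous_invFun := continuous_prodTop E F
    (φ.continuous_invFun.comp (continuous_prodTop_fst E' F'))
    (ψ.continuous_invFun.comp (continuous_prodTop_snd E' F'))

def prodComm (E F : GBundle 𝒜) : Iso (E.prod F) (F.prod E) where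
  equiv := fun x => LinearEquiv.prodComm (𝒜.Fib x) (E.Fib x) (F.Fib x)
  map_act := fun _ _ _ => rfl
  continuous_toFun := continuous_prodTop F E (continuous_prodTop_snd E F)
    (continuous_prodTop_fst E F)
  continuous_invFun := continuous_prodTop E F (continuous_prodTop_snd F E)
    (continuous_prodTop_fst F E)

def prodAssoc (E F H : GBundle 𝒜) : Iso ((E.prod F).prod H) (E.prod (F.prod H)) where
  equiv := fun x => LinearEquiv.prodAssoc (𝒜.Fib x) (E.Fib x) (F.Fib x) (H.Fib x)
  map_act := fun _ _ _ => rfl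
  continuous_toFun := continuous_prodTop E (F.prod H)
    ((continuous_prodTop_fst E F).comp (continuous_prodTop_fst (E.prod F) H))
    (continuous_prodTop F H
      ((continuous_prodTop_snd E F).comp (continuous_prodTop_fst (E.prod F) H))
      (continuous_prodTop_snd (E.prod F) H))
  continuous_invFun := continuous_prodTop (E.prod F) H
    (continuous_prodTop E F (continuous_prodTop_fst E (F.prod H))
      ((continuous_prodTop_fst F H).comp (continuous_prodTop_snd E (F.prod H))))
    ((continuous_prodTop_snd F H).comp (continuous_prodTop_snd E (F.prod H)))

/-- `0 ⊕ E ≅ E`. -/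
def zeroProd [ContinuousSMul G X] (E : GBundle 𝒜) : Iso ((zero 𝒜).prod E) E where
  equiv := fun _ =>
    { toFun := fun v => v.2
      map_add' := fun _ _ => rfl
      map_smul' := fun _ _ => rfl
      invFun := fun v => (PUnit.unit, v)
      left_inv := fun _ => rfl
      right_inv := fun _ => rfl }
  map_act := fun _ _ _ => rfl
  continuous_toFun := continuous_prodTop_snd (zero 𝒜) E
  continuous_invFun := continuous_prodTop (zero 𝒜) E
    (continuous_induced_rng.2 E.continuous_proj) continuous_id

end GBundle

/-- `E` and `F` are isomorphic `G`-`𝒜`-bundles. -/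
instance isoSetoid (𝒜 : GAlgBundle G X A) : Setoid (GBundle 𝒜) where
  r E F := Nonempty (GBundle.Iso E F)
  iseqv := ⟨fun E => ⟨GBundle.Iso.refl E⟩, fun ⟨φ⟩ => ⟨φ.symm⟩, fun ⟨φ⟩ ⟨ψ⟩ => ⟨φ.trans ψ⟩⟩

/-- Isomorphism classes of `G`-`𝒜`-bundles. -/
def IsoClass (𝒜 : GAlgBundle G X A) : Type (max w (u + 1)) := Quotient (isoSetoid 𝒜)

instance [ContinuousSMul G X] (𝒜 : GAlgBundle G X A) : Zero (IsoClass 𝒜) :=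
  ⟨Quotient.mk (isoSetoid 𝒜) (GBundle.zero 𝒜)⟩

instance (𝒜 : GAlgBundle G X A) : Add (IsoClass 𝒜) :=
  ⟨Quotient.map₂ GBundle.prod (fun _ _ ⟨φ⟩ _ _ ⟨ψ⟩ => ⟨φ.prod ψ⟩)⟩

/-- Addition of isomorphism classes is given by the Whitney sum. -/
instance [ContinuousSMul G X] (𝒜 : GAlgBundle G X A) : AddCommMonoid (IsoClass 𝒜) where
  add_assoc := by
    rintro ⟨E⟩ ⟨F⟩ ⟨H⟩
    exact Quotient.sound ⟨GBundle.prodAssoc E F H⟩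
  add_comm := by
    rintro ⟨E⟩ ⟨F⟩
    exact Quotient.sound ⟨GBundle.prodComm E F⟩
  zero_add := by
    rintro ⟨E⟩
    exact Quotient.sound ⟨GBundle.zeroProd E⟩
  add_zero := by
    rintro ⟨E⟩
    exact Quotient.sound ⟨(GBundle.prodComm _ _).trans (GBundle.zeroProd E)⟩
  nsmul := nsmulRec

/-- `K_G^𝒜(X)`, the Grothendieck group of the additive category of `G`-`𝒜`-bundles. -/
abbrev KG [ContinuousSMul G X] (𝒜 : GAlgBundle G X A) : Type (max w (u + 1)) :=
  Algebra.GrothendieckAddGroup (IsoClass 𝒜)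

/-- The class `[E]` in `K_G^𝒜(X)`. -/
def KG.cls [ContinuousSMul G X] (E : GBundle 𝒜) : KG 𝒜 :=
  Algebra.GrothendieckAddGroup.of (Quotient.mk (isoSetoid 𝒜) E : IsoClass 𝒜)

/-! ### `ε`-symmetric forms and Grothendieck-Witt groups -/

/-- An `ε`-symmetric form on a `G`-`𝒜`-bundle `E`, where `𝒜` carries the anti-involution `s`: a
continuous equivariant form `B(v, w) = ψ(v)(w)` with values in `𝒜`, linear in `w`, such that
`B(w, v) = ε B(v, w)^*` and each `ψ_x : E_x → Hom(E_x, 𝒜_x)` is bijective. -/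
structure Form (s : AntiInvolution 𝒜) (ε : ℤˣ) (E : GBundle 𝒜) where
  form : ∀ x, E.Fib x →+ (E.Fib x →ₗ[𝒜.Fib x] 𝒜.Fib x)
  symm : ∀ x v w, form x w v = ε • s.dag x (form x v w)
  bijective : ∀ x, Function.Bijective (form x)
  map_act : ∀ g x v w, form (g • x) (E.act g x v) (E.act g x w) = 𝒜.act g x (form x v w)
  continuous_form : Continuous (fun p : Tot (E.prod E).Fib =>
    (⟨p.proj, form p.proj p.snd.1 p.snd.2⟩ : Tot 𝒜.Fib))

/-- The zero section of an algebra bundle is continuous. -/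
theorem continuous_zeroSection (𝒜 : GAlgBundle G X A) :
    Continuous (fun x : X => (⟨x, 0⟩ : Tot 𝒜.Fib)) := by
  refine continuous_iff_continuousAt.2 fun x₀ => ?_
  have hU := (𝒜.isOpen_dom x₀).mem_nhds (𝒜.mem_dom x₀)
  refine ContinuousOn.continuousAt (s := 𝒜.dom x₀) ?_ hU
  rw [continuousOn_iff_continuous_domRestrict]
  refine ((𝒜.chart_triv x₀).2.comp (continuous_id.prodMk (continuous_const (y := (0 : A))))).congr
    fun x => ?_
  exact congrArg (fun a => (⟨x.1, a⟩ : Tot 𝒜.Fib)) (map_zero (𝒜.chart x₀ x).symm)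

/-- Fibrewise addition in an algebra bundle is continuous. -/
theorem continuous_fibAdd [ContinuousAdd A] (𝒜 : GAlgBundle G X A) {Z : Type*}
    [TopologicalSpace Z] {π : Z → X} {a b : ∀ z, 𝒜.Fib (π z)}
    (ha : Continuous fun z => (⟨π z, a z⟩ : Tot 𝒜.Fib))
    (hb : Continuous fun z => (⟨π z, b z⟩ : Tot 𝒜.Fib)) :
    Continuous fun z => (⟨π z, a z + b z⟩ : Tot 𝒜.Fib) := by
  refine continuous_iff_continuousAt.2 fun z₀ => ?_
  have hπ : Continuous π := 𝒜.continuous_proj.comp ha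
  have hU := ((𝒜.isOpen_dom (π z₀)).preimage hπ).mem_nhds (𝒜.mem_dom (π z₀))
  refine ContinuousOn.continuousAt (s := π ⁻¹' 𝒜.dom (π z₀)) ?_ hU
  rw [continuousOn_iff_continuous_domRestrict]
  have h1 := (𝒜.chart_triv (π z₀)).1.comp
    ((ha.comp (continuous_subtype_val (p := (· ∈ π ⁻¹' 𝒜.dom (π z₀))))).subtype_mk
      (fun z => z.2))
  have h2 := (𝒜.chart_triv (π z₀)).1.comp
    ((hb.comp (continuous_subtype_val (p := (· ∈ π ⁻¹' 𝒜.dom (π z₀))))).subtype_mk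
      (fun z => z.2))
  refine ((𝒜.chart_triv (π z₀)).2.comp ((continuous_fst.comp h1).prodMk
    ((continuous_snd.comp h1).add (continuous_snd.comp h2)))).congr fun z => ?_
  refine congrArg (fun c => (⟨π z.1, c⟩ : Tot 𝒜.Fib)) ?_
  change (𝒜.chart (π z₀) ⟨π z.1, z.2⟩).symm (𝒜.chart (π z₀) ⟨π z.1, z.2⟩ (a z.1) +
    𝒜.chart (π z₀) ⟨π z.1, z.2⟩ (b z.1)) = a z.1 + b z.1
  rw [map_add, AlgEquiv.symm_apply_apply, AlgEquiv.symm_apply_apply]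

/-- A `G`-`𝒜`-bundle with an `ε`-symmetric form. -/
structure SymBundle (s : AntiInvolution 𝒜) (ε : ℤˣ) where
  E : GBundle 𝒜
  B : Form s ε E

variable {s : AntiInvolution 𝒜} {ε : ℤˣ}

/-- An isometry of bundles with `ε`-symmetric forms. -/
structure Isometry (P Q : SymBundle s ε) extends GBundle.Iso P.E Q.E where
  map_form : ∀ x v w, Q.B.form x (equiv x v) (equiv x w) = P.B.form x v w

namespace SymBundle

def reflI (P : SymBundle s ε) : Isometry P P where
  toIso := GBundle.Iso.refl P.E
  map_form := fun _ _ _ => rfl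

def symmI {P Q : SymBundle s ε} (φ : Isometry P Q) : Isometry Q P where
  toIso := φ.toIso.symm
  map_form := by
    intro x v w
    rw [← φ.map_form]
    congr 1
    · exact congrArg _ ((φ.equiv x).apply_symm_apply v)
    · exact (φ.equiv x).apply_symm_apply w

def transI {P Q R : SymBundle s ε} (φ : Isometry P Q) (ψ : Isometry Q R) : Isometry P R where
  toIso := φ.toIso.trans ψ.toIso
  map_form := fun x v w => (ψ.map_form x _ _).trans (φ.map_form x v w)

/-- The zero bundle with its unique form. -/
def zero (s : AntiInvolution 𝒜) (ε : ℤˣ) [ContinuousSMul G X] : SymBundle s ε where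
  E := GBundle.zero 𝒜
  B :=
    { form := fun _ => 0
      symm := by intro x v w; simp
      bijective := by
        intro x
        refine ⟨fun v w _ => Subsingleton.elim (α := PUnit) v w, fun f => ⟨PUnit.unit, ?_⟩⟩
        refine LinearMap.ext fun v => ?_
        have hv : v = 0 := Subsingleton.elim (α := PUnit) _ _
        rw [hv, map_zero, map_zero]
      map_act := by intro g x v w; simp
      continuous_form := (continuous_zeroSection 𝒜).comp ((GBundle.zero 𝒜).prod _).continuous_proj }

/-- The orthogonal sum. -/
def prod [ContinuousAdd A] (P Q : SymBundle s ε) : SymBundle s ε where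
  E := P.E.prod Q.E
  B :=
    { form := fun x => AddMonoidHom.mk'
        (fun v : P.E.Fib x × Q.E.Fib x => (P.B.form x v.1).coprod (Q.B.form x v.2)) (by
          intro v w
          refine LinearMap.ext fun u => ?_
          change P.B.form x (v.1 + w.1) u.1 + Q.B.form x (v.2 + w.2) u.2 =
            (P.B.form x v.1 u.1 + Q.B.form x v.2 u.2) + (P.B.form x w.1 u.1 + Q.B.form x w.2 u.2)
          rw [map_add, map_add, LinearMap.add_apply, LinearMap.add_apply]
          abel)
      symm := by
        intro x v w
        change P.B.form x w.1 v.1 + Q.B.form x w.2 v.2 =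
          ε • s.dag x (P.B.form x v.1 w.1 + Q.B.form x v.2 w.2)
        rw [P.B.symm x v.1 w.1, Q.B.symm x v.2 w.2, map_add, smul_add]
      bijective := by
        intro x
        constructor
        · intro v w h
          have h' : ∀ u : P.E.Fib x × Q.E.Fib x, P.B.form x v.1 u.1 + Q.B.form x v.2 u.2 =
              P.B.form x w.1 u.1 + Q.B.form x w.2 u.2 := fun u => LinearMap.congr_fun h u
          refine Prod.ext ((P.B.bijective x).1 (LinearMap.ext fun u => ?_))
            ((Q.B.bijective x).1 (LinearMap.ext fun u => ?_))
          · simpa using h' (u, 0)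
          · simpa using h' (0, u)
        · intro f
          let f' : (P.E.Fib x × Q.E.Fib x) →ₗ[𝒜.Fib x] 𝒜.Fib x := f
          obtain ⟨v, hv⟩ := (P.B.bijective x).2 (f' ∘ₗ LinearMap.inl _ _ _)
          obtain ⟨w, hw⟩ := (Q.B.bijective x).2 (f' ∘ₗ LinearMap.inr _ _ _)
          refine ⟨(v, w), ?_⟩
          change (P.B.form x v).coprod (Q.B.form x w) = f'
          rw [hv, hw]
          exact LinearMap.coprod_comp_inl_inr f'
      map_act := by
        intro g x v w
        change P.B.form (g • x) (P.E.act g x v.1) (P.E.act g x w.1) +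
          Q.B.form (g • x) (Q.E.act g x v.2) (Q.E.act g x w.2) =
          𝒜.act g x (P.B.form x v.1 w.1 + Q.B.form x v.2 w.2)
        rw [P.B.map_act, Q.B.map_act, map_add]
      continuous_form := by
        have h1 := GBundle.continuous_prodTop_fst (P.E.prod Q.E) (P.E.prod Q.E)
        have h2 := GBundle.continuous_prodTop_snd (P.E.prod Q.E) (P.E.prod Q.E)
        have hf := GBundle.continuous_prodTop_fst P.E Q.E
        have hs := GBundle.continuous_prodTop_snd P.E Q.E
        exact continuous_fibAdd 𝒜
          (P.B.continuous_form.comp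
            (GBundle.continuous_prodTop P.E P.E (hf.comp h1) (hf.comp h2) :
              Continuous fun p : Tot ((P.E.prod Q.E).prod (P.E.prod Q.E)).Fib =>
                (⟨p.proj, (p.snd.1.1, p.snd.2.1)⟩ : Tot (P.E.prod P.E).Fib)))
          (Q.B.continuous_form.comp
            (GBundle.continuous_prodTop Q.E Q.E (hs.comp h1) (hs.comp h2) :
              Continuous fun p : Tot ((P.E.prod Q.E).prod (P.E.prod Q.E)).Fib =>
                (⟨p.proj, (p.snd.1.2, p.snd.2.2)⟩ : Tot (Q.E.prod Q.E).Fib))) }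

end SymBundle

/-- `P` and `Q` are isometric. -/
instance isometrySetoid (s : AntiInvolution 𝒜) (ε : ℤˣ) : Setoid (SymBundle s ε) where
  r P Q := Nonempty (Isometry P Q)
  iseqv := ⟨fun P => ⟨P.reflI⟩, fun ⟨φ⟩ => ⟨SymBundle.symmI φ⟩,
    fun ⟨φ⟩ ⟨ψ⟩ => ⟨SymBundle.transI φ ψ⟩⟩

/-- Isometry classes of `G`-`𝒜`-bundles with an `ε`-symmetric form. -/
def IsometryClass (s : AntiInvolution 𝒜) (ε : ℤˣ) : Type (max w (u + 1)) :=
  Quotient (isometrySetoid s ε)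

instance [ContinuousSMul G X] : Zero (IsometryClass s ε) :=
  ⟨Quotient.mk (isometrySetoid s ε) (SymBundle.zero s ε)⟩

instance [ContinuousAdd A] : Add (IsometryClass s ε) :=
  ⟨Quotient.map₂ SymBundle.prod (fun _ _ ⟨φ⟩ _ _ ⟨ψ⟩ =>
    ⟨{ toIso := φ.toIso.prod ψ.toIso
       map_form := fun x v w =>
        congrArg₂ (· + ·) (φ.map_form x v.1 w.1) (ψ.map_form x v.2 w.2) }⟩)⟩

/-- Addition of isometry classes is given by the orthogonal sum. -/
instance [ContinuousSMul G X] [ContinuousAdd A] : AddCommMonoid (IsometryClass s ε) where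
  add_assoc := by
    rintro ⟨P⟩ ⟨Q⟩ ⟨R⟩
    exact Quotient.sound ⟨{
      toIso := GBundle.prodAssoc P.E Q.E R.E
      map_form := fun x v w => (add_assoc (P.B.form x v.1.1 w.1.1) (Q.B.form x v.1.2 w.1.2)
        (R.B.form x v.2 w.2)).symm }⟩
  add_comm := by
    rintro ⟨P⟩ ⟨Q⟩
    exact Quotient.sound ⟨{
      toIso := GBundle.prodComm P.E Q.E
      map_form := fun x v w => add_comm (Q.B.form x v.2 w.2) (P.B.form x v.1 w.1) }⟩
  zero_add := by
    rintro ⟨P⟩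
    exact Quotient.sound ⟨{
      toIso := GBundle.zeroProd P.E
      map_form := fun x v w => (zero_add (P.B.form x v.2 w.2)).symm }⟩
  add_zero := by
    rintro ⟨P⟩
    exact Quotient.sound ⟨{
      toIso := (GBundle.prodComm P.E _).trans (GBundle.zeroProd P.E)
      map_form := fun x v w => (add_zero (P.B.form x v.1 w.1)).symm }⟩
  nsmul := nsmulRec

/-- The Grothendieck-Witt group `_εGR^𝒜(X)`: the Grothendieck group of the category of
`ε`-symmetric forms on `G`-`𝒜`-bundles. -/
abbrev GW [ContinuousSMul G X] [ContinuousAdd A] (s : AntiInvolution 𝒜) (ε : ℤˣ) :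
    Type (max w (u + 1)) :=
  Algebra.GrothendieckAddGroup (IsometryClass s ε)

/-- The class `[E, ψ]` in `_εGR^𝒜(X)`. -/
def GW.cls [ContinuousSMul G X] [ContinuousAdd A] (P : SymBundle s ε) : GW s ε :=
  Algebra.GrothendieckAddGroup.of (Quotient.mk (isometrySetoid s ε) P : IsometryClass s ε)

end Bundles

/-! ### The group of order two, and the algebras `𝒜⁺ = 𝒜⁰ ⊗ M₂(ℝ)` and `𝒜 = 𝒜⁰ ⊗ ℂ` -/

/-- The group `{1, τ}` of order two. -/
abbrev C2 : Type := Multiplicative (ZMod 2)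

/-- The homomorphism `{1, τ} → M` that sends `τ` to the element `t` of order dividing two. -/
def ofInvolution {M : Type*} [Monoid M] (t : M) (ht : t * t = 1) : C2 →* M where
  toFun := fun g => if g = 1 then 1 else t
  map_one' := if_pos rfl
  map_mul' := by
    intro g h
    have key : ∀ g h : C2, (g = 1 ∧ g * h = h) ∨ (h = 1 ∧ g * h = g) ∨
        (g ≠ 1 ∧ h ≠ 1 ∧ g * h = 1) := by decide
    rcases key g h with ⟨h1, h2⟩ | ⟨h1, h2⟩ | ⟨h1, h2, h3⟩
    · rw [h2, if_pos h1, one_mul]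
    · rw [h2, if_pos h1, mul_one]
    · rw [h3, if_pos rfl, if_neg h1, if_neg h2, ht]

/-- `τ` acts on `ℂ` by complex conjugation. -/
def conjAction : C2 →* (ℂ ≃ₐ[ℝ] ℂ) :=
  ofInvolution Complex.conjAe (by ext z; simp)

/-- The diagonal matrix `diag(1, -1)`. -/
def diagMat : Matrix (Fin 2) (Fin 2) ℝ := Matrix.diagonal ![1, -1]

theorem diagMat_mul_self : diagMat * diagMat = 1 := by
  ext i j; fin_cases i <;> fin_cases j <;> simp [diagMat]

/-- Conjugation by `diag(1, -1)` on `M₂(ℝ)`. -/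
def diagConj : Matrix (Fin 2) (Fin 2) ℝ ≃ₐ[ℝ] Matrix (Fin 2) (Fin 2) ℝ :=
  AlgEquiv.ofLinearEquiv
    { toFun := fun m => diagMat * m * diagMat
      map_add' := by intro a b; rw [mul_add, add_mul]
      map_smul' := by intro c a; simp
      invFun := fun m => diagMat * m * diagMat
      left_inv := by
        intro m
        simp only [mul_assoc, diagMat_mul_self, mul_one]
        rw [← mul_assoc, diagMat_mul_self, one_mul]
      right_inv := by
        intro m
        simp only [mul_assoc, diagMat_mul_self, mul_one]
        rw [← mul_assoc, diagMat_mul_self, one_mul] }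
    (by change diagMat * 1 * diagMat = 1; rw [mul_one, diagMat_mul_self])
    (by
      intro a b
      change diagMat * (a * b) * diagMat = diagMat * a * diagMat * (diagMat * b * diagMat)
      calc diagMat * (a * b) * diagMat = diagMat * a * 1 * b * diagMat := by
            simp only [mul_assoc, one_mul]
        _ = _ := by rw [← diagMat_mul_self]; simp only [mul_assoc])

/-- `τ` acts on `M₂(ℝ)` by conjugation with `diag(1, -1)`. -/
def diagAction : C2 →* (Matrix (Fin 2) (Fin 2) ℝ ≃ₐ[ℝ] Matrix (Fin 2) (Fin 2) ℝ) :=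
  ofInvolution diagConj (by
    refine AlgEquiv.ext fun m => ?_
    change diagMat * (diagMat * m * diagMat) * diagMat = m
    simp only [mul_assoc, diagMat_mul_self, mul_one]
    rw [← mul_assoc, diagMat_mul_self, one_mul])

section Real

variable {X : Type w} [TopologicalSpace X] [MulAction C2 X]
  {A : Type u} [Ring A] [Algebra ℝ A] [TopologicalSpace A]

/-- `KR^𝒜(X)`, the Grothendieck group of Real `𝒜`-bundles: a Real `𝒜`-bundle is a
`G`-`𝒜`-bundle for `G = {1, τ}`. -/
abbrev KR [ContinuousSMul C2 X] (𝒜 : GAlgBundle C2 X A) : Type (max w (u + 1)) := KG 𝒜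

/-- The Real algebra bundle `𝒜⁺ = 𝒜⁰ ⊗ M₂(ℝ)`. -/
abbrev plusBundle (𝒜 : GAlgBundle C2 X A) : GAlgBundle C2 X (A ⊗[ℝ] Matrix (Fin 2) (Fin 2) ℝ) :=
  tensorBundle 𝒜 (Matrix (Fin 2) (Fin 2) ℝ) diagAction

/-- The Real algebra bundle `𝒜 = 𝒜⁰ ⊗ ℂ`, with `τ(a ⊗ z) = τ(a) ⊗ z̄`. -/
abbrev complexBundle (𝒜 : GAlgBundle C2 X A) : GAlgBundle C2 X (A ⊗[ℝ] ℂ) :=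
  tensorBundle 𝒜 ℂ conjAction

/-- The anti-involution `a ⊗ z ↦ a^* ⊗ z` on `𝒜 = 𝒜⁰ ⊗ ℂ`. -/
abbrev complexDag {𝒜 : GAlgBundle C2 X A} (s : AntiInvolution 𝒜) :
    AntiInvolution (complexBundle 𝒜) :=
  s.tensor ℂ conjAction

/-- The element `a ⊗ b` of the fibre of `𝒜 ⊗ B` at `x`. -/
def tmulFib {𝒜 : GAlgBundle C2 X A} {B : Type} [Ring B] [Algebra ℝ B] [Module.Finite ℝ B]
    (β : C2 →* (B ≃ₐ[ℝ] B)) {x : X} (a : 𝒜.Fib x) (b : B) : (tensorBundle 𝒜 B β).Fib x :=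
  (a ⊗ₜ[ℝ] b : 𝒜.Fib x ⊗[ℝ] B)

/-- `ι` identifies the `G`-`𝒜⁰`-bundle `F` with a `G`-stable `𝒜⁰`-subbundle of the underlying
bundle of the `G`-`(𝒜⁰ ⊗ B)`-bundle `E`. -/
structure IsSubbundle {𝒜 : GAlgBundle C2 X A} {B : Type} [Ring B] [Algebra ℝ B]
    [Module.Finite ℝ B] {β : C2 →* (B ≃ₐ[ℝ] B)} {F : GBundle 𝒜} {E : GBundle (tensorBundle 𝒜 B β)}
    (ι : ∀ x, F.Fib x →+ E.Fib x) : Prop where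
  map_smul : ∀ x (a : 𝒜.Fib x) (v : F.Fib x), ι x (a • v) = tmulFib β a 1 • ι x v
  map_act : ∀ g x (v : F.Fib x), ι (g • x) (F.act g x v) = E.act g x (ι x v)
  isEmbedding : Topology.IsEmbedding
    (fun p : Tot F.Fib => (⟨p.proj, ι p.proj p.snd⟩ : Tot E.Fib))

/-- `F` is (isomorphic to) the corner `e₁₁ E` of the Real `𝒜⁺`-bundle `E`, where
`e₁₁ ∈ M₂(ℝ)` is the matrix unit. -/
def IsCorner {𝒜 : GAlgBundle C2 X A} (F : GBundle 𝒜) (E : GBundle (plusBundle 𝒜)) : Prop :=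
  ∃ ι : ∀ x, F.Fib x →+ E.Fib x, IsSubbundle ι ∧
    ∀ x (v : E.Fib x), v ∈ Set.range (ι x) ↔
      tmulFib diagAction (1 : 𝒜.Fib x) (Matrix.single 0 0 1) • v = v

/-- `F` is (isomorphic to) a real form of `E`, that is, `E = F ⊕ iF ≅ F ⊗ ℂ`, on which the symmetric
form of `E` takes values in `𝒜⁰` and is positive definite. -/
def IsPositiveRealForm {𝒜 : GAlgBundle C2 X A} {s : AntiInvolution 𝒜} (F : GBundle 𝒜)
    (P : SymBundle (complexDag s) 1) : Prop :=
  ∃ ι : ∀ x, F.Fib x →+ P.E.Fib x, IsSubbundle ι ∧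
    (∀ x (v : P.E.Fib x), ∃! p : F.Fib x × F.Fib x,
      v = ι x p.1 + tmulFib conjAction (1 : 𝒜.Fib x) Complex.I • ι x p.2) ∧
    (∀ x (v w : F.Fib x), ∃ a : 𝒜.Fib x,
      P.B.form x (ι x v) (ι x w) = tmulFib conjAction a 1) ∧
    (∀ x (v : F.Fib x), ∃ a : 𝒜.Fib x,
      P.B.form x (ι x v) (ι x v) = tmulFib conjAction (a * s.dag x a) 1)

instance tensor_continuousAdd {A B : Type*} [Ring A] [Algebra ℝ A] [Ring B] [Algebra ℝ B]
    [TopologicalSpace A] [ContinuousAdd A] : ContinuousAdd (A ⊗[ℝ] B) :=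
  continuousAdd_iInf fun f => continuousAdd_induced (slice A f)

/-- `A` is a (unital) `C^*`-algebra over `ℝ`: it is `*`-isometrically isomorphic to an algebra of
bounded operators on a real Hilbert space (norm-closed, when `A` is complete). -/
def IsRealCStarAlgebra (A : Type u) [NormedRing A] [NormedAlgebra ℝ A] [StarRing A] : Prop :=
  ∃ (H : Type u) (_ : NormedAddCommGroup H) (_ : InnerProductSpace ℝ H) (_ : CompleteSpace H)
    (π : A →ₐ[ℝ] (H →L[ℝ] H)),
    (∀ a, ‖π a‖ = ‖a‖) ∧ ∀ a, π (star a) = ContinuousLinearMap.adjoint (π a)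

/-- The anti-involution `s` makes `𝒜` a bundle of `*`-algebras with fibre the `*`-algebra `A`: the
local trivializations are `*`-isomorphisms. -/
def AntiInvolution.IsModelledOnStar [StarRing A] {𝒜 : GAlgBundle C2 X A}
    (s : AntiInvolution 𝒜) : Prop :=
  ∀ (x₀ : X) (x : 𝒜.dom x₀) (a : 𝒜.Fib x),
    𝒜.chart x₀ x (s.dag x a) = star (𝒜.chart x₀ x a)

variable (X) [ContinuousSMul C2 X]

/-- The trivial Real algebra bundle `X × ℂ`, with `τ(x, z) = (τ x, z̄)`. -/
def realC : GAlgBundle C2 X ℂ :=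
  trivialBundle X conjAction (continuous_prod_of_discrete_left.2 fun g =>
    ((conjAction g : ℂ ≃ₐ[ℝ] ℂ).toLinearMap).continuous_of_finiteDimensional)

/-- The identity of `ℂ`, as an anti-involution on the bundle `X × ℂ`. -/
def realCDag : AntiInvolution (realC X) where
  dag := fun _ => LinearMap.id
  dag_dag := fun _ _ => rfl
  dag_mul := fun _ a b => mul_comm (G := ℂ) a b
  dag_act := fun _ _ _ => rfl
  continuous_dag := continuous_id

/-- `GR(X)`, the Grothendieck-Witt group of symmetric forms on Real vector bundles over `X`
(complex vector bundles with an antilinear involution that covers the one of `X`). -/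
abbrev GR : Type (max w 1) := GW (realCDag X) 1

/-- `KO_G(X)` for `G = {1, τ}`, the Grothendieck group of real `G`-vector bundles, i.e. of
`G`-bundles over the trivial algebra bundle `X × ℝ` with `G` acting trivially on `ℝ`. -/
abbrev KOG : Type (max w 1) :=
  KG (trivialBundle X (1 : C2 →* (ℝ ≃ₐ[ℝ] ℝ)) continuous_snd)

end Real

end TwistedK

end

open scoped TensorProduct

noncomputable section

namespace TwistedK

open Filter Topology

universe u w

/-! ### Square roots in Banach algebras -/

section SqrtOneSub

variable {R : Type*} [NormedRing R] [NormedAlgebra ℝ R]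

/-! Both isomorphisms come from a relation between isomorphism classes of objects that is total and
single-valued in both directions and compatible with direct sums. Such a relation is an isomorphism
of monoids, hence of Grothendieck groups (`exists_grothendieck_equiv`).

The first is Morita equivalence. Since τ fixes e₁₁, the image of e₁₁ is a G-stable 𝒜-subbundle F of
E (`exists_isCorner`), and w = e₁₁w + e₂₁(e₁₂w) recovers E as F ⊗ ℝ². Complexification F ↦ F ⊗ ℂ has
the same shape, so both are treated together: a `HalfRep` presents ℝ² as a left ideal of B, the
first column of M₂(ℝ) or all of ℂ, and `IsHalf.exists_iso` identifies E with `GBundle.double`.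

For the second, let b = Re B. As B is bilinear over ℂ, multiplication by i is self-adjoint for b.
Averaging gives an invariant metric g on E for which i is skew (`exists_unitary_metric`). The
operator T with g(Tv, w) = b(v, w) is self-adjoint, invertible and equivariant, and anticommutes
with i. Its sign J = |T|⁻¹T, with |T| the positive square root of T², is an equivariant involution
that anticommutes with i and makes b(Jv, w) positive (`SymBundle.exists_polarization`). The fixed
bundle F of J satisfies E = F ⊕ iF, and B is real and positive on it (`exists_isPositiveRealForm`).

The class of F is unique. If F and F' are two positive real forms of E, the projection of F to F'
along iF' is an isomorphism: followed by the projection back to F, it is represented by h + τ^*h',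
where h and h' are the restricted metrics and τ takes the iF' component, and this sum is
nondegenerate (`IsMetricHalf.exists_iso_of_left`). Conversely F determines (E, B): any two invariant
metrics on F are related by the square root of one relative to the other (`Metric.exists_isometry`),
and a metric on F extends to a unique ℂ-bilinear form on F ⊗ ℂ.

These arguments need operator theory over a real C^*-algebra A. Positivity in A is tested on the
vector states a ↦ ⟨ξ, aξ⟩ of a faithful representation, and square roots are limits of the iteration
y ↦ (z + y²)/2, which requires no complex scalars. A nondegenerate positive form dominates the
coordinates of a frame (`IsPosForm.isCoercive`), so it turns a finitely generated projective module
into a Banach space. Neumann series then give invertibility (`bijective_of_lower_bound`), whence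
sums of metrics are nondegenerate and partitions of unity produce metrics (`exists_metric`). In a
chart normed by a metric, continuous families of A-linear maps become norm continuous
(`MetricChart`). So inverses, representing operators and square roots vary continuously, and the
image of a continuous family of projections is locally trivial (`IsProj.isLocallyTrivial`).

The third isomorphism is the case A = ℝ of the second, transferred along ℂ ≅ ℝ ⊗ ℂ. -/

/-- The iteration `y ↦ (z + y²) / 2`, whose limit `y` satisfies `(1 - y)² = 1 - z`. -/
def sqrtIter (z : R) : ℕ → R
  | 0 => 0
  | k + 1 => (2 : ℝ)⁻¹ • (z + sqrtIter z k * sqrtIter z k)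

theorem sqrtIter_succ (z : R) (k : ℕ) :
    sqrtIter z (k + 1) = (2 : ℝ)⁻¹ • (z + sqrtIter z k * sqrtIter z k) := rfl

theorem sqrtIter_one_nonneg (k : ℕ) : 0 ≤ sqrtIter (1 : ℝ) k := by
  cases k with
  | zero => exact le_rfl
  | succ k => rw [sqrtIter_succ]; exact mul_nonneg (by norm_num) (add_nonneg zero_le_one (mul_self_nonneg _))

theorem sqrtIter_one_le (k : ℕ) : sqrtIter (1 : ℝ) k ≤ 1 := by
  induction k with
  | zero => exact zero_le_one
  | succ k ih =>
    rw [sqrtIter_succ, smul_eq_mul]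
    nlinarith [sqrtIter_one_nonneg k]

/-- The recursion has nonnegative coefficients, so the scalar iterates at 1 majorize those of every
`z` in the unit ball. This reduces convergence in a Banach algebra to a bounded monotone real
sequence. -/
theorem norm_sqrtIter_le {z : R} (hz : ‖z‖ ≤ 1) (k : ℕ) : ‖sqrtIter z k‖ ≤ sqrtIter (1 : ℝ) k := by
  induction k with
  | zero => simp [sqrtIter]
  | succ k ih =>
    rw [sqrtIter_succ, sqrtIter_succ, norm_smul, smul_eq_mul, norm_inv, Real.norm_two]
    gcongr
    exact (norm_add_le _ _).trans (add_le_add hz ((norm_mul_le _ _).trans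
      (mul_le_mul ih ih (norm_nonneg _) (sqrtIter_one_nonneg k))))

/-- Rests on y² − x² = (y − x)y + x(y − x), which needs no commutativity and lets increments be
majorized by induction. -/
theorem sqrtIter_succ_sub (z : R) (k : ℕ) :
    sqrtIter z (k + 1 + 1) - sqrtIter z (k + 1) =
      (2 : ℝ)⁻¹ • ((sqrtIter z (k + 1) - sqrtIter z k) * sqrtIter z (k + 1) +
        sqrtIter z k * (sqrtIter z (k + 1) - sqrtIter z k)) := by
  rw [sqrtIter_succ z (k + 1)]
  conv_lhs => rw [sub_eq_add_neg]; arg 2; rw [sqrtIter_succ z k]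
  rw [← sub_eq_add_neg, ← smul_sub]
  congr 1
  noncomm_ring

theorem norm_sqrtIter_succ_sub_le {z : R} (hz : ‖z‖ ≤ 1) (k : ℕ) :
    ‖sqrtIter z (k + 1) - sqrtIter z k‖ ≤ sqrtIter (1 : ℝ) (k + 1) - sqrtIter (1 : ℝ) k := by
  induction k with
  | zero => simpa [sqrtIter, norm_smul] using hz
  | succ k ih =>
    rw [sqrtIter_succ_sub, sqrtIter_succ_sub, norm_smul, smul_eq_mul, norm_inv, Real.norm_two]
    gcongr
    refine (norm_add_le _ _).trans (add_le_add ((norm_mul_le _ _).trans ?_)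
      ((norm_mul_le _ _).trans ?_))
    · exact mul_le_mul ih (norm_sqrtIter_le hz _) (norm_nonneg _) ((norm_nonneg _).trans ih)
    · exact mul_le_mul (norm_sqrtIter_le hz _) ih (norm_nonneg _) (sqrtIter_one_nonneg k)

theorem sqrtIter_one_monotone : Monotone (sqrtIter (1 : ℝ)) :=
  monotone_nat_of_le_succ fun k => by
    have := norm_sqrtIter_succ_sub_le (R := ℝ) (z := 1) (by simp) k
    linarith [norm_nonneg (sqrtIter (1 : ℝ) (k + 1) - sqrtIter (1 : ℝ) k)]

theorem norm_sqrtIter_sub_le {z : R} (hz : ‖z‖ ≤ 1) {m n : ℕ} (hmn : m ≤ n) :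
    ‖sqrtIter z n - sqrtIter z m‖ ≤ sqrtIter (1 : ℝ) n - sqrtIter (1 : ℝ) m := by
  induction n, hmn using Nat.le_induction with
  | base => simp
  | succ n _ ih =>
    calc ‖sqrtIter z (n + 1) - sqrtIter z m‖
        = ‖(sqrtIter z (n + 1) - sqrtIter z n) + (sqrtIter z n - sqrtIter z m)‖ := by
          rw [sub_add_sub_cancel]
      _ ≤ _ := (norm_add_le _ _).trans (add_le_add (norm_sqrtIter_succ_sub_le hz n) ih)
      _ = _ := by ring

/-- The limit of `sqrtIter`. -/
def sqrtLim (z : R) : R := limUnder atTop (sqrtIter z)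

/-- The value of the limit plays no role: T minus the n-th iterate is only a tail bound, uniform in
`z`. -/
theorem exists_tendsto_sqrtIter_one :
    ∃ T, Tendsto (sqrtIter (1 : ℝ)) atTop (𝓝 T) ∧ ∀ k, sqrtIter (1 : ℝ) k ≤ T := by
  have hb : BddAbove (Set.range (sqrtIter (1 : ℝ))) :=
    ⟨1, by rintro _ ⟨k, rfl⟩; exact sqrtIter_one_le k⟩
  exact ⟨_, tendsto_atTop_ciSup sqrtIter_one_monotone hb, fun k => le_ciSup hb k⟩

variable [CompleteSpace R]

theorem tendsto_sqrtIter {z : R} (hz : ‖z‖ ≤ 1) :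
    Tendsto (sqrtIter z) atTop (𝓝 (sqrtLim z)) := by
  obtain ⟨T, hT, hle⟩ := exists_tendsto_sqrtIter_one
  refine CauchySeq.tendsto_limUnder ?_
  refine cauchySeq_of_le_tendsto_0' (fun n => T - sqrtIter (1 : ℝ) n) (fun n m hnm => ?_) ?_
  · rw [dist_comm, dist_eq_norm]
    linarith [norm_sqrtIter_sub_le hz hnm, hle m]
  · simpa using hT.const_sub T

theorem norm_sqrtLim_le {z : R} (hz : ‖z‖ ≤ 1) : ‖sqrtLim z‖ ≤ 1 :=
  le_of_tendsto (tendsto_sqrtIter hz).norm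
    (Eventually.of_forall fun k => (norm_sqrtIter_le hz k).trans (sqrtIter_one_le k))

theorem one_sub_sqrtLim_mul_self {z : R} (hz : ‖z‖ ≤ 1) :
    (1 - sqrtLim z) * (1 - sqrtLim z) = 1 - z := by
  have h := tendsto_sqrtIter hz
  have h1 : Tendsto (fun k => sqrtIter z (k + 1)) atTop (𝓝 (sqrtLim z)) :=
    h.comp (tendsto_add_atTop_nat 1)
  have h2 : Tendsto (fun k => sqrtIter z (k + 1)) atTop
      (𝓝 ((2 : ℝ)⁻¹ • (z + sqrtLim z * sqrtLim z))) :=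
    ((h.mul h).const_add z).const_smul _
  have h3 := tendsto_nhds_unique h1 h2
  have h4 : (2 : ℝ) • sqrtLim z = z + sqrtLim z * sqrtLim z := by
    conv_lhs => rw [h3]
    rw [smul_smul]; norm_num
  rw [two_smul] at h4
  have h5 : (1 - sqrtLim z) * (1 - sqrtLim z) =
      1 - (sqrtLim z + sqrtLim z) + sqrtLim z * sqrtLim z := by noncomm_ring
  rw [h5, h4]
  noncomm_ring

/-- Any closed condition stable under one step of the iteration passes to the limit. Commutation,
self-adjointness and linearity over A reach square roots in this way. -/
theorem sqrtLim_mem {z : R} (hz : ‖z‖ ≤ 1) {K : Set R} (hK : IsClosed K) (h0 : (0 : R) ∈ K)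
    (hstep : ∀ y ∈ K, (2 : ℝ)⁻¹ • (z + y * y) ∈ K) : sqrtLim z ∈ K := by
  refine hK.mem_of_tendsto (tendsto_sqrtIter hz) (Eventually.of_forall fun k => ?_)
  induction k with
  | zero => exact h0
  | succ k ih => exact hstep _ ih

theorem commute_sqrtLim {z c : R} (hz : ‖z‖ ≤ 1) (hc : c * z = z * c) :
    c * sqrtLim z = sqrtLim z * c := by
  refine sqrtLim_mem (K := {y | c * y = y * c}) hz (isClosed_eq (by fun_prop) (by fun_prop))
    (by simp) fun y hy => ?_
  rw [Set.mem_ofPred_eq] at hy ⊢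
  rw [mul_smul_comm, smul_mul_assoc, mul_add, add_mul, hc, ← mul_assoc, hy, mul_assoc, hy,
    mul_assoc]

/-- The scalar tail bound does not depend on `z`, so the limit is uniform on the closed unit ball.
-/
theorem continuousOn_sqrtLim : ContinuousOn (sqrtLim (R := R)) (Metric.closedBall 0 1) := by
  obtain ⟨T, hT, hle⟩ := exists_tendsto_sqrtIter_one
  have hcont : ∀ k, Continuous fun z : R => sqrtIter z k := by
    intro k
    induction k with
    | zero => exact continuous_const
    | succ k ih => exact (continuous_id.add (ih.mul ih)).const_smul _
  have hu : TendstoUniformlyOn (fun k (z : R) => sqrtIter z k) sqrtLim atTop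
      (Metric.closedBall 0 1) := by
    rw [Metric.tendstoUniformlyOn_iff]
    intro ε hε
    have h0 : Tendsto (fun n => T - sqrtIter (1 : ℝ) n) atTop (𝓝 0) := by
      simpa using hT.const_sub T
    filter_upwards [h0.eventually_lt_const hε] with n hn z hz
    have hz' : ‖z‖ ≤ 1 := by simpa using hz
    refine lt_of_le_of_lt ?_ hn
    rw [dist_eq_norm]
    refine le_of_tendsto ((tendsto_sqrtIter hz').sub_const _).norm ?_
    filter_upwards [eventually_ge_atTop n] with m hm
    linarith [norm_sqrtIter_sub_le hz' hm, hle m]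
  exact hu.continuousOn (Frequently.of_forall fun k => (hcont k).continuousOn)

end SqrtOneSub

/-! ### Real `C^*`-algebras -/

/-- An isometric `*`-representation of `A` on a real Hilbert space `H`. -/
structure StarRep (A H : Type*) [NormedRing A] [NormedAlgebra ℝ A] [StarRing A]
    [NormedAddCommGroup H] [InnerProductSpace ℝ H] [CompleteSpace H] where
  π : A →ₐ[ℝ] (H →L[ℝ] H)
  norm_π : ∀ a, ‖π a‖ = ‖a‖
  π_star : ∀ a, π (star a) = ContinuousLinearMap.adjoint (π a)

namespace StarRep

variable {A H : Type*} [NormedRing A] [NormedAlgebra ℝ A] [StarRing A]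
  [NormedAddCommGroup H] [InnerProductSpace ℝ H] [CompleteSpace H] (ρ : StarRep A H)

theorem π_injective : Function.Injective ρ.π := by
  intro a b h
  rw [← sub_eq_zero, ← norm_eq_zero, ← ρ.norm_π, map_sub, h, sub_self, norm_zero]

include ρ in
-- A star ring structure alone says nothing about real scalars; linearity is read off from the
-- adjoint in the faithful representation.
theorem star_smul (c : ℝ) (a : A) : star (c • a) = c • star a := by
  apply ρ.π_injective
  rw [ρ.π_star, map_smul, map_smul, map_smul, ρ.π_star]

include ρ in
theorem norm_star (a : A) : ‖star a‖ = ‖a‖ := by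
  rw [← ρ.norm_π, ρ.π_star, LinearIsometryEquiv.norm_map, ρ.norm_π]

include ρ in
theorem continuous_star : Continuous (star : A → A) := by
  refine (AddMonoidHomClass.isometry_of_norm (starAddEquiv : A ≃+ A) ?_).continuous
  exact fun a => ρ.norm_star a

/-- The functional `a ↦ ⟨ξ, a ξ⟩`. -/
def ev (ξ : H) : A →ₗ[ℝ] ℝ where
  toFun := fun a => inner ℝ ξ (ρ.π a ξ)
  map_add' := fun a b => by rw [map_add, add_apply, inner_add_right]
  map_smul' := fun c a => by
    rw [map_smul, smul_apply, inner_smul_right]; rfl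

theorem ev_apply (ξ : H) (a : A) : ρ.ev ξ a = inner ℝ ξ (ρ.π a ξ) := rfl

theorem inner_star (a : A) (ξ η : H) : inner ℝ (ρ.π (star a) ξ) η = inner ℝ ξ (ρ.π a η) := by
  rw [ρ.π_star, ContinuousLinearMap.adjoint_inner_left]

theorem ev_star (ξ : H) (a : A) : ρ.ev ξ (star a) = ρ.ev ξ a := by
  rw [ev_apply, real_inner_comm, inner_star, ev_apply]

/-- Conjugation moves a vector state from ξ to c^*ξ. With the norm bound on states this gives c a
c^* ≤ ‖a‖ c c^*, the basic inequality in the estimates on forms. -/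
theorem ev_conj (ξ : H) (c a : A) : ρ.ev ξ (c * a * star c) = ρ.ev (ρ.π (star c) ξ) a := by
  rw [ev_apply, ev_apply, inner_star, map_mul, map_mul]
  rfl

theorem ev_mul_star (ξ : H) (c : A) : ρ.ev ξ (c * star c) = ‖ρ.π (star c) ξ‖ ^ 2 := by
  rw [← real_inner_self_eq_norm_sq, inner_star, ev_apply, map_mul]
  rfl

theorem ev_one (ξ : H) : ρ.ev ξ 1 = ‖ξ‖ ^ 2 := by
  rw [ev_apply, map_one, ← real_inner_self_eq_norm_sq]
  rfl

theorem ev_mul_star_nonneg (ξ : H) (c : A) : 0 ≤ ρ.ev ξ (c * star c) := by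
  rw [ev_mul_star]; positivity

theorem norm_π_apply_le (a : A) (ξ : H) : ‖ρ.π a ξ‖ ≤ ‖a‖ * ‖ξ‖ := by
  rw [← ρ.norm_π]; exact (ρ.π a).le_opNorm ξ

theorem ev_le (ξ : H) (a : A) : ρ.ev ξ a ≤ ‖a‖ * ‖ξ‖ ^ 2 := by
  refine (real_inner_le_norm _ _).trans ?_
  calc ‖ξ‖ * ‖ρ.π a ξ‖ ≤ ‖ξ‖ * (‖a‖ * ‖ξ‖) := by gcongr; exact ρ.norm_π_apply_le a ξ
    _ = _ := by ring

theorem norm_le_of_apply {a : A} {C : ℝ} (hC : 0 ≤ C) (h : ∀ ξ, ‖ρ.π a ξ‖ ≤ C * ‖ξ‖) :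
    ‖a‖ ≤ C := by
  rw [← ρ.norm_π]
  exact ContinuousLinearMap.opNorm_le_bound _ hC h

/-- Cauchy–Schwarz for the positive scalar form ⟨ξ, aη⟩ at η = aξ yields ‖aξ‖⁴ ≤ C‖ξ‖² · C‖aξ‖². -/
theorem norm_le_of_ev_le {a : A} (ha : star a = a) (h0 : ∀ ξ, 0 ≤ ρ.ev ξ a) {C : ℝ} (hC : 0 ≤ C)
    (h : ∀ ξ, ρ.ev ξ a ≤ C * ‖ξ‖ ^ 2) : ‖a‖ ≤ C := by
  refine ρ.norm_le_of_apply hC fun ξ => ?_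
  let b : LinearMap.BilinForm ℝ H := LinearMap.mk₂ ℝ (fun ξ η => inner ℝ ξ (ρ.π a η))
    (fun _ _ _ => inner_add_left _ _ _) (fun _ _ _ => real_inner_smul_left _ _ _)
    (fun _ _ _ => by rw [map_add, inner_add_right])
    (fun _ _ _ => by rw [map_smul, real_inner_smul_right]; rfl)
  have hb : LinearMap.IsSymm b := ⟨fun ξ η => by
    change inner ℝ ξ (ρ.π a η) = inner ℝ η (ρ.π a ξ)
    rw [← inner_star, ha, real_inner_comm]⟩
  have h1 : (inner ℝ ξ (ρ.π a (ρ.π a ξ)) : ℝ) ^ 2 ≤ ρ.ev ξ a * ρ.ev (ρ.π a ξ) a :=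
    LinearMap.BilinForm.apply_sq_le_of_symm b h0 hb ξ (ρ.π a ξ)
  rw [← inner_star, ha, real_inner_self_eq_norm_sq] at h1
  have h2 := mul_le_mul (h ξ) (h (ρ.π a ξ)) (h0 _) (by positivity)
  by_contra! hlt
  have hpos : 0 < ‖ρ.π a ξ‖ := lt_of_le_of_lt (by positivity) hlt
  have h3 : (C * ‖ξ‖) ^ 2 < ‖ρ.π a ξ‖ ^ 2 := pow_lt_pow_left₀ hlt (by positivity) two_ne_zero
  have h4 : 0 < ‖ρ.π a ξ‖ ^ 2 := by positivity
  nlinarith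

/-- A positive element of a real `C^*`-algebra is of the form `c c^*`. -/
theorem exists_eq_mul_star [CompleteSpace A] {a : A} (ha : star a = a) (h0 : ∀ ξ, 0 ≤ ρ.ev ξ a) :
    ∃ c, a = c * star c := by
  by_cases ha0 : a = 0
  · exact ⟨0, by simp [ha0]⟩
  have hn : 0 < ‖a‖ := norm_pos_iff.2 ha0
  -- After scaling, 0 ≤ a/‖a‖ ≤ 1 on all vector states, hence also 0 ≤ z ≤ 1 and ‖z‖ ≤ 1. The square
  -- of 1 − `sqrtLim z` is then 1 − z = a/‖a‖.
  set z : A := 1 - ‖a‖⁻¹ • a with hz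
  have hzs : star z = z := by rw [hz, star_sub, star_one, ρ.star_smul, ha]
  have hev : ∀ ξ, ρ.ev ξ z = ‖ξ‖ ^ 2 - ‖a‖⁻¹ * ρ.ev ξ a := fun ξ => by
    rw [hz, map_sub, ev_one, map_smul, smul_eq_mul]
  have hz1 : ‖z‖ ≤ 1 := by
    refine ρ.norm_le_of_ev_le hzs (fun ξ => ?_) zero_le_one fun ξ => ?_
    · rw [hev, sub_nonneg, inv_mul_le_iff₀ hn]; exact ρ.ev_le ξ a
    · rw [hev, one_mul]
      have := mul_nonneg (inv_nonneg.2 hn.le) (h0 ξ)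
      linarith
  have hs : star (1 - sqrtLim z) = 1 - sqrtLim z := by
    rw [star_sub, star_one]
    congr 1
    refine sqrtLim_mem (K := {y | star y = y}) hz1
      (isClosed_eq ρ.continuous_star continuous_id) (star_zero A) fun y hy => ?_
    rw [Set.mem_ofPred_eq] at hy ⊢
    rw [ρ.star_smul, star_add, hzs, star_mul, hy]
  refine ⟨√‖a‖ • (1 - sqrtLim z), ?_⟩
  rw [ρ.star_smul, hs, smul_mul_smul_comm, one_sub_sqrtLim_mul_self hz1, hz, sub_sub_cancel,
    smul_smul, Real.mul_self_sqrt hn.le, mul_inv_cancel₀ hn.ne', one_smul]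

end StarRep

/-! ### Frames and positive forms -/

/-- A finite frame `v = ∑ fᵢ(v) eᵢ` of an `A`-module `M`. -/
structure Frame (A M : Type*) [Ring A] [AddCommGroup M] [Module A M] where
  ι : Type
  [fintype : Fintype ι]
  e : ι → M
  f : ι → M →ₗ[A] A
  sum_eq : ∀ v, ∑ i, f i v • e i = v

attribute [instance] Frame.fintype

theorem Frame.map_eq {A M : Type*} [Ring A] [AddCommGroup M] [Module A M] (F : Frame A M)
    {N : Type*} [AddCommGroup N] [Module A N] (φ : M →ₗ[A] N) (v : M) :
    φ v = ∑ i, F.f i v • φ (F.e i) := by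
  conv_lhs => rw [← F.sum_eq v]
  simp

/-- `g` is a hermitian form. -/
def IsHerm {A M : Type*} [Ring A] [StarRing A] [AddCommGroup M] [Module A M]
    (g : M →+ (M →ₗ[A] A)) : Prop :=
  ∀ v w, g w v = star (g v w)

/-- `g` is a hermitian form that takes values of the form `c c^*` on the diagonal. -/
structure IsPosForm {A M : Type*} [Ring A] [StarRing A] [AddCommGroup M] [Module A M]
    (g : M →+ (M →ₗ[A] A)) : Prop where
  herm : IsHerm g
  nonneg : ∀ v, ∃ c, g v v = c * star c

theorem IsHerm.smul_left {A M : Type*} [Ring A] [StarRing A] [AddCommGroup M] [Module A M]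
    {g : M →+ (M →ₗ[A] A)} (hg : IsHerm g) (a : A) (v w : M) : g (a • v) w = g v w * star a := by
  rw [hg w, map_smul, smul_eq_mul, star_mul, ← hg]

theorem IsHerm.sum_left {A M : Type*} [Ring A] [StarRing A] [AddCommGroup M] [Module A M]
    {g : M →+ (M →ₗ[A] A)} (hg : IsHerm g) {ι : Type*} (s : Finset ι) (a : ι → A) (e : ι → M)
    (w : M) : g (∑ i ∈ s, a i • e i) w = ∑ i ∈ s, g (e i) w * star (a i) := by
  rw [map_sum, LinearMap.sum_apply]
  exact Finset.sum_congr rfl fun i _ => hg.smul_left _ _ _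

/-! ### Vector states of positive forms: Cauchy–Schwarz, coercivity and domination. -/

section Core

variable {A H : Type*} [NormedRing A] [NormedAlgebra ℝ A] [StarRing A]
  [NormedAddCommGroup H] [InnerProductSpace ℝ H] [CompleteSpace H] (ρ : StarRep A H)
  {M : Type*} [AddCommGroup M] [Module A M] [Module ℝ M] [IsScalarTower ℝ A M]

omit [Module ℝ M] [IsScalarTower ℝ A M] in
theorem IsPosForm.ev_nonneg {g : M →+ (M →ₗ[A] A)} (hg : IsPosForm g) (ξ : H) (v : M) :
    0 ≤ ρ.ev ξ (g v v) := by
  obtain ⟨c, hc⟩ := hg.nonneg v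
  rw [hc]; exact ρ.ev_mul_star_nonneg ξ c

omit [Module ℝ M] [IsScalarTower ℝ A M] in
-- The algebraic shape c c^* of diagonal values is awkward for sums and limits. By the existence of
-- square roots in A it may be checked on vector states.
theorem isPosForm_of_ev [CompleteSpace A] {g : M →+ (M →ₗ[A] A)} (hg : IsHerm g)
    (h : ∀ ξ v, 0 ≤ ρ.ev ξ (g v v)) : IsPosForm g :=
  ⟨hg, fun v => ρ.exists_eq_mul_star (hg v v).symm fun ξ => h ξ v⟩

omit [StarRing A] in
theorem form_real_smul_right (g : M →+ (M →ₗ[A] A)) (c : ℝ) (v w : M) :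
    g v (c • w) = c • g v w := LinearMap.map_smul_of_tower _ _ _

include ρ in
theorem IsHerm.real_smul_left {g : M →+ (M →ₗ[A] A)} (hg : IsHerm g) (c : ℝ) (v w : M) :
    g (c • v) w = c • g v w := by
  rw [hg w, form_real_smul_right, ρ.star_smul, ← hg]

/-- The scalar form `(v, w) ↦ ⟨ξ, g(v, w) ξ⟩`. -/
def evForm {g : M →+ (M →ₗ[A] A)} (hg : IsHerm g) (ξ : H) : LinearMap.BilinForm ℝ M :=
  LinearMap.mk₂ ℝ (fun v w => ρ.ev ξ (g v w))
    (fun v v' w => by rw [map_add, LinearMap.add_apply, map_add])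
    (fun c v w => by rw [hg.real_smul_left ρ, map_smul])
    (fun v w w' => by rw [map_add, map_add])
    (fun c v w => by rw [form_real_smul_right, map_smul])

theorem evForm_apply {g : M →+ (M →ₗ[A] A)} (hg : IsHerm g) (ξ : H) (v w : M) :
    evForm ρ hg ξ v w = ρ.ev ξ (g v w) := rfl

theorem evForm_isSymm {g : M →+ (M →ₗ[A] A)} (hg : IsHerm g) (ξ : H) :
    LinearMap.IsSymm (evForm ρ hg ξ) :=
  ⟨fun v w => by
    rw [RingHom.id_apply, evForm_apply, evForm_apply, hg v w, ρ.ev_star]⟩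

theorem IsPosForm.ev_sq_le {g : M →+ (M →ₗ[A] A)} (hg : IsPosForm g) (ξ : H) (v w : M) :
    (ρ.ev ξ (g v w)) ^ 2 ≤ ρ.ev ξ (g v v) * ρ.ev ξ (g w w) :=
  LinearMap.BilinForm.apply_sq_le_of_symm (evForm ρ hg.herm ξ) (fun v => hg.ev_nonneg ρ ξ v)
    (evForm_isSymm ρ hg.herm ξ) v w

/-- The Cauchy-Schwarz inequality for a form with values in a `C^*`-algebra. -/
theorem IsPosForm.cauchy_schwarz {g : M →+ (M →ₗ[A] A)} (hg : IsPosForm g) (ξ : H) (u v : M) :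
    ρ.ev ξ (g u v * star (g u v)) ≤ ‖g u u‖ * ρ.ev ξ (g v v) := by
  set a := g u v with ha
  -- With a = g(u, v), the values are g(au, v) = a a^* and g(au, au) = a g(u, u) a^*; the latter is
  -- at most ‖g(u, u)‖ a a^* on each state, so one factor of a a^* cancels.
  have h1 := hg.ev_sq_le ρ ξ (a • u) v
  rw [hg.herm.smul_left, hg.herm.smul_left, map_smul, smul_eq_mul, ρ.ev_conj, ← ha] at h1
  have h2 := ρ.ev_le (ρ.π (star a) ξ) (g u u)
  rw [← ρ.ev_mul_star] at h2
  have h3 := ρ.ev_mul_star_nonneg ξ a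
  have h4 := hg.ev_nonneg ρ ξ v
  by_contra! hlt
  have h5 := mul_le_mul_of_nonneg_right h2 h4
  have h6 : 0 < ρ.ev ξ (a * star a) := lt_of_le_of_lt (by positivity) hlt
  nlinarith

theorem IsPosForm.norm_sq_le {g : M →+ (M →ₗ[A] A)} (hg : IsPosForm g) (u v : M) (ρ : StarRep A H) :
    ‖g u v‖ ^ 2 ≤ ‖g u u‖ * ‖g v v‖ := by
  have h : ‖star (g u v)‖ ≤ √(‖g u u‖ * ‖g v v‖) := by
    refine ρ.norm_le_of_apply (by positivity) fun ξ => ?_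
    refine le_of_sq_le_sq ?_ (by positivity)
    rw [← ρ.ev_mul_star, mul_pow, Real.sq_sqrt (by positivity), mul_assoc]
    exact (hg.cauchy_schwarz ρ ξ u v).trans
      (mul_le_mul_of_nonneg_left (ρ.ev_le ξ _) (norm_nonneg _))
  rw [ρ.norm_star] at h
  calc ‖g u v‖ ^ 2 ≤ √(‖g u u‖ * ‖g v v‖) ^ 2 := by gcongr
    _ = _ := Real.sq_sqrt (by positivity)

/-- A form that dominates the coordinates of the frame `F`. -/
def IsCoercive (F : Frame A M) (g : M →+ (M →ₗ[A] A)) : Prop :=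
  ∃ C : ℝ, 0 ≤ C ∧ ∀ i v ξ, ρ.ev ξ (F.f i v * star (F.f i v)) ≤ C * ρ.ev ξ (g v v)

/-- Surjectivity represents each coordinate fᵢ as g(uᵢ, ·), and Cauchy–Schwarz bounds it by ‖g(uᵢ,
uᵢ)‖. -/
theorem IsPosForm.isCoercive {g : M →+ (M →ₗ[A] A)} (hg : IsPosForm g) (F : Frame A M)
    (hb : Function.Surjective g) : IsCoercive ρ F g := by
  choose u hu using fun i => hb (F.f i)
  refine ⟨∑ i, ‖g (u i) (u i)‖, Finset.sum_nonneg fun i _ => norm_nonneg _, fun i v ξ => ?_⟩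
  rw [← hu i]
  refine (hg.cauchy_schwarz ρ ξ (u i) v).trans ?_
  refine mul_le_mul_of_nonneg_right ?_ (hg.ev_nonneg ρ ξ v)
  exact Finset.single_le_sum (f := fun i => ‖g (u i) (u i)‖) (fun i _ => norm_nonneg _)
    (Finset.mem_univ i)

omit [Module ℝ M] [IsScalarTower ℝ A M] in
-- Positivity at xᵢ − xⱼ bounds each cross term by the mean of the two diagonal terms.
theorem IsPosForm.ev_sum_le {g : M →+ (M →ₗ[A] A)} (hg : IsPosForm g) (ξ : H) {ι : Type*}
    [Fintype ι] (x : ι → M) :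
    ρ.ev ξ (g (∑ i, x i) (∑ i, x i)) ≤ Fintype.card ι * ∑ i, ρ.ev ξ (g (x i) (x i)) := by
  have h2 : ∀ i j, ρ.ev ξ (g (x i) (x j)) ≤
      (ρ.ev ξ (g (x i) (x i)) + ρ.ev ξ (g (x j) (x j))) / 2 := by
    intro i j
    have h := hg.ev_nonneg ρ ξ (x i - x j)
    have hs : ρ.ev ξ (g (x j) (x i)) = ρ.ev ξ (g (x i) (x j)) := by
      rw [hg.herm (x i) (x j), ρ.ev_star]
    simp only [map_sub, LinearMap.sub_apply] at h
    linarith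
  calc ρ.ev ξ (g (∑ i, x i) (∑ i, x i)) = ∑ i, ∑ j, ρ.ev ξ (g (x i) (x j)) := by
        simp only [map_sum, LinearMap.sum_apply]
        exact Finset.sum_comm
    _ ≤ ∑ i, ∑ j, (ρ.ev ξ (g (x i) (x i)) + ρ.ev ξ (g (x j) (x j))) / 2 :=
        Finset.sum_le_sum fun i _ => Finset.sum_le_sum fun j _ => h2 i j
    _ = _ := by
        simp only [← Finset.sum_div, Finset.sum_add_distrib, Finset.sum_const, Finset.card_univ,
          nsmul_eq_mul, ← Finset.mul_sum]
        ring

omit [Module ℝ M] [IsScalarTower ℝ A M] in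
/-- A coercive form dominates every positive form. -/
theorem IsCoercive.dominates {F : Frame A M} {g h : M →+ (M →ₗ[A] A)}
    (hc : IsCoercive ρ F g) (hh : IsPosForm h) :
    ∃ C : ℝ, 0 ≤ C ∧ ∀ v ξ, ρ.ev ξ (h v v) ≤ C * ρ.ev ξ (g v v) := by
  obtain ⟨C, hC, hCle⟩ := hc
  refine ⟨Fintype.card F.ι * ∑ i, ‖h (F.e i) (F.e i)‖ * C, ?_, fun v ξ => ?_⟩
  · exact mul_nonneg (Nat.cast_nonneg _)
      (Finset.sum_nonneg fun i _ => mul_nonneg (norm_nonneg _) hC)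
  -- Expansion in the frame reduces h(v, v) to the terms fᵢ h(eᵢ, eᵢ) fᵢ^* ≤ ‖h(eᵢ, eᵢ)‖ fᵢ fᵢ^*,
  -- which coercivity compares with g.
  conv_lhs => rw [← F.sum_eq v]
  refine (hh.ev_sum_le ρ ξ _).trans ?_
  rw [mul_assoc, Finset.sum_mul]
  refine mul_le_mul_of_nonneg_left (Finset.sum_le_sum fun i _ => ?_) (Nat.cast_nonneg _)
  rw [hh.herm.smul_left, map_smul, smul_eq_mul, ρ.ev_conj]
  refine (ρ.ev_le _ _).trans ?_
  rw [← ρ.ev_mul_star, mul_assoc]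
  exact mul_le_mul_of_nonneg_left (hCle i v ξ) (norm_nonneg _)

/-- Cauchy–Schwarz for the positive form g(z·, ·) at v and zv: the square of g(zv, zv) is at most
g(zv, v) g(z²v, zv) ≤ θ² g(v, v) g(zv, zv). -/
theorem IsPosForm.sq_contraction {g : M →+ (M →ₗ[A] A)} (hg : IsPosForm g) {z : M →ₗ[ℝ] M}
    (hz : ∀ v w, g (z v) w = g v (z w)) {θ : ℝ} (hθ : 0 ≤ θ) (ξ : H)
    (h0 : ∀ v, 0 ≤ ρ.ev ξ (g (z v) v)) (h1 : ∀ v, ρ.ev ξ (g (z v) v) ≤ θ * ρ.ev ξ (g v v)) (v : M) :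
    ρ.ev ξ (g (z v) (z v)) ≤ θ ^ 2 * ρ.ev ξ (g v v) := by
  let b : LinearMap.BilinForm ℝ M := (evForm ρ hg.herm ξ).comp z LinearMap.id
  have hb : LinearMap.IsSymm b := ⟨fun v w => by
    change ρ.ev ξ (g (z v) w) = ρ.ev ξ (g (z w) v)
    rw [hz, hg.herm (z w) v, ρ.ev_star]⟩
  have h2 : (ρ.ev ξ (g (z v) (z v))) ^ 2 ≤ ρ.ev ξ (g (z v) v) * ρ.ev ξ (g (z (z v)) (z v)) :=
    LinearMap.BilinForm.apply_sq_le_of_symm b h0 hb v (z v)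
  have h3 := mul_le_mul (h1 v) (h1 (z v)) (h0 _) (mul_nonneg hθ (hg.ev_nonneg ρ ξ v))
  have h4 := hg.ev_nonneg ρ ξ (z v)
  have h5 := hg.ev_nonneg ρ ξ v
  by_contra! hlt
  have h6 : 0 < ρ.ev ξ (g (z v) (z v)) := lt_of_le_of_lt (by positivity) hlt
  nlinarith

end Core

/-! ### Normed modules with a frame -/

section NormedModule

variable {A : Type*} [NormedRing A] [NormedAlgebra ℝ A]
  {M : Type*} [NormedAddCommGroup M] [NormedSpace ℝ M] [Module A M] [IsScalarTower ℝ A M]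
  {N : Type*} [NormedAddCommGroup N] [NormedSpace ℝ N] [Module A N] [IsScalarTower ℝ A N]

/-- The coordinates of the frame are bounded. -/
def Frame.IsBounded (F : Frame A M) : Prop :=
  ∃ C : ℝ, 0 ≤ C ∧ ∀ i v, ‖F.f i v‖ ≤ C * ‖v‖

variable [IsBoundedSMul A M] [IsBoundedSMul A N]

omit [NormedAlgebra ℝ A] [NormedSpace ℝ M] [IsScalarTower ℝ A M] [NormedSpace ℝ N]
  [IsScalarTower ℝ A N] [IsBoundedSMul A M] in
theorem Frame.IsBounded.bound {F : Frame A M} (hF : F.IsBounded) (φ : M →ₗ[A] N) :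
    ∃ C : ℝ, ∀ v, ‖φ v‖ ≤ C * ‖v‖ := by
  obtain ⟨C, hC, hCle⟩ := hF
  refine ⟨∑ i, C * ‖φ (F.e i)‖, fun v => ?_⟩
  rw [F.map_eq φ v, Finset.sum_mul]
  refine (norm_sum_le _ _).trans (Finset.sum_le_sum fun i _ => ?_)
  refine (norm_smul_le _ _).trans ?_
  calc ‖F.f i v‖ * ‖φ (F.e i)‖ ≤ (C * ‖v‖) * ‖φ (F.e i)‖ := by gcongr; exact hCle i v
    _ = _ := by ring

/-- An `A`-linear map between finitely generated projective modules, as a bounded operator. -/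
def Frame.IsBounded.toCLM {F : Frame A M} (hF : F.IsBounded) (φ : M →ₗ[A] N) : M →L[ℝ] N :=
  LinearMap.mkContinuousOfExistsBound
    { toFun := φ
      map_add' := map_add φ
      map_smul' := fun c v => LinearMap.map_smul_of_tower φ c v } (hF.bound φ)

/-- The map `n ↦ (v ↦ fᵢ(v) n)`. -/
def Frame.IsBounded.rankOne {F : Frame A M} (hF : F.IsBounded) (i : F.ι) :
    N →L[ℝ] M →L[ℝ] N :=
  LinearMap.mkContinuous₂
    (LinearMap.mk₂ ℝ (fun (n : N) (v : M) => F.f i v • n)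
      (fun _ _ _ => smul_add _ _ _)
      (fun c n v => by
        rw [← algebraMap_smul A c n, ← algebraMap_smul A c, smul_smul, smul_smul,
          Algebra.commutes])
      (fun _ _ _ => by rw [map_add, add_smul])
      (fun c n v => by rw [LinearMap.map_smul_of_tower, smul_assoc]))
    hF.choose (fun n v => by
      refine (norm_smul_le _ _).trans ?_
      calc ‖F.f i v‖ * ‖n‖ ≤ (hF.choose * ‖v‖) * ‖n‖ := by
            gcongr; exact hF.choose_spec.2 i v
        _ = _ := by ring)

omit [IsBoundedSMul A M] in
/-- A family of `A`-linear operators is norm continuous if it is continuous on the frame. -/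
theorem Frame.IsBounded.continuousAt {F : Frame A M} (hF : F.IsBounded) {Z : Type*}
    [TopologicalSpace Z] {Φ : Z → M →L[ℝ] N} (hΦ : ∀ z (a : A) v, Φ z (a • v) = a • Φ z v) {z₀ : Z}
    (h : ∀ i, ContinuousAt (fun z => Φ z (F.e i)) z₀) : ContinuousAt Φ z₀ := by
  have heq : Φ = fun z => ∑ i, hF.rankOne i (Φ z (F.e i)) := by
    funext z
    ext v
    rw [sum_apply]
    let φ : M →ₗ[A] N := { toFun := Φ z, map_add' := map_add _, map_smul' := hΦ z }
    exact F.map_eq φ v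
  rw [heq]
  exact tendsto_finsetSum _ fun i _ => ((hF.rankOne i).continuous.continuousAt.comp (h i))

omit [NormedAlgebra ℝ A] [NormedSpace ℝ M] [IsScalarTower ℝ A M] in
-- The coordinates of a Cauchy sequence converge in A, and the frame reassembles their limits.
theorem Frame.IsBounded.completeSpace [CompleteSpace A] {F : Frame A M} (hF : F.IsBounded) :
    CompleteSpace M := by
  obtain ⟨C, hC, hCle⟩ := hF
  refine Metric.complete_of_cauchySeq_tendsto fun u hu => ?_
  have hf : ∀ i, LipschitzWith C.toNNReal (F.f i) := fun i => by
    refine LipschitzWith.of_dist_le_mul fun v w => ?_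
    rw [dist_eq_norm, dist_eq_norm, ← map_sub, Real.coe_toNNReal C hC]
    exact hCle i _
  choose a ha using fun i => cauchySeq_tendsto_of_complete ((hf i).uniformContinuous.comp_cauchySeq hu)
  refine ⟨∑ i, a i • F.e i, ?_⟩
  have h : u = fun n => ∑ i, F.f i (u n) • F.e i := funext fun n => (F.sum_eq _).symm
  rw [h]
  exact tendsto_finsetSum _ fun i _ => (ha i).smul_const (F.e i)

end NormedModule

/-! ### The norm defined by a positive form -/

section FormNorm

variable {A H : Type*} [NormedRing A] [NormedAlgebra ℝ A] [StarRing A]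
  [NormedAddCommGroup H] [InnerProductSpace ℝ H] [CompleteSpace H] {ρ : StarRep A H}
  {M : Type*} [AddCommGroup M] [Module A M]

theorem IsCoercive.eq_zero {F : Frame A M} {g : M →+ (M →ₗ[A] A)} (hc : IsCoercive ρ F g)
    {v : M} (hv : g v v = 0) : v = 0 := by
  obtain ⟨C, hC, hCle⟩ := hc
  rw [← F.sum_eq v]
  refine Finset.sum_eq_zero fun i _ => ?_
  have h : star (F.f i v) = 0 := by
    apply ρ.π_injective
    refine ContinuousLinearMap.ext fun ξ => ?_
    have h1 := hCle i v ξ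
    rw [hv, map_zero, mul_zero, ρ.ev_mul_star] at h1
    rw [map_zero, zero_apply, ← norm_eq_zero]
    exact pow_eq_zero_iff two_ne_zero |>.1 (le_antisymm h1 (by positivity))
  rw [star_eq_zero] at h
  rw [h, zero_smul]

theorem IsCoercive.norm_sq_le {F : Frame A M} {g : M →+ (M →ₗ[A] A)} (hc : IsCoercive ρ F g) :
    ∃ C : ℝ, 0 ≤ C ∧ ∀ i v, ‖F.f i v‖ ≤ C * √‖g v v‖ := by
  obtain ⟨C, hC, hCle⟩ := hc
  refine ⟨√C, by positivity, fun i v => ?_⟩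
  rw [← ρ.norm_star, ← Real.sqrt_mul hC]
  refine ρ.norm_le_of_apply (by positivity) fun ξ => ?_
  refine le_of_sq_le_sq ?_ (by positivity)
  rw [← ρ.ev_mul_star, mul_pow, Real.sq_sqrt (by positivity), mul_assoc]
  exact (hCle i v ξ).trans (mul_le_mul_of_nonneg_left (ρ.ev_le ξ _) hC)

variable [Module ℝ M] [IsScalarTower ℝ A M]

/-- The norm `‖v‖ = ‖g(v, v)‖^(1/2)`. -/
@[reducible] def formNorm (g : M →+ (M →ₗ[A] A)) : Norm M := ⟨fun v => √‖g v v‖⟩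

/-- Definiteness comes from coercivity and the triangle inequality from the A-valued Cauchy–Schwarz
inequality, as for Hilbert C^*-modules. -/
theorem IsCoercive.normCore {F : Frame A M} {g : M →+ (M →ₗ[A] A)} (hg : IsPosForm g)
    (hc : IsCoercive ρ F g) : @NormedSpace.Core ℝ M _ _ _ (formNorm g) :=
  letI := formNorm g
  { norm_nonneg := fun v => Real.sqrt_nonneg _
    norm_smul := fun c v => by
      change √‖g (c • v) (c • v)‖ = |c| * √‖g v v‖
      rw [hg.herm.real_smul_left ρ, form_real_smul_right, smul_smul, norm_smul,
        Real.sqrt_mul (norm_nonneg _), Real.norm_eq_abs, abs_mul_self, Real.sqrt_mul_self_eq_abs]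
    norm_triangle := fun v w => by
      change √‖g (v + w) (v + w)‖ ≤ √‖g v v‖ + √‖g w w‖
      refine Real.sqrt_le_iff.2 ⟨by positivity, ?_⟩
      have h1 : ∀ v w, ‖g v w‖ ≤ √‖g v v‖ * √‖g w w‖ := fun v w => by
        rw [← Real.sqrt_mul (norm_nonneg _)]
        exact Real.le_sqrt_of_sq_le (hg.norm_sq_le v w ρ)
      have h2 := h1 v w
      have h3 := h1 w v
      have h4 : g (v + w) (v + w) = g v v + g v w + (g w v + g w w) := by
        simp only [map_add, LinearMap.add_apply]; abel
      rw [h4]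
      have h5 := Real.sq_sqrt (norm_nonneg (g v v))
      have h6 := Real.sq_sqrt (norm_nonneg (g w w))
      have h7 := norm_add_le (g v v + g v w) (g w v + g w w)
      have h8 := norm_add_le (g v v) (g v w)
      have h9 := norm_add_le (g w v) (g w w)
      nlinarith
    norm_eq_zero_iff := fun v => by
      change √‖g v v‖ = 0 ↔ v = 0
      rw [Real.sqrt_eq_zero (norm_nonneg _), norm_eq_zero]
      exact ⟨hc.eq_zero, fun h => by rw [h, map_zero]⟩ }

end FormNorm

/-- The norm of `M` is the one defined by the form `g`. -/
def IsFormNorm {A M : Type*} [NormedRing A] [NormedAddCommGroup M] [Module A M]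
    (g : M →+ (M →ₗ[A] A)) : Prop :=
  ∀ v, ‖v‖ = √‖g v v‖

section FormNormed

variable {A H : Type*} [NormedRing A] [NormedAlgebra ℝ A] [StarRing A]
  [NormedAddCommGroup H] [InnerProductSpace ℝ H] [CompleteSpace H] (ρ : StarRep A H)
  {M : Type*} [NormedAddCommGroup M] [NormedSpace ℝ M] [Module A M] [IsScalarTower ℝ A M]
  {g : M →+ (M →ₗ[A] A)}

omit [NormedSpace ℝ M] [IsScalarTower ℝ A M] in
include ρ in
theorem IsFormNorm.isBoundedSMul (hn : IsFormNorm g) (hg : IsPosForm g) : IsBoundedSMul A M := by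
  refine .of_norm_smul_le fun a v => ?_
  rw [hn, hn]
  refine Real.sqrt_le_iff.2 ⟨by positivity, ?_⟩
  rw [mul_pow, Real.sq_sqrt (norm_nonneg _), hg.herm.smul_left, map_smul, smul_eq_mul]
  calc ‖a * g v v * star a‖ ≤ ‖a‖ * ‖g v v‖ * ‖star a‖ :=
        (norm_mul_le _ _).trans (mul_le_mul_of_nonneg_right (norm_mul_le _ _) (norm_nonneg _))
    _ = _ := by rw [ρ.norm_star]; ring

omit [NormedSpace ℝ M] [IsScalarTower ℝ A M] in
theorem IsFormNorm.isBounded (hn : IsFormNorm g) {F : Frame A M} (hc : IsCoercive ρ F g) :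
    F.IsBounded := by
  obtain ⟨C, hC, h⟩ := hc.norm_sq_le
  exact ⟨C, hC, fun i v => by rw [hn]; exact h i v⟩

omit [NormedSpace ℝ M] [IsScalarTower ℝ A M] in
-- Turns an inequality between vector states into one between norms: g(w, w) is positive, so its
-- norm is controlled by its states.
theorem IsFormNorm.norm_le (hn : IsFormNorm g) (hg : IsPosForm g) {v w : M} {θ : ℝ} (hθ : 0 ≤ θ)
    (h : ∀ ξ, ρ.ev ξ (g w w) ≤ θ ^ 2 * ρ.ev ξ (g v v)) : ‖w‖ ≤ θ * ‖v‖ := by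
  rw [hn, hn]
  refine Real.sqrt_le_iff.2 ⟨by positivity, ?_⟩
  rw [mul_pow, Real.sq_sqrt (norm_nonneg _)]
  refine ρ.norm_le_of_ev_le (hg.herm w w).symm (fun ξ => hg.ev_nonneg ρ ξ w) (by positivity)
    fun ξ => (h ξ).trans ?_
  rw [mul_assoc]
  exact mul_le_mul_of_nonneg_left (ρ.ev_le ξ _) (by positivity)

end FormNormed

/-- The real vector space that underlies a module over a real algebra. -/
@[reducible] def realModule (A M : Type*) [Ring A] [Algebra ℝ A] [AddCommGroup M] [Module A M] :
    Module ℝ M := Module.compHom M (algebraMap ℝ A)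

theorem realModule_isScalarTower (A M : Type*) [Ring A] [Algebra ℝ A] [AddCommGroup M]
    [Module A M] : @IsScalarTower ℝ A M _ _ (realModule A M).toSMul :=
  @IsScalarTower.mk ℝ A M _ _ (realModule A M).toSMul fun c a v => by
    change (c • a) • v = algebraMap ℝ A c • (a • v)
    rw [smul_smul, Algebra.smul_def]

/-! ### Positive operators -/

/-- `S` is self-adjoint and positive for the form `g`. -/
structure IsPosEndo {A M : Type*} [Ring A] [StarRing A] [AddCommGroup M] [Module A M]
    (g : M →+ (M →ₗ[A] A)) (S : M →ₗ[A] M) : Prop where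
  sym : ∀ v w, g (S v) w = g v (S w)
  nonneg : ∀ v, ∃ c, g (S v) v = c * star c

theorem IsPosEndo.isPosForm {A M : Type*} [Ring A] [StarRing A] [AddCommGroup M] [Module A M]
    {g : M →+ (M →ₗ[A] A)} (hg : IsHerm g) {S : M →ₗ[A] M} (hS : IsPosEndo g S) :
    IsPosForm (g.comp S.toAddMonoidHom) where
  herm := fun v w => by
    change g (S w) v = star (g (S v) w)
    rw [hS.sym, hg]
  nonneg := hS.nonneg

section Core

variable {A H : Type*} [NormedRing A] [NormedAlgebra ℝ A] [StarRing A]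
  [NormedAddCommGroup H] [InnerProductSpace ℝ H] [CompleteSpace H] (ρ : StarRep A H)

/-- The contraction `1 - c⁻¹ S` for an operator `0 < ε ≤ S ≤ c`. -/
theorem IsFormNorm.norm_one_sub_le {M : Type*} [NormedAddCommGroup M] [NormedSpace ℝ M]
    [Module A M] [IsScalarTower ℝ A M] {g : M →+ (M →ₗ[A] A)} (hn : IsFormNorm g)
    (hg : IsPosForm g) {S : M →L[ℝ] M}
    (hS : ∀ v w, g (S v) w = g v (S w)) {ε c : ℝ} (hεc : ε ≤ c) (hc : 0 < c)
    (h1 : ∀ v ξ, ε * ρ.ev ξ (g v v) ≤ ρ.ev ξ (g (S v) v))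
    (h2 : ∀ v ξ, ρ.ev ξ (g (S v) v) ≤ c * ρ.ev ξ (g v v)) : ‖1 - c⁻¹ • S‖ ≤ 1 - c⁻¹ * ε := by
  have hθ : 0 ≤ 1 - c⁻¹ * ε := by
    rw [sub_nonneg, inv_mul_le_iff₀ hc]; linarith
  refine ContinuousLinearMap.opNorm_le_bound _ hθ fun v => ?_
  refine hn.norm_le ρ hg hθ fun ξ => ?_
  have hz : ∀ v w, g ((1 - c⁻¹ • S) v) w = g v w - c⁻¹ • g (S v) w := fun v w => by
    change g (v - c⁻¹ • S v) w = _
    rw [map_sub, LinearMap.sub_apply, hg.herm.real_smul_left ρ]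
  have hzv : ∀ v, ρ.ev ξ (g ((1 - c⁻¹ • S) v) v) =
      ρ.ev ξ (g v v) - c⁻¹ * ρ.ev ξ (g (S v) v) := fun v => by
    rw [hz, map_sub, map_smul, smul_eq_mul]
  refine hg.sq_contraction ρ (z := ((1 - c⁻¹ • S : M →L[ℝ] M) : M →ₗ[ℝ] M)) ?_ hθ ξ ?_ ?_ v
  · intro v w
    change g ((1 - c⁻¹ • S) v) w = g v (w - c⁻¹ • S w)
    rw [hz, hS, map_sub, form_real_smul_right]
  · intro v
    refine le_of_le_of_eq ?_ (hzv v).symm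
    rw [sub_nonneg, inv_mul_le_iff₀ hc]
    exact h2 v ξ
  · intro v
    refine le_of_eq_of_le (hzv v) ?_
    have := mul_le_mul_of_nonneg_left (h1 v ξ) (inv_nonneg.2 hc.le)
    linarith

variable [CompleteSpace A] {M : Type*} [AddCommGroup M] [Module A M]

/-- In the Banach norm of g, the operator 1 − c⁻¹S is a strict contraction for large c, so the
Neumann series inverts c⁻¹S. -/
theorem bijective_of_lower_bound {F : Frame A M} {g : M →+ (M →ₗ[A] A)} (hg : IsPosForm g)
    (hc : IsCoercive ρ F g) {S : M →ₗ[A] M} (hS : IsPosEndo g S) {ε : ℝ} (hε : 0 < ε)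
    (h1 : ∀ v ξ, ε * ρ.ev ξ (g v v) ≤ ρ.ev ξ (g (S v) v)) : Function.Bijective S := by
  let := realModule A M
  have := realModule_isScalarTower A M
  let := formNorm g
  let : NormedAddCommGroup M := NormedAddCommGroup.ofCore (hc.normCore hg)
  let : NormedSpace ℝ M := NormedSpace.ofCore (hc.normCore hg)
  have hn : IsFormNorm g := fun v => rfl
  have := hn.isBoundedSMul ρ hg
  have hF := hn.isBounded ρ hc
  have := hF.completeSpace
  obtain ⟨C, hC, hdom⟩ := hc.dominates ρ (hS.isPosForm hg.herm)
  -- Adding ε to the upper bound C makes c positive even when C = 0 and ensures ε ≤ c.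
  set c : ℝ := C + ε
  have hc0 : 0 < c := by positivity
  set T : M →L[ℝ] M := hF.toCLM S
  have hθ := hn.norm_one_sub_le ρ hg (S := T) (c := c) hS.sym (by linarith) hc0 h1
    (fun v ξ => (hdom v ξ).trans
      (mul_le_mul_of_nonneg_right (by linarith) (hg.ev_nonneg ρ ξ v)))
  have hlt : ‖1 - c⁻¹ • T‖ < 1 := by
    have : 0 < c⁻¹ * ε := by positivity
    linarith
  have hu := isUnit_one_sub_of_norm_lt_one hlt
  rw [sub_sub_cancel] at hu
  obtain ⟨u, hu⟩ := hu
  have hT : Function.Bijective (c⁻¹ • T) := by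
    rw [← hu]
    refine Function.bijective_iff_has_inverse.2 ⟨(↑u⁻¹ : M →L[ℝ] M), fun v => ?_, fun v => ?_⟩
    · exact congrArg (fun φ : M →L[ℝ] M => φ v) u.inv_mul
    · exact congrArg (fun φ : M →L[ℝ] M => φ v) u.mul_inv
  constructor
  · intro v w h
    exact hT.1 (congrArg (fun v : M => c⁻¹ • v) h)
  · intro w
    obtain ⟨v, hv⟩ := hT.2 (c⁻¹ • w)
    exact ⟨v, smul_right_injective M (inv_ne_zero hc0.ne') hv⟩

end Core

/-! ### Nondegeneracy of coercive forms and stability under positive perturbation. -/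

section Core

variable {A H : Type*} [NormedRing A] [NormedAlgebra ℝ A] [StarRing A] [CompleteSpace A]
  [NormedAddCommGroup H] [InnerProductSpace ℝ H] [CompleteSpace H] (ρ : StarRep A H)
  {M : Type*} [AddCommGroup M] [Module A M]

omit [CompleteSpace A] in
theorem IsPosForm.isCoercive_of_surjective {g : M →+ (M →ₗ[A] A)} (hg : IsPosForm g)
    (F : Frame A M) (hb : Function.Surjective g) : IsCoercive ρ F g := by
  let := realModule A M
  have := realModule_isScalarTower A M
  exact hg.isCoercive ρ F hb

omit [CompleteSpace A] in
-- Young's inequality with weight K: expand K⁻¹(Kx − y)² ≥ 0 for the norms x, y of a^*ξ and b^*ξ.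
theorem StarRep.two_mul_ev_le (ξ : H) (a b : A) {K : ℝ} (hK : 0 < K) :
    2 * ρ.ev ξ (a * star b) ≤ K * ρ.ev ξ (a * star a) + K⁻¹ * ρ.ev ξ (b * star b) := by
  have h : ρ.ev ξ (a * star b) ≤ ‖ρ.π (star a) ξ‖ * ‖ρ.π (star b) ξ‖ := by
    refine le_of_eq_of_le ?_ (real_inner_le_norm _ _)
    rw [ρ.inner_star, ρ.ev_apply, map_mul]
    rfl
  rw [ρ.ev_mul_star, ρ.ev_mul_star]
  set x := ‖ρ.π (star a) ξ‖
  set y := ‖ρ.π (star b) ξ‖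
  have h2 : 0 ≤ K⁻¹ * (K * x - y) ^ 2 := by positivity
  have h3 : K⁻¹ * (K * x - y) ^ 2 = K * x ^ 2 - 2 * (x * y) + K⁻¹ * y ^ 2 := by
    field_simp
    ring
  linarith

/-- A coercive form is nondegenerate. -/
theorem IsCoercive.bijective {F : Frame A M} {g : M →+ (M →ₗ[A] A)} (hg : IsPosForm g)
    (hc : IsCoercive ρ F g) : Function.Bijective g := by
  constructor
  · rw [injective_iff_map_eq_zero]
    intro v hv
    exact hc.eq_zero (by rw [hv, LinearMap.zero_apply])
  -- The frame operator of the eᵢ relative to g. It is positive, and once it is known to be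
  -- invertible, a preimage of a functional φ can be written down.
  let S : M →ₗ[A] M := ∑ i, (g (F.e i)).smulRight (F.e i)
  have hSv : ∀ v, S v = ∑ i, g (F.e i) v • F.e i := fun v => by
    simp [S, LinearMap.sum_apply]
  have hS1 : ∀ v w, g (S v) w = ∑ i, g (F.e i) w * star (g (F.e i) v) := fun v w => by
    rw [hSv, hg.herm.sum_left]
  have hS : IsPosEndo g S := by
    have hsym : ∀ v w, g (S v) w = g v (S w) := fun v w => by
      rw [hg.herm (S w) v, hS1, hS1, star_sum]
      exact Finset.sum_congr rfl fun i _ => by rw [star_mul, star_star]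
    refine ⟨hsym, fun v => ρ.exists_eq_mul_star ?_ fun ξ => ?_⟩
    · rw [← hg.herm, hsym]
    · rw [hS1, map_sum]
      exact Finset.sum_nonneg fun i _ => ρ.ev_mul_star_nonneg ξ _
  obtain ⟨C, hC, hCle⟩ := id hc
  -- Young's inequality applied to g(v, v) = ∑ g(eᵢ, v) fᵢ(v)^* leaves the error K⁻¹ · card · C ·
  -- g(v, v). This K makes the error at most g(v, v), so it is absorbed on the left.
  set K : ℝ := Fintype.card F.ι * C + 1 with hKdef
  have hK : 0 < K := by positivity
  have hlow : ∀ v ξ, K⁻¹ * ρ.ev ξ (g v v) ≤ ρ.ev ξ (g (S v) v) := by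
    intro v ξ
    have h1 : g v v = ∑ i, g (F.e i) v * star (F.f i v) := by
      rw [← hg.herm.sum_left, F.sum_eq]
    have h2 : 2 * ρ.ev ξ (g v v) ≤ K * ρ.ev ξ (g (S v) v) +
        K⁻¹ * (Fintype.card F.ι * C * ρ.ev ξ (g v v)) := by
      conv_lhs => rw [h1]
      rw [hS1, map_sum, map_sum, Finset.mul_sum, Finset.mul_sum]
      calc ∑ i, 2 * ρ.ev ξ (g (F.e i) v * star (F.f i v))
          ≤ ∑ i, (K * ρ.ev ξ (g (F.e i) v * star (g (F.e i) v)) +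
              K⁻¹ * (C * ρ.ev ξ (g v v))) :=
            Finset.sum_le_sum fun i _ => (ρ.two_mul_ev_le ξ _ _ hK).trans
              (add_le_add le_rfl (mul_le_mul_of_nonneg_left (hCle i v ξ) (inv_nonneg.2 hK.le)))
        _ = _ := by
            rw [Finset.sum_add_distrib, Finset.sum_const, Finset.card_univ, nsmul_eq_mul]
            ring
    have h3 : K⁻¹ * (Fintype.card F.ι * C * ρ.ev ξ (g v v)) ≤ ρ.ev ξ (g v v) := by
      rw [inv_mul_le_iff₀ hK]
      have := hg.ev_nonneg ρ ξ v
      nlinarith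
    rw [inv_mul_le_iff₀ hK]
    linarith
  have hbij := bijective_of_lower_bound ρ hg hc hS (inv_pos.2 hK) hlow
  intro φ
  -- If Su = ∑ φ(eᵢ)^* eᵢ, then g(u, Sw) = g(Su, w) = ∑ g(eᵢ, w) φ(eᵢ) = φ(Sw), and every vector is
  -- some Sw.
  obtain ⟨u, hu⟩ := hbij.2 (∑ i, star (φ (F.e i)) • F.e i)
  refine ⟨u, LinearMap.ext fun w => ?_⟩
  obtain ⟨w, rfl⟩ := hbij.2 w
  rw [← hS.sym, hu, hg.herm.sum_left, hSv, map_sum]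
  refine Finset.sum_congr rfl fun i _ => ?_
  rw [star_star, map_smul, smul_eq_mul]

include ρ in
theorem IsPosForm.add {g h : M →+ (M →ₗ[A] A)} (hg : IsPosForm g) (hh : IsPosForm h) :
    IsPosForm (g + h) := by
  have hherm : IsHerm (g + h) := fun v w => by
    simp only [AddMonoidHom.add_apply, LinearMap.add_apply, star_add]
    rw [hg.herm v w, hh.herm v w]
  refine isPosForm_of_ev ρ hherm fun ξ v => ?_
  change 0 ≤ ρ.ev ξ (g v v + h v v)
  rw [map_add]
  exact add_nonneg (hg.ev_nonneg ρ ξ v) (hh.ev_nonneg ρ ξ v)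

include ρ in
/-- The sum of a nondegenerate positive form and a positive form is nondegenerate. -/
theorem IsPosForm.add_bijective (F : Frame A M) {g h : M →+ (M →ₗ[A] A)} (hg : IsPosForm g)
    (hb : Function.Surjective g) (hh : IsPosForm h) :
    IsPosForm (g + h) ∧ Function.Bijective (g + h) := by
  have hev : ∀ ξ v, ρ.ev ξ ((g + h) v v) = ρ.ev ξ (g v v) + ρ.ev ξ (h v v) := fun ξ v => by
    rw [← map_add]; rfl
  have hpos : IsPosForm (g + h) := hg.add ρ hh
  obtain ⟨C, hC, hCle⟩ := hg.isCoercive_of_surjective ρ F hb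
  refine ⟨hpos, IsCoercive.bijective ρ (F := F) hpos ⟨C, hC, fun i v ξ => (hCle i v ξ).trans ?_⟩⟩
  rw [hev]
  exact mul_le_mul_of_nonneg_left (le_add_of_nonneg_right (hh.ev_nonneg ρ ξ v)) hC

omit [CompleteSpace A] in
-- The positive form g(S·, ·) is again surjective onto the dual, hence coercive, so it dominates g.
theorem IsPosEndo.lower_bound (F : Frame A M) {g : M →+ (M →ₗ[A] A)} (hg : IsPosForm g)
    (hb : Function.Surjective g) {S : M →ₗ[A] M} (hS : IsPosEndo g S)
    (hSb : Function.Surjective S) :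
    ∃ ε : ℝ, 0 < ε ∧ ∀ v ξ, ε * ρ.ev ξ (g v v) ≤ ρ.ev ξ (g (S v) v) := by
  have hp := hS.isPosForm hg.herm
  have hc := hp.isCoercive_of_surjective ρ F (hb.comp hSb)
  obtain ⟨C, hC, hle⟩ := hc.dominates ρ hg
  refine ⟨(C + 1)⁻¹, by positivity, fun v ξ => ?_⟩
  rw [inv_mul_le_iff₀ (by positivity)]
  refine (hle v ξ).trans (mul_le_mul_of_nonneg_right (by linarith) ?_)
  exact hp.ev_nonneg ρ ξ v

include ρ in
/-- The sum of a positive operator and a positive invertible operator is invertible. -/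
theorem IsPosEndo.add_bijective (F : Frame A M) {g : M →+ (M →ₗ[A] A)} (hg : IsPosForm g)
    (hb : Function.Surjective g) {S T : M →ₗ[A] M} (hS : IsPosEndo g S)
    (hSb : Function.Surjective S) (hT : IsPosEndo g T) : Function.Bijective (S + T) := by
  obtain ⟨ε, hε, hle⟩ := hS.lower_bound ρ F hg hb hSb
  have hadd : ∀ v w, g ((S + T) v) w = g (S v) w + g (T v) w := fun v w => by
    rw [LinearMap.add_apply, map_add, LinearMap.add_apply]
  have hsym : ∀ v w, g ((S + T) v) w = g v ((S + T) w) := fun v w => by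
    rw [hadd, LinearMap.add_apply, map_add, hS.sym, hT.sym]
  have hTn : ∀ ξ v, 0 ≤ ρ.ev ξ (g (T v) v) := fun ξ v => (hT.isPosForm hg.herm).ev_nonneg ρ ξ v
  have hSn : ∀ ξ v, 0 ≤ ρ.ev ξ (g (S v) v) := fun ξ v => (hS.isPosForm hg.herm).ev_nonneg ρ ξ v
  refine bijective_of_lower_bound ρ hg (hg.isCoercive_of_surjective ρ F hb)
    ⟨hsym, fun v => ρ.exists_eq_mul_star ?_ fun ξ => ?_⟩ hε fun v ξ => ?_
  · rw [← hg.herm, hsym]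
  · rw [hadd, map_add]; exact add_nonneg (hSn ξ v) (hTn ξ v)
  · rw [hadd, map_add]
    exact (hle v ξ).trans (le_add_of_nonneg_right (hTn ξ v))

end Core

/-! ### Square roots of positive operators -/

section PosSqrt

variable {A H : Type*} [NormedRing A] [NormedAlgebra ℝ A] [StarRing A]
  [NormedAddCommGroup H] [InnerProductSpace ℝ H] [CompleteSpace H] (ρ : StarRep A H)
  {M : Type*} [NormedAddCommGroup M] [NormedSpace ℝ M] [Module A M] [IsScalarTower ℝ A M]
  [IsBoundedSMul A M] [CompleteSpace M]

/-- The square root of `S`, provided that `‖1 - c⁻¹ S‖ ≤ 1`. -/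
def posSqrt (c : ℝ) (S : M →L[ℝ] M) : M →L[ℝ] M := √c • (1 - sqrtLim (1 - c⁻¹ • S))

theorem continuousAt_posSqrt {c : ℝ} {S : M →L[ℝ] M} (hS : ‖1 - c⁻¹ • S‖ < 1) :
    ContinuousAt (posSqrt c) S := by
  have h1 : ContinuousAt (sqrtLim (R := M →L[ℝ] M)) (1 - c⁻¹ • S) :=
    continuousOn_sqrtLim.continuousAt
      (mem_of_superset (Metric.isOpen_ball.mem_nhds (by simpa using hS)) Metric.ball_subset_closedBall)
  have h2 : ContinuousAt (fun S : M →L[ℝ] M => 1 - c⁻¹ • S) S := by fun_prop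
  have h3 : ContinuousAt (fun S : M →L[ℝ] M => sqrtLim (1 - c⁻¹ • S)) S :=
    ContinuousAt.comp (f := fun S : M →L[ℝ] M => 1 - c⁻¹ • S) h1 h2
  exact (continuousAt_const.sub h3).const_smul √c

theorem posSqrt_mul_self {c : ℝ} (hc : 0 < c) {S : M →L[ℝ] M} (hS : ‖1 - c⁻¹ • S‖ ≤ 1) :
    posSqrt c S * posSqrt c S = S := by
  rw [posSqrt, smul_mul_smul_comm, one_sub_sqrtLim_mul_self hS, sub_sub_cancel,
    Real.mul_self_sqrt hc.le, smul_smul, mul_inv_cancel₀ hc.ne', one_smul]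

theorem commute_posSqrt {c : ℝ} {S T : M →L[ℝ] M} (hS : ‖1 - c⁻¹ • S‖ ≤ 1)
    (hT : T * S = S * T) : T * posSqrt c S = posSqrt c S * T := by
  have h : T * (1 - c⁻¹ • S) = (1 - c⁻¹ • S) * T := by
    rw [mul_sub, sub_mul, mul_smul_comm, smul_mul_assoc, hT, mul_one, one_mul]
  rw [posSqrt, mul_smul_comm, smul_mul_assoc, mul_sub, sub_mul, commute_sqrtLim hS h, mul_one,
    one_mul]

omit [StarRing A] in
-- The iteration runs among bounded ℝ-linear operators; A-linearity is a closed condition preserved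
-- by each step.
theorem sqrtLim_map_smul {z : M →L[ℝ] M} (hz : ‖z‖ ≤ 1) (hlin : ∀ (a : A) v, z (a • v) = a • z v)
    (a : A) (v : M) : sqrtLim z (a • v) = a • sqrtLim z v := by
  refine sqrtLim_mem (K := {y | ∀ (a : A) v, y (a • v) = a • y v}) hz ?_ ?_ ?_ a v
  · simp only [Set.ofPred_forall]
    refine isClosed_iInter fun a => isClosed_iInter fun v => isClosed_eq (by fun_prop) ?_
    exact (ContinuousLinearMap.apply ℝ M v).continuous.const_smul a
  · intro a v
    simp
  · intro y hy a v
    rw [Set.mem_ofPred_eq] at hy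
    change (2 : ℝ)⁻¹ • (z (a • v) + y (y (a • v))) = a • (2 : ℝ)⁻¹ • (z v + y (y v))
    rw [hlin, hy, hy, ← smul_add, smul_algebra_smul_comm]

/-- `g` is separately continuous. -/
def IsSepContinuous (g : M →+ (M →ₗ[A] A)) : Prop :=
  (∀ v, Continuous fun w => g v w) ∧ ∀ w, Continuous fun v => g v w

omit [CompleteSpace M] [IsBoundedSMul A M] in
include ρ in
theorem IsHerm.isSepContinuous {g : M →+ (M →ₗ[A] A)} (hg : IsHerm g) {F : Frame A M}
    (hF : F.IsBounded) : IsSepContinuous g := by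
  have h : ∀ v, Continuous fun w => g v w := fun v => (hF.toCLM (g v)).continuous
  exact ⟨h, fun w => (ρ.continuous_star.comp (h w)).congr fun v => (hg w v).symm⟩

omit [IsBoundedSMul A M] in
include ρ in
theorem sqrtLim_sym {g : M →+ (M →ₗ[A] A)} (hg : IsHerm g) (hgc : IsSepContinuous g)
    {z : M →L[ℝ] M} (hz : ‖z‖ ≤ 1) (hsym : ∀ v w, g (z v) w = g v (z w)) (v w : M) :
    g (sqrtLim z v) w = g v (sqrtLim z w) := by
  refine sqrtLim_mem (K := {y | ∀ v w, g (y v) w = g v (y w)}) hz ?_ ?_ ?_ v w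
  · simp only [Set.ofPred_forall]
    refine isClosed_iInter fun v => isClosed_iInter fun w => isClosed_eq ?_ ?_
    · exact (hgc.2 w).comp (ContinuousLinearMap.apply ℝ M v).continuous
    · exact (hgc.1 v).comp (ContinuousLinearMap.apply ℝ M w).continuous
  · intro v w
    simp
  · intro y hy v w
    rw [Set.mem_ofPred_eq] at hy
    change g ((2 : ℝ)⁻¹ • (z v + y (y v))) w = g v ((2 : ℝ)⁻¹ • (z w + y (y w)))
    rw [hg.real_smul_left ρ, form_real_smul_right, map_add, map_add, LinearMap.add_apply, hsym,
      hy, hy]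

omit [StarRing A] in
theorem posSqrt_map_smul {c : ℝ} {S : M →L[ℝ] M} (hS : ‖1 - c⁻¹ • S‖ ≤ 1)
    (hlin : ∀ (a : A) v, S (a • v) = a • S v) (a : A) (v : M) :
    posSqrt c S (a • v) = a • posSqrt c S v := by
  change √c • (a • v - sqrtLim (1 - c⁻¹ • S) (a • v)) = a • √c • (v - sqrtLim (1 - c⁻¹ • S) v)
  rw [sqrtLim_map_smul hS, ← smul_sub, smul_algebra_smul_comm]
  intro a v
  change a • v - c⁻¹ • S (a • v) = a • (v - c⁻¹ • S v)
  rw [hlin, smul_sub, smul_algebra_smul_comm]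

omit [IsBoundedSMul A M] in
include ρ in
/-- The square root is self-adjoint and positive. -/
theorem posSqrt_isPos {g : M →+ (M →ₗ[A] A)} (hg : IsPosForm g) (hgc : IsSepContinuous g)
    {c : ℝ} {S : M →L[ℝ] M} (hS : ‖1 - c⁻¹ • S‖ ≤ 1)
    (hsym : ∀ v w, g (S v) w = g v (S w)) :
    (∀ v w, g (posSqrt c S v) w = g v (posSqrt c S w)) ∧
      ∀ v, ∃ a, g (posSqrt c S v) v = a * star a := by
  set z : M →L[ℝ] M := 1 - c⁻¹ • S with hz
  have hz1 : ∀ v w, g (z v) w = g v (z w) := fun v w => by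
    change g (v - c⁻¹ • S v) w = g v (w - c⁻¹ • S w)
    rw [map_sub, map_sub, LinearMap.sub_apply, hg.herm.real_smul_left ρ, form_real_smul_right, hsym]
  have h1 := sqrtLim_sym ρ hg.herm hgc hS hz1
  have h2 := sqrtLim_sym ρ hg.herm hgc (norm_sqrtLim_le hS) h1
  have hY : ∀ v, posSqrt c S v = √c • (v - sqrtLim z v) := fun v => rfl
  -- Positivity of the root, not only self-adjointness: y = `sqrtLim z` has norm at most 1 and is
  -- self-adjoint, so 1 − y is itself the square of the self-adjoint W.
  set W : M →L[ℝ] M := 1 - sqrtLim (sqrtLim z) with hW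
  have hWW : ∀ v, v - sqrtLim z v = W (W v) := fun v =>
    (congrArg (fun T : M →L[ℝ] M => T v) (one_sub_sqrtLim_mul_self (norm_sqrtLim_le hS))).symm
  have hWs : ∀ v w, g (W v) w = g v (W w) := fun v w => by
    change g (v - sqrtLim (sqrtLim z) v) w = g v (w - sqrtLim (sqrtLim z) w)
    rw [map_sub, map_sub, LinearMap.sub_apply, h2]
  refine ⟨fun v w => ?_, fun v => ?_⟩
  · rw [hY, hY, hg.herm.real_smul_left ρ, form_real_smul_right, map_sub, map_sub,
      LinearMap.sub_apply, h1]
  · obtain ⟨a, ha⟩ := hg.nonneg (W v)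
    refine ⟨√√c • a, ?_⟩
    rw [hY, hWW, hg.herm.real_smul_left ρ, hWs, ha, ρ.star_smul, smul_mul_smul_comm,
      Real.mul_self_sqrt (Real.sqrt_nonneg c)]

end PosSqrt

/-! ### Existence and uniqueness of the positive square root on a module with a frame. -/

section ExistsSqrt

variable {A H : Type*} [NormedRing A] [NormedAlgebra ℝ A] [StarRing A] [CompleteSpace A]
  [NormedAddCommGroup H] [InnerProductSpace ℝ H] [CompleteSpace H] (ρ : StarRep A H)

omit [CompleteSpace A] in
include ρ in
/-- For an invertible positive operator `S`, `‖1 - c⁻¹ S‖ < 1` for a suitable `c`. -/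
theorem IsPosEndo.exists_norm_one_sub_lt {M : Type*} [NormedAddCommGroup M] [NormedSpace ℝ M]
    [Module A M] [IsScalarTower ℝ A M] (F : Frame A M) {g : M →+ (M →ₗ[A] A)}
    (hn : IsFormNorm g) (hg : IsPosForm g) (hb : Function.Surjective g) {S : M →ₗ[A] M}
    (hS : IsPosEndo g S) (hSb : Function.Surjective S) {T : M →L[ℝ] M} (hT : ∀ v, T v = S v) :
    ∃ c : ℝ, 0 < c ∧ ‖1 - c⁻¹ • T‖ < 1 := by
  obtain ⟨ε, hε, h1⟩ := hS.lower_bound ρ F hg hb hSb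
  obtain ⟨C, hC, hdom⟩ := (hg.isCoercive ρ F hb).dominates ρ (hS.isPosForm hg.herm)
  have hc0 : 0 < C + ε := by positivity
  refine ⟨C + ε, hc0, ?_⟩
  have hθ := hn.norm_one_sub_le ρ hg (S := T) (c := C + ε) (ε := ε)
    (fun v w => by rw [hT, hT]; exact hS.sym v w) (by linarith) hc0
    (fun v ξ => by rw [hT]; exact h1 v ξ)
    (fun v ξ => by
      rw [hT]
      exact (hdom v ξ).trans (mul_le_mul_of_nonneg_right (by linarith) (hg.ev_nonneg ρ ξ v)))
  have : 0 < (C + ε)⁻¹ * ε := by positivity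
  linarith

variable {M : Type*} [AddCommGroup M] [Module A M]

include ρ in
/-- An invertible positive operator has a unique positive square root. -/
theorem IsPosEndo.exists_sqrt (F : Frame A M) {g : M →+ (M →ₗ[A] A)} (hg : IsPosForm g)
    (hb : Function.Surjective g) {S : M →ₗ[A] M} (hS : IsPosEndo g S)
    (hSb : Function.Bijective S) :
    ∃ Y : M →ₗ[A] M, (IsPosEndo g Y ∧ ∀ v, Y (Y v) = S v) ∧
      ∀ Z : M →ₗ[A] M, IsPosEndo g Z → (∀ v, Z (Z v) = S v) → Z = Y := by
  let := realModule A M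
  have := realModule_isScalarTower A M
  have hc := hg.isCoercive ρ F hb
  let := formNorm g
  let : NormedAddCommGroup M := NormedAddCommGroup.ofCore (hc.normCore hg)
  let : NormedSpace ℝ M := NormedSpace.ofCore (hc.normCore hg)
  have hn : IsFormNorm g := fun v => rfl
  have := hn.isBoundedSMul ρ hg
  have hF := hn.isBounded ρ hc
  have := hF.completeSpace
  obtain ⟨c, hc0, hlt⟩ := hS.exists_norm_one_sub_lt ρ F hn hg hb hSb.2 (T := hF.toCLM S)
    fun v => rfl
  obtain ⟨h1, h2⟩ := posSqrt_isPos ρ hg (hg.herm.isSepContinuous ρ hF) hlt.le hS.sym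
  let Y : M →ₗ[A] M :=
    { toFun := posSqrt c (hF.toCLM S)
      map_add' := map_add _
      map_smul' := posSqrt_map_smul hlt.le (map_smul S) }
  have hYY : ∀ v, Y (Y v) = S v := fun v =>
    congrArg (fun T : M →L[ℝ] M => T v) (posSqrt_mul_self hc0 hlt.le)
  have hY : IsPosEndo g Y := ⟨h1, h2⟩
  refine ⟨Y, ⟨hY, hYY⟩, fun Z hZ hZZ => ?_⟩
  -- Z commutes with S = Z², hence with the root Y, a limit of polynomials in S.
  have hcomm : hF.toCLM Z * posSqrt c (hF.toCLM S) = posSqrt c (hF.toCLM S) * hF.toCLM Z := by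
    refine commute_posSqrt hlt.le (ContinuousLinearMap.ext fun v => ?_)
    change Z (S v) = S (Z v)
    rw [← hZZ, ← hZZ]
  have hYZ : ∀ v, Z (Y v) = Y (Z v) := fun v =>
    congrArg (fun T : M →L[ℝ] M => T v) hcomm
  have hYs : Function.Surjective Y := fun w => by
    obtain ⟨v, hv⟩ := hSb.2 w
    exact ⟨Y v, by rw [hYY, hv]⟩
  -- As Y and Z commute, (Y + Z)(Z − Y) = Z² − Y² = 0, and Y + Z is injective because Y is positive
  -- invertible and Z positive.
  have hinj := (hY.add_bijective ρ F hg hb hYs hZ).1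
  refine LinearMap.ext fun v => hinj ?_
  rw [LinearMap.add_apply, LinearMap.add_apply, hZZ, hYZ, hYY, add_comm]

end ExistsSqrt

/-! ### Continuity in total spaces -/

theorem continuous_of_local {X Z Y : Type*} [TopologicalSpace X] [TopologicalSpace Z]
    [TopologicalSpace Y] {π : Z → X} (hπ : Continuous π) {φ : Z → Y}
    (h : ∀ x₀, ∃ V : Set X, IsOpen V ∧ x₀ ∈ V ∧ Continuous fun z : {z // π z ∈ V} => φ z) :
    Continuous φ := by
  refine continuous_iff_continuousAt.2 fun z₀ => ?_
  obtain ⟨V, hVo, hV, hc⟩ := h (π z₀)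
  refine ContinuousOn.continuousAt (s := π ⁻¹' V) ?_ ((hVo.preimage hπ).mem_nhds hV)
  rw [continuousOn_iff_continuous_domRestrict]
  exact hc

section Triv

variable {X : Type w} [TopologicalSpace X] {F : X → Type u} [TopologicalSpace (Tot F)]
  {M : Type u} [TopologicalSpace M] {V : Set X} {e : ∀ x : V, F x ≃ M} {Z : Type*}
  [TopologicalSpace Z]

theorem IsTrivializationOn.continuous_coord (h : IsTrivializationOn V e) {φ : Z → Tot F}
    (hφ : Continuous φ) (hV : ∀ z, (φ z).proj ∈ V) :
    Continuous fun z => e ⟨(φ z).proj, hV z⟩ (φ z).snd :=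
  continuous_snd.comp (h.1.comp (hφ.subtype_mk hV))

theorem IsTrivializationOn.continuous_mk (h : IsTrivializationOn V e) {π : Z → V}
    (hπ : Continuous π) {m : Z → M} (hm : Continuous m) :
    Continuous fun z => (⟨π z, (e (π z)).symm (m z)⟩ : Tot F) :=
  h.2.comp (hπ.prodMk hm)

/-- Continuity of a map to the total space can be tested in a trivialization. -/
theorem IsTrivializationOn.continuous_of_coord (h : IsTrivializationOn V e) {φ : Z → Tot F}
    (hφ : Continuous fun z => (φ z).proj) (hV : ∀ z, (φ z).proj ∈ V)
    (hm : Continuous fun z => e ⟨(φ z).proj, hV z⟩ (φ z).snd) : Continuous φ := by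
  refine (h.continuous_mk (hφ.subtype_mk hV) hm).congr fun z => ?_
  simp

end Triv

section AlgBundle

variable {G : Type} [Group G] [TopologicalSpace G] {X : Type w} [TopologicalSpace X]
  [MulAction G X] {A : Type u} [Ring A] [Algebra ℝ A] [TopologicalSpace A]
  {𝒜 : GAlgBundle G X A} {Z : Type*} [TopologicalSpace Z]

theorem continuous_fibSmul [ContinuousSMul ℝ A] {π : Z → X} {a : ∀ z, 𝒜.Fib (π z)} {c : Z → ℝ}
    (hc : Continuous c) (ha : Continuous fun z => (⟨π z, a z⟩ : Tot 𝒜.Fib)) :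
    Continuous fun z => (⟨π z, c z • a z⟩ : Tot 𝒜.Fib) := by
  have hπ : Continuous π := 𝒜.continuous_proj.comp ha
  refine continuous_of_local hπ fun x₀ =>
    ⟨𝒜.dom x₀, 𝒜.isOpen_dom x₀, 𝒜.mem_dom x₀, ?_⟩
  refine (𝒜.chart_triv x₀).continuous_of_coord (hπ.comp continuous_subtype_val) (fun z => z.2) ?_
  refine ((hc.comp continuous_subtype_val).smul ((𝒜.chart_triv x₀).continuous_coord
    (ha.comp continuous_subtype_val) fun z => z.2)).congr fun z => ?_
  exact (map_smul (𝒜.chart x₀ ⟨π z.1, z.2⟩) _ _).symm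

theorem continuous_fibSum [ContinuousAdd A] {π : Z → X} {ι : Type*} (I : Finset ι)
    {a : ι → ∀ z, 𝒜.Fib (π z)} (hπ : Continuous π)
    (ha : ∀ i ∈ I, Continuous fun z => (⟨π z, a i z⟩ : Tot 𝒜.Fib)) :
    Continuous fun z => (⟨π z, ∑ i ∈ I, a i z⟩ : Tot 𝒜.Fib) := by
  classical
  induction I using Finset.induction_on with
  | empty => exact (continuous_zeroSection 𝒜).comp hπ
  | insert i I hi ih =>
    simp only [Finset.sum_insert hi]
    exact continuous_fibAdd 𝒜 (ha i (Finset.mem_insert_self i I))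
      (ih fun j hj => ha j (Finset.mem_insert_of_mem hj))

end AlgBundle

section ModuleBundle

variable {G : Type} [Group G] [TopologicalSpace G] {X : Type w} [TopologicalSpace X]
  [MulAction G X] {A : Type u} [Ring A] [Algebra ℝ A] [TopologicalSpace A]
  {𝒜 : GAlgBundle G X A} {Z : Type*} [TopologicalSpace Z]

omit [Algebra ℝ A] in
-- The model M comes with a bare topology; continuity of its addition is inherited from A^n through
-- the continuous retraction.
theorem IsFGProjective.continuous_add [ContinuousAdd A] {M : Type u} [AddCommGroup M] [Module A M]
    [TopologicalSpace M] (hM : IsFGProjective A M) : ContinuousAdd M := by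
  obtain ⟨ι, _, i, r, hir⟩ := hM
  refine ⟨?_⟩
  have h : Continuous fun p : M × M => r (i p.1 + i p.2) := by fun_prop
  refine h.congr fun p => ?_
  rw [← map_add, hir]

theorem GBundle.continuous_fibAdd [ContinuousAdd A] (E : GBundle 𝒜) {π : Z → X}
    {a b : ∀ z, E.Fib (π z)} (ha : Continuous fun z => (⟨π z, a z⟩ : Tot E.Fib))
    (hb : Continuous fun z => (⟨π z, b z⟩ : Tot E.Fib)) :
    Continuous fun z => (⟨π z, a z + b z⟩ : Tot E.Fib) := by
  have hπ : Continuous π := E.continuous_proj.comp ha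
  refine continuous_of_local hπ fun x₀ => ?_
  obtain ⟨V, hV, hVo, hxV, M, _, _, _, hM, e, he, htriv⟩ := E.locallyTrivial x₀
  have := hM.continuous_add
  refine ⟨V, hVo, hxV, ?_⟩
  refine htriv.continuous_of_coord (hπ.comp continuous_subtype_val) (fun z => z.2) ?_
  refine ((htriv.continuous_coord (ha.comp continuous_subtype_val) fun z => z.2).add
    (htriv.continuous_coord (hb.comp continuous_subtype_val) fun z => z.2)).congr fun z => ?_
  exact (map_add (e ⟨π z.1, z.2⟩) _ _).symm

theorem GBundle.continuous_realSmul [ContinuousConstSMul ℝ A] (E : GBundle 𝒜) (c : ℝ) {π : Z → X}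
    {a : ∀ z, E.Fib (π z)} (ha : Continuous fun z => (⟨π z, a z⟩ : Tot E.Fib)) :
    Continuous fun z => (⟨π z, algebraMap ℝ (𝒜.Fib (π z)) c • a z⟩ : Tot E.Fib) := by
  have hπ : Continuous π := E.continuous_proj.comp ha
  refine continuous_of_local hπ fun x₀ => ?_
  obtain ⟨V, hV, hVo, hxV, M, _, _, _, ⟨ι, _, i, r, hir⟩, e, he, htriv⟩ := E.locallyTrivial x₀
  refine ⟨V, hVo, hxV, ?_⟩
  refine htriv.continuous_of_coord (hπ.comp continuous_subtype_val) (fun z => z.2) ?_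
  have h : Continuous fun m : M => r (c • i m) := by fun_prop
  refine (h.comp (htriv.continuous_coord (ha.comp continuous_subtype_val)
    fun z => z.2)).congr fun z => ?_
  change r (c • i (e ⟨π z.1, z.2⟩ (a z.1))) =
    e ⟨π z.1, z.2⟩ (algebraMap ℝ (𝒜.Fib (π z.1)) c • a z.1)
  rw [he ⟨π z.1, z.2⟩, AlgEquiv.commutes, ← algebraMap_smul A c (i _), ← map_smul, hir]

theorem GBundle.continuous_zero (E : GBundle 𝒜) :
    Continuous fun x : X => (⟨x, 0⟩ : Tot E.Fib) := by
  refine continuous_of_local (π := id) continuous_id fun x₀ => ?_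
  obtain ⟨V, hV, hVo, hxV, M, _, _, _, hM, e, he, htriv⟩ := E.locallyTrivial x₀
  refine ⟨V, hVo, hxV, htriv.continuous_of_coord continuous_subtype_val (fun z => z.2) ?_⟩
  exact (continuous_const (y := (0 : M))).congr fun z => (map_zero (e ⟨z.1, z.2⟩)).symm

end ModuleBundle

/-! ### Transport of forms -/

section Transport

variable {R A E M : Type*} [Ring R] [Algebra ℝ R] [Ring A] [Algebra ℝ A] [AddCommGroup E]
  [Module R E] [AddCommGroup M] [Module A M]

theorem symm_smul_of_semilinear (κ : R ≃ₐ[ℝ] A) (e : E ≃+ M) (he : ∀ a v, e (a • v) = κ a • e v)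
    (a : A) (m : M) : e.symm (a • m) = κ.symm a • e.symm m := by
  rw [AddEquiv.symm_apply_eq, he, AlgEquiv.apply_symm_apply, AddEquiv.apply_symm_apply]

/-- The form on `M` that corresponds to `g` under a semilinear bijection `E ≃ M`. -/
def transportForm (κ : R ≃ₐ[ℝ] A) (e : E ≃+ M) (he : ∀ a v, e (a • v) = κ a • e v)
    (g : E →+ (E →ₗ[R] R)) : M →+ (M →ₗ[A] A) :=
  AddMonoidHom.mk' (fun v =>
    { toFun := fun w => κ (g (e.symm v) (e.symm w))
      map_add' := fun w w' => by rw [map_add, map_add, map_add]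
      map_smul' := fun a w => by
        rw [symm_smul_of_semilinear κ e he, map_smul, smul_eq_mul, map_mul,
          AlgEquiv.apply_symm_apply]
        rfl })
    (fun v v' => LinearMap.ext fun w => by
      change κ (g (e.symm (v + v')) (e.symm w)) =
        κ (g (e.symm v) (e.symm w)) + κ (g (e.symm v') (e.symm w))
      rw [map_add, map_add, LinearMap.add_apply, map_add])

theorem transportForm_apply (κ : R ≃ₐ[ℝ] A) (e : E ≃+ M) (he : ∀ a v, e (a • v) = κ a • e v)
    (g : E →+ (E →ₗ[R] R)) (v w : M) :
    transportForm κ e he g v w = κ (g (e.symm v) (e.symm w)) := rfl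

theorem transportForm_bijective (κ : R ≃ₐ[ℝ] A) (e : E ≃+ M)
    (he : ∀ a v, e (a • v) = κ a • e v) {g : E →+ (E →ₗ[R] R)} (hg : Function.Bijective g) :
    Function.Bijective (transportForm κ e he g) := by
  constructor
  · intro v v' h
    refine e.symm.injective (hg.1 (LinearMap.ext fun w => κ.injective ?_))
    have := LinearMap.congr_fun h (e w)
    rwa [transportForm_apply, transportForm_apply, AddEquiv.symm_apply_apply] at this
  · intro φ
    let ψ : E →ₗ[R] R :=
      { toFun := fun w => κ.symm (φ (e w))
        map_add' := fun w w' => by rw [map_add, map_add, map_add]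
        map_smul' := fun a w => by
          rw [he, map_smul, smul_eq_mul, map_mul, AlgEquiv.symm_apply_apply]
          rfl }
    obtain ⟨u, hu⟩ := hg.2 ψ
    refine ⟨e u, LinearMap.ext fun w => ?_⟩
    rw [transportForm_apply, AddEquiv.symm_apply_apply, hu]
    change κ (κ.symm (φ (e (e.symm w)))) = φ w
    rw [AlgEquiv.apply_symm_apply, AddEquiv.apply_symm_apply]

theorem transportForm_isPosForm [StarRing R] [StarRing A] {κ : R ≃ₐ[ℝ] A}
    (hκ : ∀ a, κ (star a) = star (κ a)) (e : E ≃+ M) (he : ∀ a v, e (a • v) = κ a • e v)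
    {g : E →+ (E →ₗ[R] R)} (hg : IsPosForm g) : IsPosForm (transportForm κ e he g) where
  herm := fun v w => by rw [transportForm_apply, transportForm_apply, hg.herm (e.symm v), hκ]
  nonneg := fun v => by
    obtain ⟨c, hc⟩ := hg.nonneg (e.symm v)
    exact ⟨κ c, by rw [transportForm_apply, hc, map_mul, hκ]⟩

/-- The frame on `M` that corresponds to a frame on `E`. -/
def Frame.transport (κ : R ≃ₐ[ℝ] A) (e : E ≃+ M) (he : ∀ a v, e (a • v) = κ a • e v)
    (F : Frame R E) : Frame A M where
  ι := F.ι
  e := fun i => e (F.e i)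
  f := fun i =>
    { toFun := fun w => κ (F.f i (e.symm w))
      map_add' := fun w w' => by rw [map_add, map_add, map_add]
      map_smul' := fun a w => by
        rw [symm_smul_of_semilinear κ e he, map_smul, smul_eq_mul, map_mul,
          AlgEquiv.apply_symm_apply]
        rfl }
  sum_eq := fun v => by
    change ∑ i, κ (F.f i (e.symm v)) • e (F.e i) = v
    simp only [← he]
    rw [← map_sum, F.sum_eq, AddEquiv.apply_symm_apply]

end Transport

/-- The frame of a finitely generated projective module. -/
theorem IsFGProjective.exists_frame {A M : Type u} [Ring A] [TopologicalSpace A] [AddCommGroup M]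
    [Module A M] [TopologicalSpace M] [IsTopologicalRing A] (h : IsFGProjective A M) :
    ∃ F : Frame A M, (∀ i, Continuous (F.f i)) ∧ Continuous fun a : F.ι → A => ∑ i, a i • F.e i := by
  classical
  obtain ⟨ι, _, i, r, hir⟩ := h
  let _ := Fintype.ofFinite ι
  have hr : ∀ a : ι → A, ∑ k, a k • r (Pi.single k 1) = r a := fun a => by
    conv_rhs => rw [pi_eq_sum_univ a, map_sum]
    refine Finset.sum_congr rfl fun k _ => ?_
    rw [map_smul]
    congr 2
    funext j
    by_cases hj : j = k
    · subst hj; simp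
    · rw [Pi.single_eq_of_ne hj, if_neg (Ne.symm hj)]
  refine ⟨{ ι := ι, e := fun k => r (Pi.single k 1),
            f := fun k => (LinearMap.proj k).comp (i : M →ₗ[A] (ι → A)),
            sum_eq := fun v => (hr (i v)).trans (hir v) }, fun k => ?_, ?_⟩
  · exact (continuous_apply k).comp i.continuous
  · exact r.continuous.congr fun a => (hr a).symm

/-! ### The fibres of a bundle of `C^*`-algebras -/

section Fibre

variable {X : Type w} [TopologicalSpace X] [MulAction C2 X] {A : Type u} [NormedRing A]
  [NormedAlgebra ℝ A] {𝒜 : GAlgBundle C2 X A}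

/-- The `*`-ring structure of a fibre. -/
@[reducible] def AntiInvolution.starRing (s : AntiInvolution 𝒜) (x : X) : StarRing (𝒜.Fib x) where
  star := s.dag x
  star_involutive := s.dag_dag x
  star_mul := s.dag_mul x
  star_add := map_add (s.dag x)

/-- The chart at `x`, on the fibre over `x`. -/
def GAlgBundle.chartAt (𝒜 : GAlgBundle C2 X A) (x : X) : 𝒜.Fib x ≃ₐ[ℝ] A :=
  𝒜.chart x ⟨x, 𝒜.mem_dom x⟩

/-- The norm of a fibre. -/
@[reducible] def GAlgBundle.normedRing (𝒜 : GAlgBundle C2 X A) (x : X) : NormedRing (𝒜.Fib x) :=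
  NormedRing.induced (𝒜.Fib x) A (𝒜.chartAt x) (𝒜.chartAt x).injective

@[reducible] def GAlgBundle.normedAlgebra (𝒜 : GAlgBundle C2 X A) (x : X) :
    @NormedAlgebra ℝ (𝒜.Fib x) _ (𝒜.normedRing x).toSeminormedRing :=
  letI := 𝒜.normedRing x
  { (inferInstance : Algebra ℝ (𝒜.Fib x)) with
    norm_smul_le := fun c a => by
      change ‖𝒜.chartAt x (c • a)‖ ≤ ‖c‖ * ‖𝒜.chartAt x a‖
      rw [map_smul]
      exact norm_smul_le _ _ }

theorem GAlgBundle.completeSpace [CompleteSpace A] (𝒜 : GAlgBundle C2 X A) (x : X) :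
    @CompleteSpace (𝒜.Fib x) (𝒜.normedRing x).toPseudoMetricSpace.toUniformSpace := by
  let := 𝒜.normedRing x
  have h : _root_.Isometry (𝒜.chartAt x) := AddMonoidHomClass.isometry_of_norm _ fun a => rfl
  exact (completeSpace_congr (e := (𝒜.chartAt x).toEquiv) h.isUniformEmbedding).2 inferInstance

/-- `g` is a hermitian form on a module over the fibre at `x` with positive diagonal values. -/
abbrev IsPosFormAt (s : AntiInvolution 𝒜) (x : X) {E : Type*} [AddCommGroup E]
    [Module (𝒜.Fib x) E] (g : E →+ (E →ₗ[𝒜.Fib x] 𝒜.Fib x)) : Prop :=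
  @IsPosForm _ _ _ (s.starRing x) _ _ g

/-- `S` is positive and self-adjoint for `g`. -/
abbrev IsPosEndoAt (s : AntiInvolution 𝒜) (x : X) {E : Type*} [AddCommGroup E]
    [Module (𝒜.Fib x) E] (g : E →+ (E →ₗ[𝒜.Fib x] 𝒜.Fib x)) (S : E →ₗ[𝒜.Fib x] E) : Prop :=
  @IsPosEndo _ _ _ (s.starRing x) _ _ g S

variable [StarRing A] {s : AntiInvolution 𝒜} (hs : s.IsModelledOnStar)
  {H : Type*} [NormedAddCommGroup H] [InnerProductSpace ℝ H] [CompleteSpace H] (ρ : StarRep A H)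
  (x : X)

/-- The representation of a fibre. -/
@[reducible] def fibRep :
    @StarRep (𝒜.Fib x) H (𝒜.normedRing x) (𝒜.normedAlgebra x) (s.starRing x) _ _ _ :=
  letI := 𝒜.normedRing x
  letI := 𝒜.normedAlgebra x
  letI := s.starRing x
  { π := ρ.π.comp (𝒜.chartAt x : 𝒜.Fib x →ₐ[ℝ] A)
    norm_π := fun a => ρ.norm_π (𝒜.chartAt x a)
    π_star := fun a => by
      change ρ.π (𝒜.chartAt x (s.dag x a)) = ContinuousLinearMap.adjoint (ρ.π (𝒜.chartAt x a))
      rw [← ρ.π_star]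
      exact congrArg ρ.π (hs x ⟨x, 𝒜.mem_dom x⟩ a) }

variable [CompleteSpace A] {E : Type*} [AddCommGroup E] [Module (𝒜.Fib x) E]

include hs ρ

/-- A fibre is itself a complete real C^*-algebra through its chart (`fibRep`), so the results over
A apply to it verbatim. -/
theorem IsPosFormAt.add_bijective (F : Frame (𝒜.Fib x) E) {g h : E →+ (E →ₗ[𝒜.Fib x] 𝒜.Fib x)}
    (hg : IsPosFormAt s x g) (hb : Function.Surjective g) (hh : IsPosFormAt s x h) :
    IsPosFormAt s x (g + h) ∧ Function.Bijective (g + h) := by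
  let := 𝒜.normedRing x
  let := 𝒜.normedAlgebra x
  let := s.starRing x
  have := 𝒜.completeSpace x
  exact IsPosForm.add_bijective (fibRep hs ρ x) F hg hb hh

theorem IsPosEndoAt.exists_sqrt (F : Frame (𝒜.Fib x) E) {g : E →+ (E →ₗ[𝒜.Fib x] 𝒜.Fib x)}
    (hg : IsPosFormAt s x g) (hb : Function.Surjective g) {S : E →ₗ[𝒜.Fib x] E}
    (hS : IsPosEndoAt s x g S) (hSb : Function.Bijective S) :
    ∃ Y : E →ₗ[𝒜.Fib x] E, (IsPosEndoAt s x g Y ∧ ∀ v, Y (Y v) = S v) ∧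
      ∀ Z : E →ₗ[𝒜.Fib x] E, IsPosEndoAt s x g Z → (∀ v, Z (Z v) = S v) → Z = Y := by
  let := 𝒜.normedRing x
  let := 𝒜.normedAlgebra x
  let := s.starRing x
  have := 𝒜.completeSpace x
  exact IsPosEndo.exists_sqrt (fibRep hs ρ x) F hg hb hS hSb

theorem IsPosFormAt.add {g h : E →+ (E →ₗ[𝒜.Fib x] 𝒜.Fib x)}
    (hg : IsPosFormAt s x g) (hh : IsPosFormAt s x h) : IsPosFormAt s x (g + h) := by
  let := 𝒜.normedRing x
  let := 𝒜.normedAlgebra x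
  let := s.starRing x
  have := 𝒜.completeSpace x
  exact IsPosForm.add (fibRep hs ρ x) hg hh

omit ρ [CompleteSpace A] hs [StarRing A] in
theorem isPosFormAt_zero : IsPosFormAt s x (0 : E →+ (E →ₗ[𝒜.Fib x] 𝒜.Fib x)) := by
  let := s.starRing x
  exact ⟨fun v w => (star_zero (𝒜.Fib x)).symm, fun v => ⟨0, (zero_mul _).symm⟩⟩

omit ρ [CompleteSpace A] hs [StarRing A] in
theorem IsPosFormAt.smul {g : E →+ (E →ₗ[𝒜.Fib x] 𝒜.Fib x)} (hg : IsPosFormAt s x g) {c : ℝ}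
    (hc : 0 ≤ c) : IsPosFormAt s x (c • g) := by
  let := s.starRing x
  refine ⟨fun v w => ?_, fun v => ?_⟩
  · change c • g w v = s.dag x (c • g v w)
    rw [map_smul, hg.herm v w]
    rfl
  · obtain ⟨a, ha⟩ := hg.nonneg v
    refine ⟨√c • a, ?_⟩
    change c • g v v = √c • a * s.dag x (√c • a)
    rw [ha, map_smul, smul_mul_smul_comm, Real.mul_self_sqrt hc]
    rfl

end Fibre

theorem GBundle.exists_frame {X : Type w} [TopologicalSpace X] [MulAction C2 X] {A : Type u}
    [Ring A] [Algebra ℝ A] [TopologicalSpace A] [IsTopologicalRing A] {𝒜 : GAlgBundle C2 X A}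
    (E : GBundle 𝒜) (x : X) : Nonempty (Frame (𝒜.Fib x) (E.Fib x)) := by
  obtain ⟨V, hV, hVo, hxV, M, _, _, _, hM, e, he, htriv⟩ := E.locallyTrivial x
  obtain ⟨F, -, -⟩ := hM.exists_frame
  exact ⟨F.transport (𝒜.chart x ⟨x, hV hxV⟩).symm (e ⟨x, hxV⟩).symm
    (symm_smul_of_semilinear _ _ (he ⟨x, hxV⟩))⟩

/-! ### Hermitian forms and metrics on bundles -/

section Metric

variable {X : Type w} [TopologicalSpace X] [MulAction C2 X] {A : Type u} [NormedRing A]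
  [NormedAlgebra ℝ A] {𝒜 : GAlgBundle C2 X A}

/-- A continuous hermitian form on a bundle. -/
structure HForm (s : AntiInvolution 𝒜) (E : GBundle 𝒜) where
  form : ∀ x, E.Fib x →+ (E.Fib x →ₗ[𝒜.Fib x] 𝒜.Fib x)
  herm : ∀ x v w, form x w v = s.dag x (form x v w)
  continuous_form : Continuous (fun p : Tot (E.prod E).Fib =>
    (⟨p.proj, form p.proj p.snd.1 p.snd.2⟩ : Tot 𝒜.Fib))

/-- A metric: a nondegenerate positive hermitian form. -/
structure Metric (s : AntiInvolution 𝒜) (E : GBundle 𝒜) extends HForm s E where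
  nonneg : ∀ x v, ∃ a, form x v v = a * s.dag x a
  bijective : ∀ x, Function.Bijective (form x)

variable {s : AntiInvolution 𝒜} {E : GBundle 𝒜}

theorem HForm.continuous_apply (b : HForm s E) {Z : Type*} [TopologicalSpace Z] {π : Z → X}
    {v w : ∀ z, E.Fib (π z)} (hv : Continuous fun z => (⟨π z, v z⟩ : Tot E.Fib))
    (hw : Continuous fun z => (⟨π z, w z⟩ : Tot E.Fib)) :
    Continuous fun z => (⟨π z, b.form (π z) (v z) (w z)⟩ : Tot 𝒜.Fib) :=
  b.continuous_form.comp (GBundle.continuous_prodTop E E (φ := fun z => ⟨π z, (v z, w z)⟩) hv hw)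

theorem Metric.isPosFormAt (g : Metric s E) (x : X) : IsPosFormAt s x (g.form x) :=
  @IsPosForm.mk _ _ _ (s.starRing x) _ _ _ (g.herm x) (g.nonneg x)

/-- The standard form `∑ fₖ(w) fₖ(v)^*` on a module with a frame. -/
def Frame.stdForm {A M : Type*} [Ring A] [StarRing A] [AddCommGroup M] [Module A M]
    (F : Frame A M) : M →+ (M →ₗ[A] A) :=
  AddMonoidHom.mk' (fun v => ∑ k, (F.f k).smulRight (star (F.f k v))) (fun v w => by
    rw [← Finset.sum_add_distrib]
    refine Finset.sum_congr rfl fun k _ => ?_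
    ext u
    simp [mul_add])

theorem Frame.stdForm_apply {A M : Type*} [Ring A] [StarRing A] [AddCommGroup M] [Module A M]
    (F : Frame A M) (v w : M) : F.stdForm v w = ∑ k, F.f k w * star (F.f k v) := by
  simp [Frame.stdForm, LinearMap.sum_apply]

variable [CompleteSpace A] [StarRing A] {H : Type*} [NormedAddCommGroup H] [InnerProductSpace ℝ H]
  [CompleteSpace H] (ρ : StarRep A H)

include ρ in
-- The form is coercive with constant 1: each fᵢ fᵢ^* is one of the positive summands of the
-- diagonal value.
theorem Frame.stdForm_isPosForm {M : Type*} [AddCommGroup M] [Module A M] (F : Frame A M) :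
    IsPosForm F.stdForm ∧ Function.Bijective F.stdForm := by
  have hherm : IsHerm F.stdForm := fun v w => by
    rw [F.stdForm_apply, F.stdForm_apply, star_sum]
    exact Finset.sum_congr rfl fun k _ => by rw [star_mul, star_star]
  have hev : ∀ ξ v, ρ.ev ξ (F.stdForm v v) = ∑ k, ρ.ev ξ (F.f k v * star (F.f k v)) :=
    fun ξ v => by rw [F.stdForm_apply, map_sum]
  have hpos : IsPosForm F.stdForm := isPosForm_of_ev ρ hherm fun ξ v => by
    rw [hev]
    exact Finset.sum_nonneg fun k _ => ρ.ev_mul_star_nonneg ξ _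
  refine ⟨hpos, IsCoercive.bijective ρ (F := F) hpos ⟨1, zero_le_one, fun i v ξ => ?_⟩⟩
  rw [hev, one_mul]
  exact Finset.single_le_sum (f := fun k => ρ.ev ξ (F.f k v * star (F.f k v)))
    (fun k _ => ρ.ev_mul_star_nonneg ξ _) (Finset.mem_univ i)

omit [CompleteSpace A] in
theorem AntiInvolution.IsModelledOnStar.symm (hs : s.IsModelledOnStar) (x₀ : X) (x : 𝒜.dom x₀)
    (a : A) : (𝒜.chart x₀ x).symm (star a) = s.dag x ((𝒜.chart x₀ x).symm a) := by
  rw [AlgEquiv.symm_apply_eq, hs, AlgEquiv.apply_symm_apply]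

include ρ in
-- The standard form of a frame of the model, carried to the fibres by the trivialization. The
-- charts are *-isomorphisms, so positivity survives.
theorem exists_local_metric (hs : s.IsModelledOnStar) (E : GBundle 𝒜) (x₀ : X) :
    ∃ V : Set X, IsOpen V ∧ x₀ ∈ V ∧
      ∃ L : ∀ x, E.Fib x →+ (E.Fib x →ₗ[𝒜.Fib x] 𝒜.Fib x),
        (∀ x ∈ V, IsPosFormAt s x (L x) ∧ Function.Bijective (L x)) ∧
        Continuous (fun p : {p : Tot (E.prod E).Fib // p.proj ∈ V} =>
          (⟨p.1.proj, L p.1.proj p.1.snd.1 p.1.snd.2⟩ : Tot 𝒜.Fib)) := by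
  classical
  obtain ⟨V, hV, hVo, hxV, M, _, _, _, hM, e, he, htriv⟩ := E.locallyTrivial x₀
  obtain ⟨F, hf, -⟩ := hM.exists_frame
  have he' : ∀ (x : V) (a : A) (m : M), (e x).symm (a • m) =
      (𝒜.chart x₀ ⟨x, hV x.2⟩).symm a • (e x).symm m := fun x =>
    symm_smul_of_semilinear _ _ (he x)
  let L' : ∀ x : V, E.Fib x →+ (E.Fib x →ₗ[𝒜.Fib x] 𝒜.Fib x) := fun x =>
    transportForm (𝒜.chart x₀ ⟨x, hV x.2⟩).symm (e x).symm (he' x) F.stdForm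
  let L : ∀ x, E.Fib x →+ (E.Fib x →ₗ[𝒜.Fib x] 𝒜.Fib x) := fun x =>
    if hx : x ∈ V then L' ⟨x, hx⟩ else 0
  have hL : ∀ x (hx : x ∈ V), L x = L' ⟨x, hx⟩ := fun x hx => dif_pos hx
  obtain ⟨hp, hb⟩ := F.stdForm_isPosForm ρ
  refine ⟨V, hVo, hxV, L, fun x hx => ?_, ?_⟩
  · rw [hL x hx]
    refine ⟨?_, transportForm_bijective _ _ _ hb⟩
    let := s.starRing x
    exact transportForm_isPosForm (hs.symm x₀ ⟨x, hV hx⟩) _ _ hp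
  · have h1 := htriv.continuous_coord ((GBundle.continuous_prodTop_fst E E).comp
      (continuous_subtype_val (p := fun p : Tot (E.prod E).Fib => p.proj ∈ V))) fun z => z.2
    have h2 := htriv.continuous_coord ((GBundle.continuous_prodTop_snd E E).comp
      (continuous_subtype_val (p := fun p : Tot (E.prod E).Fib => p.proj ∈ V))) fun z => z.2
    have h3 : Continuous fun m : M × M => F.stdForm m.1 m.2 := by
      simp only [F.stdForm_apply]
      refine continuous_finsetSum _ fun k _ => ?_
      exact ((hf k).comp continuous_snd).mul (ρ.continuous_star.comp ((hf k).comp continuous_fst))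
    have hπ : Continuous fun z : {p : Tot (E.prod E).Fib // p.proj ∈ V} =>
        (⟨z.1.proj, hV z.2⟩ : 𝒜.dom x₀) :=
      ((E.prod E).continuous_proj.comp continuous_subtype_val).subtype_mk _
    refine ((𝒜.chart_triv x₀).continuous_mk hπ (h3.comp (h1.prodMk h2))).congr fun z => ?_
    refine congrArg (fun a => (⟨z.1.proj, a⟩ : Tot 𝒜.Fib)) ?_
    rw [hL _ z.2]
    rfl

include ρ in
/-- Every bundle has a metric. -/
theorem exists_metric [T2Space X] [ParacompactSpace X] (hs : s.IsModelledOnStar)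
    (E : GBundle 𝒜) : Nonempty (Metric s E) := by
  classical
  choose V hVo hxV L hL hLc using exists_local_metric ρ hs E
  obtain ⟨φ, hφ⟩ := PartitionOfUnity.exists_isSubordinate isClosed_univ V hVo
    fun x _ => Set.mem_iUnion.2 ⟨x, hxV x⟩
  have hmem : ∀ x i, i ∈ φ.fintsupport x → x ∈ V i := fun x i hi =>
    hφ i ((φ.mem_fintsupport_iff x i).1 hi)
  let B : ∀ x, E.Fib x →+ (E.Fib x →ₗ[𝒜.Fib x] 𝒜.Fib x) := fun x =>
    ∑ i ∈ φ.finsupport x, φ i x • L i x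
  have hpos : ∀ x (I : Finset X), I ⊆ φ.finsupport x →
      IsPosFormAt s x (∑ i ∈ I, φ i x • L i x) := by
    intro x I hI
    induction I using Finset.induction_on with
    | empty => exact isPosFormAt_zero x
    | insert i I hi ih =>
      rw [Finset.sum_insert hi]
      refine IsPosFormAt.add hs ρ x (IsPosFormAt.smul x (hL i x ?_).1 (φ.nonneg i x))
        (ih fun j hj => hI (Finset.mem_insert_of_mem hj))
      exact hmem x i (φ.finsupport_subset_fintsupport x (hI (Finset.mem_insert_self i I)))
  have hbij : ∀ x, Function.Bijective (B x) := by
    intro x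
    obtain ⟨F⟩ := E.exists_frame x
    obtain ⟨i, hi⟩ := φ.exists_pos (Set.mem_univ x)
    have hi' : i ∈ φ.finsupport x := (φ.mem_finsupport x).2 hi.ne'
    have hiV := hL i x (hmem x i (φ.finsupport_subset_fintsupport x hi'))
    -- Some weight at x is strictly positive. That summand alone is nondegenerate, and adding the
    -- remaining positive forms keeps it so.
    have h1 : B x = φ i x • L i x + ∑ j ∈ (φ.finsupport x).erase i, φ j x • L j x :=
      (Finset.add_sum_erase _ _ hi').symm
    rw [h1]
    refine (IsPosFormAt.add_bijective hs ρ x F (IsPosFormAt.smul x hiV.1 hi.le) ?_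
      (hpos x _ (Finset.erase_subset _ _))).2
    intro f
    obtain ⟨v, hv⟩ := hiV.2.2 ((φ i x)⁻¹ • f)
    refine ⟨v, ?_⟩
    change φ i x • L i x v = f
    rw [hv, smul_smul, mul_inv_cancel₀ hi.ne', one_smul]
  have hBpos : ∀ x, IsPosFormAt s x (B x) := fun x => hpos x _ (Finset.Subset.refl _)
  refine ⟨{ form := B, herm := fun x => letI := s.starRing x; (hBpos x).herm,
            nonneg := fun x => letI := s.starRing x; (hBpos x).nonneg,
            bijective := hbij, continuous_form := ?_ }⟩
  refine continuous_of_local (E.prod E).continuous_proj fun x₀ => ?_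
  -- Near x₀ the supports meeting the point lie in the fixed finite set `φ.fintsupport x₀`, so the
  -- form is locally a sum over a constant index set.
  obtain ⟨W, hW, hWo, hxW⟩ := eventually_nhds_iff.1 (φ.eventually_finsupport_subset x₀)
  refine ⟨W ∩ ⋂ i ∈ φ.fintsupport x₀, V i, hWo.inter (isOpen_biInter_finset fun i _ => hVo i),
    ⟨hxW, Set.mem_iInter₂.2 fun i hi => hmem x₀ i hi⟩, ?_⟩
  set U := W ∩ ⋂ i ∈ φ.fintsupport x₀, V i
  have hsum : Continuous fun z : {p : Tot (E.prod E).Fib // p.proj ∈ U} =>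
      (⟨z.1.proj, ∑ i ∈ φ.fintsupport x₀, φ i z.1.proj • L i z.1.proj z.1.snd.1 z.1.snd.2⟩ :
        Tot 𝒜.Fib) := by
    have hπ : Continuous fun z : {p : Tot (E.prod E).Fib // p.proj ∈ U} => z.1.proj :=
      (E.prod E).continuous_proj.comp continuous_subtype_val
    refine continuous_fibSum (φ.fintsupport x₀) hπ fun i hi => ?_
    refine continuous_fibSmul ((φ i).continuous.comp hπ) ?_
    exact (hLc i).comp (continuous_subtype_val.subtype_mk
      fun z : {p : Tot (E.prod E).Fib // p.proj ∈ U} => Set.mem_iInter₂.1 z.2.2 i hi)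
  refine hsum.congr fun z => ?_
  refine congrArg (fun a => (⟨z.1.proj, a⟩ : Tot 𝒜.Fib)) ?_
  have hBz : B z.1.proj = ∑ i ∈ φ.fintsupport x₀, φ i z.1.proj • L i z.1.proj := by
    refine Finset.sum_subset (hW _ z.2.1) fun i _ hi => ?_
    rw [φ.mem_finsupport] at hi
    refine AddMonoidHom.ext fun v => ?_
    change φ i z.1.proj • L i z.1.proj v = 0
    rw [Function.notMem_support.1 hi, zero_smul]
  change _ = B z.1.proj z.1.snd.1 z.1.snd.2
  rw [hBz, AddMonoidHom.finsetSum_apply, LinearMap.sum_apply]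
  rfl

end Metric

/-! ### Charts with the norm of a metric -/

section Chart

variable {X : Type w} [TopologicalSpace X] [MulAction C2 X] {A : Type u} [NormedRing A]
  [NormedAlgebra ℝ A] {𝒜 : GAlgBundle C2 X A}

/-- A local trivialization of `E` near `x₀`, whose model is normed by the metric `g` at `x₀`. -/
structure MetricChart {s : AntiInvolution 𝒜} {E : GBundle 𝒜} (g : Metric s E) (x₀ : X) where
  V : Set X
  hV : V ⊆ 𝒜.dom x₀
  isOpen : IsOpen V
  mem : x₀ ∈ V
  M : Type u
  [normed : NormedAddCommGroup M]
  [normedSpace : NormedSpace ℝ M]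
  [module : Module A M]
  [tower : IsScalarTower ℝ A M]
  [boundedSMul : IsBoundedSMul A M]
  [complete : CompleteSpace M]
  F : Frame A M
  isBounded : F.IsBounded
  e : ∀ x : V, E.Fib x ≃+ M
  e_smul : ∀ (x : V) (a : 𝒜.Fib x) (v : E.Fib x),
    e x (a • v) = 𝒜.chart x₀ ⟨x, hV x.2⟩ a • e x v
  triv : IsTrivializationOn V (fun x => (e x).toEquiv)
  isFormNorm : IsFormNorm (transportForm (𝒜.chart x₀ ⟨x₀, hV mem⟩) (e ⟨x₀, mem⟩)
    (e_smul ⟨x₀, mem⟩) (g.form x₀))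

attribute [instance] MetricChart.normed MetricChart.normedSpace MetricChart.module
  MetricChart.tower MetricChart.boundedSMul MetricChart.complete

variable {s : AntiInvolution 𝒜} {E E' : GBundle 𝒜}

/-- The family `φ` of linear maps is continuous on the total space. -/
def IsContMap (φ : ∀ x, E.Fib x →ₗ[𝒜.Fib x] E'.Fib x) : Prop :=
  Continuous (fun p : Tot E.Fib => (⟨p.proj, φ p.proj p.snd⟩ : Tot E'.Fib))

theorem IsContMap.comp_continuous {φ : ∀ x, E.Fib x →ₗ[𝒜.Fib x] E'.Fib x} (hφ : IsContMap φ)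
    {Z : Type*} [TopologicalSpace Z] {π : Z → X} {v : ∀ z, E.Fib (π z)}
    (hv : Continuous fun z => (⟨π z, v z⟩ : Tot E.Fib)) :
    Continuous fun z => (⟨π z, φ (π z) (v z)⟩ : Tot E'.Fib) :=
  Continuous.comp (f := fun z => (⟨π z, v z⟩ : Tot E.Fib)) hφ hv

section Exists

variable [CompleteSpace A] [StarRing A] {H : Type*} [NormedAddCommGroup H] [InnerProductSpace ℝ H]
  [CompleteSpace H] (ρ : StarRep A H)

omit [CompleteSpace A] in
theorem transportForm_isPosFormAt (hs : s.IsModelledOnStar) {x₀ : X} (x : 𝒜.dom x₀)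
    {E M : Type*} [AddCommGroup E] [Module (𝒜.Fib x) E] [AddCommGroup M] [Module A M] (e : E ≃+ M)
    (he : ∀ a v, e (a • v) = 𝒜.chart x₀ x a • e v) {g : E →+ (E →ₗ[𝒜.Fib x] 𝒜.Fib x)}
    (hg : IsPosFormAt s x g) : IsPosForm (transportForm (𝒜.chart x₀ x) e he g) := by
  let := s.starRing x
  exact transportForm_isPosForm (hs x₀ x) e he hg

omit [CompleteSpace A] in
include ρ in
-- Both the coordinates and the synthesis map of the frame are continuous for the form norm; this
-- pins down its topology.
theorem IsCoercive.continuous_frame {M : Type*} [AddCommGroup M] [Module A M] [Module ℝ M]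
    [IsScalarTower ℝ A M] {F : Frame A M} {g : M →+ (M →ₗ[A] A)} (hg : IsPosForm g)
    (hc : IsCoercive ρ F g) :
    (Continuous[(@NormedAddCommGroup.ofCore ℝ M _ _ _ (formNorm g)
      (hc.normCore hg)).toPseudoMetricSpace.toUniformSpace.toTopologicalSpace, _]
        fun v i => F.f i v) ∧
    Continuous[_, (@NormedAddCommGroup.ofCore ℝ M _ _ _ (formNorm g)
      (hc.normCore hg)).toPseudoMetricSpace.toUniformSpace.toTopologicalSpace]
        fun a : F.ι → A => ∑ i, a i • F.e i := by
  let _ := formNorm g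
  let _ := NormedAddCommGroup.ofCore (hc.normCore hg)
  let _ : NormedSpace ℝ M :=
    { (inferInstance : Module ℝ M) with
      norm_smul_le := fun c v => ((hc.normCore hg).norm_smul c v).le }
  have hn : IsFormNorm g := fun v => rfl
  have _ := hn.isBoundedSMul ρ hg
  obtain ⟨C, hC, hCle⟩ := hn.isBounded ρ hc
  exact ⟨continuous_pi fun i => AddMonoidHomClass.continuous_of_bound (F.f i) C (hCle i),
    continuous_finsetSum _ fun i _ => (continuous_apply i).smul continuous_const⟩

include ρ in
theorem Metric.exists_chart (hs : s.IsModelledOnStar) (g : Metric s E) (x₀ : X) :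
    Nonempty (MetricChart g x₀) := by
  obtain ⟨V, hV, hVo, hxV, M, _, _, tM, hM, e, he, htriv⟩ := E.locallyTrivial x₀
  obtain ⟨F, hf, hsum⟩ := hM.exists_frame
  let _ := realModule A M
  have _ := realModule_isScalarTower A M
  set g₀ := transportForm (𝒜.chart x₀ ⟨x₀, hV hxV⟩) (e ⟨x₀, hxV⟩) (he ⟨x₀, hxV⟩) (g.form x₀)
    with hg₀
  have hp : IsPosForm g₀ := transportForm_isPosFormAt hs ⟨x₀, hV hxV⟩ _ _ (g.isPosFormAt x₀)
  have hb : Function.Bijective g₀ := transportForm_bijective _ _ _ (g.bijective x₀)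
  have hc := hp.isCoercive ρ F hb.2
  obtain ⟨hfN, hsN⟩ := hc.continuous_frame ρ hp
  -- The identity factors through the product of copies of A by maps continuous for either topology,
  -- so the given topology and the norm topology agree.
  have hid : (id : M → M) = (fun a : F.ι → A => ∑ i, a i • F.e i) ∘ fun v i => F.f i v :=
    funext fun v => (F.sum_eq v).symm
  have htop : tM = (@NormedAddCommGroup.ofCore ℝ M _ _ _ (formNorm g₀)
      (hc.normCore hp)).toPseudoMetricSpace.toUniformSpace.toTopologicalSpace := by
    refine le_antisymm (continuous_id_iff_le.1 ?_) (continuous_id_iff_le.1 ?_)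
    · rw [hid]
      exact @Continuous.comp _ _ _ tM _ (@NormedAddCommGroup.ofCore ℝ M _ _ _ (formNorm g₀)
        (hc.normCore hp)).toPseudoMetricSpace.toUniformSpace.toTopologicalSpace _ _ hsN
        (continuous_pi hf)
    · rw [hid]
      exact @Continuous.comp _ _ _ (@NormedAddCommGroup.ofCore ℝ M _ _ _ (formNorm g₀)
        (hc.normCore hp)).toPseudoMetricSpace.toUniformSpace.toTopologicalSpace _ tM _ _ hsum
        hfN
  let _ := formNorm g₀
  -- The norm is installed on top of the existing topology, so that the trivialization remains a
  -- homeomorphism without transport.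
  let _ : NormedAddCommGroup M := NormedAddCommGroup.ofCoreReplaceTopology (hc.normCore hp) htop
  let _ : NormedSpace ℝ M :=
    { (inferInstance : Module ℝ M) with
      norm_smul_le := fun c v => ((hc.normCore hp).norm_smul c v).le }
  have hn : IsFormNorm g₀ := fun v => rfl
  have _ := hn.isBoundedSMul ρ hp
  have hF := hn.isBounded ρ hc
  exact ⟨{ V := V, hV := hV, isOpen := hVo, mem := hxV, M := M, tower := inferInstance,
           boundedSMul := hn.isBoundedSMul ρ hp, complete := hF.completeSpace, F := F,
           isBounded := hF, e := e, e_smul := he, triv := htriv, isFormNorm := hn }⟩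

end Exists

namespace MetricChart

variable {g : Metric s E} {g' : Metric s E'} {x₀ : X} (C : MetricChart g x₀)
  (C' : MetricChart g' x₀)

theorem eventually_mem : ∀ᶠ x in 𝓝 x₀, x ∈ C.V := C.isOpen.mem_nhds C.mem

theorem e_symm_smul (x : C.V) (a : A) (m : C.M) :
    (C.e x).symm (a • m) = (𝒜.chart x₀ ⟨x, C.hV x.2⟩).symm a • (C.e x).symm m :=
  symm_smul_of_semilinear _ _ (C.e_smul x) a m

/-- The family `φ` in the charts, at the point `x`. -/
def opLin (φ : ∀ x, E.Fib x →ₗ[𝒜.Fib x] E'.Fib x) (x : X) (hx : x ∈ C.V) (hx' : x ∈ C'.V) :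
    C.M →ₗ[A] C'.M where
  toFun := fun m => C'.e ⟨x, hx'⟩ (φ x ((C.e ⟨x, hx⟩).symm m))
  map_add' := fun m m' => by rw [map_add, map_add, map_add]
  map_smul' := fun a m => by
    rw [C.e_symm_smul, map_smul, C'.e_smul, AlgEquiv.apply_symm_apply]
    rfl

open Classical in
/-- The family `φ` in the charts, as a family of bounded operators (zero outside of the charts). -/
def op (φ : ∀ x, E.Fib x →ₗ[𝒜.Fib x] E'.Fib x) (x : X) : C.M →L[ℝ] C'.M :=
  if h : x ∈ C.V ∧ x ∈ C'.V then C.isBounded.toCLM (C.opLin C' φ x h.1 h.2) else 0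

theorem op_apply (φ : ∀ x, E.Fib x →ₗ[𝒜.Fib x] E'.Fib x) {x : X} (hx : x ∈ C.V) (hx' : x ∈ C'.V)
    (m : C.M) : C.op C' φ x m = C'.e ⟨x, hx'⟩ (φ x ((C.e ⟨x, hx⟩).symm m)) := by
  rw [op, dif_pos ⟨hx, hx'⟩]
  rfl

theorem op_smul (φ : ∀ x, E.Fib x →ₗ[𝒜.Fib x] E'.Fib x) (x : X) (a : A) (m : C.M) :
    C.op C' φ x (a • m) = a • C.op C' φ x m := by
  rw [op]
  split_ifs with h
  · exact map_smul (C.opLin C' φ x h.1 h.2) a m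
  · simp

/-- An A-linear family is determined by finitely many frame vectors, so pointwise continuity there
upgrades to continuity in operator norm. -/
theorem continuousAt_op_of_mem {φ : ∀ x, E.Fib x →ₗ[𝒜.Fib x] E'.Fib x} (hφ : IsContMap φ) {x : X}
    (hx : x ∈ C.V) (hx' : x ∈ C'.V) : ContinuousAt (C.op C' φ) x := by
  refine C.isBounded.continuousAt (C.op_smul C' φ) fun i => ?_
  refine ContinuousOn.continuousAt (s := C.V ∩ C'.V) ?_
    ((C.isOpen.inter C'.isOpen).mem_nhds ⟨hx, hx'⟩)
  rw [continuousOn_iff_continuous_domRestrict]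
  have h1 := C.triv.continuous_mk (π := fun x : ↥(C.V ∩ C'.V) => (⟨x, x.2.1⟩ : C.V))
    (continuous_subtype_val.subtype_mk _) (continuous_const (y := C.F.e i))
  refine (C'.triv.continuous_coord (hφ.comp_continuous h1) fun x => x.2.2).congr fun x => ?_
  exact (C.op_apply C' φ x.2.1 x.2.2 (C.F.e i)).symm

theorem continuousAt_op {φ : ∀ x, E.Fib x →ₗ[𝒜.Fib x] E'.Fib x} (hφ : IsContMap φ) :
    ContinuousAt (C.op C' φ) x₀ :=
  C.continuousAt_op_of_mem C' hφ C.mem C'.mem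

/-- The converse passage: on the common domain φ is the operator in the charts composed with the two
trivializations, and evaluation of bounded operators is jointly continuous. -/
theorem continuousAt_of_op {φ : ∀ x, E.Fib x →ₗ[𝒜.Fib x] E'.Fib x}
    (h : ContinuousAt (C.op C' φ) x₀) {p : Tot E.Fib} (hp : p.proj = x₀) :
    ContinuousAt (fun p : Tot E.Fib => (⟨p.proj, φ p.proj p.snd⟩ : Tot E'.Fib)) p := by
  have hWo : IsOpen {p : Tot E.Fib | p.proj ∈ C.V ∩ C'.V} :=
    (C.isOpen.inter C'.isOpen).preimage E.continuous_proj
  have hpW : p ∈ {p : Tot E.Fib | p.proj ∈ C.V ∩ C'.V} := by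
    change p.proj ∈ C.V ∩ C'.V
    rw [hp]; exact ⟨C.mem, C'.mem⟩
  refine (hWo.isOpenEmbedding_subtypeVal.continuousAt_iff
    (g := fun p : Tot E.Fib => (⟨p.proj, φ p.proj p.snd⟩ : Tot E'.Fib)) (x := ⟨p, hpW⟩)).1 ?_
  have hπ : Continuous fun z : {p : Tot E.Fib | p.proj ∈ C.V ∩ C'.V} => z.1.proj :=
    E.continuous_proj.comp continuous_subtype_val
  have h1 : Continuous fun z : {p : Tot E.Fib | p.proj ∈ C.V ∩ C'.V} =>
      C.e ⟨z.1.proj, z.2.1⟩ z.1.snd :=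
    C.triv.continuous_coord continuous_subtype_val fun z => z.2.1
  have h2 : ContinuousAt (fun z : {p : Tot E.Fib | p.proj ∈ C.V ∩ C'.V} =>
      C.op C' φ z.1.proj) ⟨p, hpW⟩ :=
    ContinuousAt.comp (f := fun z : {p : Tot E.Fib | p.proj ∈ C.V ∩ C'.V} => z.1.proj)
      (g := C.op C' φ) (x := ⟨p, hpW⟩) (by change ContinuousAt _ p.proj; rw [hp]; exact h) hπ.continuousAt
  have h3 := h2.clm_apply h1.continuousAt
  have h4 : Continuous fun z : {p : Tot E.Fib | p.proj ∈ C.V ∩ C'.V} =>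
      (⟨z.1.proj, z.2.2⟩ : C'.V) := hπ.subtype_mk _
  refine (C'.triv.2.continuousAt.comp (h4.continuousAt.prodMk h3)).congr
    (Eventually.of_forall fun z => ?_)
  refine congrArg (fun v => (⟨z.1.proj, v⟩ : Tot E'.Fib)) ?_
  change (C'.e ⟨z.1.proj, z.2.2⟩).symm (C.op C' φ z.1.proj (C.e ⟨z.1.proj, z.2.1⟩ z.1.snd)) = _
  rw [C.op_apply C' φ z.2.1 z.2.2, AddEquiv.symm_apply_apply, AddEquiv.symm_apply_apply]

open Classical in
/-- The form `b` in the chart. -/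
def fm (b : HForm s E) (x : X) : C.M →+ (C.M →ₗ[A] A) :=
  if hx : x ∈ C.V then
    transportForm (𝒜.chart x₀ ⟨x, C.hV hx⟩) (C.e ⟨x, hx⟩) (C.e_smul ⟨x, hx⟩) (b.form x)
  else 0

theorem fm_eq (b : HForm s E) {x : X} (hx : x ∈ C.V) : C.fm b x =
    transportForm (𝒜.chart x₀ ⟨x, C.hV hx⟩) (C.e ⟨x, hx⟩) (C.e_smul ⟨x, hx⟩) (b.form x) :=
  dif_pos hx

theorem fm_apply (b : HForm s E) {x : X} (hx : x ∈ C.V) (v w : C.M) : C.fm b x v w =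
    𝒜.chart x₀ ⟨x, C.hV hx⟩ (b.form x ((C.e ⟨x, hx⟩).symm v) ((C.e ⟨x, hx⟩).symm w)) := by
  rw [C.fm_eq b hx]
  rfl

theorem continuousAt_fm (b : HForm s E) (v w : C.M) :
    ContinuousAt (fun x => C.fm b x v w) x₀ := by
  refine ContinuousOn.continuousAt (s := C.V) ?_ C.eventually_mem
  rw [continuousOn_iff_continuous_domRestrict]
  have h : ∀ v : C.M, Continuous fun x : C.V => (⟨x, (C.e x).symm v⟩ : Tot E.Fib) := fun v =>
    C.triv.continuous_mk continuous_id continuous_const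
  refine ((𝒜.chart_triv x₀).continuous_coord (b.continuous_apply (h v) (h w))
    fun x => C.hV x.2).congr fun x => ?_
  exact (C.fm_apply b x.2 v w).symm

variable [StarRing A]

/-- The form is extended by zero outside of the chart and stays hermitian there, so representing
operators can be formed at every x without a membership proof. -/
theorem fm_isHerm (hs : s.IsModelledOnStar) (b : HForm s E) (x : X) : IsHerm (C.fm b x) := by
  by_cases hx : x ∈ C.V
  · intro v w
    rw [C.fm_apply b hx, C.fm_apply b hx, b.herm, hs]
  · rw [fm, dif_neg hx]
    intro v w
    exact (star_zero A).symm

theorem fm_isPosForm (hs : s.IsModelledOnStar) (h : Metric s E) {x : X} (hx : x ∈ C.V) :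
    IsPosForm (C.fm h.toHForm x) := by
  rw [C.fm_eq _ hx]
  exact transportForm_isPosFormAt hs ⟨x, C.hV hx⟩ _ _ (h.isPosFormAt x)

omit [StarRing A] in
theorem fm_bijective (h : Metric s E) {x : X} (hx : x ∈ C.V) :
    Function.Bijective (C.fm h.toHForm x) := by
  rw [C.fm_eq _ hx]
  exact transportForm_bijective _ _ _ (h.bijective x)

omit [StarRing A] in
theorem isFormNorm_fm : IsFormNorm (C.fm g.toHForm x₀) := by
  rw [C.fm_eq _ C.mem]
  exact C.isFormNorm

end MetricChart

end Chart

/-! ### The operator of a form -/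

section FormOp

variable {A M : Type*} [Ring A] [StarRing A] [AddCommGroup M] [Module A M]

/-- The operator `T` such that `g(Tv, w) = b(v, w)`. -/
def formOp {g b : M →+ (M →ₗ[A] A)} (hg : IsHerm g) (hgb : Function.Bijective g)
    (hb : IsHerm b) : M →ₗ[A] M where
  toFun := fun v => (AddEquiv.ofBijective g hgb).symm (b v)
  map_add' := fun v w => by rw [map_add, map_add]
  map_smul' := fun a v => by
    rw [AddEquiv.symm_apply_eq]
    refine LinearMap.ext fun w => ?_
    change _ = g (a • _) w
    rw [hb.smul_left, hg.smul_left]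
    congr 1
    exact LinearMap.congr_fun ((AddEquiv.ofBijective g hgb).apply_symm_apply (b v)).symm w

theorem formOp_spec {g b : M →+ (M →ₗ[A] A)} (hg : IsHerm g) (hgb : Function.Bijective g)
    (hb : IsHerm b) (v : M) : g (formOp hg hgb hb v) = b v :=
  (AddEquiv.ofBijective g hgb).apply_symm_apply (b v)

theorem formOp_bijective {g b : M →+ (M →ₗ[A] A)} (hg : IsHerm g) (hgb : Function.Bijective g)
    (hb : IsHerm b) (hbb : Function.Bijective b) : Function.Bijective (formOp hg hgb hb) :=
  (AddEquiv.ofBijective g hgb).symm.bijective.comp hbb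

/-- Only the coefficients involve b; the vectors depend on g alone. So for fixed g the operator
varies continuously with b. -/
theorem formOp_eq {g b : M →+ (M →ₗ[A] A)} (hg : IsHerm g) (hgb : Function.Bijective g)
    (hb : IsHerm b) (F : Frame A M) (v : M) : formOp hg hgb hb v =
      ∑ i, b (F.e i) v • (AddEquiv.ofBijective g hgb).symm (F.f i) := by
  refine hgb.1 (LinearMap.ext fun w => ?_)
  rw [formOp_spec, hg.sum_left, F.map_eq (b v) w]
  refine Finset.sum_congr rfl fun i _ => ?_
  have h : g ((AddEquiv.ofBijective g hgb).symm (F.f i)) = F.f i :=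
    (AddEquiv.ofBijective g hgb).apply_symm_apply (F.f i)
  rw [h, ← hb, smul_eq_mul]

end FormOp

theorem eventually_norm_one_sub_lt {M Z : Type*} [NormedAddCommGroup M] [NormedSpace ℝ M]
    [TopologicalSpace Z] {Φ : Z → M →L[ℝ] M} {z₀ : Z} (h : ContinuousAt Φ z₀) {c : ℝ}
    (hlt : ‖1 - c⁻¹ • Φ z₀‖ < 1) : ∀ᶠ z in 𝓝 z₀, ‖1 - c⁻¹ • Φ z‖ < 1 := by
  have h : ContinuousAt (fun z => ‖1 - c⁻¹ • Φ z‖) z₀ := by fun_prop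
  exact h.eventually (gt_mem_nhds hlt)

/-! ### Continuity of inverses, representing operators and square roots over the base. -/

section Bundle

variable {X : Type w} [TopologicalSpace X] [MulAction C2 X] {A : Type u} [NormedRing A]
  [NormedAlgebra ℝ A] [CompleteSpace A] [StarRing A] {𝒜 : GAlgBundle C2 X A}
  {s : AntiInvolution 𝒜} {E E' : GBundle 𝒜}
  {H : Type*} [NormedAddCommGroup H] [InnerProductSpace ℝ H] [CompleteSpace H] (ρ : StarRep A H)

section
include ρ

/-- The inverse of a continuous family of bijections is continuous. -/
theorem Metric.isContMap_symm (hs : s.IsModelledOnStar) (g : Metric s E) (g' : Metric s E')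
    {φ : ∀ x, E.Fib x ≃ₗ[𝒜.Fib x] E'.Fib x} (hφ : IsContMap fun x => (φ x).toLinearMap) :
    IsContMap fun x => (φ x).symm.toLinearMap := by
  refine continuous_iff_continuousAt.2 fun p => ?_
  obtain ⟨C⟩ := g.exists_chart ρ hs p.proj
  obtain ⟨C'⟩ := g'.exists_chart ρ hs p.proj
  refine C'.continuousAt_of_op C (φ := fun x => (φ x).symm.toLinearMap) ?_ rfl
  have h1 : ∀ x (_ : x ∈ C.V) (_ : x ∈ C'.V) (m : C.M),
      C'.op C (fun x => (φ x).symm.toLinearMap) x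
        (C.op C' (fun x => (φ x).toLinearMap) x m) = m := fun x hx hx' m => by
    rw [C'.op_apply C _ hx' hx, C.op_apply C' _ hx hx', AddEquiv.symm_apply_apply]
    change C.e ⟨x, hx⟩ ((φ x).symm (φ x _)) = m
    rw [LinearEquiv.symm_apply_apply, AddEquiv.apply_symm_apply]
  have h2 : ∀ x (_ : x ∈ C.V) (_ : x ∈ C'.V) (m : C'.M),
      C.op C' (fun x => (φ x).toLinearMap) x
        (C'.op C (fun x => (φ x).symm.toLinearMap) x m) = m := fun x hx hx' m => by
    rw [C'.op_apply C _ hx' hx, C.op_apply C' _ hx hx', AddEquiv.symm_apply_apply]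
    change C'.e ⟨x, hx'⟩ (φ x ((φ x).symm _)) = m
    rw [LinearEquiv.apply_symm_apply, AddEquiv.apply_symm_apply]
  let L : C.M ≃L[ℝ] C'.M := ContinuousLinearEquiv.equivOfInverse
    (C.op C' (fun x => (φ x).toLinearMap) p.proj)
    (C'.op C (fun x => (φ x).symm.toLinearMap) p.proj)
    (h1 _ C.mem C'.mem) (h2 _ C.mem C'.mem)
  have hL : (L : C.M →L[ℝ] C'.M) = C.op C' (fun x => (φ x).toLinearMap) p.proj := rfl
  -- Inversion is continuous at an invertible operator between Banach spaces; near the point the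
  -- inverse operator is the chart expression of the fibrewise inverses.
  have hcont : ContinuousAt (ContinuousLinearMap.inverse : (C.M →L[ℝ] C'.M) → _)
      (C.op C' (fun x => (φ x).toLinearMap) p.proj) := by
    rw [← hL]
    exact (contDiffAt_map_inverse (n := 0) L).continuousAt
  refine (ContinuousAt.comp (f := C.op C' fun x => (φ x).toLinearMap) hcont
    (C.continuousAt_op C' hφ)).congr ?_
  filter_upwards [C.eventually_mem, C'.eventually_mem] with x hx hx'
  exact ContinuousLinearMap.inverse_eq (ContinuousLinearMap.ext (h2 x hx hx'))
    (ContinuousLinearMap.ext (h1 x hx hx'))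

end

/-- The operators `T` such that `g(Tv, w) = b(v, w)`. -/
def Metric.op (g : Metric s E) (b : HForm s E) (x : X) : E.Fib x →ₗ[𝒜.Fib x] E.Fib x :=
  letI := s.starRing x
  formOp (g.herm x) (g.bijective x) (b.herm x)

omit [CompleteSpace A] [StarRing A] in
theorem Metric.op_spec (g : Metric s E) (b : HForm s E) (x : X) (v : E.Fib x) :
    g.form x (g.op b x v) = b.form x v :=
  letI := s.starRing x
  formOp_spec (g.herm x) (g.bijective x) (b.herm x) v

omit [CompleteSpace A] [StarRing A] in
theorem Metric.op_bijective (g : Metric s E) (b : HForm s E)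
    (hb : ∀ x, Function.Bijective (b.form x)) (x : X) : Function.Bijective (g.op b x) :=
  letI := s.starRing x
  formOp_bijective (g.herm x) (g.bijective x) (b.herm x) (hb x)

include ρ in
-- The metric varies with the point as well as b. Both are represented relative to the one fixed
-- form g at the centre of the chart, giving continuous operators G and N with G the identity at the
-- centre; the sought operator is G⁻¹N nearby.
theorem Metric.isContMap_op (hs : s.IsModelledOnStar) (g : Metric s E) (b : HForm s E) :
    IsContMap (g.op b) := by
  refine continuous_iff_continuousAt.2 fun p => ?_
  obtain ⟨C⟩ := g.exists_chart ρ hs p.proj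
  refine C.continuousAt_of_op C ?_ rfl
  have h0 := C.fm_isHerm hs g.toHForm p.proj
  have h0b := C.fm_bijective g C.mem
  let Op : HForm s E → X → (C.M →L[ℝ] C.M) := fun c x =>
    C.isBounded.toCLM (formOp h0 h0b (C.fm_isHerm hs c x))
  have hOp : ∀ c x v, C.fm g.toHForm p.proj (Op c x v) = C.fm c x v := fun c x v =>
    formOp_spec h0 h0b (C.fm_isHerm hs c x) v
  have hcont : ∀ c, ContinuousAt (Op c) p.proj := fun c => by
    refine C.isBounded.continuousAt (fun x a v => map_smul (formOp h0 h0b (C.fm_isHerm hs c x)) a v)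
      fun i => ?_
    change ContinuousAt (fun x => formOp h0 h0b (C.fm_isHerm hs c x) (C.F.e i)) p.proj
    simp only [formOp_eq _ _ _ C.F]
    exact tendsto_finsetSum _ fun j _ => (C.continuousAt_fm c _ _).smul continuousAt_const
  have hone : Op g.toHForm p.proj = 1 :=
    ContinuousLinearMap.ext fun v => h0b.1 (hOp _ _ v)
  have hmul : ∀ x, x ∈ C.V → Op g.toHForm x * C.op C (g.op b) x = Op b x := fun x hx => by
    refine ContinuousLinearMap.ext fun v => h0b.1 ?_
    rw [hOp]
    change C.fm g.toHForm p.proj (Op g.toHForm x _) = _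
    rw [hOp]
    refine LinearMap.ext fun w => ?_
    change C.fm g.toHForm x (C.op C (g.op b) x v) w = _
    rw [C.fm_apply _ hx, C.fm_apply _ hx, C.op_apply C _ hx hx, AddEquiv.symm_apply_apply,
      g.op_spec]
  have hinv : ContinuousAt (fun x => Ring.inverse (Op g.toHForm x) * Op b x) p.proj := by
    refine ContinuousAt.mul ?_ (hcont b)
    have h1 : ContinuousAt Ring.inverse (Op g.toHForm p.proj) := by
      rw [hone]
      exact NormedRing.inverse_continuousAt (1 : (C.M →L[ℝ] C.M)ˣ)
    exact ContinuousAt.comp (f := Op g.toHForm) h1 (hcont g.toHForm)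
  have hunit : ∀ᶠ x in 𝓝 p.proj, IsUnit (Op g.toHForm x) := by
    refine (hcont g.toHForm).eventually (Units.isOpen.mem_nhds ?_)
    rw [hone]
    exact isUnit_one
  refine hinv.congr ?_
  filter_upwards [hunit, C.eventually_mem] with x hu hx
  rw [← hmul x hx, Ring.inverse_mul_cancel_left _ _ hu]

omit [CompleteSpace A] in
theorem MetricChart.opLin_isPosEndo (hs : s.IsModelledOnStar) {g : Metric s E} {x₀ : X}
    (C : MetricChart g x₀) (Z : ∀ x, E.Fib x →ₗ[𝒜.Fib x] E.Fib x) {x : X} (hx : x ∈ C.V)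
    (hZ : IsPosEndoAt s x (g.form x) (Z x)) :
    IsPosEndo (C.fm g.toHForm x) (C.opLin C Z x hx hx) := by
  obtain ⟨hsym, hnn⟩ := hZ
  have hap : ∀ m, (C.e ⟨x, hx⟩).symm (C.opLin C Z x hx hx m) = Z x ((C.e ⟨x, hx⟩).symm m) :=
    fun m => AddEquiv.symm_apply_apply _ _
  refine ⟨fun v w => ?_, fun v => ?_⟩
  · rw [C.fm_apply _ hx, C.fm_apply _ hx, hap, hap]
    exact congrArg _ (hsym _ _)
  · obtain ⟨c, hc⟩ := hnn ((C.e ⟨x, hx⟩).symm v)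
    refine ⟨𝒜.chart x₀ ⟨x, C.hV hx⟩ c, ?_⟩
    rw [C.fm_apply _ hx, hap, hc, map_mul]
    exact congrArg _ (hs _ _ _)

include ρ in
/-- The square root of a continuous family of invertible positive operators. -/
theorem Metric.exists_sqrt (hs : s.IsModelledOnStar) (g : Metric s E)
    {S : ∀ x, E.Fib x →ₗ[𝒜.Fib x] E.Fib x} (hc : IsContMap S)
    (hS : ∀ x, IsPosEndoAt s x (g.form x) (S x)) (hb : ∀ x, Function.Bijective (S x)) :
    ∃ Y : ∀ x, E.Fib x →ₗ[𝒜.Fib x] E.Fib x, IsContMap Y ∧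
      ∀ x, (IsPosEndoAt s x (g.form x) (Y x) ∧ ∀ v, Y x (Y x v) = S x v) ∧
        ∀ Z : E.Fib x →ₗ[𝒜.Fib x] E.Fib x, IsPosEndoAt s x (g.form x) Z →
          (∀ v, Z (Z v) = S x v) → Z = Y x := by
  have hex : ∀ x, ∃ Y : E.Fib x →ₗ[𝒜.Fib x] E.Fib x,
      (IsPosEndoAt s x (g.form x) Y ∧ ∀ v, Y (Y v) = S x v) ∧
        ∀ Z : E.Fib x →ₗ[𝒜.Fib x] E.Fib x, IsPosEndoAt s x (g.form x) Z →
          (∀ v, Z (Z v) = S x v) → Z = Y := fun x =>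
    (E.exists_frame x).elim fun F =>
      IsPosEndoAt.exists_sqrt hs ρ x F (g.isPosFormAt x) (g.bijective x).2 (hS x) (hb x)
  choose Y hY hYu using hex
  refine ⟨Y, ?_, fun x => ⟨hY x, hYu x⟩⟩
  refine continuous_iff_continuousAt.2 fun p => ?_
  obtain ⟨C⟩ := g.exists_chart ρ hs p.proj
  refine C.continuousAt_of_op C ?_ rfl
  have hpos := fun (Z : ∀ x, E.Fib x →ₗ[𝒜.Fib x] E.Fib x) x hx => C.opLin_isPosEndo hs Z (x := x) hx
  have hbij : ∀ x (hx : x ∈ C.V), Function.Bijective (C.opLin C S x hx hx) := fun x hx =>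
    (C.e ⟨x, hx⟩).bijective.comp ((hb x).comp (C.e ⟨x, hx⟩).symm.bijective)
  have hpf := fun x (hx : x ∈ C.V) => C.fm_isPosForm hs g hx
  have hfb := fun x (hx : x ∈ C.V) => C.fm_bijective g hx
  have hop : ∀ (Z : ∀ x, E.Fib x →ₗ[𝒜.Fib x] E.Fib x) x (hx : x ∈ C.V) v,
      C.op C Z x v = C.opLin C Z x hx hx v := fun Z x hx v => C.op_apply C Z hx hx v
  -- The scaling constant is chosen at the centre. The strict inequality persists nearby, so one
  -- formula for the root applies on a neighbourhood.
  obtain ⟨c, hc0, hlt⟩ := (hpos S _ C.mem (hS _)).exists_norm_one_sub_lt ρ C.F C.isFormNorm_fm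
    (hpf _ C.mem) (hfb _ C.mem).2 (hbij _ C.mem).2 (hop S _ C.mem)
  have hSc := C.continuousAt_op C hc
  have hev := eventually_norm_one_sub_lt hSc hlt
  refine (ContinuousAt.comp (f := C.op C S) (continuousAt_posSqrt hlt) hSc).congr ?_
  filter_upwards [hev, C.eventually_mem] with x hx hxV
  obtain ⟨Y₁, -, hu⟩ := (hpos S x hxV (hS x)).exists_sqrt ρ C.F (hpf x hxV) (hfb x hxV).2
    (hbij x hxV)
  have hsym : ∀ v w, C.fm g.toHForm x (C.op C S x v) w = C.fm g.toHForm x v (C.op C S x w) :=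
    fun v w => by rw [hop S x hxV, hop S x hxV]; exact (hpos S x hxV (hS x)).sym v w
  obtain ⟨h1, h2⟩ := posSqrt_isPos ρ (hpf x hxV)
    ((hpf x hxV).herm.isSepContinuous ρ C.isBounded) hx.le hsym
  let Z : C.M →ₗ[A] C.M :=
    { toFun := posSqrt c (C.op C S x)
      map_add' := map_add _
      map_smul' := posSqrt_map_smul hx.le (C.op_smul C S x) }
  -- Uniqueness of the positive root identifies the norm-continuous formula with the fibrewise
  -- chosen Y, although the norm comes from the metric at the centre and positivity refers to the
  -- metric at x.
  have hZ : Z = Y₁ := hu Z ⟨h1, h2⟩ fun v =>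
    (congrArg (fun T : C.M →L[ℝ] C.M => T v) (posSqrt_mul_self hc0 hx.le)).trans (hop S x hxV v)
  have hYx : C.opLin C Y x hxV hxV = Y₁ := hu _ (hpos Y x hxV (hY x).1) fun v => by
    change C.e ⟨x, hxV⟩ (Y x ((C.e ⟨x, hxV⟩).symm (C.e ⟨x, hxV⟩ _))) = C.e ⟨x, hxV⟩ (S x _)
    rw [AddEquiv.symm_apply_apply, (hY x).2]
  refine ContinuousLinearMap.ext fun v => ?_
  rw [hop Y x hxV, hYx, ← hZ]
  rfl

end Bundle

/-! ### The image of a projection -/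

section Image

variable {X : Type w} [TopologicalSpace X] [MulAction C2 X] {A : Type u} [NormedRing A]
  [NormedAlgebra ℝ A] {𝒜 : GAlgBundle C2 X A} {s : AntiInvolution 𝒜} {E : GBundle 𝒜}

/-- A continuous equivariant family of projections. -/
structure IsProj (e : ∀ x, E.Fib x →ₗ[𝒜.Fib x] E.Fib x) : Prop where
  cont : IsContMap e
  idem : ∀ x v, e x (e x v) = e x v
  map_act : ∀ g x v, e (g • x) (E.act g x v) = E.act g x (e x v)

/-- The total space of the image, as a subspace. -/
instance imageTop (e : ∀ x, E.Fib x →ₗ[𝒜.Fib x] E.Fib x) :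
    TopologicalSpace (Tot fun x => LinearMap.range (e x)) :=
  TopologicalSpace.induced
    (fun p : Tot fun x => LinearMap.range (e x) => (⟨p.proj, p.snd.1⟩ : Tot E.Fib)) inferInstance

theorem isEmbedding_image (e : ∀ x, E.Fib x →ₗ[𝒜.Fib x] E.Fib x) :
    IsEmbedding (fun p : Tot fun x => LinearMap.range (e x) => (⟨p.proj, p.snd.1⟩ : Tot E.Fib)) :=
  ⟨⟨rfl⟩, by
    rintro ⟨x, v⟩ ⟨y, w⟩ h
    obtain rfl : x = y := congrArg Bundle.TotalSpace.proj h
    exact congrArg _ (Subtype.ext (Bundle.TotalSpace.mk_inj.1 h))⟩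

section LocTriv

variable [CompleteSpace A] [StarRing A] {H : Type*} [NormedAddCommGroup H] [InnerProductSpace ℝ H]
  [CompleteSpace H] (ρ : StarRep A H)

omit [NormedAlgebra ℝ A] [CompleteSpace A] [StarRing A] in
-- A retract of a retract of A^n, with the frame coordinates as inclusion and e after synthesis as
-- retraction.
theorem isFGProjective_range {M : Type u} [NormedAddCommGroup M] [NormedSpace ℝ M] [Module A M]
    [IsBoundedSMul A M] {F : Frame A M} (hF : F.IsBounded) {e : M →ₗ[A] M} (he : Continuous e)
    (hee : ∀ v, e (e v) = e v) : IsFGProjective A (LinearMap.range e) := by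
  obtain ⟨C, hC, hCle⟩ := hF
  let r : (F.ι → A) →ₗ[A] M :=
    { toFun := fun a => ∑ i, a i • F.e i
      map_add' := fun a b => by simp only [Pi.add_apply, add_smul, Finset.sum_add_distrib]
      map_smul' := fun c a => by
        simp only [Pi.smul_apply, smul_assoc, Finset.smul_sum, RingHom.id_apply] }
  refine ⟨F.ι, inferInstance,
    ⟨LinearMap.pi fun i => (F.f i).comp (LinearMap.range e).subtype, continuous_pi fun i =>
      (AddMonoidHomClass.continuous_of_bound (F.f i) C (hCle i)).comp continuous_subtype_val⟩,
    ⟨e.rangeRestrict.comp r,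
      Continuous.subtype_mk (he.comp (continuous_finsetSum _ fun i _ =>
        (continuous_apply i).smul continuous_const)) _⟩, ?_⟩
  rintro ⟨_, v, rfl⟩
  refine Subtype.ext ?_
  change e (∑ i, F.f i (e v) • F.e i) = e v
  rw [F.sum_eq, hee]

include ρ in
-- Norm-close projections are conjugate: near x₀ an invertible operator carries the image of P(x)
-- onto the image of P(x₀).
theorem IsProj.isLocallyTrivial (hs : s.IsModelledOnStar) (g : Metric s E)
    {e : ∀ x, E.Fib x →ₗ[𝒜.Fib x] E.Fib x} (he : IsProj e) :
    IsLocallyTrivial 𝒜 fun x => LinearMap.range (e x) := by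
  intro x₀
  obtain ⟨C⟩ := g.exists_chart ρ hs x₀
  set P : X → C.M →L[ℝ] C.M := C.op C e with hP
  have hPP : ∀ x ∈ C.V, P x * P x = P x := fun x hx => ContinuousLinearMap.ext fun m => by
    change P x (P x m) = P x m
    rw [hP, C.op_apply C e hx hx, C.op_apply C e hx hx, AddEquiv.symm_apply_apply, he.idem]
  have hPe : ∀ x (hx : x ∈ C.V) (v : E.Fib x), P x (C.e ⟨x, hx⟩ v) = C.e ⟨x, hx⟩ (e x v) :=
    fun x hx v => by
      rw [hP, C.op_apply C e hx hx, AddEquiv.symm_apply_apply]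
  have hPc : ∀ x ∈ C.V, ContinuousAt P x := fun x hx => C.continuousAt_op_of_mem C he.cont hx hx
  -- This operator equals 1 at x₀ and satisfies u(x)P(x) = P(x₀)P(x) = P(x₀)u(x). Where it is
  -- invertible it conjugates P(x) to P(x₀).
  set u : X → C.M →L[ℝ] C.M := fun x => P x₀ * P x + (1 - P x₀) * (1 - P x) with hu
  have huc : ∀ x ∈ C.V, ContinuousAt u x := fun x hx =>
    (continuousAt_const.mul (hPc x hx)).add
      (continuousAt_const.mul (continuousAt_const.sub (hPc x hx)))
  have hu1 : u x₀ = 1 := by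
    have := hPP x₀ C.mem
    change P x₀ * P x₀ + (1 - P x₀) * (1 - P x₀) = 1
    rw [(show IsIdempotentElem (P x₀) from this).one_sub.eq, this, add_sub_cancel]
  have huP : ∀ x ∈ C.V, u x * P x = P x₀ * P x := fun x hx => by
    change (P x₀ * P x + (1 - P x₀) * (1 - P x)) * P x = _
    rw [add_mul, mul_assoc, mul_assoc, hPP x hx, sub_mul 1 (P x), hPP x hx, one_mul, sub_self,
      mul_zero, add_zero]
  have hPu : ∀ x, P x₀ * u x = P x₀ * P x := fun x => by
    change P x₀ * (P x₀ * P x + (1 - P x₀) * (1 - P x)) = _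
    rw [mul_add, ← mul_assoc, ← mul_assoc, hPP x₀ C.mem, mul_sub (P x₀), hPP x₀ C.mem, mul_one,
      sub_self, zero_mul, add_zero]
  have hVo : IsOpen {x | x ∈ C.V ∧ IsUnit (u x)} := by
    refine isOpen_iff_mem_nhds.2 fun x hx => ?_
    filter_upwards [C.isOpen.mem_nhds hx.1, (huc x hx.1).eventually (Units.isOpen.mem_nhds hx.2)]
      with y h1 h2 using ⟨h1, h2⟩
  set V : Set X := {x | x ∈ C.V ∧ IsUnit (u x)} with hV
  set w : X → C.M →L[ℝ] C.M := fun x => Ring.inverse (u x) with hw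
  have huw : ∀ x : V, ∀ m, u x (w x m) = m := fun x m =>
    congrArg (fun T : C.M →L[ℝ] C.M => T m) (Ring.mul_inverse_cancel _ x.2.2)
  have hwu : ∀ x : V, ∀ m, w x (u x m) = m := fun x m =>
    congrArg (fun T : C.M →L[ℝ] C.M => T m) (Ring.inverse_mul_cancel _ x.2.2)
  have hwP : ∀ x : V, ∀ m, w x (P x₀ m) = P x (w x m) := fun x m => by
    have h1 : P x₀ (u x (w x m)) = u x (P x (w x m)) :=
      congrArg (fun T : C.M →L[ℝ] C.M => T (w x m)) ((hPu x).trans (huP x x.2.1).symm)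
    rw [huw] at h1
    rw [h1, hwu]
  have hwc : Continuous fun x : V => w x := continuous_iff_continuousAt.2 fun x => by
    obtain ⟨U, hU⟩ := x.2.2
    have h1 : ContinuousAt Ring.inverse (u x) := by
      rw [← hU]; exact NormedRing.inverse_continuousAt U
    exact (ContinuousAt.comp (f := u) h1 (huc x x.2.1)).comp continuous_subtype_val.continuousAt
  let e₀ : C.M →ₗ[A] C.M :=
    { toFun := P x₀, map_add' := map_add _, map_smul' := C.op_smul C e x₀ }
  have he₀ : ∀ m, e₀ m = P x₀ m := fun m => rfl
  let ε : ∀ x : V, LinearMap.range (e x) ≃+ LinearMap.range e₀ := fun x =>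
    { toFun := fun v => ⟨P x₀ (C.e ⟨x, x.2.1⟩ v), ⟨_, rfl⟩⟩
      invFun := fun m => ⟨(C.e ⟨x, x.2.1⟩).symm (w x m), by
        obtain ⟨m, n, rfl⟩ := m
        refine ⟨(C.e ⟨x, x.2.1⟩).symm (w x n), ?_⟩
        rw [AddEquiv.eq_symm_apply, ← hPe, AddEquiv.apply_symm_apply]
        exact (hwP x n).symm⟩
      left_inv := by
        rintro ⟨_, v, rfl⟩
        refine Subtype.ext ?_
        change (C.e ⟨x, x.2.1⟩).symm (w x (P x₀ (C.e ⟨x, x.2.1⟩ (e x v)))) = e x v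
        rw [AddEquiv.symm_apply_eq, ← hPe]
        refine Eq.trans (congrArg (w x) ?_) (hwu x _)
        exact congrArg (fun T : C.M →L[ℝ] C.M => T (C.e ⟨x, x.2.1⟩ v)) (huP x x.2.1).symm
      right_inv := by
        rintro ⟨_, m, rfl⟩
        refine Subtype.ext ?_
        change P x₀ (C.e ⟨x, x.2.1⟩ ((C.e ⟨x, x.2.1⟩).symm (w x (P x₀ m)))) = P x₀ m
        rw [AddEquiv.apply_symm_apply, hwP]
        refine (congrArg (fun T : C.M →L[ℝ] C.M => T (w x m)) (hPu x)).symm.trans ?_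
        exact congrArg (P x₀) (huw x m)
      map_add' := fun v v' => Subtype.ext (by
        change P x₀ (C.e ⟨x, x.2.1⟩ (v.1 + v'.1)) = _
        rw [map_add, map_add]; rfl) }
  refine ⟨V, fun x hx => C.hV hx.1, hVo, ⟨C.mem, by rw [hu1]; exact isUnit_one⟩,
    LinearMap.range e₀, inferInstance, inferInstance, inferInstance,
    isFGProjective_range C.isBounded (P x₀).continuous fun m =>
      congrArg (fun T : C.M →L[ℝ] C.M => T m) (hPP x₀ C.mem), ε, ?_, ?_, ?_⟩
  · intro x a v
    refine Subtype.ext ?_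
    change P x₀ (C.e ⟨x, x.2.1⟩ (a • v.1)) = _
    rw [C.e_smul, hP, C.op_smul C e]
    rfl
  · have h1 : Continuous fun p : {p : Tot (fun x => LinearMap.range (e x)) // p.proj ∈ V} =>
        (⟨p.1.proj, p.1.snd.1⟩ : Tot E.Fib) :=
      (isEmbedding_image e).continuous.comp continuous_subtype_val
    have h2 := C.triv.continuous_coord h1 fun p => p.2.1
    refine Continuous.prodMk ?_ ?_
    · exact (E.continuous_proj.comp h1).subtype_mk _
    · exact ((P x₀).continuous.comp h2).subtype_mk _
  · refine (isEmbedding_image e).continuous_iff.2 ?_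
    refine C.triv.continuous_mk (π := fun q : V × LinearMap.range e₀ => ⟨q.1, q.1.2.1⟩)
      (m := fun q => w q.1 q.2) ?_ ?_
    · exact (continuous_subtype_val.comp continuous_fst).subtype_mk _
    · exact (hwc.comp continuous_fst).clm_apply (continuous_subtype_val.comp continuous_snd)

end LocTriv

/-- The image of a projection, as a bundle. -/
def imageBundle {e : ∀ x, E.Fib x →ₗ[𝒜.Fib x] E.Fib x} (he : IsProj e)
    (hl : IsLocallyTrivial 𝒜 fun x => LinearMap.range (e x)) : GBundle 𝒜 where
  Fib := fun x => LinearMap.range (e x)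
  continuous_proj := E.continuous_proj.comp (isEmbedding_image e).continuous
  locallyTrivial := hl
  act := fun g x => AddMonoidHom.mk' (fun v => ⟨E.act g x v.1, by
    obtain ⟨v, w, rfl⟩ := v
    exact ⟨E.act g x w, he.map_act g x w⟩⟩) fun v w => Subtype.ext (map_add (E.act g x) _ _)
  act_smul := fun g x a v => Subtype.ext (E.act_smul g x a v.1)
  act_one := fun x v => (isEmbedding_image e).injective (E.act_one x v.1)
  act_mul := fun g h x v => (isEmbedding_image e).injective (E.act_mul g h x v.1)
  continuous_act := (isEmbedding_image e).continuous_iff.2 (E.continuous_act.comp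
    (continuous_fst.prodMk ((isEmbedding_image e).continuous.comp continuous_snd)))

end Image

/-! ### The fibres of `𝒜 ⊗ B` -/

section TensorFibre

variable {X : Type w} [TopologicalSpace X] [MulAction C2 X] {A : Type u} [Ring A] [Algebra ℝ A]
  [TopologicalSpace A] {𝒜 : GAlgBundle C2 X A} {B : Type} [Ring B] [Algebra ℝ B]
  [Module.Finite ℝ B] {β : C2 →* (B ≃ₐ[ℝ] B)} {x : X}

theorem tmulFib_mul (a a' : 𝒜.Fib x) (b b' : B) :
    tmulFib β a b * tmulFib β a' b' = tmulFib β (a * a') (b * b') :=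
  Algebra.TensorProduct.tmul_mul_tmul a a' b b'

theorem tmulFib_one : tmulFib β (1 : 𝒜.Fib x) 1 = 1 := rfl

theorem tmulFib_add_left (a a' : 𝒜.Fib x) (b : B) :
    tmulFib β (a + a') b = tmulFib β a b + tmulFib β a' b :=
  TensorProduct.add_tmul a a' b

theorem tmulFib_add_right (a : 𝒜.Fib x) (b b' : B) :
    tmulFib β a (b + b') = tmulFib β a b + tmulFib β a b' :=
  TensorProduct.tmul_add a b b'

theorem tmulFib_zero_left (b : B) : tmulFib β (0 : 𝒜.Fib x) b = 0 :=
  TensorProduct.zero_tmul _ b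

theorem tmulFib_zero_right (a : 𝒜.Fib x) : tmulFib β a (0 : B) = 0 :=
  TensorProduct.tmul_zero _ a

theorem tmulFib_neg_right (a : 𝒜.Fib x) (b : B) : tmulFib β a (-b) = -tmulFib β a b :=
  TensorProduct.tmul_neg a b

theorem tmulFib_smul (c : ℝ) (a : 𝒜.Fib x) (b : B) : tmulFib β a (c • b) = tmulFib β (c • a) b :=
  (TensorProduct.smul_tmul c a b).symm

theorem act_tmulFib (g : C2) (a : 𝒜.Fib x) (b : B) :
    (tensorBundle 𝒜 B β).act g x (tmulFib β a b) = tmulFib β (𝒜.act g x a) (β g b) := rfl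

theorem tmulFib_induction {P : (tensorBundle 𝒜 B β).Fib x → Prop}
    (h : ∀ a b, P (tmulFib β a b)) (hadd : ∀ s t, P s → P t → P (s + t))
    (t : (tensorBundle 𝒜 B β).Fib x) : P t := by
  refine TensorProduct.induction_on (motive := P) (t : 𝒜.Fib x ⊗[ℝ] B) ?_ h hadd
  have := h 0 0
  rwa [tmulFib_zero_left] at this

/-- `a ⊗ b ↦ f(b) a`, on the fibres. -/
def fibSlice (β : C2 →* (B ≃ₐ[ℝ] B)) (f : Module.Dual ℝ B) (x : X) :
    (tensorBundle 𝒜 B β).Fib x →+ 𝒜.Fib x :=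
  (slice (𝒜.Fib x) f).toAddMonoidHom

theorem fibSlice_tmulFib (f : Module.Dual ℝ B) (a : 𝒜.Fib x) (b : B) :
    fibSlice β f x (tmulFib β a b) = f b • a := by
  change slice (𝒜.Fib x) f (a ⊗ₜ[ℝ] b) = f b • a
  simp [slice]

theorem fibSlice_tmulFib_mul (f : Module.Dual ℝ B) (a : 𝒜.Fib x)
    (t : (tensorBundle 𝒜 B β).Fib x) :
    fibSlice β f x (tmulFib β a 1 * t) = a * fibSlice β f x t := by
  refine tmulFib_induction (P := fun t => fibSlice β f x (tmulFib β a 1 * t) =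
    a * fibSlice β f x t) (fun a' b => ?_) (fun s t hs ht => ?_) t
  · rw [tmulFib_mul, one_mul, fibSlice_tmulFib, fibSlice_tmulFib, mul_smul_comm]
  · rw [mul_add, map_add, hs, ht, map_add, mul_add]

variable {Z : Type*} [TopologicalSpace Z]

theorem continuous_tensor_iff {π : Z → X} {t : ∀ z, (tensorBundle 𝒜 B β).Fib (π z)} :
    (Continuous fun z => (⟨π z, t z⟩ : Tot (tensorBundle 𝒜 B β).Fib)) ↔
      ∀ f : Module.Dual ℝ B, Continuous fun z => (⟨π z, fibSlice β f (π z) (t z)⟩ : Tot 𝒜.Fib) :=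
  continuous_tensorTot_iff 𝒜 B fun z => ⟨π z, t z⟩

theorem continuous_tmulFib [ContinuousSMul ℝ A] {π : Z → X} {a : ∀ z, 𝒜.Fib (π z)}
    (ha : Continuous fun z => (⟨π z, a z⟩ : Tot 𝒜.Fib)) (b : B) :
    Continuous fun z => (⟨π z, tmulFib β (a z) b⟩ : Tot (tensorBundle 𝒜 B β).Fib) := by
  refine continuous_tensor_iff.2 fun f => ?_
  simp only [fibSlice_tmulFib]
  exact continuous_fibSmul continuous_const ha

omit [Module.Finite ℝ B] in
theorem continuous_slice (f : Module.Dual ℝ B) : Continuous (slice A f) := by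
  rw [continuous_iff_le_induced]
  exact iInf_le _ f

omit [Module.Finite ℝ B] in
theorem continuous_to_tensor_iff {t : Z → A ⊗[ℝ] B} :
    Continuous t ↔ ∀ f : Module.Dual ℝ B, Continuous fun z => slice A f (t z) := by
  unfold tensorTopology
  rw [continuous_iInf_rng]
  exact forall_congr' fun f => continuous_induced_rng

omit [Module.Finite ℝ B] [TopologicalSpace A] in
theorem slice_tmul (f : Module.Dual ℝ B) (a : A) (b : B) : slice A f (a ⊗ₜ[ℝ] b) = f b • a := by
  simp [slice]

omit [Module.Finite ℝ B] in
theorem continuous_tmul [ContinuousConstSMul ℝ A] (b : B) :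
    Continuous fun a : A => a ⊗ₜ[ℝ] b := by
  refine continuous_to_tensor_iff.2 fun f => ?_
  simp only [slice_tmul]
  exact continuous_const_smul _

omit [Module.Finite ℝ B] in
theorem continuous_one_tmul_mul (b : B) :
    Continuous fun t : A ⊗[ℝ] B => (1 : A) ⊗ₜ[ℝ] b * t := by
  refine continuous_to_tensor_iff.2 fun f => ?_
  have h : ∀ t : A ⊗[ℝ] B, slice A f ((1 : A) ⊗ₜ[ℝ] b * t) =
      slice A (f ∘ₗ LinearMap.mulLeft ℝ b) t := fun t => by
    induction t using TensorProduct.induction_on with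
    | zero => rw [mul_zero, map_zero, map_zero]
    | tmul a' b' =>
      rw [Algebra.TensorProduct.tmul_mul_tmul, one_mul, slice_tmul, slice_tmul]
      rfl
    | add s t hs ht => rw [mul_add, map_add, hs, ht, map_add]
  simp only [h]
  exact continuous_slice _

/-- Continuity of the scalar action is not a field of `GBundle`. In a trivialization 1 ⊗ b becomes a
constant element, whose action on a retract of a free module is continuous. -/
theorem GBundle.continuous_tmulFib_smul (E : GBundle (tensorBundle 𝒜 B β)) (b : B) {π : Z → X}
    {v : ∀ z, E.Fib (π z)} (hv : Continuous fun z => (⟨π z, v z⟩ : Tot E.Fib)) :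
    Continuous fun z => (⟨π z, tmulFib β (1 : 𝒜.Fib (π z)) b • v z⟩ : Tot E.Fib) := by
  have hπ : Continuous π := E.continuous_proj.comp hv
  refine continuous_of_local hπ fun x₀ => ?_
  obtain ⟨V, hV, hVo, hxV, M, _, _, _, ⟨ι, _, i, r, hir⟩, e, he, htriv⟩ := E.locallyTrivial x₀
  refine ⟨V, hVo, hxV, ?_⟩
  refine htriv.continuous_of_coord (hπ.comp continuous_subtype_val) (fun z => z.2) ?_
  have h : Continuous fun m : M => r (((1 : A) ⊗ₜ[ℝ] b) • i m) :=
    r.continuous.comp (continuous_pi fun k => (continuous_one_tmul_mul b).comp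
      ((continuous_apply k).comp i.continuous))
  refine (h.comp (htriv.continuous_coord (hv.comp continuous_subtype_val)
    fun z => z.2)).congr fun z => ?_
  change r (((1 : A) ⊗ₜ[ℝ] b) • i (e ⟨π z.1, z.2⟩ (v z.1))) =
    e ⟨π z.1, z.2⟩ (tmulFib β (1 : 𝒜.Fib (π z.1)) b • v z.1)
  have h1 : (tensorBundle 𝒜 B β).chart x₀ ⟨π z.1, hV z.2⟩ (tmulFib β (1 : 𝒜.Fib (π z.1)) b) =
      (1 : A) ⊗ₜ[ℝ] b := by
    change (𝒜.chart x₀ ⟨π z.1, hV z.2⟩ 1) ⊗ₜ[ℝ] b = _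
    rw [map_one]
  rw [he ⟨π z.1, z.2⟩, h1, ← map_smul, hir]

end TensorFibre

/-! ### Restriction along a map of algebra bundles -/

section Comap

variable {X : Type w} [TopologicalSpace X] [MulAction C2 X]
  {D : Type u} [Ring D] [Algebra ℝ D] [TopologicalSpace D]
  {C : Type u} [Ring C] [Algebra ℝ C] [TopologicalSpace C]

/-- A map of algebra bundles that is constant in the charts, and that makes the fibre of the target
a finitely generated projective module. -/
structure AlgBundleMap (𝒟 : GAlgBundle C2 X D) (𝒞 : GAlgBundle C2 X C) where
  map : ∀ x, 𝒟.Fib x →ₐ[ℝ] 𝒞.Fib x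
  map_act : ∀ g x d, map (g • x) (𝒟.act g x d) = 𝒞.act g x (map x d)
  model : D →ₐ[ℝ] C
  dom_le : ∀ x₀, 𝒞.dom x₀ ⊆ 𝒟.dom x₀
  map_chart : ∀ x₀ (x : 𝒞.dom x₀) d,
    𝒞.chart x₀ x (map x d) = model (𝒟.chart x₀ ⟨x, dom_le x₀ x.2⟩ d)
  fg : @IsFGProjective D _ _ C _ (Module.compHom C model.toRingHom) _

/-- Coordinates of M over C, each expanded in coordinates of C over D. -/
theorem IsFGProjective.comap {θ : D →ₐ[ℝ] C}
    (hC : @IsFGProjective D _ _ C _ (Module.compHom C θ.toRingHom) _) {M : Type u}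
    [AddCommGroup M] [Module C M] [TopologicalSpace M] (hM : IsFGProjective C M) :
    @IsFGProjective D _ _ M _ (Module.compHom M θ.toRingHom) _ := by
  let _ : Module D C := Module.compHom C θ.toRingHom
  let _ : Module D M := Module.compHom M θ.toRingHom
  obtain ⟨κ, _, j, q, hjq⟩ := hC
  obtain ⟨ι, _, i, r, hir⟩ := hM
  refine ⟨ι × κ, inferInstance,
    ⟨{ toFun := fun m k => j (i m k.1) k.2
       map_add' := fun m m' => by funext k; simp
       map_smul' := fun d m => by
        funext k
        change j (i (θ d • m) k.1) k.2 = d • j (i m k.1) k.2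
        rw [map_smul]
        exact congrFun (map_smul j d (i m k.1)) k.2 },
      continuous_pi fun k => (continuous_apply k.2).comp
        (j.continuous.comp ((continuous_apply k.1).comp i.continuous))⟩,
    ⟨{ toFun := fun a => r fun l => q fun k => a (l, k)
       map_add' := fun a b => by
        rw [← map_add]
        congr 1
        funext l
        exact map_add q (fun k => a (l, k)) (fun k => b (l, k))
       map_smul' := fun d a => by
        change _ = θ d • r fun l => q fun k => a (l, k)
        rw [← map_smul]
        congr 1
        funext l
        exact map_smul q d (fun k => a (l, k)) },
      r.continuous.comp (continuous_pi fun l => q.continuous.comp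
        (continuous_pi fun k => continuous_apply (l, k)))⟩, fun m => ?_⟩
  change r (fun l => q fun k => j (i m l) k) = m
  simp only [hjq, hir]

variable {𝒟 : GAlgBundle C2 X D} {𝒞 : GAlgBundle C2 X C}

/-- Restriction of the operators along a map of algebra bundles. -/
def GBundle.comap (θ : AlgBundleMap 𝒟 𝒞) (E : GBundle 𝒞) : GBundle 𝒟 where
  Fib := E.Fib
  module := fun x => Module.compHom (E.Fib x) (θ.map x).toRingHom
  continuous_proj := E.continuous_proj
  locallyTrivial := by
    intro x₀
    obtain ⟨V, hV, hVo, hxV, M, _, _, _, hM, e, he, htriv⟩ := E.locallyTrivial x₀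
    refine ⟨V, hV.trans (θ.dom_le x₀), hVo, hxV, M, inferInstance,
      Module.compHom M θ.model.toRingHom, inferInstance, θ.fg.comap hM, e, fun x d v => ?_, htriv⟩
    exact (he x _ v).trans (congrArg (fun c => c • e x v) (θ.map_chart x₀ ⟨x, hV x.2⟩ d))
  act := E.act
  act_smul := fun g x d v => (E.act_smul g x (θ.map x d) v).trans
    (congrArg (fun c => c • E.act g x v) (θ.map_act g x d).symm)
  act_one := E.act_one
  act_mul := E.act_mul
  continuous_act := E.continuous_act

/-- The inclusion `𝒜 → 𝒜 ⊗ B`. -/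
def tensorIncl {A : Type u} [Ring A] [Algebra ℝ A] [TopologicalSpace A] [ContinuousAdd A]
    [ContinuousConstSMul ℝ A]
    (𝒜 : GAlgBundle C2 X A) (B : Type) [Ring B] [Algebra ℝ B] [Module.Finite ℝ B]
    (β : C2 →* (B ≃ₐ[ℝ] B)) : AlgBundleMap 𝒜 (tensorBundle 𝒜 B β) where
  map := fun x => (Algebra.TensorProduct.includeLeft : 𝒜.Fib x →ₐ[ℝ] 𝒜.Fib x ⊗[ℝ] B)
  map_act := fun g x a => by
    change tmulFib β (𝒜.act g x a) 1 = (tensorBundle 𝒜 B β).act g x (tmulFib β a 1)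
    rw [act_tmulFib, map_one]
  model := Algebra.TensorProduct.includeLeft
  dom_le := fun x₀ => subset_rfl
  map_chart := fun x₀ x a => by
    change 𝒜.chart x₀ x a ⊗ₜ[ℝ] (1 : B) = 𝒜.chart x₀ x a ⊗ₜ[ℝ] (1 : B)
    rfl
  fg := by
    -- A basis of B makes A ⊗ B free over A, with the slices along the dual basis as continuous
    -- coordinates.
    let b := Module.finBasis ℝ B
    let _ : Module A (A ⊗[ℝ] B) := Module.compHom (A ⊗[ℝ] B)
      (Algebra.TensorProduct.includeLeft : A →ₐ[ℝ] A ⊗[ℝ] B).toRingHom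
    have hsm : ∀ (a a' : A) (c : B), (a ⊗ₜ[ℝ] (1 : B)) * (a' ⊗ₜ[ℝ] c) = (a * a') ⊗ₜ[ℝ] c :=
      fun a a' c => by rw [Algebra.TensorProduct.tmul_mul_tmul, one_mul]
    have hsl : ∀ (f : Module.Dual ℝ B) (a : A) (t : A ⊗[ℝ] B),
        slice A f ((a ⊗ₜ[ℝ] (1 : B)) * t) = a * slice A f t := fun f a t => by
      induction t using TensorProduct.induction_on with
      | zero => rw [mul_zero, map_zero, mul_zero]
      | tmul a' c => rw [hsm, slice_tmul, slice_tmul, mul_smul_comm]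
      | add s t hs ht => rw [mul_add, map_add, hs, ht, map_add, mul_add]
    have hr : Continuous fun a : Fin (Module.finrank ℝ B) → A => ∑ k, a k ⊗ₜ[ℝ] b k :=
      continuous_finsetSum _ fun k _ => (continuous_tmul (b k)).comp (continuous_apply k)
    refine ⟨Fin (Module.finrank ℝ B), inferInstance,
      ⟨{ toFun := fun t k => slice A (b.coord k) t
         map_add' := fun s t => by funext k; simp
         map_smul' := fun a t => funext fun k => hsl _ a t },
        continuous_pi fun k => continuous_slice _⟩,
      ⟨{ toFun := fun a => ∑ k, a k ⊗ₜ[ℝ] b k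
         map_add' := fun a a' => by
          simp only [Pi.add_apply, TensorProduct.add_tmul, Finset.sum_add_distrib]
         map_smul' := fun c a => by
          change ∑ k, (c * a k) ⊗ₜ[ℝ] b k = (c ⊗ₜ[ℝ] (1 : B)) * ∑ k, a k ⊗ₜ[ℝ] b k
          rw [Finset.mul_sum]
          exact Finset.sum_congr rfl fun k _ => (hsm c (a k) (b k)).symm },
        hr⟩,
      fun t => ?_⟩
    change ∑ k, slice A (b.coord k) t ⊗ₜ[ℝ] b k = t
    induction t using TensorProduct.induction_on with
    | zero => simp
    | tmul a c =>
      simp only [slice_tmul, TensorProduct.smul_tmul]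
      rw [← TensorProduct.tmul_sum]
      exact congrArg _ (b.sum_repr c)
    | add s t hs ht => simp only [map_add, TensorProduct.add_tmul, Finset.sum_add_distrib, hs, ht]

end Comap

/-! ### The double of a bundle -/

/-- The sign character of `{1, τ}`. -/
def sgn : C2 →* ℤˣ := ofInvolution (-1) (by simp)

/-- A representation of `B` on `ℝ²` for which `ℝ² ≅ ⟨j₀, j₁⟩ ⊂ B` is a left ideal, compatibly with
the action `diag(1, -1)` of `τ`. -/
structure HalfRep {B : Type} [Ring B] [Algebra ℝ B] (β : C2 →* (B ≃ₐ[ℝ] B)) where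
  r : B →ₐ[ℝ] Matrix (Fin 2) (Fin 2) ℝ
  j : Fin 2 → B
  mul_j : ∀ b k, b * j k = ∑ l, r b l k • j l
  r_j : ∀ k l, r (j k) l 0 = if l = k then 1 else 0
  β_j₀ : ∀ g, β g (j 0) = j 0
  β_j₁ : ∀ g, β g (j 1) = sgn g • j 1
  r_β₀ : ∀ g b k, r (β g b) k k = r b k k
  r_β₁ : ∀ g b k l, k ≠ l → r (β g b) k l = sgn g • r b k l

section DoubleModule

variable {B : Type} [Ring B] [Algebra ℝ B] {β : C2 →* (B ≃ₐ[ℝ] B)} (R : HalfRep β)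

/-- A matrix coefficient. -/
def HalfRep.entry (i j : Fin 2) : Module.Dual ℝ B :=
  Matrix.entryLinearMap ℝ ℝ i j ∘ₗ R.r.toLinearMap

theorem HalfRep.entry_apply (i j : Fin 2) (b : B) : R.entry i j b = R.r b i j := rfl

variable {A : Type*} [Ring A] [Algebra ℝ A]

/-- The four slices assemble A ⊗ B → M₂(A), and this is its multiplicativity; the module axioms for
M × M amount to it. -/
theorem HalfRep.slice_entry_mul (i j : Fin 2) (t t' : A ⊗[ℝ] B) :
    slice A (R.entry i j) (t * t') = slice A (R.entry i 0) t * slice A (R.entry 0 j) t' +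
      slice A (R.entry i 1) t * slice A (R.entry 1 j) t' := by
  induction t using TensorProduct.induction_on with
  | zero => simp
  | add p q hp hq => rw [add_mul, map_add, hp, hq, map_add, map_add]; noncomm_ring
  | tmul a b =>
    induction t' using TensorProduct.induction_on with
    | zero => simp
    | add p q hp hq => rw [mul_add, map_add, hp, hq, map_add, map_add]; noncomm_ring
    | tmul a' b' =>
      rw [Algebra.TensorProduct.tmul_mul_tmul]
      simp only [slice_tmul, R.entry_apply, map_mul, Matrix.mul_apply, Fin.sum_univ_two,
        smul_mul_smul_comm, add_smul]

theorem HalfRep.slice_entry_one (i j : Fin 2) :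
    slice A (R.entry i j) 1 = if i = j then 1 else 0 := by
  rw [Algebra.TensorProduct.one_def, slice_tmul, R.entry_apply, map_one, Matrix.one_apply]
  split_ifs <;> simp

variable (A) (M : Type*) [AddCommGroup M] [Module A M]

/-- The module `M ⊗ ℝ²` over `A ⊗ B`. -/
@[reducible] def HalfRep.doubleModule : Module (A ⊗[ℝ] B) (M × M) where
  smul := fun t v => (slice A (R.entry 0 0) t • v.1 + slice A (R.entry 0 1) t • v.2,
    slice A (R.entry 1 0) t • v.1 + slice A (R.entry 1 1) t • v.2)
  one_smul := fun v => by
    refine Prod.ext ?_ ?_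
    · change slice A (R.entry 0 0) 1 • v.1 + slice A (R.entry 0 1) 1 • v.2 = v.1
      simp [R.slice_entry_one]
    · change slice A (R.entry 1 0) 1 • v.1 + slice A (R.entry 1 1) 1 • v.2 = v.2
      simp [R.slice_entry_one]
  mul_smul := fun t t' v => by
    have h : ∀ i, slice A (R.entry i 0) (t * t') • v.1 + slice A (R.entry i 1) (t * t') • v.2 =
        slice A (R.entry i 0) t • (slice A (R.entry 0 0) t' • v.1 + slice A (R.entry 0 1) t' • v.2) +
        slice A (R.entry i 1) t •
          (slice A (R.entry 1 0) t' • v.1 + slice A (R.entry 1 1) t' • v.2) := fun i => by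
      simp only [R.slice_entry_mul, add_smul, mul_smul, smul_add]
      abel
    exact Prod.ext (h 0) (h 1)
  smul_zero := fun t => by
    refine Prod.ext ?_ ?_
    · change slice A (R.entry 0 0) t • (0 : M) + slice A (R.entry 0 1) t • (0 : M) = 0
      simp
    · change slice A (R.entry 1 0) t • (0 : M) + slice A (R.entry 1 1) t • (0 : M) = 0
      simp
  smul_add := fun t v v' => by
    have h : ∀ i, slice A (R.entry i 0) t • (v.1 + v'.1) + slice A (R.entry i 1) t • (v.2 + v'.2) =
        (slice A (R.entry i 0) t • v.1 + slice A (R.entry i 1) t • v.2) +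
        (slice A (R.entry i 0) t • v'.1 + slice A (R.entry i 1) t • v'.2) := fun i => by
      rw [smul_add, smul_add]; abel
    exact Prod.ext (h 0) (h 1)
  add_smul := fun t t' v => by
    have h : ∀ i, slice A (R.entry i 0) (t + t') • v.1 + slice A (R.entry i 1) (t + t') • v.2 =
        (slice A (R.entry i 0) t • v.1 + slice A (R.entry i 1) t • v.2) +
        (slice A (R.entry i 0) t' • v.1 + slice A (R.entry i 1) t' • v.2) := fun i => by
      rw [map_add, map_add, add_smul, add_smul]; abel
    exact Prod.ext (h 0) (h 1)
  zero_smul := fun v => by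
    refine Prod.ext ?_ ?_
    · change slice A (R.entry 0 0) 0 • v.1 + slice A (R.entry 0 1) 0 • v.2 = 0
      simp
    · change slice A (R.entry 1 0) 0 • v.1 + slice A (R.entry 1 1) 0 • v.2 = 0
      simp

end DoubleModule

/-- M × M is M tensored with the left ideal spanned by j₀ and j₁, included in M ⊗ B. By `r_j` the
first column of the matrix coefficients recovers the two components, which gives the retraction. -/
theorem HalfRep.isFGProjective {B : Type} [Ring B] [Algebra ℝ B] {β : C2 →* (B ≃ₐ[ℝ] B)}
    (R : HalfRep β) {A : Type u} [Ring A] [Algebra ℝ A] [TopologicalSpace A] [ContinuousAdd A]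
    [ContinuousConstSMul ℝ A] {M : Type u} [AddCommGroup M] [Module A M] [TopologicalSpace M]
    (hM : IsFGProjective A M) :
    @IsFGProjective (A ⊗[ℝ] B) _ _ (M × M) _ (R.doubleModule A M) _ := by
  let _ := R.doubleModule A M
  obtain ⟨ι, _, i, r, hir⟩ := hM
  have hmul : ∀ (t : A ⊗[ℝ] B) (a a' : A),
      t * (a ⊗ₜ[ℝ] R.j 0 + a' ⊗ₜ[ℝ] R.j 1) =
        (slice A (R.entry 0 0) t * a + slice A (R.entry 0 1) t * a') ⊗ₜ[ℝ] R.j 0 +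
        (slice A (R.entry 1 0) t * a + slice A (R.entry 1 1) t * a') ⊗ₜ[ℝ] R.j 1 :=
    fun t a a' => by
      induction t using TensorProduct.induction_on with
      | zero => simp
      | add p q hp hq =>
        rw [add_mul, hp, hq]
        simp only [map_add, add_mul, TensorProduct.add_tmul]
        abel
      | tmul c b =>
        simp only [mul_add, Algebra.TensorProduct.tmul_mul_tmul, R.mul_j, Fin.sum_univ_two,
          TensorProduct.tmul_add, slice_tmul, R.entry_apply, TensorProduct.add_tmul,
          smul_mul_assoc, ← TensorProduct.smul_tmul]
        abel
  let φ : M × M → ι → A ⊗[ℝ] B := fun m k => i m.1 k ⊗ₜ[ℝ] R.j 0 + i m.2 k ⊗ₜ[ℝ] R.j 1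
  let ψ : (ι → A ⊗[ℝ] B) → M × M := fun t =>
    (r fun k => slice A (R.entry 0 0) (t k), r fun k => slice A (R.entry 1 0) (t k))
  have hφ : Continuous φ := continuous_pi fun k =>
    ((continuous_tmul _).comp ((continuous_apply k).comp (i.continuous.comp continuous_fst))).add
    ((continuous_tmul _).comp ((continuous_apply k).comp (i.continuous.comp continuous_snd)))
  have hψ : Continuous ψ :=
    (r.continuous.comp (continuous_pi fun k => (continuous_slice _).comp
      (continuous_apply k))).prodMk
    (r.continuous.comp (continuous_pi fun k => (continuous_slice _).comp (continuous_apply k)))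
  have hrsum : ∀ (a b : A) (c d : ι → A), (r fun k => a * c k + b * d k) = a • r c + b • r d :=
    fun a b c d => by rw [← map_smul, ← map_smul, ← map_add]; rfl
  refine ⟨ι, inferInstance,
    ⟨{ toFun := φ
       map_add' := fun m m' => by
        funext k
        simp only [φ, Prod.fst_add, Prod.snd_add, map_add, Pi.add_apply, TensorProduct.add_tmul]
        abel
       map_smul' := fun t m => by
        funext k
        change i (slice A (R.entry 0 0) t • m.1 + slice A (R.entry 0 1) t • m.2) k ⊗ₜ[ℝ] R.j 0 +
          i (slice A (R.entry 1 0) t • m.1 + slice A (R.entry 1 1) t • m.2) k ⊗ₜ[ℝ] R.j 1 =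
          t * (i m.1 k ⊗ₜ[ℝ] R.j 0 + i m.2 k ⊗ₜ[ℝ] R.j 1)
        rw [hmul]
        simp only [map_add, map_smul, Pi.add_apply, Pi.smul_apply, smul_eq_mul] }, hφ⟩,
    ⟨{ toFun := ψ
       map_add' := fun t t' => by
        refine Prod.ext ?_ ?_
        · change (r fun k => slice A (R.entry 0 0) (t k + t' k)) = r _ + r _
          simp only [map_add]
          exact map_add r _ _
        · change (r fun k => slice A (R.entry 1 0) (t k + t' k)) = r _ + r _
          simp only [map_add]
          exact map_add r _ _
       map_smul' := fun c t => by
        have h : ∀ l, (r fun k => slice A (R.entry l 0) (c * t k)) =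
            slice A (R.entry l 0) c • (r fun k => slice A (R.entry 0 0) (t k)) +
            slice A (R.entry l 1) c • (r fun k => slice A (R.entry 1 0) (t k)) := fun l => by
          simp only [R.slice_entry_mul]
          exact hrsum _ _ _ _
        exact Prod.ext (h 0) (h 1) }, hψ⟩, fun m => ?_⟩
  refine Prod.ext ?_ ?_
  · change (r fun k => slice A (R.entry 0 0) (i m.1 k ⊗ₜ[ℝ] R.j 0 + i m.2 k ⊗ₜ[ℝ] R.j 1)) = m.1
    simp only [map_add, slice_tmul, R.entry_apply, R.r_j]
    simp only [if_true, one_smul, zero_ne_one, if_false, zero_smul, add_zero]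
    exact hir m.1
  · change (r fun k => slice A (R.entry 1 0) (i m.1 k ⊗ₜ[ℝ] R.j 0 + i m.2 k ⊗ₜ[ℝ] R.j 1)) = m.2
    simp only [map_add, slice_tmul, R.entry_apply, R.r_j]
    simp only [if_true, one_smul, one_ne_zero, if_false, zero_smul, zero_add]
    exact hir m.2

/-! ### The bundle F ⊗ ℝ² over 𝒜 ⊗ B. -/

section DoubleBundle

variable {X : Type w} [TopologicalSpace X] [MulAction C2 X] {A : Type u} [Ring A] [Algebra ℝ A]
  [TopologicalSpace A] [IsTopologicalRing A] [ContinuousConstSMul ℝ A] {𝒜 : GAlgBundle C2 X A}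
  {B : Type} [Ring B] [Algebra ℝ B] [Module.Finite ℝ B] {β : C2 →* (B ≃ₐ[ℝ] B)}

theorem sgn_map {M N : Type*} [AddCommGroup M] [AddCommGroup N] (φ : M →+ N) (g : C2) (v : M) :
    φ (sgn g • v) = sgn g • φ v := by
  rcases Int.units_eq_one_or (sgn g) with h | h
  · rw [h, one_smul, one_smul]
  · rw [h, Units.neg_smul, one_smul, Units.neg_smul, one_smul, map_neg]

omit [IsTopologicalRing A] in
theorem GBundle.continuous_neg (E : GBundle 𝒜) {Z : Type*} [TopologicalSpace Z] {π : Z → X}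
    {a : ∀ z, E.Fib (π z)} (ha : Continuous fun z => (⟨π z, a z⟩ : Tot E.Fib)) :
    Continuous fun z => (⟨π z, -a z⟩ : Tot E.Fib) := by
  refine (E.continuous_realSmul (-1) ha).congr fun z => ?_
  rw [map_neg, map_one, neg_smul, one_smul]

omit [IsTopologicalRing A] [ContinuousConstSMul ℝ A] in
theorem HalfRep.entry_act (R : HalfRep β) {x : X} (g : C2) (t : (tensorBundle 𝒜 B β).Fib x) (k : Fin 2) :
    fibSlice β (R.entry k k) (g • x) ((tensorBundle 𝒜 B β).act g x t) =
      𝒜.act g x (fibSlice β (R.entry k k) x t) := by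
  refine tmulFib_induction (P := fun t => fibSlice β (R.entry k k) (g • x)
    ((tensorBundle 𝒜 B β).act g x t) = 𝒜.act g x (fibSlice β (R.entry k k) x t))
    (fun a b => ?_) (fun s t hs ht => ?_) t
  · rw [act_tmulFib, fibSlice_tmulFib, fibSlice_tmulFib, R.entry_apply, R.r_β₀, map_smul]
    rfl
  · rw [map_add, map_add, hs, ht, map_add, map_add]

omit [IsTopologicalRing A] [ContinuousConstSMul ℝ A] in
theorem HalfRep.entry_act' (R : HalfRep β) {x : X} (g : C2) (t : (tensorBundle 𝒜 B β).Fib x)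
    {k l : Fin 2} (hkl : k ≠ l) :
    fibSlice β (R.entry k l) (g • x) ((tensorBundle 𝒜 B β).act g x t) =
      sgn g • 𝒜.act g x (fibSlice β (R.entry k l) x t) := by
  refine tmulFib_induction (P := fun t => fibSlice β (R.entry k l) (g • x)
    ((tensorBundle 𝒜 B β).act g x t) = sgn g • 𝒜.act g x (fibSlice β (R.entry k l) x t))
    (fun a b => ?_) (fun s t hs ht => ?_) t
  · rw [act_tmulFib, fibSlice_tmulFib, fibSlice_tmulFib, R.entry_apply, R.r_β₁ _ _ _ _ hkl,
      map_smul, R.entry_apply]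
    rcases Int.units_eq_one_or (sgn g) with h | h
    · rw [h, one_smul, one_smul]
    · rw [h, Units.neg_smul, one_smul, Units.neg_smul, one_smul, neg_smul]
  · rw [map_add, map_add, hs, ht, map_add, map_add, smul_add]

/-- The bundle `F ⊗ ℝ²` over `𝒜 ⊗ B`. -/
def GBundle.double (F : GBundle 𝒜) (R : HalfRep β) : GBundle (tensorBundle 𝒜 B β) where
  Fib := fun x => F.Fib x × F.Fib x
  module := fun x => R.doubleModule (𝒜.Fib x) (F.Fib x)
  top := GBundle.prodTop F F
  continuous_proj := (F.prod F).continuous_proj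
  locallyTrivial := by
    intro x₀
    obtain ⟨V, hV, hVo, hxV, M, _, _, _, hM, e, he, htriv⟩ := F.locallyTrivial x₀
    refine ⟨V, hV, hVo, hxV, M × M, inferInstance, R.doubleModule A M, inferInstance,
      R.isFGProjective hM, fun x => (e x).prodCongr (e x), ?_, ?_, ?_⟩
    · intro x t v
      have h : ∀ f : Module.Dual ℝ B, slice A f ((tensorBundle 𝒜 B β).chart x₀ ⟨x, hV x.2⟩ t) =
          𝒜.chart x₀ ⟨x, hV x.2⟩ (slice (𝒜.Fib x) f t) := fun f =>
        slice_map f (𝒜.chart x₀ ⟨x, hV x.2⟩).toLinearMap LinearMap.id t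
      have h' : ∀ f f' : Module.Dual ℝ B,
          e x (slice (𝒜.Fib x) f t • v.1 + slice (𝒜.Fib x) f' t • v.2) =
          slice A f ((tensorBundle 𝒜 B β).chart x₀ ⟨x, hV x.2⟩ t) • e x v.1 +
          slice A f' ((tensorBundle 𝒜 B β).chart x₀ ⟨x, hV x.2⟩ t) • e x v.2 := fun f f' => by
        rw [map_add, he, he, h, h]
      exact Prod.ext (h' _ _) (h' _ _)
    · have h0 : Continuous fun p : {p : Tot (F.prod F).Fib // p.proj ∈ V} => p.1.proj :=
        (F.prod F).continuous_proj.comp continuous_subtype_val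
      have h1 := htriv.continuous_coord ((GBundle.continuous_prodTop_fst F F).comp
        (continuous_subtype_val (p := fun p => p.proj ∈ V))) fun p => p.2
      have h2 := htriv.continuous_coord ((GBundle.continuous_prodTop_snd F F).comp
        (continuous_subtype_val (p := fun p => p.proj ∈ V))) fun p => p.2
      exact (h0.subtype_mk _).prodMk (h1.prodMk h2)
    · exact GBundle.continuous_prodTop F F
        (htriv.continuous_mk continuous_fst (continuous_fst.comp continuous_snd))
        (htriv.continuous_mk continuous_fst (continuous_snd.comp continuous_snd))
  -- The sign on the second summand matches the effect of τ on j₁: conjugation by diag(1, −1)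
  -- negates e₂₁, and complex conjugation negates i.
  act := fun g x => AddMonoidHom.mk' (fun v => (F.act g x v.1, sgn g • F.act g x v.2))
    fun v w => Prod.ext (map_add (F.act g x) _ _) (by
      change sgn g • F.act g x (v.2 + w.2) = sgn g • F.act g x v.2 + sgn g • F.act g x w.2
      rw [map_add, smul_add])
  act_smul := fun g x t v => by
    have h0 := R.entry_act g t
    have h1 := fun k l => R.entry_act' g t (k := k) (l := l)
    refine Prod.ext ?_ ?_
    · change F.act g x (fibSlice β (R.entry 0 0) x t • v.1 + fibSlice β (R.entry 0 1) x t • v.2) =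
        fibSlice β (R.entry 0 0) (g • x) ((tensorBundle 𝒜 B β).act g x t) • F.act g x v.1 +
        fibSlice β (R.entry 0 1) (g • x) ((tensorBundle 𝒜 B β).act g x t) • sgn g • F.act g x v.2
      rw [h0, h1 _ _ zero_ne_one, map_add, F.act_smul, F.act_smul]
      rcases Int.units_eq_one_or (sgn g) with h | h
      · simp only [h, one_smul]
      · simp only [h, one_smul, Units.neg_smul, neg_smul, smul_neg, neg_neg]
    · change sgn g • F.act g x
          (fibSlice β (R.entry 1 0) x t • v.1 + fibSlice β (R.entry 1 1) x t • v.2) =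
        fibSlice β (R.entry 1 0) (g • x) ((tensorBundle 𝒜 B β).act g x t) • F.act g x v.1 +
        fibSlice β (R.entry 1 1) (g • x) ((tensorBundle 𝒜 B β).act g x t) • sgn g • F.act g x v.2
      rw [h0, h1 _ _ one_ne_zero, map_add, F.act_smul, F.act_smul]
      rcases Int.units_eq_one_or (sgn g) with h | h
      · simp only [h, one_smul]
      · simp only [h, one_smul, Units.neg_smul, neg_smul, smul_neg, neg_add]
  act_one := by
    rintro x ⟨v, v'⟩
    have h := (F.prod F).act_one x (v, v')
    refine Eq.trans ?_ h
    refine congrArg (fun u => (⟨_, u⟩ : Tot (F.prod F).Fib)) (Prod.ext rfl ?_)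
    change sgn 1 • F.act 1 x v' = F.act 1 x v'
    rw [map_one]
    exact one_smul ℤˣ _
  act_mul := by
    rintro g h x ⟨v, v'⟩
    have key : ∀ (y z : X) (_ : y = z) (p q : F.Fib y) (p' q' : F.Fib z) (ε : ℤˣ)
        (_ : (⟨y, p⟩ : Tot F.Fib) = ⟨z, p'⟩) (_ : (⟨y, q⟩ : Tot F.Fib) = ⟨z, q'⟩),
        (⟨y, (p, ε • q)⟩ : Tot fun x => F.Fib x × F.Fib x) = ⟨z, (p', ε • q')⟩ := by
      rintro y _ rfl p q p' q' ε hp hq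
      rw [Bundle.TotalSpace.mk_inj.1 hp, Bundle.TotalSpace.mk_inj.1 hq]
    refine (key _ _ (mul_smul g h x) _ _ _ _ (sgn (g * h)) (F.act_mul g h x v)
      (F.act_mul g h x v')).trans ?_
    refine congrArg (fun u => (⟨_, u⟩ : Tot (F.prod F).Fib)) (Prod.ext rfl ?_)
    change sgn (g * h) • F.act g (h • x) (F.act h x v') =
      sgn g • F.act g (h • x) (sgn h • F.act h x v')
    rw [sgn_map (F.act g (h • x)), map_mul]
    exact mul_smul (sgn g) (sgn h) _
  continuous_act := by
    refine continuous_prod_of_discrete_left.2 fun g => ?_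
    have hc : ∀ {φ : Tot (F.prod F).Fib → Tot F.Fib}, Continuous φ →
        Continuous fun p => (⟨g • (φ p).proj, F.act g _ (φ p).snd⟩ : Tot F.Fib) := fun hφ =>
      F.continuous_act.comp (continuous_const.prodMk hφ)
    refine GBundle.continuous_prodTop F F (hc (GBundle.continuous_prodTop_fst F F)) ?_
    have h2 := hc (GBundle.continuous_prodTop_snd F F)
    rcases Int.units_eq_one_or (sgn g) with h | h
    · refine h2.congr fun p => ?_
      refine congrArg (fun u => (⟨_, u⟩ : Tot F.Fib)) ?_
      change F.act g _ p.snd.2 = sgn g • F.act g _ p.snd.2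
      rw [h, one_smul]
    · refine (F.continuous_neg h2).congr fun p => ?_
      refine congrArg (fun u => (⟨_, u⟩ : Tot F.Fib)) ?_
      change -F.act g _ p.snd.2 = sgn g • F.act g _ p.snd.2
      rw [h, Units.neg_smul, one_smul]

theorem GBundle.double_tmulFib_smul (F : GBundle 𝒜) (R : HalfRep β) {x : X} (a : 𝒜.Fib x) (b : B)
    (v : (F.double R).Fib x) : tmulFib β a b • v =
      ((R.r b 0 0 • a) • v.1 + (R.r b 0 1 • a) • v.2,
        (R.r b 1 0 • a) • v.1 + (R.r b 1 1 • a) • v.2) := by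
  have h := fun k l => fibSlice_tmulFib (β := β) (R.entry k l) a b
  refine Prod.ext ?_ ?_
  · change fibSlice β (R.entry 0 0) x (tmulFib β a b) • v.1 +
      fibSlice β (R.entry 0 1) x (tmulFib β a b) • v.2 = _
    rw [h, h]
    rfl
  · change fibSlice β (R.entry 1 0) x (tmulFib β a b) • v.1 +
      fibSlice β (R.entry 1 1) x (tmulFib β a b) • v.2 = _
    rw [h, h]
    rfl

end DoubleBundle

/-! ### The two half representations -/

theorem ofInvolution_cases {M : Type*} [Monoid M] (t : M) (ht : t * t = 1) (g : C2) :
    (ofInvolution t ht g = 1 ∧ sgn g = 1) ∨ (ofInvolution t ht g = t ∧ sgn g = -1) := by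
  by_cases hg : g = 1
  · exact Or.inl ⟨by rw [hg, map_one], by rw [hg, map_one]⟩
  · exact Or.inr ⟨if_neg hg, if_neg hg⟩

theorem diagConj_apply (m : Matrix (Fin 2) (Fin 2) ℝ) :
    diagConj m = !![m 0 0, -m 0 1; -m 1 0, m 1 1] := by
  change diagMat * m * diagMat = _
  ext i j
  fin_cases i <;> fin_cases j <;> simp [diagMat, Matrix.mul_apply, Matrix.diagonal]

/-- The standard representation of `M₂(ℝ)`. -/
def matrixHalf : HalfRep diagAction where
  r := AlgHom.id ℝ _
  j := ![Matrix.single 0 0 1, Matrix.single 1 0 1]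
  mul_j := fun b k => by
    ext p q
    fin_cases k <;> fin_cases p <;> fin_cases q <;> simp [Matrix.mul_apply, Matrix.single]
  r_j := fun k l => by fin_cases k <;> fin_cases l <;> simp [Matrix.single]
  β_j₀ := fun g => by
    rcases ofInvolution_cases diagConj _ g with ⟨h, -⟩ | ⟨h, -⟩
    · rw [diagAction, h]; rfl
    · rw [diagAction, h, diagConj_apply]
      ext p q
      fin_cases p <;> fin_cases q <;> simp [Matrix.single]
  β_j₁ := fun g => by
    rcases ofInvolution_cases diagConj _ g with ⟨h, h'⟩ | ⟨h, h'⟩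
    · rw [diagAction, h, h', one_smul]; rfl
    · rw [diagAction, h, diagConj_apply, h', Units.neg_smul, one_smul]
      ext p q
      fin_cases p <;> fin_cases q <;> simp [Matrix.single]
  r_β₀ := fun g b k => by
    rcases ofInvolution_cases diagConj _ g with ⟨h, -⟩ | ⟨h, -⟩
    · rw [diagAction, h]; rfl
    · rw [diagAction, h, diagConj_apply]
      fin_cases k <;> simp
  r_β₁ := fun g b k l hkl => by
    rcases ofInvolution_cases diagConj _ g with ⟨h, h'⟩ | ⟨h, h'⟩
    · rw [diagAction, h, h', one_smul]; rfl
    · rw [diagAction, h, diagConj_apply, h', Units.neg_smul, one_smul]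
      fin_cases k <;> fin_cases l <;> simp at hkl ⊢

/-- The representation of `ℂ` on itself. -/
def complexHalf : HalfRep conjAction where
  r := Algebra.leftMulMatrix Complex.basisOneI
  j := ![1, Complex.I]
  mul_j := fun b k => by
    fin_cases k <;> apply Complex.ext <;>
      simp [Algebra.leftMulMatrix_eq_repr_mul, Complex.basisOneI]
  r_j := fun k l => by
    fin_cases k <;> fin_cases l <;>
      simp [Algebra.leftMulMatrix_eq_repr_mul, Complex.basisOneI]
  β_j₀ := fun g => map_one _
  β_j₁ := fun g => by
    rcases ofInvolution_cases Complex.conjAe (by ext z; simp) g with ⟨h, h'⟩ | ⟨h, h'⟩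
    · rw [conjAction, h, h', one_smul]; rfl
    · rw [conjAction, h, h', Units.neg_smul, one_smul]
      simp
  r_β₀ := fun g b k => by
    rcases ofInvolution_cases Complex.conjAe (by ext z; simp) g with ⟨h, h'⟩ | ⟨h, h'⟩
    · rw [conjAction, h]; rfl
    · rw [conjAction, h]
      fin_cases k <;> simp [Algebra.leftMulMatrix_eq_repr_mul, Complex.basisOneI]
  r_β₁ := fun g b k l hkl => by
    rcases ofInvolution_cases Complex.conjAe (by ext z; simp) g with ⟨h, h'⟩ | ⟨h, h'⟩
    · rw [conjAction, h, h', one_smul]; rfl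
    · rw [conjAction, h, h', Units.neg_smul, one_smul]
      fin_cases k <;> fin_cases l <;>
        simp [Algebra.leftMulMatrix_eq_repr_mul, Complex.basisOneI] at hkl ⊢

/-! ### Isomorphisms of Grothendieck groups -/

/-- A relation is used rather than a function because corners and real forms are only determined up
to isomorphism. Zero needs no hypothesis, since an additive bijection of monoids preserves it. -/
theorem exists_grothendieck_equiv {M N : Type*} [AddCommMonoid M] [AddCommMonoid N]
    (R : M → N → Prop) (hM : ∀ m, ∃ n, R m n) (hN : ∀ n, ∃ m, R m n)
    (h₁ : ∀ m n n', R m n → R m n' → n = n') (h₂ : ∀ m m' n, R m n → R m' n → m = m')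
    (hadd : ∀ m m' n n', R m n → R m' n' → R (m + m') (n + n')) :
    ∃ f : Algebra.GrothendieckAddGroup M ≃+ Algebra.GrothendieckAddGroup N,
      ∀ m n, R m n → f (Algebra.GrothendieckAddGroup.of m) = Algebra.GrothendieckAddGroup.of n := by
  choose φ hφ using hM
  choose ψ hψ using hN
  let e : M ≃+ N :=
    { toFun := φ
      invFun := ψ
      left_inv := fun m => h₂ _ _ _ (hψ _) (hφ m)
      right_inv := fun n => h₁ _ _ _ (hφ _) (hψ n)
      map_add' := fun m m' => h₁ _ _ _ (hφ _) (hadd _ _ _ _ (hφ m) (hφ m')) }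
  let F : Algebra.GrothendieckAddGroup M →+ Algebra.GrothendieckAddGroup N :=
    Algebra.GrothendieckAddGroup.lift (Algebra.GrothendieckAddGroup.of.comp e.toAddMonoidHom)
  let G : Algebra.GrothendieckAddGroup N →+ Algebra.GrothendieckAddGroup M :=
    Algebra.GrothendieckAddGroup.lift (Algebra.GrothendieckAddGroup.of.comp e.symm.toAddMonoidHom)
  have hF : ∀ m, F (Algebra.GrothendieckAddGroup.of m) = Algebra.GrothendieckAddGroup.of (φ m) :=
    fun m => DFunLike.congr_fun (Algebra.GrothendieckAddGroup.lift.symm_apply_apply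
      (Algebra.GrothendieckAddGroup.of.comp e.toAddMonoidHom)) m
  have hG : ∀ n, G (Algebra.GrothendieckAddGroup.of n) = Algebra.GrothendieckAddGroup.of (ψ n) :=
    fun n => DFunLike.congr_fun (Algebra.GrothendieckAddGroup.lift.symm_apply_apply
      (Algebra.GrothendieckAddGroup.of.comp e.symm.toAddMonoidHom)) n
  refine ⟨AddMonoidHom.toAddEquiv F G ?_ ?_, fun m n h => ?_⟩
  · refine Algebra.GrothendieckAddGroup.lift.symm.injective (AddMonoidHom.ext fun m => ?_)
    change G (F (Algebra.GrothendieckAddGroup.of m)) = Algebra.GrothendieckAddGroup.of m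
    rw [hF, hG]
    exact congrArg _ (e.symm_apply_apply m)
  · refine Algebra.GrothendieckAddGroup.lift.symm.injective (AddMonoidHom.ext fun n => ?_)
    change F (G (Algebra.GrothendieckAddGroup.of n)) = Algebra.GrothendieckAddGroup.of n
    rw [hG, hF]
    exact congrArg _ (e.apply_symm_apply n)
  · change F _ = _
    rw [hF, h₁ _ _ _ (hφ m) h]

/-! ### Halves of bundles -/

section Restrict

variable {X : Type w} [TopologicalSpace X] [MulAction C2 X]
  {D : Type u} [Ring D] [Algebra ℝ D] [TopologicalSpace D]
  {C : Type u} [Ring C] [Algebra ℝ C] [TopologicalSpace C]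
  {𝒟 : GAlgBundle C2 X D} {𝒞 : GAlgBundle C2 X C}

/-- Restriction of the operators for fibrewise isomorphisms. -/
def comapEquiv (θ : AlgBundleMap 𝒟 𝒞) {E E' : GBundle 𝒞} {x : X}
    (φ : E.Fib x ≃ₗ[𝒞.Fib x] E'.Fib x) : (E.comap θ).Fib x ≃ₗ[𝒟.Fib x] (E'.comap θ).Fib x :=
  { φ.toAddEquiv with map_smul' := fun d (v : E.Fib x) => map_smul φ (θ.map x d) v }

theorem continuous_act_apply (E : GBundle 𝒞) (g : C2) {Z : Type*} [TopologicalSpace Z] {π : Z → X}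
    {v : ∀ z, E.Fib (π z)} (hv : Continuous fun z => (⟨π z, v z⟩ : Tot E.Fib)) :
    Continuous fun z => (⟨g • π z, E.act g (π z) (v z)⟩ : Tot E.Fib) :=
  E.continuous_act.comp ((continuous_const (y := g)).prodMk hv)

end Restrict

section Half

variable {X : Type w} [TopologicalSpace X] [MulAction C2 X] {A : Type u} [NormedRing A]
  [NormedAlgebra ℝ A] {𝒜 : GAlgBundle C2 X A} {B : Type} [Ring B] [Algebra ℝ B]
  [Module.Finite ℝ B] {β : C2 →* (B ≃ₐ[ℝ] B)}

/-- Restriction of the operators along `𝒜 → 𝒜 ⊗ B`. -/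
abbrev GBundle.restrict (E : GBundle (tensorBundle 𝒜 B β)) : GBundle 𝒜 :=
  E.comap (tensorIncl 𝒜 B β)

/-- Multiplication by `1 ⊗ b`. -/
def GBundle.tmulEnd (E : GBundle (tensorBundle 𝒜 B β)) (b : B) (x : X) :
    E.restrict.Fib x →ₗ[𝒜.Fib x] E.restrict.Fib x where
  toFun := fun v : E.Fib x => tmulFib β (1 : 𝒜.Fib x) b • v
  map_add' := fun v w : E.Fib x => smul_add _ v w
  map_smul' := fun a (v : E.Fib x) => by
    change tmulFib β (1 : 𝒜.Fib x) b • tmulFib β a 1 • v =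
      tmulFib β a 1 • tmulFib β (1 : 𝒜.Fib x) b • v
    rw [smul_smul, smul_smul, tmulFib_mul, tmulFib_mul, one_mul, mul_one, one_mul, mul_one]

theorem GBundle.isContMap_tmulEnd (E : GBundle (tensorBundle 𝒜 B β)) (b : B) :
    IsContMap (E.tmulEnd b) :=
  E.continuous_tmulFib_smul b continuous_id

theorem IsSubbundle.injective {F : GBundle 𝒜} {E : GBundle (tensorBundle 𝒜 B β)}
    {ι : ∀ x, F.Fib x →+ E.Fib x} (h : IsSubbundle ι) (x : X) : Function.Injective (ι x) :=
  fun v w hvw => Bundle.TotalSpace.mk_inj.1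
    (h.isEmbedding.injective (congrArg (fun u => (⟨x, u⟩ : Tot E.Fib)) hvw) :
      (⟨x, v⟩ : Tot F.Fib) = ⟨x, w⟩)

/-- `E = j₀ F ⊕ j₁ F`. -/
structure IsHalf (R : HalfRep β) {F : GBundle 𝒜} {E : GBundle (tensorBundle 𝒜 B β)}
    (ι : ∀ x, F.Fib x →+ E.Fib x) : Prop extends IsSubbundle ι where
  j₀_smul : ∀ x (v : F.Fib x), tmulFib β (1 : 𝒜.Fib x) (R.j 0) • ι x v = ι x v
  existsUnique : ∀ x (w : E.Fib x), ∃! p : F.Fib x × F.Fib x,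
    w = ι x p.1 + tmulFib β (1 : 𝒜.Fib x) (R.j 1) • ι x p.2

/-- Left multiplication by b permutes the span of j₀, j₁ through the matrix r(b), and a commutes
with 1 ⊗ jₗ. This is exactly the action on the double of F. -/
theorem IsHalf.map_smul_tmul {R : HalfRep β} {F : GBundle 𝒜}
    {E : GBundle (tensorBundle 𝒜 B β)} {ι : ∀ x, F.Fib x →+ E.Fib x} (h : IsHalf R ι) {x : X}
    (a : 𝒜.Fib x) (b : B) (v : F.Fib x) (k : Fin 2) :
    tmulFib β a b • tmulFib β (1 : 𝒜.Fib x) (R.j k) • ι x v =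
      ι x ((R.r b 0 k • a) • v) + tmulFib β (1 : 𝒜.Fib x) (R.j 1) • ι x ((R.r b 1 k • a) • v) := by
  have h1 : ∀ (c : 𝒜.Fib x) (d : B), tmulFib β c d = tmulFib β 1 d * tmulFib β c 1 := fun c d => by
    rw [tmulFib_mul, one_mul, mul_one]
  rw [smul_smul, tmulFib_mul, mul_one, R.mul_j, Fin.sum_univ_two, tmulFib_add_right, tmulFib_smul,
    tmulFib_smul, add_smul, h1 _ (R.j 0), h1 _ (R.j 1), mul_smul, mul_smul, ← h.map_smul,
    ← h.map_smul, h.j₀_smul]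

variable [CompleteSpace A] [StarRing A] {s : AntiInvolution 𝒜} (hs : s.IsModelledOnStar)
  {H : Type*} [NormedAddCommGroup H] [InnerProductSpace ℝ H] [CompleteSpace H] (ρ : StarRep A H)
  [T2Space X] [ParacompactSpace X]

include hs ρ

/-- A continuous equivariant family of isomorphisms is an isomorphism. -/
theorem exists_iso {E E' : GBundle 𝒜} (φ : ∀ x, E.Fib x ≃ₗ[𝒜.Fib x] E'.Fib x)
    (hact : ∀ g x v, φ (g • x) (E.act g x v) = E'.act g x (φ x v))
    (hc : IsContMap fun x => (φ x).toLinearMap) : ∃ Φ : GBundle.Iso E E', Φ.equiv = φ := by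
  obtain ⟨g⟩ := exists_metric ρ hs E
  obtain ⟨g'⟩ := exists_metric ρ hs E'
  exact ⟨⟨φ, hact, hc, g.isContMap_symm ρ hs g' hc⟩, rfl⟩

/-- Continuity of the inverse concerns only total spaces, so it may be checked over 𝒜, where metrics
exist; no C^*-structure on A ⊗ B is needed. -/
theorem exists_iso_tensor {E E' : GBundle (tensorBundle 𝒜 B β)}
    (φ : ∀ x, E.Fib x ≃ₗ[(tensorBundle 𝒜 B β).Fib x] E'.Fib x)
    (hact : ∀ g x v, φ (g • x) (E.act g x v) = E'.act g x (φ x v))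
    (hc : Continuous fun p : Tot E.Fib => (⟨p.proj, φ p.proj p.snd⟩ : Tot E'.Fib)) :
    ∃ Φ : GBundle.Iso E E', Φ.equiv = φ := by
  obtain ⟨g⟩ := exists_metric ρ hs E.restrict
  obtain ⟨g'⟩ := exists_metric ρ hs E'.restrict
  exact ⟨⟨φ, hact, hc, g.isContMap_symm ρ hs g'
    (φ := fun x => comapEquiv (tensorIncl 𝒜 B β) (φ x)) hc⟩, rfl⟩

/-- A half of `E` determines `E`. -/
theorem IsHalf.exists_iso {R : HalfRep β} {F : GBundle 𝒜} {E : GBundle (tensorBundle 𝒜 B β)}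
    {ι : ∀ x, F.Fib x →+ E.Fib x} (h : IsHalf R ι) : ∃ Φ : GBundle.Iso (F.double R) E,
      ∀ x (v : F.Fib x × F.Fib x),
        Φ.equiv x v = ι x v.1 + tmulFib β (1 : 𝒜.Fib x) (R.j 1) • ι x v.2 := by
  let ψ : ∀ x, (F.double R).Fib x →+ E.Fib x := fun x => AddMonoidHom.mk'
    (fun v : F.Fib x × F.Fib x => ι x v.1 + tmulFib β (1 : 𝒜.Fib x) (R.j 1) • ι x v.2)
    fun v w : F.Fib x × F.Fib x => by
      change ι x (v.1 + w.1) + tmulFib β (1 : 𝒜.Fib x) (R.j 1) • ι x (v.2 + w.2) = _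
      rw [map_add, map_add, smul_add]
      abel
  have hψ : ∀ x (t : (tensorBundle 𝒜 B β).Fib x) (v : (F.double R).Fib x),
      ψ x (t • v) = t • ψ x v := fun x t v => by
    refine tmulFib_induction (P := fun t => ψ x (t • v) = t • ψ x v) (fun a b => ?_)
      (fun p q hp hq => ?_) t
    · rw [F.double_tmulFib_smul]
      change ι x ((R.r b 0 0 • a) • v.1 + (R.r b 0 1 • a) • v.2) +
        tmulFib β (1 : 𝒜.Fib x) (R.j 1) • ι x ((R.r b 1 0 • a) • v.1 + (R.r b 1 1 • a) • v.2) =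
        tmulFib β a b • (ι x v.1 + tmulFib β (1 : 𝒜.Fib x) (R.j 1) • ι x v.2)
      have h0 := h.map_smul_tmul a b v.1 0
      rw [h.j₀_smul] at h0
      rw [smul_add (tmulFib β a b), h0, h.map_smul_tmul a b v.2 1, map_add, map_add, smul_add]
      abel
    · rw [add_smul, add_smul, map_add, hp, hq]
  let φ : ∀ x, (F.double R).Fib x →ₗ[(tensorBundle 𝒜 B β).Fib x] E.Fib x := fun x =>
    { toFun := ψ x, map_add' := map_add (ψ x), map_smul' := hψ x }
  have hb : ∀ x, Function.Bijective (φ x) := fun x => by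
    refine ⟨fun v w hvw => ?_, fun w => ?_⟩
    · exact (h.existsUnique x (φ x v)).unique rfl hvw
    · obtain ⟨p, hp, -⟩ := h.existsUnique x w
      exact ⟨p, hp.symm⟩
  obtain ⟨Φ, hΦ⟩ := exists_iso_tensor hs ρ (fun x => LinearEquiv.ofBijective (φ x) (hb x))
    (fun g x v => by
      change ι (g • x) (F.act g x v.1) +
        tmulFib β 1 (R.j 1) • ι (g • x) (sgn g • F.act g x v.2) =
        E.act g x (ι x v.1 + tmulFib β 1 (R.j 1) • ι x v.2)
      rw [sgn_map (ι (g • x)), h.map_act, h.map_act, map_add, E.act_smul, act_tmulFib, R.β_j₁,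
        map_one]
      rcases Int.units_eq_one_or (sgn g) with h | h
      · simp only [h, one_smul]
      · simp only [h, one_smul, Units.neg_smul, smul_neg, tmulFib_neg_right, neg_smul])
    (by
      have h1 := h.isEmbedding.continuous.comp (GBundle.continuous_prodTop_fst F F)
      have h2 := h.isEmbedding.continuous.comp (GBundle.continuous_prodTop_snd F F)
      exact E.continuous_fibAdd h1 (E.continuous_tmulFib_smul (R.j 1) h2))
  exact ⟨Φ, fun x v => by rw [hΦ]; rfl⟩

end Half

/-! ### Corners -/

section Subbundle

variable {X : Type w} [TopologicalSpace X] [MulAction C2 X] {A : Type u} [NormedRing A]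
  [NormedAlgebra ℝ A] {𝒜 : GAlgBundle C2 X A} {B : Type} [Ring B] [Algebra ℝ B]
  [Module.Finite ℝ B] {β : C2 →* (B ≃ₐ[ℝ] B)}

/-- Subbundles with the same image are isomorphic. -/
theorem IsSubbundle.exists_iso_of_range_eq {F F' : GBundle 𝒜} {E : GBundle (tensorBundle 𝒜 B β)}
    {ι : ∀ x, F.Fib x →+ E.Fib x} {ι' : ∀ x, F'.Fib x →+ E.Fib x} (h : IsSubbundle ι)
    (h' : IsSubbundle ι') (hr : ∀ x, Set.range (ι x) = Set.range (ι' x)) :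
    Nonempty (GBundle.Iso F F') := by
  have h1 : ∀ x v, ∃ v', ι' x v' = ι x v := fun x v => by
    have : ι x v ∈ Set.range (ι' x) := hr x ▸ ⟨v, rfl⟩
    exact this
  have h2 : ∀ x v', ∃ v, ι x v = ι' x v' := fun x v' => by
    have : ι' x v' ∈ Set.range (ι x) := (hr x).symm ▸ ⟨v', rfl⟩
    exact this
  choose φ hφ using h1
  choose φ' hφ' using h2
  refine ⟨{ equiv := fun x =>
      { toFun := φ x
        map_add' := fun v w => h'.injective x (by rw [map_add, hφ, hφ, hφ, map_add])
        map_smul' := fun a v => h'.injective x (by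
          rw [RingHom.id_apply, h'.map_smul, hφ, hφ, h.map_smul])
        invFun := φ' x
        left_inv := fun v => h.injective x (by rw [hφ', hφ])
        right_inv := fun v => h'.injective x (by rw [hφ, hφ']) }
            map_act := fun g x v => h'.injective _ ?_
            continuous_toFun := h'.isEmbedding.continuous_iff.2 ?_
            continuous_invFun := h.isEmbedding.continuous_iff.2 ?_ }⟩
  · change ι' _ (φ _ (F.act g x v)) = ι' _ (F'.act g x (φ x v))
    rw [hφ, h.map_act, h'.map_act, hφ]
  · refine h.isEmbedding.continuous.congr fun p => ?_
    exact congrArg (fun u => (⟨p.proj, u⟩ : Tot E.Fib)) (hφ p.proj p.snd).symm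
  · refine h'.isEmbedding.continuous.congr fun p => ?_
    exact congrArg (fun u => (⟨p.proj, u⟩ : Tot E.Fib)) (hφ' p.proj p.snd).symm

theorem Iso.isEmbedding {C : Type u} [Ring C] [Algebra ℝ C] [TopologicalSpace C]
    {𝒞 : GAlgBundle C2 X C} {E E' : GBundle 𝒞} (Φ : GBundle.Iso E E') :
    IsEmbedding fun p : Tot E.Fib => (⟨p.proj, Φ.equiv p.proj p.snd⟩ : Tot E'.Fib) :=
  Function.LeftInverse.isEmbedding
    (f := fun p : Tot E'.Fib => (⟨p.proj, (Φ.equiv p.proj).symm p.snd⟩ : Tot E.Fib))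
    (fun p => congrArg (fun u => (⟨p.proj, u⟩ : Tot E.Fib))
      ((Φ.equiv p.proj).symm_apply_apply p.snd)) Φ.continuous_invFun Φ.continuous_toFun

theorem IsSubbundle.comp_iso {F F' : GBundle 𝒜} {E E' : GBundle (tensorBundle 𝒜 B β)}
    {ι : ∀ x, F.Fib x →+ E.Fib x} (h : IsSubbundle ι) (Ψ : GBundle.Iso F' F)
    (Φ : GBundle.Iso E E') :
    IsSubbundle (F := F') (E := E') fun x =>
      (((Φ.equiv x).toAddEquiv : E.Fib x →+ E'.Fib x).comp (ι x)).comp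
        ((Ψ.equiv x).toAddEquiv : F'.Fib x →+ F.Fib x) where
  map_smul := fun x a v => by
    change Φ.equiv x (ι x (Ψ.equiv x (a • v))) = tmulFib β a 1 • Φ.equiv x (ι x (Ψ.equiv x v))
    have h1 : Ψ.equiv x (a • v) = a • Ψ.equiv x v := (Ψ.equiv x).map_smul a v
    rw [h1, h.map_smul]
    exact (Φ.equiv x).map_smul _ _
  map_act := fun g x v => by
    change Φ.equiv _ (ι _ (Ψ.equiv _ (F'.act g x v))) = E'.act g x (Φ.equiv x (ι x (Ψ.equiv x v)))
    rw [Ψ.map_act, h.map_act, Φ.map_act]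
  isEmbedding := ((Iso.isEmbedding Φ).comp h.isEmbedding).comp (Iso.isEmbedding Ψ)

theorem IsSubbundle.prod {F F' : GBundle 𝒜} {E E' : GBundle (tensorBundle 𝒜 B β)}
    {ι : ∀ x, F.Fib x →+ E.Fib x} {ι' : ∀ x, F'.Fib x →+ E'.Fib x} (h : IsSubbundle ι)
    (h' : IsSubbundle ι') :
    IsSubbundle (F := F.prod F') (E := E.prod E') fun x => (ι x).prodMap (ι' x) where
  map_smul := fun x a v => Prod.ext (h.map_smul x a v.1) (h'.map_smul x a v.2)
  map_act := fun g x v => Prod.ext (h.map_act g x v.1) (h'.map_act g x v.2)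
  isEmbedding := by
    have hc : Continuous fun p : Tot (F.prod F').Fib =>
        (⟨p.proj, (ι p.proj p.snd.1, ι' p.proj p.snd.2)⟩ : Tot (E.prod E').Fib) :=
      GBundle.continuous_prodTop E E'
        (h.isEmbedding.continuous.comp (GBundle.continuous_prodTop_fst F F'))
        (h'.isEmbedding.continuous.comp (GBundle.continuous_prodTop_snd F F'))
    have h1 : IsEmbedding fun p : Tot (F.prod F').Fib =>
        ((⟨p.proj, p.snd.1⟩, ⟨p.proj, p.snd.2⟩) : Tot F.Fib × Tot F'.Fib) :=
      ⟨⟨rfl⟩, by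
        rintro ⟨x, v, v'⟩ ⟨y, w, w'⟩ hp
        obtain rfl : x = y := congrArg (fun q => q.1.proj) hp
        rw [Prod.mk.injEq] at hp
        have h2 : v = w := Bundle.TotalSpace.mk_inj.1 hp.1
        have h3 : v' = w' := Bundle.TotalSpace.mk_inj.1 hp.2
        rw [h2, h3]⟩
    exact IsEmbedding.of_comp hc (continuous_induced_dom (f := fun p : Tot (E.prod E').Fib =>
      ((⟨p.proj, p.snd.1⟩, ⟨p.proj, p.snd.2⟩) : Tot E.Fib × Tot E'.Fib)))
      ((h.isEmbedding.prodMap h'.isEmbedding).comp h1)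

theorem GBundle.isSubbundle_double (F : GBundle 𝒜) (R : HalfRep β) :
    IsSubbundle (F := F) (E := F.double R) fun x => AddMonoidHom.inl (F.Fib x) (F.Fib x) where
  map_smul := fun x a v => by
    rw [F.double_tmulFib_smul, map_one]
    refine Prod.ext ?_ ?_
    · change a • v = ((1 : Matrix (Fin 2) (Fin 2) ℝ) 0 0 • a) • v +
        ((1 : Matrix (Fin 2) (Fin 2) ℝ) 0 1 • a) • (0 : F.Fib x)
      simp
    · change 0 = ((1 : Matrix (Fin 2) (Fin 2) ℝ) 1 0 • a) • v +
        ((1 : Matrix (Fin 2) (Fin 2) ℝ) 1 1 • a) • (0 : F.Fib x)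
      simp
  map_act := fun g x v => Prod.ext rfl (by
    change 0 = sgn g • F.act g x 0
    rw [map_zero, smul_zero])
  isEmbedding := Function.LeftInverse.isEmbedding
    (f := fun p : Tot (F.prod F).Fib => (⟨p.proj, p.snd.1⟩ : Tot F.Fib)) (fun p => rfl)
    (GBundle.continuous_prodTop_fst F F) (GBundle.continuous_prodTop F F
      (φ := fun p : Tot F.Fib => ⟨p.proj, (p.snd, 0)⟩) continuous_id
      (F.continuous_zero.comp F.continuous_proj))

end Subbundle

/-! ### Morita equivalence between Real 𝒜⁺-bundles and their corners. -/

section Corner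

variable {X : Type w} [TopologicalSpace X] [MulAction C2 X] {A : Type u} [NormedRing A]
  [NormedAlgebra ℝ A] {𝒜 : GAlgBundle C2 X A}

theorem isCorner_double (F : GBundle 𝒜) : IsCorner F (F.double matrixHalf) := by
  refine ⟨_, F.isSubbundle_double matrixHalf, fun x v => ?_⟩
  rw [F.double_tmulFib_smul]
  have h00 : matrixHalf.r (Matrix.single 0 0 1) 0 0 = 1 :=
    Matrix.single_apply_same (α := ℝ) (0 : Fin 2) (0 : Fin 2) 1
  have h01 : matrixHalf.r (Matrix.single 0 0 1) 0 1 = 0 :=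
    Matrix.single_apply_of_ne (0 : Fin 2) (0 : Fin 2) (1 : ℝ) 0 1 (by decide)
  have h10 : matrixHalf.r (Matrix.single 0 0 1) 1 0 = 0 :=
    Matrix.single_apply_of_ne (0 : Fin 2) (0 : Fin 2) (1 : ℝ) 1 0 (by decide)
  have h11 : matrixHalf.r (Matrix.single 0 0 1) 1 1 = 0 :=
    Matrix.single_apply_of_ne (0 : Fin 2) (0 : Fin 2) (1 : ℝ) 1 1 (by decide)
  constructor
  · rintro ⟨v, rfl⟩
    refine Prod.ext ?_ ?_
    · change (matrixHalf.r (Matrix.single 0 0 1) 0 0 • (1 : 𝒜.Fib x)) • v +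
        (matrixHalf.r (Matrix.single 0 0 1) 0 1 • (1 : 𝒜.Fib x)) • (0 : F.Fib x) = v
      simp [h00, h01]
    · change (matrixHalf.r (Matrix.single 0 0 1) 1 0 • (1 : 𝒜.Fib x)) • v +
        (matrixHalf.r (Matrix.single 0 0 1) 1 1 • (1 : 𝒜.Fib x)) • (0 : F.Fib x) = 0
      simp [h10, h11]
  · intro hv
    refine ⟨v.1, Prod.ext rfl ?_⟩
    have h2 := congrArg Prod.snd hv
    change _ = (v.2 : F.Fib x) at h2
    change (0 : F.Fib x) = v.2
    rw [← h2]
    simp [h10, h11]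

/-- Decompose 1 = e₁₁ + e₂₂ with e₂₂ = e₂₁e₁₂: the components of w are e₁₁w and e₁₂w, both in the
corner. Multiplying a decomposition by e₁₁ and by e₁₂ shows its uniqueness. -/
theorem IsCorner.exists_isHalf {F : GBundle 𝒜} {E : GBundle (plusBundle 𝒜)} (h : IsCorner F E) :
    ∃ ι : ∀ x, F.Fib x →+ E.Fib x, IsHalf matrixHalf ι := by
  obtain ⟨ι, hι, hr⟩ := h
  have hmul : ∀ (x : X) (i j k l : Fin 2) (v : E.Fib x),
      tmulFib diagAction (1 : 𝒜.Fib x) (Matrix.single i j 1) •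
        tmulFib diagAction (1 : 𝒜.Fib x) (Matrix.single k l 1) • v =
      if j = k then tmulFib diagAction (1 : 𝒜.Fib x) (Matrix.single i l 1) • v else 0 :=
    fun x i j k l v => by
      rw [smul_smul, tmulFib_mul, one_mul]
      split_ifs with hjk
      · rw [hjk, Matrix.single_mul_single_same, one_mul]
      · rw [Matrix.single_mul_single_of_ne _ _ _ _ hjk, tmulFib_zero_right, zero_smul]
  have h1 : ∀ x v, tmulFib diagAction (1 : 𝒜.Fib x) (Matrix.single 0 0 1) • ι x v = ι x v :=
    fun x v => (hr x _).1 ⟨v, rfl⟩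
  refine ⟨ι, { hι with j₀_smul := h1, existsUnique := fun x w => ?_ }⟩
  have hj : matrixHalf.j 1 = Matrix.single 1 0 1 := rfl
  obtain ⟨p, hp⟩ := (hr x (tmulFib diagAction (1 : 𝒜.Fib x) (Matrix.single 0 0 1) • w)).2 (by
    rw [hmul, if_pos rfl])
  obtain ⟨q, hq⟩ := (hr x (tmulFib diagAction (1 : 𝒜.Fib x) (Matrix.single 0 1 1) • w)).2 (by
    rw [hmul, if_pos rfl])
  refine ⟨(p, q), ?_, ?_⟩
  · change w = ι x p + tmulFib diagAction (1 : 𝒜.Fib x) (matrixHalf.j 1) • ι x q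
    rw [hp, hq, hj, hmul, if_pos rfl, ← add_smul, ← tmulFib_add_right]
    have hone : (Matrix.single 0 0 1 + Matrix.single 1 1 1 : Matrix (Fin 2) (Fin 2) ℝ) = 1 := by
      ext i j; fin_cases i <;> fin_cases j <;> simp [Matrix.single]
    rw [hone, tmulFib_one, one_smul]
  · rintro ⟨p', q'⟩ (hw : w = ι x p' + tmulFib diagAction (1 : 𝒜.Fib x) (matrixHalf.j 1) • ι x q')
    rw [hj] at hw
    refine Prod.ext (hι.injective x ?_) (hι.injective x ?_)
    · change ι x p' = ι x p
      rw [hp, hw, ← h1 x q', smul_add, hmul, hmul, if_neg (by decide), h1, add_zero]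
    · change ι x q' = ι x q
      rw [hq, hw, ← h1 x p', smul_add, hmul, hmul, if_neg (by decide), if_pos rfl, h1, zero_add]

theorem IsCorner.comp_iso {F F' : GBundle 𝒜} {E E' : GBundle (plusBundle 𝒜)} (h : IsCorner F E)
    (Ψ : GBundle.Iso F' F) (Φ : GBundle.Iso E E') : IsCorner F' E' := by
  obtain ⟨ι, hι, hr⟩ := h
  refine ⟨_, hι.comp_iso Ψ Φ, fun x v => ?_⟩
  obtain ⟨v, rfl⟩ := (Φ.equiv x).surjective v
  rw [← map_smul, (Φ.equiv x).injective.eq_iff, ← hr]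
  constructor
  · rintro ⟨u, hu⟩
    exact ⟨Ψ.equiv x u, (Φ.equiv x).injective hu⟩
  · rintro ⟨u, rfl⟩
    exact ⟨(Ψ.equiv x).symm u, congrArg (fun u => Φ.equiv x (ι x u))
      ((Ψ.equiv x).apply_symm_apply u)⟩

theorem IsCorner.exists_iso_of_left {F F' : GBundle 𝒜} {E : GBundle (plusBundle 𝒜)}
    (h : IsCorner F E) (h' : IsCorner F' E) : Nonempty (GBundle.Iso F F') := by
  obtain ⟨ι, hι, hr⟩ := h
  obtain ⟨ι', hι', hr'⟩ := h'
  exact hι.exists_iso_of_range_eq hι' fun x => Set.ext fun v => (hr x v).trans (hr' x v).symm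

theorem IsCorner.prod {F F' : GBundle 𝒜} {E E' : GBundle (plusBundle 𝒜)} (h : IsCorner F E)
    (h' : IsCorner F' E') : IsCorner (F.prod F') (E.prod E') := by
  obtain ⟨ι, hι, hr⟩ := h
  obtain ⟨ι', hι', hr'⟩ := h'
  refine ⟨_, hι.prod hι', fun x v => ?_⟩
  have h2 : tmulFib diagAction (1 : 𝒜.Fib x) (Matrix.single 0 0 1) • v = v ↔
      tmulFib diagAction (1 : 𝒜.Fib x) (Matrix.single 0 0 1) • (v.1 : E.Fib x) = v.1 ∧
      tmulFib diagAction (1 : 𝒜.Fib x) (Matrix.single 0 0 1) • (v.2 : E'.Fib x) = v.2 :=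
    Prod.ext_iff
  rw [h2, ← hr, ← hr']
  constructor
  · rintro ⟨u, rfl⟩
    exact ⟨⟨u.1, rfl⟩, ⟨u.2, rfl⟩⟩
  · rintro ⟨⟨u, hu⟩, ⟨u', hu'⟩⟩
    exact ⟨(u, u'), Prod.ext hu hu'⟩

variable [CompleteSpace A] [StarRing A] {s : AntiInvolution 𝒜} (hs : s.IsModelledOnStar)
  {H : Type*} [NormedAddCommGroup H] [InnerProductSpace ℝ H] [CompleteSpace H] (ρ : StarRep A H)
  [T2Space X] [ParacompactSpace X]

include hs ρ

/-- Conjugation by diag(1, −1) fixes e₁₁, so multiplication by it is an equivariant projection. Its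
image is taken in the restriction of E to 𝒜. -/
theorem exists_isCorner (E : GBundle (plusBundle 𝒜)) : ∃ F : GBundle 𝒜, IsCorner F E := by
  have hee : (Matrix.single 0 0 1 * Matrix.single 0 0 1 : Matrix (Fin 2) (Fin 2) ℝ) =
      Matrix.single 0 0 1 := by rw [Matrix.single_mul_single_same, one_mul]
  have hidem : ∀ x (v : E.Fib x), tmulFib diagAction (1 : 𝒜.Fib x) (Matrix.single 0 0 1) •
      tmulFib diagAction (1 : 𝒜.Fib x) (Matrix.single 0 0 1) • v =
      tmulFib diagAction (1 : 𝒜.Fib x) (Matrix.single 0 0 1) • v := fun x v => by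
    rw [smul_smul, tmulFib_mul, one_mul, hee]
  have he : IsProj (E.tmulEnd (Matrix.single 0 0 1)) :=
    { cont := E.isContMap_tmulEnd _
      idem := hidem
      map_act := fun g x (v : E.Fib x) => by
        change tmulFib diagAction (1 : 𝒜.Fib (g • x)) (Matrix.single 0 0 1) • E.act g x v =
          E.act g x (tmulFib diagAction (1 : 𝒜.Fib x) (Matrix.single 0 0 1) • v)
        rw [E.act_smul, act_tmulFib, map_one]
        exact congrArg (fun b => tmulFib diagAction (1 : 𝒜.Fib (g • x)) b • E.act g x v)
          (matrixHalf.β_j₀ g).symm }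
  obtain ⟨m⟩ : Nonempty (Metric s E.restrict) := exists_metric ρ hs E.restrict
  refine ⟨imageBundle he (he.isLocallyTrivial ρ hs m),
    fun x => (LinearMap.range (E.tmulEnd (Matrix.single 0 0 1) x)).subtype.toAddMonoidHom,
    IsSubbundle.mk (F := imageBundle he (he.isLocallyTrivial ρ hs m)) (fun _ _ _ => rfl)
      (fun _ _ _ => rfl) (isEmbedding_image (E.tmulEnd (Matrix.single 0 0 1))), fun x v => ⟨?_, fun h => ?_⟩⟩
  · rintro ⟨⟨_, u, rfl⟩, rfl⟩
    exact hidem x u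
  · exact ⟨⟨v, v, h⟩, rfl⟩

variable [ContinuousSMul C2 X]

/-- The isomorphism `KR^{𝒜⁺}(X) ≅ K_G^𝒜(X)`. -/
theorem exists_corner_equiv : ∃ f : KR (plusBundle 𝒜) ≃+ KG 𝒜, ∀ E : GBundle (plusBundle 𝒜),
    (∃ F : GBundle 𝒜, IsCorner F E) ∧
      ∀ F : GBundle 𝒜, IsCorner F E → f (KG.cls E) = KG.cls F := by
  obtain ⟨f, hf⟩ := exists_grothendieck_equiv
    (fun (m : IsoClass (plusBundle 𝒜)) (n : IsoClass 𝒜) =>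
      ∃ E F, m = Quotient.mk _ E ∧ n = Quotient.mk _ F ∧ IsCorner F E)
    (by
      rintro ⟨E⟩
      obtain ⟨F, hF⟩ := exists_isCorner hs ρ E
      exact ⟨_, E, F, rfl, rfl, hF⟩)
    (by
      rintro ⟨F⟩
      exact ⟨_, _, F, rfl, rfl, isCorner_double F⟩)
    (by
      rintro _ _ _ ⟨E, F, rfl, rfl, h⟩ ⟨E', F', hE, rfl, h'⟩
      obtain ⟨Φ⟩ := Quotient.exact hE
      exact Quotient.sound ((h.comp_iso (GBundle.Iso.refl F) Φ).exists_iso_of_left h'))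
    (by
      rintro _ _ _ ⟨E, F, rfl, rfl, h⟩ ⟨E', F', rfl, hF, h'⟩
      obtain ⟨Ψ⟩ := Quotient.exact hF
      -- Two 𝒜⁺-bundles with isomorphic corners are both isomorphic to the double of the common
      -- corner.
      obtain ⟨ι, hι⟩ := h.exists_isHalf
      obtain ⟨ι', hι'⟩ := (h'.comp_iso Ψ (GBundle.Iso.refl E')).exists_isHalf
      obtain ⟨Φ, -⟩ := hι.exists_iso hs ρ
      obtain ⟨Φ', -⟩ := hι'.exists_iso hs ρ
      exact Quotient.sound ⟨Φ.symm.trans Φ'⟩)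
    (by
      rintro _ _ _ _ ⟨E, F, rfl, rfl, h⟩ ⟨E', F', rfl, rfl, h'⟩
      exact ⟨E.prod E', F.prod F', rfl, rfl, h.prod h'⟩)
  exact ⟨f, fun E => ⟨exists_isCorner hs ρ E, fun F hF => hf _ _ ⟨E, F, rfl, rfl, hF⟩⟩⟩

end Corner

/-! ### Invariant metrics -/

/-- The inverse is the action of g⁻¹, whose target is the fibre at g⁻¹gx rather than x. Comparing in
the total space avoids the cast. -/
theorem act_bijective_of {G : Type*} [Group G] {X : Type*} [MulAction G X] {F : X → Type*}
    (act : ∀ (g : G) (x : X), F x → F (g • x))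
    (act_one : ∀ x v, (⟨(1 : G) • x, act 1 x v⟩ : Tot F) = ⟨x, v⟩)
    (act_mul : ∀ g h x v, (⟨(g * h) • x, act (g * h) x v⟩ : Tot F) =
      ⟨g • h • x, act g (h • x) (act h x v)⟩) (g : G) (x : X) :
    Function.Bijective (act g x) := by
  have h1 : ∀ (h k : G), h * k = 1 → ∀ (y : X) (v : F y),
      (⟨h • k • y, act h (k • y) (act k y v)⟩ : Tot F) = ⟨y, v⟩ := fun h k hk y v => by
    rw [← act_mul, hk, act_one]
  constructor
  · intro v w hvw
    have h2 := h1 g⁻¹ g (inv_mul_cancel g) x v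
    rw [hvw, h1 g⁻¹ g (inv_mul_cancel g) x w] at h2
    exact (Bundle.TotalSpace.mk_inj.1 h2).symm
  · intro u
    have key : ∀ p : Tot F, p.proj = x → (⟨g • p.proj, act g p.proj p.snd⟩ : Tot F) = ⟨g • x, u⟩ →
        ∃ v, act g x v = u := by
      rintro ⟨y, v⟩ rfl h
      exact ⟨v, Bundle.TotalSpace.mk_inj.1 h⟩
    exact key ⟨g⁻¹ • g • x, act g⁻¹ (g • x) u⟩ (inv_smul_smul g x)
      (h1 g g⁻¹ (mul_inv_cancel g) (g • x) u)

section ActEquiv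

variable {G : Type} [Group G] [TopologicalSpace G] {X : Type w} [TopologicalSpace X]
  [MulAction G X] {A : Type u} [Ring A] [Algebra ℝ A] [TopologicalSpace A] {𝒜 : GAlgBundle G X A}

/-- The action of a group element on the fibre of an algebra bundle. -/
def GAlgBundle.actEquiv (𝒜 : GAlgBundle G X A) (g : G) (x : X) : 𝒜.Fib x ≃ₐ[ℝ] 𝒜.Fib (g • x) :=
  AlgEquiv.ofBijective (𝒜.act g x)
    (act_bijective_of (fun g x => 𝒜.act g x) 𝒜.act_one 𝒜.act_mul g x)

/-- The action of a group element on the fibre of a bundle. -/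
def GBundle.actEquiv (E : GBundle 𝒜) (g : G) (x : X) : E.Fib x ≃+ E.Fib (g • x) :=
  AddEquiv.ofBijective (E.act g x)
    (act_bijective_of (fun g x => E.act g x) E.act_one E.act_mul g x)

theorem GAlgBundle.act_actEquiv_symm (𝒜 : GAlgBundle G X A) (g : G) (x : X) (a : 𝒜.Fib (g • x)) :
    𝒜.act g x ((𝒜.actEquiv g x).symm a) = a :=
  (𝒜.actEquiv g x).apply_symm_apply a

theorem GBundle.act_actEquiv_symm (E : GBundle 𝒜) (g : G) (x : X) (v : E.Fib (g • x)) :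
    E.act g x ((E.actEquiv g x).symm v) = v :=
  (E.actEquiv g x).apply_symm_apply v

theorem GAlgBundle.continuous_actEquiv_symm (𝒜 : GAlgBundle G X A) (g : G) {Z : Type*}
    [TopologicalSpace Z] {π : Z → X} {a : ∀ z, 𝒜.Fib (g • π z)}
    (ha : Continuous fun z => (⟨g • π z, a z⟩ : Tot 𝒜.Fib)) :
    Continuous fun z => (⟨π z, (𝒜.actEquiv g (π z)).symm (a z)⟩ : Tot 𝒜.Fib) := by
  refine (𝒜.continuous_act.comp ((continuous_const (y := g⁻¹)).prodMk ha)).congr fun z => ?_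
  change (⟨g⁻¹ • g • π z, 𝒜.act g⁻¹ (g • π z) (a z)⟩ : Tot 𝒜.Fib) = _
  obtain ⟨b, hb⟩ := (𝒜.actEquiv g (π z)).surjective (a z)
  rw [← hb, AlgEquiv.symm_apply_apply]
  change (⟨g⁻¹ • g • π z, 𝒜.act g⁻¹ (g • π z) (𝒜.act g (π z) b)⟩ : Tot 𝒜.Fib) = _
  rw [← 𝒜.act_mul, inv_mul_cancel, 𝒜.act_one]

end ActEquiv

section Forms

variable {X : Type w} [TopologicalSpace X] [MulAction C2 X] {A : Type u} [NormedRing A]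
  [NormedAlgebra ℝ A] {𝒜 : GAlgBundle C2 X A} {s : AntiInvolution 𝒜} {E E' : GBundle 𝒜}

/-- The pull-back of a form under the action of a group element. -/
def HForm.pull (b : HForm s E) (γ : C2) : HForm s E where
  form := fun x => transportForm (𝒜.actEquiv γ x).symm (E.actEquiv γ x).symm
    (symm_smul_of_semilinear _ _ (E.act_smul γ x)) (b.form (γ • x))
  herm := fun x v w => by
    refine (𝒜.actEquiv γ x).injective ?_
    change 𝒜.act γ x _ = 𝒜.act γ x (s.dag x _)
    rw [← s.dag_act]
    exact ((𝒜.act_actEquiv_symm γ x _).trans (b.herm _ _ _)).trans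
      (congrArg _ (𝒜.act_actEquiv_symm γ x _).symm)
  continuous_form := by
    refine 𝒜.continuous_actEquiv_symm γ (b.continuous_apply (π := fun p : Tot (E.prod E).Fib => γ • p.proj)
      (v := fun p => E.act γ p.proj p.snd.1) (w := fun p => E.act γ p.proj p.snd.2) ?_ ?_)
    · exact continuous_act_apply E γ (GBundle.continuous_prodTop_fst E E)
    · exact continuous_act_apply E γ (GBundle.continuous_prodTop_snd E E)

theorem HForm.act_pull (b : HForm s E) (γ : C2) (x : X) (v w : E.Fib x) :
    𝒜.act γ x ((b.pull γ).form x v w) = b.form (γ • x) (E.act γ x v) (E.act γ x w) :=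
  𝒜.act_actEquiv_symm γ x _

/-- Moving by δ turns the pull-back by γ into the pull-back by γδ, so the action permutes the terms
of a sum of pull-backs over the group. -/
theorem HForm.pull_act (b : HForm s E) (γ δ : C2) (x : X) (v w : E.Fib x) :
    (b.pull γ).form (δ • x) (E.act δ x v) (E.act δ x w) =
      𝒜.act δ x ((b.pull (γ * δ)).form x v w) := by
  refine (𝒜.actEquiv γ (δ • x)).injective ?_
  change 𝒜.act γ (δ • x) _ = 𝒜.act γ (δ • x) _
  rw [b.act_pull]
  have h1 : (⟨(γ * δ) • x, b.form _ (E.act (γ * δ) x v) (E.act (γ * δ) x w)⟩ : Tot 𝒜.Fib) =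
      ⟨γ • δ • x, b.form _ (E.act γ _ (E.act δ x v)) (E.act γ _ (E.act δ x w))⟩ :=
    congrArg (fun p : Tot (E.prod E).Fib => (⟨p.proj, b.form p.proj p.snd.1 p.snd.2⟩ : Tot 𝒜.Fib))
      ((E.prod E).act_mul γ δ x (v, w))
  rw [← b.act_pull, 𝒜.act_mul] at h1
  exact (Bundle.TotalSpace.mk_inj.1 h1).symm

/-- The form is invariant under the group. -/
def HForm.IsInvariant (b : HForm s E) : Prop :=
  ∀ γ x v w, b.form (γ • x) (E.act γ x v) (E.act γ x w) = 𝒜.act γ x (b.form x v w)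

/-- The pull-back of a form under a bundle map. -/
def HForm.comp (b : HForm s E') (φ : ∀ x, E.Fib x →ₗ[𝒜.Fib x] E'.Fib x) (hφ : IsContMap φ) :
    HForm s E where
  form := fun x => AddMonoidHom.mk' (fun v => b.form x (φ x v) ∘ₗ φ x) fun v w => by
    rw [map_add, map_add]; rfl
  herm := fun x v w => b.herm x (φ x v) (φ x w)
  continuous_form := b.continuous_apply (hφ.comp_continuous (GBundle.continuous_prodTop_fst E E))
    (hφ.comp_continuous (GBundle.continuous_prodTop_snd E E))

/-- The pull-back of a metric under an isomorphism. -/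
def Metric.comp (g : Metric s E') (φ : ∀ x, E.Fib x ≃ₗ[𝒜.Fib x] E'.Fib x)
    (hφ : IsContMap fun x => (φ x).toLinearMap) : Metric s E where
  toHForm := g.toHForm.comp (fun x => (φ x).toLinearMap) hφ
  nonneg := fun x v => g.nonneg x (φ x v)
  bijective := fun x => by
    refine ⟨fun v w h => (φ x).injective ((g.bijective x).1 (LinearMap.ext fun u => ?_)),
      fun f => ?_⟩
    · have h1 := LinearMap.congr_fun h ((φ x).symm u)
      change g.form x (φ x v) (φ x _) = g.form x (φ x w) (φ x _) at h1
      rwa [LinearEquiv.apply_symm_apply] at h1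
    · obtain ⟨v, hv⟩ := (g.bijective x).2 (f ∘ₗ (φ x).symm.toLinearMap)
      refine ⟨(φ x).symm v, LinearMap.ext fun u => ?_⟩
      change g.form x (φ x ((φ x).symm v)) (φ x u) = f u
      rw [LinearEquiv.apply_symm_apply, hv]
      exact congrArg f ((φ x).symm_apply_apply u)

/-- The pull-back of a metric under the action of a group element. -/
def Metric.pull (g : Metric s E) (γ : C2) : Metric s E where
  toHForm := g.toHForm.pull γ
  nonneg := fun x v => by
    obtain ⟨a, ha⟩ := g.nonneg (γ • x) (E.act γ x v)
    obtain ⟨c, rfl⟩ := (𝒜.actEquiv γ x).surjective a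
    refine ⟨c, (𝒜.actEquiv γ x).injective ?_⟩
    change 𝒜.act γ x _ = 𝒜.act γ x _
    rw [g.act_pull, ha, map_mul, ← s.dag_act]
    rfl
  bijective := fun x => transportForm_bijective _ _
    (symm_smul_of_semilinear _ _ (E.act_smul γ x)) (g.bijective (γ • x))

variable [CompleteSpace A] [StarRing A] (hs : s.IsModelledOnStar)
  {H : Type*} [NormedAddCommGroup H] [InnerProductSpace ℝ H] [CompleteSpace H] (ρ : StarRep A H)

include hs ρ

theorem Metric.exists_add (g h : Metric s E) :
    ∃ k : Metric s E, ∀ x v w, k.form x v w = g.form x v w + h.form x v w := by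
  have hb : ∀ x, IsPosFormAt s x (g.form x + h.form x) ∧
      Function.Bijective (g.form x + h.form x) := fun x =>
    (E.exists_frame x).elim fun F => IsPosFormAt.add_bijective hs ρ x F (g.isPosFormAt x)
      (g.bijective x).2 (h.isPosFormAt x)
  exact ⟨{ form := fun x => g.form x + h.form x
           herm := fun x => letI := s.starRing x; (hb x).1.herm
           continuous_form := continuous_fibAdd 𝒜 g.continuous_form h.continuous_form
           nonneg := fun x => letI := s.starRing x; (hb x).1.nonneg
           bijective := fun x => (hb x).2 }, fun _ _ _ => rfl⟩

variable [T2Space X] [ParacompactSpace X]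

/-- The sum of the pull-backs of any metric under 1 and τ; no division by two is required. -/
theorem exists_invariant_metric (E : GBundle 𝒜) :
    ∃ g : Metric s E, g.IsInvariant := by
  obtain ⟨g⟩ : Nonempty (Metric s E) := exists_metric ρ hs E
  obtain ⟨k, hk⟩ := (g.pull 1).exists_add hs ρ (g.pull (Multiplicative.ofAdd 1))
  refine ⟨k, fun γ x v w => ?_⟩
  have h1 : ∀ δ, (g.pull δ).form (γ • x) (E.act γ x v) (E.act γ x w) =
      𝒜.act γ x ((g.pull (δ * γ)).form x v w) := fun δ => g.toHForm.pull_act δ γ x v w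
  have hC : ∀ γ : C2, γ = 1 ∨ γ = Multiplicative.ofAdd 1 := by decide
  have hτ : (Multiplicative.ofAdd 1 * Multiplicative.ofAdd 1 : C2) = 1 := by decide
  rw [hk, hk, h1, h1, map_add]
  rcases hC γ with rfl | rfl
  · rw [mul_one, mul_one]
  · rw [one_mul, hτ, add_comm]

end Forms

/-! ### Equivariance of representing operators and of square roots. -/

section Sqrt

variable {X : Type w} [TopologicalSpace X] [MulAction C2 X] {A : Type u} [NormedRing A]
  [NormedAlgebra ℝ A] {𝒜 : GAlgBundle C2 X A} {s : AntiInvolution 𝒜} {E : GBundle 𝒜}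

theorem Metric.op_act (g : Metric s E) (hg : g.IsInvariant) (b : HForm s E) (hb : b.IsInvariant)
    (γ : C2) (x : X) (v : E.Fib x) : g.op b (γ • x) (E.act γ x v) = E.act γ x (g.op b x v) := by
  refine (g.bijective _).1 (LinearMap.ext fun w => ?_)
  obtain ⟨w, rfl⟩ := (E.actEquiv γ x).surjective w
  change g.form _ _ (E.act γ x w) = g.form _ _ (E.act γ x w)
  rw [g.op_spec, hg, hb, g.op_spec]

theorem Metric.op_symm (g : Metric s E) (b : HForm s E) (x : X) (v w : E.Fib x) :
    g.form x (g.op b x v) w = g.form x v (g.op b x w) := by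
  rw [g.op_spec, g.herm x _ v, g.op_spec, ← b.herm]

/-- The square root of an equivariant family of operators is equivariant. -/
theorem Metric.sqrt_act (g : Metric s E) (hg : g.IsInvariant)
    {S Y : ∀ x, E.Fib x →ₗ[𝒜.Fib x] E.Fib x}
    (hS : ∀ γ x v, S (γ • x) (E.act γ x v) = E.act γ x (S x v))
    (hY : ∀ x, (IsPosEndoAt s x (g.form x) (Y x) ∧ ∀ v, Y x (Y x v) = S x v) ∧
        ∀ Z : E.Fib x →ₗ[𝒜.Fib x] E.Fib x, IsPosEndoAt s x (g.form x) Z →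
          (∀ v, Z (Z v) = S x v) → Z = Y x) (γ : C2) (x : X) (v : E.Fib x) :
    Y (γ • x) (E.act γ x v) = E.act γ x (Y x v) := by
  -- The root at γx, transported back to x by γ, is another positive root of S there because g is
  -- invariant; uniqueness forces it to be Y at x.
  let Z : E.Fib x →ₗ[𝒜.Fib x] E.Fib x :=
    { toFun := fun v => (E.actEquiv γ x).symm (Y (γ • x) (E.act γ x v))
      map_add' := fun v w => by rw [map_add, map_add, map_add]
      map_smul' := fun a v => by
        rw [E.act_smul, map_smul]
        refine (E.actEquiv γ x).injective ?_
        rw [AddEquiv.apply_symm_apply]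
        change _ = E.act γ x (a • _)
        rw [E.act_smul]
        exact congrArg _ (E.act_actEquiv_symm γ x _).symm }
  have hZ : ∀ v, E.act γ x (Z v) = Y (γ • x) (E.act γ x v) := fun v => E.act_actEquiv_symm γ x _
  have h1 : Z = Y x := by
    refine (hY x).2 Z ?_ fun v => ?_
    · obtain ⟨⟨hsym, hnn⟩, -⟩ := (hY (γ • x)).1
      refine @IsPosEndo.mk _ _ _ (s.starRing x) _ _ _ _ (fun v w => ?_) fun v => ?_
      · refine (𝒜.actEquiv γ x).injective ?_
        change 𝒜.act γ x _ = 𝒜.act γ x _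
        rw [← hg, ← hg, hZ, hZ, hsym]
      · obtain ⟨a, ha⟩ := hnn (E.act γ x v)
        obtain ⟨c, rfl⟩ := (𝒜.actEquiv γ x).surjective a
        refine ⟨c, (𝒜.actEquiv γ x).injective ?_⟩
        change 𝒜.act γ x _ = 𝒜.act γ x _
        rw [← hg, hZ, ha, map_mul]
        exact congrArg _ (s.dag_act γ x c)
    · refine (E.actEquiv γ x).injective ?_
      change E.act γ x _ = E.act γ x _
      rw [hZ, hZ, (hY (γ • x)).1.2, hS]
  rw [← hZ, h1]

end Sqrt

/-! ### Symmetric forms over `𝒜 ⊗ ℂ` and their real parts -/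

section Complex

variable {X : Type w} [TopologicalSpace X] [MulAction C2 X] {A : Type u} [NormedRing A]
  [NormedAlgebra ℝ A] {𝒜 : GAlgBundle C2 X A} {s : AntiInvolution 𝒜} {x : X}

/-- The real part of an element of `𝒜_x ⊗ ℂ`. -/
def reFib (x : X) : (complexBundle 𝒜).Fib x →+ 𝒜.Fib x :=
  fibSlice conjAction Complex.reLm x

/-- The element `1 ⊗ i` of `𝒜_x ⊗ ℂ`. -/
def imUnit (𝒜 : GAlgBundle C2 X A) (x : X) : (complexBundle 𝒜).Fib x :=
  tmulFib conjAction (1 : 𝒜.Fib x) Complex.I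

theorem reFib_tmulFib (a : 𝒜.Fib x) (z : ℂ) : reFib x (tmulFib conjAction a z) = z.re • a :=
  fibSlice_tmulFib _ a z

theorem reFib_one (a : 𝒜.Fib x) : reFib x (tmulFib conjAction a 1) = a := by
  rw [reFib_tmulFib, Complex.one_re, one_smul]

theorem reFib_I (a : 𝒜.Fib x) : reFib x (tmulFib conjAction a Complex.I) = 0 := by
  rw [reFib_tmulFib, Complex.I_re, zero_smul]

theorem reFib_smul (a : 𝒜.Fib x) (t : (complexBundle 𝒜).Fib x) :
    reFib x (tmulFib conjAction a 1 * t) = a * reFib x t :=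
  fibSlice_tmulFib_mul _ a t

theorem imUnit_mul_tmulFib (a : 𝒜.Fib x) (z : ℂ) :
    imUnit 𝒜 x * tmulFib conjAction a z = tmulFib conjAction a (Complex.I * z) := by
  rw [imUnit, tmulFib_mul, one_mul]

theorem imUnit_mul_imUnit : imUnit 𝒜 x * imUnit 𝒜 x = -1 := by
  rw [imUnit, tmulFib_mul, one_mul, Complex.I_mul_I, tmulFib_neg_right, tmulFib_one]

theorem mul_imUnit (t : (complexBundle 𝒜).Fib x) : t * imUnit 𝒜 x = imUnit 𝒜 x * t := by
  refine tmulFib_induction (P := fun t => t * imUnit 𝒜 x = imUnit 𝒜 x * t) (fun a z => ?_)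
    (fun p q hp hq => ?_) t
  · rw [imUnit_mul_tmulFib, imUnit, tmulFib_mul, mul_one, mul_comm]
  · rw [add_mul, mul_add, hp, hq]

/-- The imaginary part of t is −Re(it), so real parts of t and of it determine t. Identities over 𝒜
⊗ ℂ are checked below by comparing these two. -/
theorem eq_reFib (t : (complexBundle 𝒜).Fib x) :
    t = tmulFib conjAction (reFib x t) 1 +
      tmulFib conjAction (-reFib x (imUnit 𝒜 x * t)) Complex.I := by
  refine tmulFib_induction (P := fun t => t = tmulFib conjAction (reFib x t) 1 +
      tmulFib conjAction (-reFib x (imUnit 𝒜 x * t)) Complex.I) (fun a z => ?_)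
    (fun p q hp hq => ?_) t
  · rw [imUnit_mul_tmulFib, reFib_tmulFib, reFib_tmulFib, ← neg_smul, ← tmulFib_smul,
      ← tmulFib_smul, ← tmulFib_add_right]
    congr 1
    apply Complex.ext <;> simp
  · rw [mul_add, map_add, map_add, neg_add, tmulFib_add_left, tmulFib_add_left]
    nth_rw 1 [hp, hq]
    abel

theorem reFib_ext {t t' : (complexBundle 𝒜).Fib x} (h : reFib x t = reFib x t')
    (h' : reFib x (imUnit 𝒜 x * t) = reFib x (imUnit 𝒜 x * t')) : t = t' := by
  rw [eq_reFib t, eq_reFib t', h, h']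

theorem reFib_act (γ : C2) (t : (complexBundle 𝒜).Fib x) :
    reFib (γ • x) ((complexBundle 𝒜).act γ x t) = 𝒜.act γ x (reFib x t) := by
  refine tmulFib_induction (P := fun t => reFib (γ • x) ((complexBundle 𝒜).act γ x t) =
    𝒜.act γ x (reFib x t)) (fun a z => ?_) (fun p q hp hq => ?_) t
  · rw [act_tmulFib, reFib_tmulFib, reFib_tmulFib, map_smul]
    congr 1
    rcases ofInvolution_cases Complex.conjAe (by ext z; simp) γ with ⟨h, -⟩ | ⟨h, -⟩
    · rw [conjAction, h]; rfl
    · rw [conjAction, h]; simp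
  · rw [map_add, map_add, map_add, hp, hq, map_add]

theorem act_imUnit (γ : C2) (x : X) :
    (complexBundle 𝒜).act γ x (imUnit 𝒜 x) = sgn γ • imUnit 𝒜 (γ • x) := by
  rw [imUnit, act_tmulFib, map_one]
  have h : conjAction γ Complex.I = sgn γ • Complex.I := complexHalf.β_j₁ γ
  rw [h]
  rcases Int.units_eq_one_or (sgn γ) with h | h
  · rw [h, one_smul, one_smul]; rfl
  · rw [h, Units.neg_smul, one_smul, Units.neg_smul, one_smul, tmulFib_neg_right]; rfl

theorem complexDag_tmulFib (a : 𝒜.Fib x) (z : ℂ) :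
    (complexDag s).dag x (tmulFib conjAction a z) = tmulFib conjAction (s.dag x a) z := rfl

theorem reFib_dag (t : (complexBundle 𝒜).Fib x) :
    reFib x ((complexDag s).dag x t) = s.dag x (reFib x t) := by
  refine tmulFib_induction (P := fun t => reFib x ((complexDag s).dag x t) = s.dag x (reFib x t))
    (fun a z => ?_) (fun p q hp hq => ?_) t
  · rw [complexDag_tmulFib, reFib_tmulFib, reFib_tmulFib, map_smul]
  · rw [map_add, map_add, hp, hq, map_add, map_add]

theorem dag_one (s : AntiInvolution 𝒜) (x : X) : s.dag x 1 = 1 :=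
  letI := s.starRing x
  star_one (𝒜.Fib x)

/-- The anti-involution is linear, not conjugate-linear, in the complex factor. For this reason i is
self-adjoint for the real part of a symmetric form, whereas for a hermitian one it would be skew. -/
theorem complexDag_imUnit : (complexDag s).dag x (imUnit 𝒜 x) = imUnit 𝒜 x := by
  rw [imUnit, complexDag_tmulFib, dag_one]

theorem continuous_reFib {Z : Type*} [TopologicalSpace Z] {π : Z → X}
    {t : ∀ z, (complexBundle 𝒜).Fib (π z)}
    (ht : Continuous fun z => (⟨π z, t z⟩ : Tot (complexBundle 𝒜).Fib)) :
    Continuous fun z => (⟨π z, reFib (π z) (t z)⟩ : Tot 𝒜.Fib) :=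
  continuous_tensor_iff.1 ht Complex.reLm

/-! #### The operator `i` -/

/-- Multiplication by `i`. -/
abbrev GBundle.mulI (E : GBundle (complexBundle 𝒜)) (x : X) :
    E.restrict.Fib x →ₗ[𝒜.Fib x] E.restrict.Fib x :=
  E.tmulEnd Complex.I x

theorem GBundle.mulI_mulI (E : GBundle (complexBundle 𝒜)) (v : E.restrict.Fib x) :
    E.mulI x (E.mulI x v) = -v := by
  let v' : E.Fib x := v
  change imUnit 𝒜 x • imUnit 𝒜 x • v' = -v'
  rw [smul_smul, imUnit_mul_imUnit, neg_smul, one_smul]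

theorem GBundle.mulI_act (E : GBundle (complexBundle 𝒜)) (γ : C2) (v : E.restrict.Fib x) :
    E.mulI (γ • x) (E.restrict.act γ x v) = sgn γ • E.restrict.act γ x (E.mulI x v) := by
  let v' : E.Fib x := v
  change imUnit 𝒜 (γ • x) • E.act γ x v' = sgn γ • E.act γ x (imUnit 𝒜 x • v')
  rw [E.act_smul, act_imUnit]
  rcases Int.units_eq_one_or (sgn γ) with h | h
  · rw [h, one_smul, one_smul]
  · rw [h, Units.neg_smul, one_smul, Units.neg_smul, one_smul, neg_smul, neg_neg]

theorem GBundle.isContMap_mulI (E : GBundle (complexBundle 𝒜)) : IsContMap E.mulI :=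
  E.isContMap_tmulEnd _

theorem GBundle.tmulFib_smul_eq (E : GBundle (complexBundle 𝒜)) (a : 𝒜.Fib x) (z : ℂ)
    (v : E.Fib x) : tmulFib conjAction a z • v =
      tmulFib conjAction (z.re • a) 1 • v + tmulFib conjAction (z.im • a) 1 • imUnit 𝒜 x • v := by
  rw [smul_smul, imUnit, tmulFib_mul, one_mul, mul_one, ← add_smul, ← tmulFib_smul,
    ← tmulFib_smul, ← tmulFib_add_right]
  congr 2
  apply Complex.ext <;> simp

/-- The `𝒜 ⊗ ℂ`-linear functional with a given real part, as an additive map. -/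
def GBundle.complexifyHom (E : GBundle (complexBundle 𝒜)) (x : X)
    (f : E.restrict.Fib x →ₗ[𝒜.Fib x] 𝒜.Fib x) : E.Fib x →+ (complexBundle 𝒜).Fib x :=
  AddMonoidHom.mk' (fun v : E.restrict.Fib x =>
    tmulFib conjAction (f v) 1 + tmulFib conjAction (-f (E.mulI x v)) Complex.I)
    fun v w : E.restrict.Fib x => by
      change tmulFib conjAction (f (v + w)) 1 +
        tmulFib conjAction (-f (E.mulI x (v + w))) Complex.I = _
      rw [map_add, map_add, map_add, neg_add, tmulFib_add_left, tmulFib_add_left]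
      abel

theorem GBundle.complexifyHom_smul (E : GBundle (complexBundle 𝒜))
    (f : E.restrict.Fib x →ₗ[𝒜.Fib x] 𝒜.Fib x) (t : (complexBundle 𝒜).Fib x) (v : E.Fib x) :
    E.complexifyHom x f (t • v) = t * E.complexifyHom x f v := by
  refine tmulFib_induction (P := fun t => E.complexifyHom x f (t • v) =
    t * E.complexifyHom x f v) (fun a z => ?_) (fun p q hp hq => ?_) t
  · let v' : E.restrict.Fib x := v
    have h1 : f ((z.re • a) • v' + (z.im • a) • E.mulI x v') =
        (z.re • a) * f v' + (z.im • a) * f (E.mulI x v') := by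
      rw [map_add, map_smul, map_smul, smul_eq_mul, smul_eq_mul]
    have h2 : f (E.mulI x ((z.re • a) • v' + (z.im • a) • E.mulI x v')) =
        (z.re • a) * f (E.mulI x v') - (z.im • a) * f v' := by
      rw [map_add, map_smul, map_smul, E.mulI_mulI, map_add, map_smul, map_smul, map_neg,
        sub_eq_add_neg, ← mul_neg, smul_eq_mul, smul_eq_mul]
    rw [E.tmulFib_smul_eq]
    refine (congrArg₂ (fun p q => tmulFib conjAction p 1 + tmulFib conjAction (-q) Complex.I)
      h1 h2).trans ?_
    change _ = tmulFib conjAction a z * (tmulFib conjAction (f v') 1 +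
      tmulFib conjAction (-f (E.mulI x v')) Complex.I)
    rw [mul_add, tmulFib_mul, tmulFib_mul, mul_one]
    refine reFib_ext ?_ ?_
    · simp only [map_add, reFib_tmulFib, Complex.one_re, Complex.I_re, Complex.mul_I_re,
        zero_smul, one_smul, neg_zero, add_zero, smul_mul_assoc, mul_neg, smul_neg, neg_smul, neg_neg]
    · simp only [mul_add, imUnit_mul_tmulFib, map_add, reFib_tmulFib, mul_one, Complex.I_re,
        Complex.I_mul_I, Complex.neg_re, Complex.one_re, Complex.I_mul_re,
        Complex.mul_I_im, zero_smul, one_smul, zero_add, smul_mul_assoc, mul_neg, smul_neg,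
        neg_smul, neg_neg]
      abel
  · rw [add_smul, map_add, hp, hq, add_mul]

/-- The `𝒜 ⊗ ℂ`-linear functional with a given real part. -/
def GBundle.complexify (E : GBundle (complexBundle 𝒜)) (x : X)
    (f : E.restrict.Fib x →ₗ[𝒜.Fib x] 𝒜.Fib x) :
    E.Fib x →ₗ[(complexBundle 𝒜).Fib x] (complexBundle 𝒜).Fib x :=
  { E.complexifyHom x f with map_smul' := E.complexifyHom_smul f }

theorem GBundle.reFib_complexify (E : GBundle (complexBundle 𝒜))
    (f : E.restrict.Fib x →ₗ[𝒜.Fib x] 𝒜.Fib x) (v : E.Fib x) :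
    reFib x (E.complexify x f v) = f v := by
  change reFib x (tmulFib conjAction (f v) 1 +
    tmulFib conjAction (-f (E.mulI x v)) Complex.I) = f v
  rw [map_add, reFib_one, reFib_I, add_zero]

theorem GBundle.reFib_imUnit_mul (E : GBundle (complexBundle 𝒜))
    (f : E.Fib x →ₗ[(complexBundle 𝒜).Fib x] (complexBundle 𝒜).Fib x) (v : E.Fib x) :
    reFib x (imUnit 𝒜 x * f v) = reFib x (f (imUnit 𝒜 x • v)) := by
  rw [map_smul, smul_eq_mul]

/-- The real part of a complex linear functional. -/
def GBundle.reDual (E : GBundle (complexBundle 𝒜)) (x : X)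
    (f : E.Fib x →ₗ[(complexBundle 𝒜).Fib x] (complexBundle 𝒜).Fib x) :
    E.restrict.Fib x →ₗ[𝒜.Fib x] 𝒜.Fib x where
  toFun := fun v : E.Fib x => reFib x (f v)
  map_add' := fun v w : E.Fib x => (congrArg (reFib x) (map_add f v w)).trans (map_add _ _ _)
  map_smul' := fun a (v : E.Fib x) => (congrArg (reFib x) (map_smul f (tmulFib conjAction a 1) v)).trans
    (reFib_smul a (f v))

/-- Re f determines f since Re(i f(v)) = Re f(iv). With `complexify` as inverse, complex functionals
correspond to real ones, so nondegeneracy can be tested on real parts. -/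
theorem GBundle.reDual_injective (E : GBundle (complexBundle 𝒜)) (x : X) :
    Function.Injective (E.reDual x) := fun f f' h => by
  have h1 : ∀ v : E.Fib x, reFib x (f v) = reFib x (f' v) := fun v => LinearMap.congr_fun h v
  refine LinearMap.ext fun v => reFib_ext (h1 v) ?_
  rw [E.reFib_imUnit_mul, E.reFib_imUnit_mul, h1]

theorem GBundle.reDual_complexify (E : GBundle (complexBundle 𝒜)) (x : X)
    (f : E.restrict.Fib x →ₗ[𝒜.Fib x] 𝒜.Fib x) : E.reDual x (E.complexify x f) = f :=
  LinearMap.ext fun v => E.reFib_complexify f v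

/-! #### Real parts of symmetric forms -/

theorem SymBundle.symm_one (P : SymBundle (complexDag s) 1) (v w : P.E.Fib x) :
    P.B.form x w v = (complexDag s).dag x (P.B.form x v w) :=
  (P.B.symm x v w).trans (one_smul _ _)

/-- The real part of a symmetric form. -/
def SymBundle.reForm (P : SymBundle (complexDag s) 1) : HForm s P.E.restrict where
  form := fun x => AddMonoidHom.mk' (fun v : P.E.Fib x => P.E.reDual x (P.B.form x v))
    fun v w : P.E.Fib x => LinearMap.ext fun u : P.E.Fib x => by
      change reFib x (P.B.form x (v + w) u) = reFib x (P.B.form x v u) + reFib x (P.B.form x w u)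
      rw [map_add, LinearMap.add_apply, map_add]
  herm := fun x v w => (congrArg (reFib x) (P.symm_one v w)).trans (reFib_dag _)
  continuous_form := continuous_reFib P.B.continuous_form

theorem SymBundle.reForm_isInvariant (P : SymBundle (complexDag s) 1) : P.reForm.IsInvariant :=
  fun γ x v w => (congrArg (reFib (γ • x)) (P.B.map_act γ x v w)).trans (reFib_act γ _)

theorem SymBundle.reForm_bijective (P : SymBundle (complexDag s) 1) (x : X) :
    Function.Bijective (P.reForm.form x) := by
  refine ⟨(P.E.reDual_injective x).comp (P.B.bijective x).1, fun f => ?_⟩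
  obtain ⟨v, hv⟩ := (P.B.bijective x).2 (P.E.complexify x f)
  exact ⟨v, (congrArg (P.E.reDual x) hv).trans (P.E.reDual_complexify x f)⟩

theorem SymBundle.reForm_mulI (P : SymBundle (complexDag s) 1) (v w : P.E.restrict.Fib x) :
    P.reForm.form x (P.E.mulI x v) w = P.reForm.form x v (P.E.mulI x w) := by
  let v' : P.E.Fib x := v
  let w' : P.E.Fib x := w
  change reFib x (P.B.form x (imUnit 𝒜 x • v') w') = reFib x (P.B.form x v' (imUnit 𝒜 x • w'))
  rw [P.symm_one w' (imUnit 𝒜 x • v'), (P.B.form x w').map_smul, (P.B.form x v').map_smul,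
    smul_eq_mul, smul_eq_mul, (complexDag s).dag_mul, complexDag_imUnit, ← P.symm_one, mul_imUnit]

theorem SymBundle.form_eq (P : SymBundle (complexDag s) 1) (v w : P.E.Fib x) :
    P.B.form x v w = tmulFib conjAction (P.reForm.form x v w) 1 +
      tmulFib conjAction (-P.reForm.form x v (P.E.mulI x w)) Complex.I := by
  refine (eq_reFib _).trans ?_
  rw [P.E.reFib_imUnit_mul]
  rfl

/-- The symmetric form with a given real part. -/
def GBundle.symBundle (E : GBundle (complexBundle 𝒜)) (b : HForm s E.restrict)
    (hb : b.IsInvariant) (hbb : ∀ x, Function.Bijective (b.form x))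
    (hI : ∀ x v w, b.form x (E.mulI x v) w = b.form x v (E.mulI x w)) :
    SymBundle (complexDag s) 1 where
  E := E
  B :=
    { form := fun x => AddMonoidHom.mk' (fun v => E.complexify x (b.form x v)) fun v w => by
        refine E.reDual_injective x (LinearMap.ext fun u => ?_)
        change reFib x (E.complexify x (b.form x (v + w)) u) =
          reFib x (E.complexify x (b.form x v) u + E.complexify x (b.form x w) u)
        refine (E.reFib_complexify _ u).trans (Eq.trans ?_ (map_add (reFib x) _ _).symm)
        refine Eq.trans ?_ (congrArg₂ (· + ·) (E.reFib_complexify (b.form x v) u)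
          (E.reFib_complexify (b.form x w) u)).symm
        exact LinearMap.congr_fun (map_add (b.form x) v w) u
      symm := fun x v w => by
        rw [one_smul]
        change E.complexify x (b.form x w) v = (complexDag s).dag x (E.complexify x (b.form x v) w)
        refine reFib_ext ?_ ?_
        · rw [reFib_dag, E.reFib_complexify, E.reFib_complexify]
          exact b.herm x v w
        -- The imaginary part of the symmetry is where the self-adjointness of i with respect to b
        -- enters.
        · rw [E.reFib_imUnit_mul, E.reFib_complexify, ← complexDag_imUnit (s := s),
            ← (complexDag s).dag_mul, reFib_dag, mul_imUnit, E.reFib_imUnit_mul,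
            E.reFib_complexify, complexDag_imUnit (s := s)]
          exact (hI x w v).symm.trans (b.herm _ _ _)
      bijective := fun x => by
        constructor
        · intro v w h
          refine (hbb x).1 ?_
          rw [← E.reDual_complexify x (b.form x v), ← E.reDual_complexify x (b.form x w)]
          exact congrArg (E.reDual x) h
        · intro f
          obtain ⟨v, hv⟩ := (hbb x).2 (E.reDual x f)
          refine ⟨v, E.reDual_injective x ?_⟩
          rw [← hv]
          exact E.reDual_complexify x _
      map_act := fun γ x v w => by
        change E.complexify (γ • x) (b.form (γ • x) (E.act γ x v)) (E.act γ x w) =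
          (complexBundle 𝒜).act γ x (E.complexify x (b.form x v) w)
        refine reFib_ext ?_ ?_
        · rw [reFib_act, E.reFib_complexify, E.reFib_complexify]
          exact hb γ x v w
        · have h1 : imUnit 𝒜 (γ • x) = sgn γ • (complexBundle 𝒜).act γ x (imUnit 𝒜 x) := by
            rw [act_imUnit, smul_smul, Int.units_mul_self, one_smul]
          rw [E.reFib_imUnit_mul, E.reFib_complexify, h1, smul_mul_assoc, ← map_mul,
            sgn_map (reFib (γ • x)), reFib_act, E.reFib_imUnit_mul, E.reFib_complexify]
          refine (congrArg (b.form (γ • x) (E.act γ x v)) (?_ : _ =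
            sgn γ • E.act γ x (E.mulI x w))).trans ?_
          · rw [← h1]
            exact E.mulI_act γ w
          · refine (sgn_map (b.form (γ • x) (E.act γ x v)).toAddMonoidHom γ _).trans ?_
            exact congrArg _ (hb γ x v (E.mulI x w))
      continuous_form := by
        have h1 := GBundle.continuous_prodTop_fst E E
        have h2 := GBundle.continuous_prodTop_snd E E
        refine TwistedK.continuous_fibAdd (complexBundle 𝒜)
          (continuous_tmulFib (b.continuous_apply h1 h2) 1)
          (continuous_tmulFib (a := fun p : Tot (E.prod E).Fib =>
            -b.form p.proj p.snd.1 (E.mulI p.proj p.snd.2)) ?_ Complex.I)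
        have h3 := continuous_fibSmul (c := fun _ => (-1 : ℝ)) continuous_const
          (b.continuous_apply h1 (E.isContMap_mulI.comp_continuous h2))
        refine h3.congr fun p => ?_
        exact congrArg (fun a => (⟨p.proj, a⟩ : Tot 𝒜.Fib)) (neg_one_smul ℝ _) }

theorem GBundle.reForm_symBundle (E : GBundle (complexBundle 𝒜)) (b : HForm s E.restrict)
    (hb : b.IsInvariant) (hbb : ∀ x, Function.Bijective (b.form x))
    (hI : ∀ x v w, b.form x (E.mulI x v) w = b.form x v (E.mulI x w)) (v w : E.restrict.Fib x) :
    (E.symBundle b hb hbb hI).reForm.form x v w = b.form x v w :=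
  E.reFib_complexify (b.form x v) w

end Complex

/-! ### Positive real forms -/

section HalfMaps

variable {X : Type w} [TopologicalSpace X] [MulAction C2 X] {A : Type u} [NormedRing A]
  [NormedAlgebra ℝ A] {𝒜 : GAlgBundle C2 X A} {B : Type} [Ring B] [Algebra ℝ B]
  [Module.Finite ℝ B] {β : C2 →* (B ≃ₐ[ℝ] B)}

/-- The inclusion of a subbundle, as a linear map. -/
def IsSubbundle.incl {F : GBundle 𝒜} {E : GBundle (tensorBundle 𝒜 B β)}
    {ι : ∀ x, F.Fib x →+ E.Fib x} (h : IsSubbundle ι) (x : X) :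
    F.Fib x →ₗ[𝒜.Fib x] E.restrict.Fib x :=
  { ι x with map_smul' := h.map_smul x }

theorem IsSubbundle.isContMap_incl {F : GBundle 𝒜} {E : GBundle (tensorBundle 𝒜 B β)}
    {ι : ∀ x, F.Fib x →+ E.Fib x} (h : IsSubbundle ι) : IsContMap h.incl :=
  h.isEmbedding.continuous

theorem GBundle.isHalf_double (F : GBundle 𝒜) (R : HalfRep β) (hR : R.j 0 = 1) :
    IsHalf (F := F) (E := F.double R) R fun x => AddMonoidHom.inl (F.Fib x) (F.Fib x) where
  toIsSubbundle := F.isSubbundle_double R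
  j₀_smul := fun x v => by rw [hR, tmulFib_one, one_smul]
  existsUnique := fun x w => by
    let i₀ : F.Fib x → (F.double R).Fib x := fun v => ((v, 0) : F.Fib x × F.Fib x)
    have hj : ∀ v : F.Fib x, tmulFib β (1 : 𝒜.Fib x) (R.j 1) • i₀ v =
        ((0, v) : F.Fib x × F.Fib x) := fun v => by
      refine (F.double_tmulFib_smul R _ _ _).trans ?_
      rw [R.r_j, R.r_j, if_neg (by decide), if_pos rfl]
      refine Prod.ext ?_ ?_
      · change ((0 : ℝ) • (1 : 𝒜.Fib x)) • v + (R.r (R.j 1) 0 1 • (1 : 𝒜.Fib x)) • (0 : F.Fib x) = 0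
        rw [zero_smul, zero_smul, smul_zero, add_zero]
      · change ((1 : ℝ) • (1 : 𝒜.Fib x)) • v + (R.r (R.j 1) 1 1 • (1 : 𝒜.Fib x)) • (0 : F.Fib x) = v
        rw [one_smul, one_smul, smul_zero, add_zero]
    have hsum : ∀ p : F.Fib x × F.Fib x,
        i₀ p.1 + tmulFib β (1 : 𝒜.Fib x) (R.j 1) • i₀ p.2 = p := fun p => by
      rw [hj]
      exact Prod.ext (add_zero _) (zero_add _)
    exact ⟨w, (hsum w).symm, fun p hp => (hsum p).symm.trans hp.symm⟩

variable [CompleteSpace A] [StarRing A] {s : AntiInvolution 𝒜} (hs : s.IsModelledOnStar)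
  {H : Type*} [NormedAddCommGroup H] [InnerProductSpace ℝ H] [CompleteSpace H] (ρ : StarRep A H)
  [T2Space X] [ParacompactSpace X]

include hs ρ

/-- The coordinates on a bundle with a half. -/
theorem IsHalf.exists_coord {R : HalfRep β} {F : GBundle 𝒜} {E : GBundle (tensorBundle 𝒜 B β)}
    {ι : ∀ x, F.Fib x →+ E.Fib x} (h : IsHalf R ι) :
    ∃ π σ : ∀ x, E.restrict.Fib x →ₗ[𝒜.Fib x] F.Fib x, IsContMap π ∧ IsContMap σ ∧
      (∀ x w, w = h.incl x (π x w) + E.tmulEnd (R.j 1) x (h.incl x (σ x w))) ∧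
      ∀ γ x w, π (γ • x) (E.restrict.act γ x w) = F.act γ x (π x w) := by
  obtain ⟨Φ, hΦ⟩ := h.exists_iso hs ρ
  have hsm : ∀ x (a : 𝒜.Fib x) (w : E.Fib x), (Φ.equiv x).symm (tmulFib β a 1 • w) =
      ((a • ((Φ.equiv x).symm w).1, a • ((Φ.equiv x).symm w).2) : F.Fib x × F.Fib x) :=
    fun x a w => by
      rw [LinearEquiv.map_smul]
      refine (F.double_tmulFib_smul R a 1 _).trans ?_
      simp
      rfl
  refine ⟨fun x =>
    { toFun := fun w : E.Fib x => ((Φ.equiv x).symm w).1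
      map_add' := fun w w' : E.Fib x => congrArg Prod.fst (map_add (Φ.equiv x).symm w w')
      map_smul' := fun a w => congrArg Prod.fst (hsm x a w) }, fun x =>
    { toFun := fun w : E.Fib x => ((Φ.equiv x).symm w).2
      map_add' := fun w w' : E.Fib x => congrArg Prod.snd (map_add (Φ.equiv x).symm w w')
      map_smul' := fun a w => congrArg Prod.snd (hsm x a w) },
    (GBundle.continuous_prodTop_fst F F).comp Φ.continuous_invFun,
    (GBundle.continuous_prodTop_snd F F).comp Φ.continuous_invFun,
    fun x w => ?_, fun γ x w => ?_⟩
  · exact (((Φ.equiv x).apply_symm_apply w).symm.trans (hΦ x _))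
  · exact congrArg Prod.fst (Φ.symm.map_act γ x w)

end HalfMaps

/-! ### Complexification of a bundle with an invariant metric. -/

section MetricHalf

variable {X : Type w} [TopologicalSpace X] [MulAction C2 X] {A : Type u} [NormedRing A]
  [NormedAlgebra ℝ A] {𝒜 : GAlgBundle C2 X A} {s : AntiInvolution 𝒜}

theorem HForm.add_left {E : GBundle 𝒜} (b : HForm s E) {x : X} (v v' w : E.Fib x) :
    b.form x (v + v') w = b.form x v w + b.form x v' w := by
  rw [map_add, LinearMap.add_apply]

/-- `P` is the complexification of the bundle `F` with the metric `h`. -/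
structure IsMetricHalf {F : GBundle 𝒜} (h : Metric s F) (P : SymBundle (complexDag s) 1)
    (ι : ∀ x, F.Fib x →+ P.E.Fib x) : Prop extends IsHalf complexHalf ι where
  invariant : h.IsInvariant
  form : ∀ x (v w : F.Fib x), P.B.form x (ι x v) (ι x w) = tmulFib conjAction (h.form x v w) 1

variable {F : GBundle 𝒜} {h : Metric s F} {P P' : SymBundle (complexDag s) 1}
  {ι : ∀ x, F.Fib x →+ P.E.Fib x} {x : X}

theorem IsMetricHalf.isPositiveRealForm (hι : IsMetricHalf h P ι) : IsPositiveRealForm F P :=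
  ⟨ι, hι.toIsSubbundle, hι.existsUnique, fun x v w => ⟨_, hι.form x v w⟩, fun x v => by
    obtain ⟨a, ha⟩ := h.nonneg x v
    exact ⟨a, by rw [hι.form, ha]⟩⟩

theorem SymBundle.reForm_mulI_mulI (P : SymBundle (complexDag s) 1) (v w : P.E.restrict.Fib x) :
    P.reForm.form x (P.E.mulI x v) (P.E.mulI x w) = -P.reForm.form x v w := by
  rw [P.reForm_mulI, P.E.mulI_mulI, map_neg]

theorem SymBundle.reForm_right_mulI {v w : P.E.Fib x} {a : 𝒜.Fib x}
    (h : P.B.form x v w = tmulFib conjAction a 1) :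
    P.reForm.form x v (P.E.mulI x w) = 0 := by
  change reFib x (P.B.form x v (imUnit 𝒜 x • w)) = 0
  rw [(P.B.form x v).map_smul, h, smul_eq_mul, imUnit_mul_tmulFib, mul_one, reFib_I]

theorem IsMetricHalf.reForm (hι : IsMetricHalf h P ι) (v w : F.Fib x) :
    P.reForm.form x (hι.incl x v) (hι.incl x w) = h.form x v w :=
  (congrArg (reFib x) (hι.form x v w)).trans (reFib_one _)

/-- On F ⊕ iF the real part is h ⊖ h: the mixed terms are real parts of i times elements of 𝒜, and
i² = −1 gives the sign on iF. -/
theorem IsMetricHalf.reForm_eq (hι : IsMetricHalf h P ι) (p q : F.Fib x × F.Fib x) :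
    P.reForm.form x (hι.incl x p.1 + P.E.mulI x (hι.incl x p.2))
      (hι.incl x q.1 + P.E.mulI x (hι.incl x q.2)) = h.form x p.1 q.1 - h.form x p.2 q.2 := by
  have h0 : ∀ v w, P.reForm.form x (hι.incl x v) (P.E.mulI x (hι.incl x w)) = 0 := fun v w =>
    SymBundle.reForm_right_mulI (hι.form x v w)
  rw [HForm.add_left, map_add, map_add, P.reForm_mulI_mulI, P.reForm_mulI, h0, h0,
    hι.reForm, hι.reForm, add_zero, zero_add, sub_eq_add_neg]

theorem IsHalf.comp_iso {B : Type} [Ring B] [Algebra ℝ B] [Module.Finite ℝ B]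
    {β : C2 →* (B ≃ₐ[ℝ] B)} {R : HalfRep β} {F F' : GBundle 𝒜} {E : GBundle (tensorBundle 𝒜 B β)}
    {ι : ∀ x, F.Fib x →+ E.Fib x} (hι : IsHalf R ι) (θ : GBundle.Iso F' F) :
    IsHalf (F := F') R fun x => (ι x).comp ((θ.equiv x).toAddEquiv : F'.Fib x →+ F.Fib x) where
  toIsSubbundle := hι.toIsSubbundle.comp_iso θ (GBundle.Iso.refl E)
  j₀_smul := fun x v => hι.j₀_smul x (θ.equiv x v)
  existsUnique := fun x w => by
    obtain ⟨p, hp, hu⟩ := hι.existsUnique x w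
    refine ⟨((θ.equiv x).symm p.1, (θ.equiv x).symm p.2), ?_, fun q hq => ?_⟩
    · change w = ι x (θ.equiv x ((θ.equiv x).symm p.1)) +
        tmulFib β (1 : 𝒜.Fib x) (R.j 1) • ι x (θ.equiv x ((θ.equiv x).symm p.2))
      rw [LinearEquiv.apply_symm_apply, LinearEquiv.apply_symm_apply]
      exact hp
    · rw [← hu (θ.equiv x q.1, θ.equiv x q.2) hq, LinearEquiv.symm_apply_apply,
        LinearEquiv.symm_apply_apply]

theorem IsMetricHalf.comp_iso (hι : IsMetricHalf h P ι) {F' : GBundle 𝒜} (θ : GBundle.Iso F' F) :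
    IsMetricHalf (F := F') (h.comp θ.equiv θ.continuous_toFun) P
      fun x => (ι x).comp ((θ.equiv x).toAddEquiv : F'.Fib x →+ F.Fib x) where
  toIsHalf := hι.toIsHalf.comp_iso θ
  invariant := fun γ x v w => by
    change h.form _ (θ.equiv _ (F'.act γ x v)) (θ.equiv _ (F'.act γ x w)) =
      𝒜.act γ x (h.form x (θ.equiv x v) (θ.equiv x w))
    rw [θ.map_act, θ.map_act, hι.invariant]
  form := fun x v w => hι.form x (θ.equiv x v) (θ.equiv x w)

variable [CompleteSpace A] [StarRing A] (hs : s.IsModelledOnStar)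
  {H : Type*} [NormedAddCommGroup H] [InnerProductSpace ℝ H] [CompleteSpace H] (ρ : StarRep A H)
  [T2Space X] [ParacompactSpace X]

include hs ρ

/-- Both bundles are identified with the double of F, where the real part of the form depends on h
alone. The identifications are linear over 𝒜 ⊗ ℂ, so agreement of real parts gives agreement of
forms. -/
theorem IsMetricHalf.exists_isometry (hι : IsMetricHalf h P ι) {ι' : ∀ x, F.Fib x →+ P'.E.Fib x}
    (hι' : IsMetricHalf h P' ι') : Nonempty (Isometry P P') := by
  obtain ⟨Φ, hΦ⟩ := hι.toIsHalf.exists_iso hs ρ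
  obtain ⟨Φ', hΦ'⟩ := hι'.toIsHalf.exists_iso hs ρ
  have h1 : ∀ x v w, P'.reForm.form x (Φ'.equiv x v) (Φ'.equiv x w) =
      P.reForm.form x (Φ.equiv x v) (Φ.equiv x w) := fun x v w => by
    refine (congrArg₂ (fun a b => P'.reForm.form x a b) (hΦ' x v) (hΦ' x w)).trans ?_
    refine Eq.trans ?_ (congrArg₂ (fun a b => P.reForm.form x a b) (hΦ x v) (hΦ x w)).symm
    exact (hι'.reForm_eq v w).trans (hι.reForm_eq v w).symm
  have h2 : ∀ x (v w : (F.double complexHalf).Fib x),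
      P'.B.form x (Φ'.equiv x v) (Φ'.equiv x w) = P.B.form x (Φ.equiv x v) (Φ.equiv x w) :=
    fun x v w => by
      refine reFib_ext (h1 x v w) ?_
      rw [P.E.reFib_imUnit_mul, P'.E.reFib_imUnit_mul, ← LinearEquiv.map_smul,
        ← LinearEquiv.map_smul]
      exact h1 x v (imUnit 𝒜 x • w)
  refine ⟨{ Φ.symm.trans Φ' with map_form := fun x v w => ?_ }⟩
  obtain ⟨v, rfl⟩ := (Φ.equiv x).surjective v
  obtain ⟨w, rfl⟩ := (Φ.equiv x).surjective w
  change P'.B.form x (Φ'.equiv x ((Φ.equiv x).symm (Φ.equiv x v)))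
    (Φ'.equiv x ((Φ.equiv x).symm (Φ.equiv x w))) = _
  rw [LinearEquiv.symm_apply_apply, LinearEquiv.symm_apply_apply, h2]

/-- Any two invariant metrics are isometric. -/
theorem Metric.exists_isometry (g g' : Metric s F) (hg : g.IsInvariant) (hg' : g'.IsInvariant) :
    ∃ θ : GBundle.Iso F F, ∀ x v w, g'.form x (θ.equiv x v) (θ.equiv x w) = g.form x v w := by
  have hpos : ∀ x, IsPosEndoAt s x (g'.form x) (g'.op g.toHForm x) := fun x =>
    @IsPosEndo.mk _ _ _ (s.starRing x) _ _ _ _ (g'.op_symm g.toHForm x) fun v => by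
      rw [g'.op_spec]
      exact g.nonneg x v
  have hb := g'.op_bijective g.toHForm g.bijective
  -- Y is the square root of the operator representing g relative to g', so g'(Yv, Yw) = g'(Y²v, w)
  -- = g(v, w).
  obtain ⟨Y, hYc, hY⟩ := g'.exists_sqrt ρ hs (g'.isContMap_op ρ hs g.toHForm) hpos hb
  have hYb : ∀ x, Function.Bijective (Y x) := fun x => by
    have h1 : Function.Bijective (Y x ∘ Y x) := by
      have : Y x ∘ Y x = g'.op g.toHForm x := funext (hY x).1.2
      rw [this]
      exact hb x
    exact ⟨h1.1.of_comp, h1.2.of_comp⟩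
  obtain ⟨θ, hθ⟩ := exists_iso hs ρ (fun x => LinearEquiv.ofBijective (Y x) (hYb x))
    (fun γ x v => g'.sqrt_act hg' (g'.op_act hg' g.toHForm hg) hY γ x v) hYc
  refine ⟨θ, fun x v w => ?_⟩
  rw [hθ]
  change g'.form x (Y x v) (Y x w) = _
  obtain ⟨⟨hsym, -⟩, hsq⟩ := (hY x).1
  rw [← hsym, hsq, g'.op_spec]

/-- An isomorphism of the halves need not preserve the metrics. Correcting it by an isometry between
two invariant metrics on F reduces to a common half and metric. -/
theorem exists_isometry_of_isMetricHalf {F' : GBundle 𝒜} {h' : Metric s F'}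
    {ι' : ∀ x, F'.Fib x →+ P'.E.Fib x} (hι : IsMetricHalf h P ι) (hι' : IsMetricHalf h' P' ι')
    (φ : GBundle.Iso F F') : Nonempty (Isometry P P') := by
  have h1 := hι'.comp_iso φ
  obtain ⟨θ, hθ⟩ := h.exists_isometry hs ρ _ hι.invariant h1.invariant
  have h2 := h1.comp_iso θ
  refine hι.exists_isometry hs ρ (ι' := _) { h2 with invariant := hι.invariant, form := fun x v w => ?_ }
  rw [h2.form]
  exact congrArg (fun a => tmulFib conjAction a 1) (hθ x v w)

omit hs ρ [CompleteSpace A] [StarRing A] [T2Space X] [ParacompactSpace X] in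
/-- The complexification of a bundle with an invariant metric. -/
theorem exists_isMetricHalf (h : Metric s F) (hinv : h.IsInvariant) :
    ∃ (P : SymBundle (complexDag s) 1) (ι : ∀ x, F.Fib x →+ P.E.Fib x), IsMetricHalf h P ι := by
  let E := F.double complexHalf
  have hfst : ∀ x (a : 𝒜.Fib x) (w : E.restrict.Fib x), a • w =
      ((a • w.1, a • w.2) : F.Fib x × F.Fib x) := fun x a w => by
    refine (F.double_tmulFib_smul complexHalf a 1 w).trans ?_
    simp
    rfl
  let p₁ : ∀ x, E.restrict.Fib x →ₗ[𝒜.Fib x] F.Fib x := fun x =>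
    { toFun := fun w : F.Fib x × F.Fib x => w.1
      map_add' := fun _ _ => rfl
      map_smul' := fun a w => congrArg Prod.fst (hfst x a w) }
  let p₂ : ∀ x, E.restrict.Fib x →ₗ[𝒜.Fib x] F.Fib x := fun x =>
    { toFun := fun w : F.Fib x × F.Fib x => w.2
      map_add' := fun _ _ => rfl
      map_smul' := fun a w => congrArg Prod.snd (hfst x a w) }
  have hp₁ : IsContMap p₁ := GBundle.continuous_prodTop_fst F F
  have hp₂ : IsContMap p₂ := GBundle.continuous_prodTop_snd F F
  let b₁ := h.toHForm.comp p₁ hp₁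
  let b₂ := h.toHForm.comp p₂ hp₂
  -- The real part of the ℂ-bilinear extension of h to F ⊕ iF, negative on the second summand.
  let b : HForm s E.restrict :=
    { form := fun x => b₁.form x - b₂.form x
      herm := fun x v w => by
        change b₁.form x w v - b₂.form x w v = s.dag x (b₁.form x v w - b₂.form x v w)
        rw [map_sub, b₁.herm, b₂.herm]
      continuous_form := by
        have h1 := continuous_fibAdd 𝒜 b₁.continuous_form
          (continuous_fibSmul (c := fun _ => (-1 : ℝ)) continuous_const b₂.continuous_form)
        refine h1.congr fun p => congrArg (fun a => (⟨p.proj, a⟩ : Tot 𝒜.Fib)) ?_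
        rw [neg_one_smul, ← sub_eq_add_neg]
        rfl }
  have hb : ∀ x (v w : F.Fib x × F.Fib x), b.form x v w = h.form x v.1 w.1 - h.form x v.2 w.2 :=
    fun _ _ _ => rfl
  have hI : ∀ x (v : F.Fib x × F.Fib x), E.mulI x v = ((-v.2, v.1) : F.Fib x × F.Fib x) :=
    fun x v => by
      refine (F.double_tmulFib_smul complexHalf 1 Complex.I v).trans ?_
      simp [complexHalf, Algebra.leftMulMatrix_eq_repr_mul, Complex.basisOneI]
      rfl
  let P := E.symBundle b (fun γ x (v w : F.Fib x × F.Fib x) => by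
      change h.form (γ • x) (F.act γ x v.1) (F.act γ x w.1) -
        h.form (γ • x) (sgn γ • F.act γ x v.2) (sgn γ • F.act γ x w.2) =
          𝒜.act γ x (h.form x v.1 w.1 - h.form x v.2 w.2)
      have h1 : h.form (γ • x) (sgn γ • F.act γ x v.2) (sgn γ • F.act γ x w.2) =
          h.form (γ • x) (F.act γ x v.2) (F.act γ x w.2) := by
        rcases Int.units_eq_one_or (sgn γ) with hγ | hγ
        · rw [hγ, one_smul, one_smul]
        · rw [hγ, Units.neg_smul, one_smul, Units.neg_smul, one_smul, map_neg, map_neg,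
            LinearMap.neg_apply, neg_neg]
      rw [h1, hinv, hinv, map_sub])
    (fun x => by
      constructor
      · intro v w hvw
        have h1 : ∀ u : F.Fib x × F.Fib x, h.form x v.1 u.1 - h.form x v.2 u.2 =
            h.form x w.1 u.1 - h.form x w.2 u.2 := fun u => LinearMap.congr_fun hvw u
        refine Prod.ext ((h.bijective x).1 (LinearMap.ext fun u => ?_))
          ((h.bijective x).1 (LinearMap.ext fun u => ?_))
        · have h2 := h1 (u, 0)
          simpa using h2
        · have h2 := h1 (0, u)
          simpa using h2
      · intro f
        have hadd : ∀ v w : F.Fib x × F.Fib x, f (v + w) = f v + f w := fun v w => map_add f _ _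
        let f₁ : F.Fib x →ₗ[𝒜.Fib x] 𝒜.Fib x := f ∘ₗ (F.isSubbundle_double complexHalf).incl x
        let f₂ : F.Fib x →ₗ[𝒜.Fib x] 𝒜.Fib x :=
          f ∘ₗ E.mulI x ∘ₗ (F.isSubbundle_double complexHalf).incl x
        obtain ⟨v₁, hv₁⟩ := (h.bijective x).2 f₁
        -- The minus sign of b on iF is compensated here: the second component represents −f(i·).
        obtain ⟨v₂, hv₂⟩ := (h.bijective x).2 (-f₂)
        refine ⟨((v₁, v₂) : F.Fib x × F.Fib x), LinearMap.ext fun (u : F.Fib x × F.Fib x) => ?_⟩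
        rw [hb, hv₁, hv₂]
        change f ((u.1, 0) : F.Fib x × F.Fib x) -
          (-f (E.mulI x ((u.2, 0) : F.Fib x × F.Fib x))) = f u
        rw [hI, sub_neg_eq_add, ← hadd]
        refine congrArg f (Prod.ext ?_ ?_)
        · change u.1 + -0 = u.1
          rw [neg_zero, add_zero]
        · exact zero_add _)
    fun x (v w : F.Fib x × F.Fib x) => by
      refine (congrArg (fun a => b.form x a w) (hI x v)).trans
        (Eq.trans ?_ (congrArg (b.form x v) (hI x w)).symm)
      change h.form x (-v.2) w.1 - h.form x v.1 w.2 = h.form x v.1 (-w.2) - h.form x v.2 w.1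
      rw [map_neg, map_neg, LinearMap.neg_apply]
      abel
  refine ⟨P, _, { F.isHalf_double complexHalf rfl with invariant := hinv, form := fun x v w => ?_ }⟩
  refine (P.form_eq _ _).trans ?_
  have h1 : P.reForm.form x ((v, 0) : F.Fib x × F.Fib x) ((w, 0) : F.Fib x × F.Fib x) =
      h.form x v w := by
    refine (E.reForm_symBundle b _ _ _ _ _).trans ((hb x _ _).trans ?_)
    rw [map_zero, sub_zero]
  have h2 : P.reForm.form x ((v, 0) : F.Fib x × F.Fib x)
      (P.E.mulI x ((w, 0) : F.Fib x × F.Fib x)) = 0 := by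
    refine (E.reForm_symBundle b _ _ _ _ _).trans ?_
    refine (congrArg (b.form x ((v, 0) : F.Fib x × F.Fib x)) (hI x (w, 0))).trans
      ((hb x _ _).trans ?_)
    change h.form x v (-0) - h.form x 0 w = 0
    simp
  refine (congrArg₂ (fun a c => tmulFib conjAction a 1 + tmulFib conjAction (-c) Complex.I)
    h1 h2).trans ?_
  rw [neg_zero, tmulFib_zero_left, add_zero]

end MetricHalf

/-! ### Uniqueness and functoriality of positive real forms. -/

section PositiveRealForm

variable {X : Type w} [TopologicalSpace X] [MulAction C2 X] {A : Type u} [NormedRing A]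
  [NormedAlgebra ℝ A] {𝒜 : GAlgBundle C2 X A} {s : AntiInvolution 𝒜}
  {F F' : GBundle 𝒜} {P P' : SymBundle (complexDag s) 1}

theorem IsPositiveRealForm.of_isometry (h : IsPositiveRealForm F P) (Ψ : GBundle.Iso F' F)
    (Φ : Isometry P P') : IsPositiveRealForm F' P' := by
  obtain ⟨ι, hι, hu, h1, h2⟩ := h
  refine ⟨_, hι.comp_iso Ψ Φ.toIso, fun x w => ?_, fun x v w => ?_, fun x v => ?_⟩
  · obtain ⟨p, hp, hpu⟩ := hu x ((Φ.equiv x).symm w)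
    have h3 : ∀ q : F'.Fib x × F'.Fib x, w = Φ.equiv x (ι x (Ψ.equiv x q.1)) +
        tmulFib conjAction (1 : 𝒜.Fib x) Complex.I • Φ.equiv x (ι x (Ψ.equiv x q.2)) ↔
        (Φ.equiv x).symm w = ι x (Ψ.equiv x q.1) +
          tmulFib conjAction (1 : 𝒜.Fib x) Complex.I • ι x (Ψ.equiv x q.2) := fun q => by
      rw [LinearEquiv.symm_apply_eq, LinearEquiv.map_add, LinearEquiv.map_smul]
    refine ⟨((Ψ.equiv x).symm p.1, (Ψ.equiv x).symm p.2), (h3 _).2 ?_, fun q hq => ?_⟩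
    · rw [LinearEquiv.apply_symm_apply, LinearEquiv.apply_symm_apply]
      exact hp
    · rw [← hpu (Ψ.equiv x q.1, Ψ.equiv x q.2) ((h3 q).1 hq), LinearEquiv.symm_apply_apply,
        LinearEquiv.symm_apply_apply]
  · obtain ⟨a, ha⟩ := h1 x (Ψ.equiv x v) (Ψ.equiv x w)
    exact ⟨a, (Φ.map_form x _ _).trans ha⟩
  · obtain ⟨a, ha⟩ := h2 x (Ψ.equiv x v)
    exact ⟨a, (Φ.map_form x _ _).trans ha⟩

variable [CompleteSpace A] [StarRing A] (hs : s.IsModelledOnStar)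
  {H : Type*} [NormedAddCommGroup H] [InnerProductSpace ℝ H] [CompleteSpace H] (ρ : StarRep A H)

include hs ρ

/-- Needed for orthogonal sums: positive elements are closed under addition, which is visible on
vector states but not in the form c c^*. -/
theorem exists_mul_star_add {x : X} (a b : 𝒜.Fib x) :
    ∃ c, a * s.dag x a + b * s.dag x b = c * s.dag x c := by
  let := 𝒜.normedRing x
  let := 𝒜.normedAlgebra x
  let := s.starRing x
  have := 𝒜.completeSpace x
  refine (fibRep hs ρ x).exists_eq_mul_star ?_ fun ξ => ?_
  · change star (a * star a + b * star b) = a * star a + b * star b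
    rw [star_add, star_mul, star_mul, star_star, star_star]
  · rw [map_add]
    exact add_nonneg ((fibRep hs ρ x).ev_mul_star_nonneg ξ a)
      ((fibRep hs ρ x).ev_mul_star_nonneg ξ b)

variable [T2Space X] [ParacompactSpace X]

/-- The form of a positive real form is a metric. -/
theorem IsPositiveRealForm.exists_isMetricHalf (hF : IsPositiveRealForm F P) :
    ∃ (h : Metric s F) (ι : ∀ x, F.Fib x →+ P.E.Fib x), IsMetricHalf h P ι := by
  obtain ⟨ι, hι, hu, h1, h2⟩ := hF
  have hH : IsHalf complexHalf ι :=
    { hι with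
      j₀_smul := fun x v => one_smul _ _
      existsUnique := hu }
  obtain ⟨π, σ, hπ, hσ, hdec, -⟩ := hH.exists_coord hs ρ
  let b : HForm s F := P.reForm.comp hι.incl hι.isContMap_incl
  have hb : ∀ x v w, P.B.form x (ι x v) (ι x w) = tmulFib conjAction (b.form x v w) 1 :=
    fun x v w => by
      obtain ⟨a, ha⟩ := h1 x v w
      have h3 : b.form x v w = a := (congrArg (reFib x) ha).trans (reFib_one a)
      rw [ha, h3]
  have h0 : ∀ x v w, P.reForm.form x (hι.incl x v) (P.E.mulI x (hι.incl x w)) = 0 := fun x v w =>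
    SymBundle.reForm_right_mulI (hb x v w)
  have hbP : ∀ x v w, b.form x v w = P.reForm.form x (hι.incl x v) (hι.incl x w) :=
    fun _ _ _ => rfl
  have hdec' : ∀ x w, w = hι.incl x (π x w) + P.E.mulI x (hι.incl x (σ x w)) := hdec
  have hπι : ∀ x v, π x (hι.incl x v) = v := fun x v => by
    have h3 := (hu x (ι x v)).unique (y₁ := (v, 0)) (y₂ := (π x (hι.incl x v), σ x (hι.incl x v)))
      (by
        change ι x v = ι x v + tmulFib conjAction (1 : 𝒜.Fib x) Complex.I • ι x 0
        rw [map_zero, smul_zero, add_zero]) (hdec' x (hι.incl x v))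
    exact (congrArg Prod.fst h3).symm
  have hπI : ∀ x v, π x (P.E.mulI x (hι.incl x v)) = 0 := fun x v => by
    have h3 := (hu x (P.E.mulI x (hι.incl x v))).unique (y₁ := (0, v))
      (y₂ := (π x (P.E.mulI x (hι.incl x v)), σ x (P.E.mulI x (hι.incl x v)))) (by
        change P.E.mulI x (hι.incl x v) =
          ι x 0 + tmulFib conjAction (1 : 𝒜.Fib x) Complex.I • ι x v
        rw [map_zero, zero_add]
        rfl) (hdec' x (P.E.mulI x (hι.incl x v)))
    exact (congrArg Prod.fst h3).symm
  -- F and iF are orthogonal for Re B, so its nondegeneracy on E restricts to F: a functional is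
  -- extended by zero on iF and the representing vector projected to F.
  have hbij : ∀ x, Function.Bijective (b.form x) := fun x => by
    constructor
    · intro v v' hv
      refine hι.injective x ((P.reForm_bijective x).1 (LinearMap.ext fun w => ?_))
      change P.reForm.form x (hι.incl x v) w = P.reForm.form x (hι.incl x v') w
      rw [hdec' x w, map_add, map_add, h0, h0, ← hbP, ← hbP, hv]
    · intro f
      obtain ⟨u, hu⟩ := (P.reForm_bijective x).2 (f ∘ₗ π x)
      refine ⟨π x u, LinearMap.ext fun w => ?_⟩
      have h3 := LinearMap.congr_fun hu (hι.incl x w)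
      change _ = f (π x (hι.incl x w)) at h3
      rw [hπι] at h3
      rw [← h3, hbP]
      conv_rhs => rw [hdec' x u]
      rw [HForm.add_left, P.reForm_mulI, h0, add_zero]
  let h : Metric s F :=
    { b with
      nonneg := fun x v => by
        obtain ⟨a, ha⟩ := h2 x v
        refine ⟨a, ?_⟩
        change reFib x (P.B.form x (ι x v) (ι x v)) = _
        rw [ha, reFib_one]
      bijective := hbij }
  refine ⟨h, ι, { hH with invariant := fun γ x v w => ?_, form := hb }⟩
  refine Eq.trans ?_ (P.reForm_isInvariant γ x (hι.incl x v) (hι.incl x w))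
  exact congrArg₂ (fun a c => P.reForm.form (γ • x) a c) (hι.map_act γ x v) (hι.map_act γ x w)

/-- A positive real form is unique up to isomorphism. -/
theorem IsMetricHalf.exists_iso_of_left {h : Metric s F} {h' : Metric s F'}
    {ι : ∀ x, F.Fib x →+ P.E.Fib x} {ι' : ∀ x, F'.Fib x →+ P.E.Fib x} (hι : IsMetricHalf h P ι)
    (hι' : IsMetricHalf h' P ι') : Nonempty (GBundle.Iso F F') := by
  have key : ∀ {F F' : GBundle 𝒜} {h : Metric s F} {h' : Metric s F'}
      {ι : ∀ x, F.Fib x →+ P.E.Fib x} {ι' : ∀ x, F'.Fib x →+ P.E.Fib x} (hι : IsMetricHalf h P ι)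
      (hι' : IsMetricHalf h' P ι') (π : ∀ x, P.E.restrict.Fib x →ₗ[𝒜.Fib x] F.Fib x)
      (σ : ∀ x, P.E.restrict.Fib x →ₗ[𝒜.Fib x] F.Fib x)
      (π' : ∀ x, P.E.restrict.Fib x →ₗ[𝒜.Fib x] F'.Fib x)
      (σ' : ∀ x, P.E.restrict.Fib x →ₗ[𝒜.Fib x] F'.Fib x), IsContMap σ' →
      (∀ x w, w = hι.incl x (π x w) + P.E.mulI x (hι.incl x (σ x w))) →
      (∀ x w, w = hι'.incl x (π' x w) + P.E.mulI x (hι'.incl x (σ' x w))) →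
      ∀ x, Function.Bijective fun v => π x (hι'.incl x (π' x (hι.incl x v))) := by
    intro F F' h h' ι ι' hι hι' π σ π' σ' hσ' hd hd' x
    -- The component in iF' of a vector of F. As Re B is h' ⊖ h' on F' ⊕ iF', the projection of F to
    -- F' does not decrease the metric, and τ^*h' measures the excess.
    let τ : ∀ x, F.Fib x →ₗ[𝒜.Fib x] F'.Fib x := fun x => σ' x ∘ₗ hι.incl x
    have hτ : IsContMap τ := hσ'.comp hι.isContMap_incl
    obtain ⟨Fr⟩ := F.exists_frame x
    have hk := (IsPosFormAt.add_bijective hs ρ x Fr (h.isPosFormAt x) (h.bijective x).2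
      (h := (h'.toHForm.comp τ hτ).form x) (@IsPosForm.mk _ _ _ (s.starRing x) _ _ _
        ((h'.toHForm.comp τ hτ).herm x) fun v => h'.nonneg x (τ x v))).2
    have h1 : ∀ v w, h'.form x (π' x (hι.incl x v)) (π' x (hι.incl x w)) =
        h.form x v w + h'.form x (τ x v) (τ x w) := fun v w => by
      have h2 := hι'.reForm_eq (π' x (hι.incl x v), τ x v) (π' x (hι.incl x w), τ x w)
      have h3 := hι.reForm v w
      rw [hd' x (hι.incl x v), hd' x (hι.incl x w)] at h3
      rw [← h3]
      exact (eq_add_of_sub_eq h2.symm)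
    -- The two projections F → F' and F' → F are adjoint to each other, both being read off from Re
    -- B between F and F'.
    have h4 : ∀ v w', h'.form x (π' x (hι.incl x v)) w' = h.form x v (π x (hι'.incl x w')) :=
      fun v w' => by
        have h5 := hι'.reForm_eq (π' x (hι.incl x v), τ x v) (w', 0)
        have h6 := hι.reForm_eq (v, 0) (π x (hι'.incl x w'), σ x (hι'.incl x w'))
        simp only [map_zero, add_zero, LinearMap.zero_apply, sub_zero]
          at h5 h6
        rw [← h5, ← h6]
        exact congrArg₂ (fun a c => P.reForm.form x a c) (hd' x (hι.incl x v)).symm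
          (hd x (hι'.incl x w'))
    have h7 : ∀ v, h.form x (π x (hι'.incl x (π' x (hι.incl x v)))) =
        (h.form x + (h'.toHForm.comp τ hτ).form x) v := fun v => LinearMap.ext fun w => by
      rw [h.herm, ← h4, h1, map_add, ← h.herm, ← h'.herm]
      rfl
    have h8 : Function.Bijective (h.form x ∘ fun v => π x (hι'.incl x (π' x (hι.incl x v)))) := by
      have h9 : (h.form x ∘ fun v => π x (hι'.incl x (π' x (hι.incl x v)))) =
          (h.form x + (h'.toHForm.comp τ hτ).form x) := funext h7
      rw [h9]
      exact hk
    exact (Function.Bijective.of_comp_iff' (h.bijective x) _).1 h8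
  obtain ⟨π, σ, hπ, hσ, hd, hact⟩ := hι.toIsHalf.exists_coord hs ρ
  obtain ⟨π', σ', hπ', hσ', hd', hact'⟩ := hι'.toIsHalf.exists_coord hs ρ
  have hb := key hι hι' π σ π' σ' hσ' hd hd'
  have hb' := key hι' hι π' σ' π σ hσ hd' hd
  -- Bijectivity of the round trip from F gives injectivity of the projection to F', and that of the
  -- round trip from F' gives surjectivity.
  have hbij : ∀ x, Function.Bijective (π' x ∘ₗ hι.incl x) := fun x =>
    ⟨Function.Injective.of_comp (f := fun v => π x (hι'.incl x v)) (hb x).1,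
      Function.Surjective.of_comp (g := fun v => π x (hι'.incl x v)) (hb' x).2⟩
  obtain ⟨Φ, -⟩ := exists_iso hs ρ (fun x => LinearEquiv.ofBijective (π' x ∘ₗ hι.incl x) (hbij x))
    (fun γ x v => (congrArg (π' (γ • x)) (hι.map_act γ x v)).trans (hact' γ x (hι.incl x v)))
    (hπ'.comp hι.isContMap_incl)
  exact ⟨Φ⟩

theorem IsPositiveRealForm.exists_iso_of_left (h : IsPositiveRealForm F P)
    (h' : IsPositiveRealForm F' P) : Nonempty (GBundle.Iso F F') := by
  obtain ⟨_, _, hι⟩ := h.exists_isMetricHalf hs ρ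
  obtain ⟨_, _, hι'⟩ := h'.exists_isMetricHalf hs ρ
  exact hι.exists_iso_of_left hs ρ hι'

theorem IsPositiveRealForm.exists_isometry (h : IsPositiveRealForm F P)
    (h' : IsPositiveRealForm F P') : Nonempty (Isometry P P') := by
  obtain ⟨_, _, hι⟩ := h.exists_isMetricHalf hs ρ
  obtain ⟨_, _, hι'⟩ := h'.exists_isMetricHalf hs ρ
  exact exists_isometry_of_isMetricHalf hs ρ hι hι' (GBundle.Iso.refl F)

theorem exists_symBundle_of_realForm (F : GBundle 𝒜) :
    ∃ P : SymBundle (complexDag s) 1, IsPositiveRealForm F P := by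
  obtain ⟨h, hinv⟩ := exists_invariant_metric hs ρ F
  obtain ⟨P, _, hι⟩ := exists_isMetricHalf h hinv
  exact ⟨P, hι.isPositiveRealForm⟩

omit [T2Space X] [ParacompactSpace X] in
theorem IsPositiveRealForm.prod (h : IsPositiveRealForm F P) (h' : IsPositiveRealForm F' P') :
    IsPositiveRealForm (F.prod F') (P.prod P') := by
  obtain ⟨ι, hι, hu, h1, h2⟩ := h
  obtain ⟨ι', hι', hu', h1', h2'⟩ := h'
  have hval : ∀ x (v w : (F.prod F').Fib x) (a a' : 𝒜.Fib x),
      P.B.form x (ι x v.1) (ι x w.1) = tmulFib conjAction a 1 →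
      P'.B.form x (ι' x v.2) (ι' x w.2) = tmulFib conjAction a' 1 →
      (P.prod P').B.form x (ι x v.1, ι' x v.2) (ι x w.1, ι' x w.2) =
        tmulFib conjAction (a + a') 1 := fun x v w a a' ha ha' => by
    rw [tmulFib_add_left, ← ha, ← ha']
    rfl
  refine ⟨_, hι.prod hι', fun x w => ?_, fun x v w => ?_, fun x v => ?_⟩
  · obtain ⟨p, hp, hpu⟩ := hu x w.1
    obtain ⟨p', hp', hpu'⟩ := hu' x w.2
    refine ⟨((p.1, p'.1), (p.2, p'.2)), Prod.ext hp hp', fun q hq => ?_⟩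
    have h3 := hpu (q.1.1, q.2.1) (congrArg Prod.fst hq)
    have h4 := hpu' (q.1.2, q.2.2) (congrArg Prod.snd hq)
    rw [← h3, ← h4]
    rfl
  · obtain ⟨a, ha⟩ := h1 x v.1 w.1
    obtain ⟨a', ha'⟩ := h1' x v.2 w.2
    exact ⟨a + a', hval x v w a a' ha ha'⟩
  · obtain ⟨a, ha⟩ := h2 x v.1
    obtain ⟨a', ha'⟩ := h2' x v.2
    obtain ⟨c, hc⟩ := exists_mul_star_add hs ρ a a'
    exact ⟨c, (hval x v v _ _ ha ha').trans (congrArg (fun b => tmulFib conjAction b 1) hc)⟩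

end PositiveRealForm

/-! ### Existence of positive real forms by polarization. -/

section Existence

variable {X : Type w} [TopologicalSpace X] [MulAction C2 X] {A : Type u} [NormedRing A]
  [NormedAlgebra ℝ A] {𝒜 : GAlgBundle C2 X A} {s : AntiInvolution 𝒜}

theorem HForm.sgn_smul {E : GBundle 𝒜} (b : HForm s E) {x : X} (γ : C2) (v w : E.Fib x) :
    b.form x (sgn γ • v) (sgn γ • w) = b.form x v w := by
  rcases Int.units_eq_one_or (sgn γ) with hγ | hγ
  · rw [hγ, one_smul, one_smul]
  · rw [hγ, Units.neg_smul, one_smul, Units.neg_smul, one_smul, map_neg, map_neg,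
      LinearMap.neg_apply, neg_neg]

theorem HForm.neg_left {E : GBundle 𝒜} (b : HForm s E) {x : X} (v w : E.Fib x) :
    b.form x (-v) w = -b.form x v w := by
  rw [map_neg, LinearMap.neg_apply]

variable [CompleteSpace A] [StarRing A] (hs : s.IsModelledOnStar)
  {H : Type*} [NormedAddCommGroup H] [InnerProductSpace ℝ H] [CompleteSpace H] (ρ : StarRep A H)
  [T2Space X] [ParacompactSpace X]

include hs ρ

/-- There is an invariant metric for which `i` is an isometry. -/
theorem exists_unitary_metric (E : GBundle (complexBundle 𝒜)) : ∃ g : Metric s E.restrict,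
    g.IsInvariant ∧ ∀ x v w, g.form x (E.mulI x v) w = -g.form x v (E.mulI x w) := by
  obtain ⟨g₀, hg₀⟩ := exists_invariant_metric hs ρ E.restrict
  let I : ∀ x, E.restrict.Fib x ≃ₗ[𝒜.Fib x] E.restrict.Fib x := fun x =>
    LinearEquiv.ofLinearMap (E.mulI x) (-E.mulI x)
      (LinearMap.ext fun v => by
        change E.mulI x (-E.mulI x v) = v
        rw [map_neg, E.mulI_mulI, neg_neg])
      (LinearMap.ext fun v => by
        change -E.mulI x (E.mulI x v) = v
        rw [E.mulI_mulI, neg_neg])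
  -- Averaging over the powers of i: g(v, w) = g₀(v, w) + g₀(iv, iw), since −1 acts trivially on a
  -- form. Invariance survives because τ carries i to −i.
  obtain ⟨g, hg⟩ := g₀.exists_add hs ρ (g₀.comp I E.isContMap_mulI)
  have hg' : ∀ x v w, g.form x v w = g₀.form x v w + g₀.form x (E.mulI x v) (E.mulI x w) := hg
  refine ⟨g, fun γ x v w => ?_, fun x v w => ?_⟩
  · rw [hg', hg', E.mulI_act, E.mulI_act, HForm.sgn_smul, hg₀, hg₀, map_add]
  · rw [hg', hg', E.mulI_mulI, E.mulI_mulI, HForm.neg_left, map_neg]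
    abel

/-- A symmetric form over `𝒜 ⊗ ℂ` has a polarization: a continuous equivariant involution `J` that
anticommutes with `i`, such that `Re B(Jv, w)` is hermitian and positive. -/
theorem SymBundle.exists_polarization (P : SymBundle (complexDag s) 1) :
    ∃ J : ∀ x, P.E.restrict.Fib x →ₗ[𝒜.Fib x] P.E.restrict.Fib x, IsContMap J ∧
      (∀ γ x v, J (γ • x) (P.E.restrict.act γ x v) = P.E.restrict.act γ x (J x v)) ∧
      (∀ x v, J x (J x v) = v) ∧ (∀ x v, J x (P.E.mulI x v) = -P.E.mulI x (J x v)) ∧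
      (∀ x v, ∃ a, P.reForm.form x (J x v) v = a * s.dag x a) ∧
      ∀ x v w, P.reForm.form x (J x v) w = P.reForm.form x v (J x w) := by
  obtain ⟨g, hg, hgI⟩ := exists_unitary_metric hs ρ P.E
  let I := P.E.mulI
  have hII : ∀ x v, I x (I x v) = -v := fun x v => P.E.mulI_mulI v
  let b := P.reForm
  let T := g.op b
  have hTc : IsContMap T := g.isContMap_op ρ hs b
  have hTb := g.op_bijective b P.reForm_bijective
  have hTg : ∀ γ x v, T (γ • x) (P.E.restrict.act γ x v) = P.E.restrict.act γ x (T x v) :=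
    g.op_act hg b P.reForm_isInvariant
  have hTs : ∀ x v w, g.form x (T x v) w = g.form x v (T x w) := fun x => g.op_symm b x
  -- i is self-adjoint for Re B but skew for g, so the operator comparing the two anticommutes with
  -- it.
  have hTI : ∀ x v, T x (I x v) = -I x (T x v) := fun x v => by
    refine (g.bijective x).1 (LinearMap.ext fun w => ?_)
    rw [g.op_spec, HForm.neg_left, hgI, neg_neg, g.op_spec]
    exact P.reForm_mulI v w
  -- Y plays the role of |T|, the positive root of T².
  obtain ⟨Y, hYc, hY⟩ := g.exists_sqrt ρ hs (S := fun x => T x ∘ₗ T x) (hTc.comp hTc)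
    (fun x => @IsPosEndo.mk _ _ _ (s.starRing x) _ _ _ _
      (fun v w => (hTs x _ _).trans (hTs x _ _)) fun v => by
        obtain ⟨a, ha⟩ := g.nonneg x (T x v)
        exact ⟨a, (hTs x (T x v) v).trans ha⟩)
    (fun x => (hTb x).comp (hTb x))
  have hYg := g.sqrt_act hg (S := fun x => T x ∘ₗ T x)
    (fun γ x v => (congrArg (T (γ • x)) (hTg γ x v)).trans (hTg γ x _)) hY
  have hYs : ∀ x v w, g.form x (Y x v) w = g.form x v (Y x w) := fun x => by
    obtain ⟨⟨h, -⟩, -⟩ := (hY x).1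
    exact h
  have hYp : ∀ x v, ∃ a, g.form x (Y x v) v = a * s.dag x a := fun x => by
    obtain ⟨⟨-, h⟩, -⟩ := (hY x).1
    exact h
  have hYY : ∀ x v, Y x (Y x v) = T x (T x v) := fun x => (hY x).1.2
  have hYb : ∀ x, Function.Bijective (Y x) := fun x => by
    have h1 : Function.Bijective (Y x ∘ Y x) := by
      have h2 : Y x ∘ Y x = T x ∘ T x := funext (hYY x)
      rw [h2]
      exact (hTb x).comp (hTb x)
    exact ⟨h1.1.of_comp, h1.2.of_comp⟩
  have hYI : ∀ x v, Y x (I x v) = I x (Y x v) := fun x v => by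
    -- The conjugate of Y by i is again a positive root of T², which commutes with i as T
    -- anticommutes with it. By uniqueness it is Y.
    have h1 : -(I x ∘ₗ Y x ∘ₗ I x) = Y x := by
      refine (hY x).2 _ (@IsPosEndo.mk _ _ _ (s.starRing x) _ _ _ _ (fun v w => ?_) fun v => ?_)
        fun v => ?_
      · change g.form x (-I x (Y x (I x v))) w = g.form x v (-I x (Y x (I x w)))
        rw [HForm.neg_left, hgI, neg_neg, hYs, map_neg, hgI]
      · obtain ⟨a, ha⟩ := hYp x (I x v)
        refine ⟨a, ?_⟩
        change g.form x (-I x (Y x (I x v))) v = _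
        rw [HForm.neg_left, hgI, neg_neg, ha]
        rfl
      · change -I x (Y x (I x (-I x (Y x (I x v))))) = T x (T x v)
        rw [map_neg (I x), hII, neg_neg, hYY, hTI, map_neg, hTI, neg_neg, hII, neg_neg]
    have h2 := LinearMap.congr_fun h1 v
    change -I x (Y x (I x v)) = Y x v at h2
    rw [← h2, map_neg, hII, neg_neg]
  have hYT : ∀ x v, Y x (T x v) = T x (Y x v) := fun x v => by
    let Te := LinearEquiv.ofBijective (T x) (hTb x)
    have hTe : ∀ v, Te.symm (T x v) = v := fun v => Te.symm_apply_apply v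
    -- Likewise T Y T⁻¹ is a positive root of T²; its positivity at Tv reduces to that of Y at Yv
    -- because g(TYv, Tv) = g(Y(Yv), Yv).
    have h1 : T x ∘ₗ Y x ∘ₗ Te.symm.toLinearMap = Y x := by
      refine (hY x).2 _ (@IsPosEndo.mk _ _ _ (s.starRing x) _ _ _ _ (fun v w => ?_) fun v => ?_)
        fun v => ?_
      · obtain ⟨v, rfl⟩ := (hTb x).2 v
        obtain ⟨w, rfl⟩ := (hTb x).2 w
        change g.form x (T x (Y x (Te.symm (T x v)))) (T x w) =
          g.form x (T x v) (T x (Y x (Te.symm (T x w))))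
        rw [hTe, hTe, hTs, ← hTs x (T x v), ← hYY, ← hYY, ← hYs, hYs x (Y x v)]
      · obtain ⟨v, rfl⟩ := (hTb x).2 v
        obtain ⟨a, ha⟩ := hYp x (Y x v)
        refine ⟨a, ?_⟩
        change g.form x (T x (Y x (Te.symm (T x v)))) (T x v) = _
        rw [hTe, hTs, ← hYY, ← hYs, ha]
        rfl
      · obtain ⟨v, rfl⟩ := (hTb x).2 v
        change T x (Y x (Te.symm (T x (Y x (Te.symm (T x v)))))) = T x (T x (T x v))
        rw [hTe, hTe, hYY]
    have h2 := LinearMap.congr_fun h1 (T x v)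
    change T x (Y x (Te.symm (T x v))) = Y x (T x v) at h2
    rw [← h2, hTe]
  let Ye : ∀ x, P.E.restrict.Fib x ≃ₗ[𝒜.Fib x] P.E.restrict.Fib x := fun x =>
    LinearEquiv.ofBijective (Y x) (hYb x)
  -- J = |T|⁻¹T is the sign of T. Then TJ = |T|, so Re B(Jv, w) = g(|T|v, w) is positive.
  let J : ∀ x, P.E.restrict.Fib x →ₗ[𝒜.Fib x] P.E.restrict.Fib x := fun x =>
    (Ye x).symm.toLinearMap ∘ₗ T x
  have hYJ : ∀ x v, Y x (J x v) = T x v := fun x v => (Ye x).apply_symm_apply (T x v)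
  have hTJ : ∀ x v, T x (J x v) = Y x v := fun x v => (hYb x).1 (by
    rw [hYT, hYJ, hYY])
  have hbJ : ∀ x v w, b.form x (J x v) w = g.form x (Y x v) w := fun x v w => by
    rw [← g.op_spec, ← hTJ]
  refine ⟨J, (g.isContMap_symm ρ hs g (φ := Ye) hYc).comp hTc, fun γ x v => (hYb _).1 ?_,
    fun x v => (hYb x).1 ?_, fun x v => (hYb x).1 ?_, fun x v => ?_, fun x v w => ?_⟩
  · rw [hYJ, hYg, hYJ, hTg]
  · rw [hYJ, hTJ]
  · refine (hYJ x (I x v)).trans ?_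
    rw [hTI, map_neg]
    exact congrArg _ ((congrArg (I x) (hYJ x v)).symm.trans (hYI x _).symm)
  · obtain ⟨a, ha⟩ := hYp x v
    exact ⟨a, (hbJ x v v).trans ha⟩
  · refine (hbJ x v w).trans ((hYs x v w).trans ?_)
    rw [P.reForm.herm, g.herm]
    exact congrArg _ (hbJ x w v).symm

/-- A symmetric form over `𝒜 ⊗ ℂ` has a positive real form. -/
theorem exists_isPositiveRealForm (P : SymBundle (complexDag s) 1) :
    ∃ F : GBundle 𝒜, IsPositiveRealForm F P := by
  obtain ⟨J, hJc, hJg, hJJ, hJI, hJp, hJs⟩ := P.exists_polarization hs ρ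
  obtain ⟨g⟩ : Nonempty (Metric s P.E.restrict) := exists_metric ρ hs P.E.restrict
  let c : ∀ x, 𝒜.Fib x := fun x => algebraMap ℝ (𝒜.Fib x) (1 / 2)
  have hc : ∀ x (v : P.E.restrict.Fib x), c x • v + c x • v = v := fun x v => by
    rw [← add_smul, ← map_add, add_halves, map_one, one_smul]
  -- The projection (1 + J)/2 onto the fixed vectors of J. Since J anticommutes with i,
  -- multiplication by i exchanges the eigenbundles for 1 and −1, whence E = F ⊕ iF.
  let e : ∀ x, P.E.restrict.Fib x →ₗ[𝒜.Fib x] P.E.restrict.Fib x := fun x =>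
    { toFun := fun v => c x • (v + J x v)
      map_add' := fun v w => by
        rw [map_add, ← smul_add]
        congr 1
        abel
      map_smul' := fun a v => by
        rw [map_smul, ← smul_add, smul_smul, RingHom.id_apply, smul_smul]
        exact congrArg (· • (v + J x v)) (Algebra.commutes _ a) }
  have he_apply : ∀ x v, e x v = c x • (v + J x v) := fun _ _ => rfl
  have hJe : ∀ x v, J x (e x v) = e x v := fun x v => by
    rw [he_apply, map_smul, map_add, hJJ, add_comm]
  have heJ : ∀ x v, J x v = v → e x v = v := fun x v hv => by
    rw [he_apply, hv, smul_add, hc]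
  have he : IsProj e :=
    { cont := P.E.restrict.continuous_realSmul (1 / 2)
        (P.E.restrict.continuous_fibAdd continuous_id hJc)
      idem := fun x v => heJ x _ (hJe x v)
      map_act := fun γ x v => by
        rw [he_apply, he_apply, P.E.restrict.act_smul, map_add, hJg]
        congr 1
        exact ((𝒜.act γ x).commutes _).symm }
  have heI : ∀ x v, J x v = v → e x (P.E.mulI x v) = 0 := fun x v hv => by
    rw [he_apply, hJI, hv, add_neg_cancel, smul_zero]
  -- Moving J across the form sends iw to −iw, so the value equals its own negative. This says that
  -- B takes values in 𝒜 on F.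
  have h0 : ∀ x v w, J x v = v → J x w = w → P.reForm.form x v (P.E.mulI x w) = 0 :=
    fun x v w hv hw => by
      have h1 : P.reForm.form x v (P.E.mulI x w) = -P.reForm.form x v (P.E.mulI x w) := by
        have h2 := hJs x v (P.E.mulI x w)
        rwa [hv, hJI, hw, map_neg] at h2
      have h2 : (2 : ℝ) • P.reForm.form x v (P.E.mulI x w) = 0 := by
        rw [two_smul]
        exact add_eq_zero_iff_eq_neg.2 h1
      rw [← one_smul ℝ (P.reForm.form x v (P.E.mulI x w)), ← inv_mul_cancel₀ (two_ne_zero' ℝ),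
        mul_smul, h2, smul_zero]
  have hfix : ∀ x (v : LinearMap.range (e x)), J x v.1 = v.1 := by
    rintro x ⟨_, v, rfl⟩
    exact hJe x v
  have hdec : ∀ x v w, J x v = v → J x w = w →
      e x (v + P.E.mulI x w) = v ∧ e x (-P.E.mulI x (v + P.E.mulI x w)) = w := fun x v w hv hw => by
    rw [map_add, heJ x v hv, heI x w hw, add_zero, map_add, P.E.mulI_mulI, neg_add, neg_neg,
      map_add, map_neg, heI x v hv, heJ x w hw, neg_zero, zero_add]
    exact ⟨rfl, rfl⟩
  let F := imageBundle he (he.isLocallyTrivial ρ hs g)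
  let ι : ∀ x, F.Fib x →+ P.E.Fib x := fun x => (LinearMap.range (e x)).subtype.toAddMonoidHom
  have hι : IsSubbundle ι := IsSubbundle.mk (F := F) (fun _ _ _ => rfl) (fun _ _ _ => rfl)
    (isEmbedding_image e)
  refine ⟨F, ι, hι, fun x w => ?_, fun x v w => ⟨P.reForm.form x v.1 w.1, ?_⟩, fun x v => ?_⟩
  · let w' : P.E.restrict.Fib x := w
    -- The real and imaginary components of w are e(w) and e(−iw).
    refine ⟨(⟨e x w', w', rfl⟩, ⟨e x (-P.E.mulI x w'), -P.E.mulI x w', rfl⟩), ?_, fun p hp => ?_⟩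
    · change w' = e x w' + P.E.mulI x (e x (-P.E.mulI x w'))
      rw [he_apply, he_apply, map_neg, hJI, neg_neg, map_smul, map_add, map_neg, P.E.mulI_mulI,
        neg_neg, P.E.mulI_mulI, ← smul_add, add_add_add_comm, add_neg_cancel, add_zero, smul_add,
        hc]
    · have h1 := hdec x _ _ (hfix x p.1) (hfix x p.2)
      have h2 : w' = p.1.1 + P.E.mulI x p.2.1 := hp
      rw [← h2] at h1
      exact Prod.ext (Subtype.ext h1.1.symm) (Subtype.ext h1.2.symm)
  · refine (P.form_eq _ _).trans ?_
    refine (congrArg (fun a => tmulFib conjAction (P.reForm.form x v.1 w.1) 1 +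
      tmulFib conjAction (-a) Complex.I) (h0 x v.1 w.1 (hfix x v) (hfix x w))).trans ?_
    rw [neg_zero, tmulFib_zero_left, add_zero]
  · obtain ⟨a, ha⟩ := hJp x v.1
    rw [hfix x v] at ha
    refine ⟨a, (P.form_eq _ _).trans ?_⟩
    refine (congrArg₂ (fun a c => tmulFib conjAction a 1 +
      tmulFib conjAction (-c) Complex.I) ha (h0 x v.1 v.1 (hfix x v) (hfix x v))).trans ?_
    rw [neg_zero, tmulFib_zero_left, add_zero]

variable [ContinuousSMul C2 X]

/-- The isomorphism `GR^{𝒜 ⊗ ℂ}(X) ≅ K_G^𝒜(X)`. -/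
theorem exists_realForm_equiv : ∃ f : GW (complexDag s) 1 ≃+ KG 𝒜,
    ∀ P : SymBundle (complexDag s) 1, (∃ F : GBundle 𝒜, IsPositiveRealForm F P) ∧
      ∀ F : GBundle 𝒜, IsPositiveRealForm F P → f (GW.cls P) = KG.cls F := by
  obtain ⟨f, hf⟩ := exists_grothendieck_equiv
    (fun (m : IsometryClass (complexDag s) 1) (n : IsoClass 𝒜) =>
      ∃ P F, m = Quotient.mk _ P ∧ n = Quotient.mk _ F ∧ IsPositiveRealForm F P)
    (by
      rintro ⟨P⟩
      obtain ⟨F, hF⟩ := exists_isPositiveRealForm hs ρ P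
      exact ⟨_, P, F, rfl, rfl, hF⟩)
    (by
      rintro ⟨F⟩
      obtain ⟨P, hP⟩ := exists_symBundle_of_realForm hs ρ F
      exact ⟨_, P, F, rfl, rfl, hP⟩)
    (by
      rintro _ _ _ ⟨P, F, rfl, rfl, h⟩ ⟨P', F', hP, rfl, h'⟩
      obtain ⟨Φ⟩ := Quotient.exact hP
      exact Quotient.sound ((h.of_isometry (GBundle.Iso.refl F) Φ).exists_iso_of_left hs ρ h'))
    (by
      rintro _ _ _ ⟨P, F, rfl, rfl, h⟩ ⟨P', F', rfl, hF, h'⟩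
      obtain ⟨Ψ⟩ := Quotient.exact hF
      exact Quotient.sound (h.exists_isometry hs ρ (h'.of_isometry Ψ P'.reflI)))
    (by
      rintro _ _ _ _ ⟨P, F, rfl, rfl, h⟩ ⟨P', F', rfl, rfl, h'⟩
      exact ⟨P.prod P', F.prod F', rfl, rfl, h.prod hs ρ h'⟩)
  exact ⟨f, fun P => ⟨exists_isPositiveRealForm hs ρ P, fun F hF => hf _ _ ⟨P, F, rfl, rfl, hF⟩⟩⟩

end Existence

/-! ### Transfer along an isomorphism of algebra bundles -/

section Transfer

variable {X : Type w} [TopologicalSpace X] [MulAction C2 X]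
  {D : Type u} [Ring D] [Algebra ℝ D] [TopologicalSpace D]
  {C : Type u} [Ring C] [Algebra ℝ C] [TopologicalSpace C]

/-- An isomorphism of algebra bundles that is constant in the charts. -/
structure AlgBundleEquiv (𝒟 : GAlgBundle C2 X D) (𝒞 : GAlgBundle C2 X C) where
  equiv : ∀ x, 𝒟.Fib x ≃ₐ[ℝ] 𝒞.Fib x
  map_act : ∀ g x d, equiv (g • x) (𝒟.act g x d) = 𝒞.act g x (equiv x d)
  continuous_toFun :
    Continuous fun p : Tot 𝒟.Fib => (⟨p.proj, equiv p.proj p.snd⟩ : Tot 𝒞.Fib)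
  continuous_invFun :
    Continuous fun p : Tot 𝒞.Fib => (⟨p.proj, (equiv p.proj).symm p.snd⟩ : Tot 𝒟.Fib)
  model : D ≃ₐ[ℝ] C
  continuous_model : Continuous model
  continuous_model_symm : Continuous model.symm
  dom_le : ∀ x₀, 𝒞.dom x₀ ⊆ 𝒟.dom x₀
  dom_ge : ∀ x₀, 𝒟.dom x₀ ⊆ 𝒞.dom x₀
  map_chart : ∀ x₀ (x : 𝒞.dom x₀) d,
    𝒞.chart x₀ x (equiv x d) = model (𝒟.chart x₀ ⟨x, dom_le x₀ x.2⟩ d)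

variable {𝒟 : GAlgBundle C2 X D} {𝒞 : GAlgBundle C2 X C}

def AlgBundleEquiv.symm (θ : AlgBundleEquiv 𝒟 𝒞) : AlgBundleEquiv 𝒞 𝒟 where
  equiv := fun x => (θ.equiv x).symm
  map_act := fun g x c => by
    rw [AlgEquiv.symm_apply_eq, θ.map_act, AlgEquiv.apply_symm_apply]
  continuous_toFun := θ.continuous_invFun
  continuous_invFun := θ.continuous_toFun
  model := θ.model.symm
  continuous_model := θ.continuous_model_symm
  continuous_model_symm := θ.continuous_model
  dom_le := θ.dom_ge
  dom_ge := θ.dom_le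
  map_chart := fun x₀ x c => by
    obtain ⟨d, rfl⟩ := (θ.equiv x).surjective c
    rw [AlgEquiv.symm_apply_apply, θ.map_chart x₀ ⟨x, θ.dom_ge x₀ x.2⟩ d,
      AlgEquiv.symm_apply_apply]

def AlgBundleEquiv.toMap (θ : AlgBundleEquiv 𝒟 𝒞) : AlgBundleMap 𝒟 𝒞 where
  map := fun x => θ.equiv x
  map_act := θ.map_act
  model := θ.model
  dom_le := θ.dom_le
  map_chart := θ.map_chart
  fg := by
    let _ : Module D C := Module.compHom C (θ.model : D →ₐ[ℝ] C).toRingHom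
    refine ⟨Unit, inferInstance,
      ⟨{ toFun := fun c _ => θ.model.symm c
         map_add' := fun c c' => funext fun _ => map_add θ.model.symm c c'
         map_smul' := fun d c => funext fun _ => ?_ },
        continuous_pi fun _ => θ.continuous_model_symm⟩,
      ⟨{ toFun := fun a => θ.model (a ())
         map_add' := fun a b => map_add θ.model (a ()) (b ())
         map_smul' := fun d a => map_mul θ.model d (a ()) },
        θ.continuous_model.comp (continuous_apply ())⟩, fun c => θ.model.apply_symm_apply c⟩
    change θ.model.symm (θ.model d * c) = d * θ.model.symm c
    rw [map_mul, AlgEquiv.symm_apply_apply]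

variable {s : AntiInvolution 𝒟} {t : AntiInvolution 𝒞} {ε : ℤˣ}

/-- Transfer of a form along an isomorphism of algebra bundles. -/
def SymBundle.comap (θ : AlgBundleEquiv 𝒟 𝒞)
    (hθ : ∀ x d, θ.equiv x (s.dag x d) = t.dag x (θ.equiv x d)) (P : SymBundle t ε) :
    SymBundle s ε where
  E := P.E.comap θ.toMap
  B :=
    { form := fun x => AddMonoidHom.mk' (fun v : P.E.Fib x =>
        { toFun := fun w : P.E.Fib x => (θ.equiv x).symm (P.B.form x v w)
          map_add' := fun w w' : P.E.Fib x =>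
            (congrArg _ (map_add (P.B.form x v) w w')).trans (map_add (θ.equiv x).symm _ _)
          map_smul' := fun d (w : P.E.Fib x) => by
            refine (congrArg (θ.equiv x).symm ((P.B.form x v).map_smul (θ.equiv x d) w)).trans ?_
            rw [smul_eq_mul, map_mul, AlgEquiv.symm_apply_apply]
            rfl }) fun v v' : P.E.Fib x => LinearMap.ext fun w : P.E.Fib x => by
        change (θ.equiv x).symm (P.B.form x (v + v') w) =
          (θ.equiv x).symm (P.B.form x v w) + (θ.equiv x).symm (P.B.form x v' w)
        rw [map_add, LinearMap.add_apply, map_add]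
      symm := fun x v w => by
        refine (θ.equiv x).injective ?_
        change θ.equiv x ((θ.equiv x).symm (P.B.form x w v)) =
          θ.equiv x (ε • s.dag x ((θ.equiv x).symm (P.B.form x v w)))
        have h : ∀ d : 𝒟.Fib x, θ.equiv x (ε • d) = ε • θ.equiv x d := fun d => by
          rcases Int.units_eq_one_or ε with h | h
          · rw [h, one_smul, one_smul]
          · rw [h, Units.neg_smul, one_smul, Units.neg_smul, one_smul, map_neg]
        rw [h, hθ, AlgEquiv.apply_symm_apply, AlgEquiv.apply_symm_apply]
        exact P.B.symm x v w
      bijective := fun x => by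
        constructor
        · intro v w h
          refine (P.B.bijective x).1 (LinearMap.ext fun u => (θ.equiv x).symm.injective ?_)
          exact LinearMap.congr_fun h u
        · intro f
          let f' : P.E.Fib x →ₗ[𝒞.Fib x] 𝒞.Fib x :=
            { toFun := fun w => θ.equiv x (f w)
              map_add' := fun w w' => (congrArg _ (map_add f w w')).trans (map_add (θ.equiv x) _ _)
              map_smul' := fun c w => by
                have h := f.map_smul ((θ.equiv x).symm c) w
                let v : P.E.Fib x := w
                refine (congrArg (fun c' : 𝒞.Fib x => θ.equiv x (f (c' • v)))
                  ((θ.equiv x).apply_symm_apply c).symm).trans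
                  ((congrArg (θ.equiv x) h).trans ?_)
                rw [smul_eq_mul, map_mul, AlgEquiv.apply_symm_apply]
                rfl }
          obtain ⟨v, hv⟩ := (P.B.bijective x).2 f'
          refine ⟨v, LinearMap.ext fun w => ?_⟩
          refine (congrArg (θ.equiv x).symm (LinearMap.congr_fun hv w)).trans ?_
          exact (θ.equiv x).symm_apply_apply (f w)
      map_act := fun g x v w => by
        refine (congrArg (θ.equiv (g • x)).symm (P.B.map_act g x v w)).trans ?_
        exact (θ.symm.map_act g x _)
      continuous_form := θ.continuous_invFun.comp P.B.continuous_form }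

theorem SymBundle.comap_isometry (θ : AlgBundleEquiv 𝒟 𝒞)
    (hθ : ∀ x d, θ.equiv x (s.dag x d) = t.dag x (θ.equiv x d)) {P Q : SymBundle t ε}
    (h : Nonempty (Isometry P Q)) : Nonempty (Isometry (P.comap θ hθ) (Q.comap θ hθ)) := by
  obtain ⟨φ⟩ := h
  exact ⟨{ equiv := fun x => comapEquiv θ.toMap (φ.equiv x)
           map_act := φ.map_act
           continuous_toFun := φ.continuous_toFun
           continuous_invFun := φ.continuous_invFun
           map_form := fun x v w => congrArg (θ.equiv x).symm (φ.map_form x v w) }⟩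

theorem SymBundle.comap_comap (θ : AlgBundleEquiv 𝒟 𝒞)
    (hθ : ∀ x d, θ.equiv x (s.dag x d) = t.dag x (θ.equiv x d))
    (hθ' : ∀ x c, θ.symm.equiv x (t.dag x c) = s.dag x (θ.symm.equiv x c)) (P : SymBundle s ε) :
    Nonempty (Isometry ((P.comap θ.symm hθ').comap θ hθ) P) :=
  ⟨{ equiv := fun x =>
      { AddEquiv.refl (P.E.Fib x) with
        map_smul' := fun d (v : P.E.Fib x) => by
          change (θ.equiv x).symm (θ.equiv x d) • v = d • v
          rw [AlgEquiv.symm_apply_apply] }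
     map_act := fun _ _ _ => rfl
     continuous_toFun := continuous_id
     continuous_invFun := continuous_id
     map_form := fun x v w => ((θ.equiv x).symm_apply_apply (P.B.form x v w)).symm }⟩

/-- Transfer changes only the ring of operators and the values of the form, not the underlying
bundle. So transfer along θ and along its inverse undo each other, with the identity map as
isometry. -/
theorem exists_transfer_equiv [ContinuousSMul C2 X] [ContinuousAdd D] [ContinuousAdd C]
    (θ : AlgBundleEquiv 𝒟 𝒞) (hθ : ∀ x d, θ.equiv x (s.dag x d) = t.dag x (θ.equiv x d)) :
    Nonempty (GW t ε ≃+ GW s ε) := by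
  have hθ' : ∀ x c, θ.symm.equiv x (t.dag x c) = s.dag x (θ.symm.equiv x c) := fun x c => by
    change (θ.equiv x).symm (t.dag x c) = s.dag x ((θ.equiv x).symm c)
    rw [AlgEquiv.symm_apply_eq, hθ, AlgEquiv.apply_symm_apply]
  obtain ⟨f, -⟩ := exists_grothendieck_equiv
    (fun (m : IsometryClass t ε) (n : IsometryClass s ε) =>
      ∃ P : SymBundle t ε, m = Quotient.mk _ P ∧ n = Quotient.mk _ (P.comap θ hθ))
    (by
      rintro ⟨P⟩
      exact ⟨_, P, rfl, rfl⟩)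
    (by
      rintro ⟨Q⟩
      refine ⟨_, Q.comap θ.symm hθ', rfl, ?_⟩
      obtain ⟨φ⟩ := SymBundle.comap_comap θ hθ hθ' Q
      exact Quotient.sound ⟨SymBundle.symmI φ⟩)
    (by
      rintro _ _ _ ⟨P, rfl, rfl⟩ ⟨P', h, rfl⟩
      exact Quotient.sound (SymBundle.comap_isometry θ hθ (Quotient.exact h)))
    (by
      rintro _ _ _ ⟨P, rfl, rfl⟩ ⟨P', rfl, h⟩
      obtain ⟨φ⟩ := SymBundle.comap_comap θ.symm hθ' hθ P
      obtain ⟨φ'⟩ := SymBundle.comap_comap θ.symm hθ' hθ P'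
      obtain ⟨ψ⟩ := SymBundle.comap_isometry θ.symm hθ' (Quotient.exact h)
      exact Quotient.sound ⟨SymBundle.transI (SymBundle.symmI φ) (SymBundle.transI ψ φ')⟩)
    (by
      rintro _ _ _ _ ⟨P, rfl, rfl⟩ ⟨P', rfl, rfl⟩
      refine ⟨P.prod P', rfl, Quotient.sound ⟨{
        equiv := fun x =>
          { AddEquiv.refl (P.E.Fib x × P'.E.Fib x) with map_smul' := fun d v => rfl }
        map_act := fun _ _ _ => rfl
        continuous_toFun := continuous_id
        continuous_invFun := continuous_id
        map_form := fun x v w => map_add (θ.equiv x).symm _ _ }⟩⟩)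
  exact ⟨f⟩

end Transfer

/-! ### The trivial bundle with fibre ℝ, and symmetric forms on Real vector bundles. -/

section TrivialReal

variable (X : Type w) [TopologicalSpace X] [MulAction C2 X] [ContinuousSMul C2 X]

theorem continuous_trivialBundle_iff {A : Type u} [Ring A] [Algebra ℝ A] [TopologicalSpace A]
    {X : Type w} [TopologicalSpace X] [MulAction C2 X] [ContinuousSMul C2 X]
    {ρ : C2 →* (A ≃ₐ[ℝ] A)} {hρ : Continuous fun q : C2 × A => ρ q.1 q.2} {Z : Type*}
    [TopologicalSpace Z] {φ : Z → Tot (trivialBundle X ρ hρ).Fib} :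
    Continuous φ ↔ (Continuous fun z => (φ z).proj) ∧ Continuous fun z => ((φ z).snd : A) :=
  continuous_induced_rng.trans continuous_prodMk

/-- The trivial real line bundle of algebras. -/
abbrev realR : GAlgBundle C2 X ℝ :=
  trivialBundle X (1 : C2 →* (ℝ ≃ₐ[ℝ] ℝ)) continuous_snd

/-- The identity, as an anti-involution of `X × ℝ`. -/
def realRDag : AntiInvolution (realR X) where
  dag := fun _ => LinearMap.id
  dag_dag := fun _ _ => rfl
  dag_mul := fun _ a b => mul_comm (G := ℝ) a b
  dag_act := fun _ _ _ => rfl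
  continuous_dag := continuous_id

theorem realRDag_isModelledOnStar : (realRDag X).IsModelledOnStar := fun _ _ _ => rfl

/-- The representation of `ℝ` on itself. -/
def realStarRep : StarRep ℝ ℝ where
  π := Algebra.ofId ℝ (ℝ →L[ℝ] ℝ)
  norm_π := fun a => norm_algebraMap' (ℝ →L[ℝ] ℝ) a
  π_star := fun a => (algebraMap_star_comm (A := ℝ →L[ℝ] ℝ) a)

theorem lid_eq (t : ℝ ⊗[ℝ] ℂ) : Algebra.TensorProduct.lid ℝ ℂ t =
    ⟨slice ℝ Complex.reLm t, slice ℝ Complex.imLm t⟩ := by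
  induction t using TensorProduct.induction_on with
  | zero => simp; rfl
  | tmul a z => apply Complex.ext <;> simp [slice, mul_comm]
  | add p q hp hq => rw [map_add, hp, hq, map_add, map_add]; rfl

/-- `ℂ ≅ ℝ ⊗ ℂ`. -/
def realCEquiv : AlgBundleEquiv (realC X) (complexBundle (realR X)) where
  equiv := fun _ => (Algebra.TensorProduct.lid ℝ ℂ).symm
  map_act := fun g x (z : ℂ) => by
    change (1 : ℝ) ⊗ₜ[ℝ] conjAction g z = 1 ⊗ₜ[ℝ] conjAction g z
    rfl
  continuous_toFun := by
    refine continuous_tensor_iff.2 fun f => ?_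
    have h := continuous_trivialBundle_iff.1
      (continuous_id : Continuous fun p : Tot (realC X).Fib => p)
    refine continuous_trivialBundle_iff.2 ⟨h.1, ?_⟩
    have hf : Continuous f := LinearMap.continuous_of_finiteDimensional f
    have key : ∀ z : ℂ, f z = slice ℝ f ((1 : ℝ) ⊗ₜ[ℝ] z) := fun z => by
      rw [slice_tmul, smul_eq_mul, mul_one]
    exact (hf.comp h.2).congr fun p => key p.snd
  continuous_invFun := by
    have h := fun f => (continuous_trivialBundle_iff.1 (continuous_tensor_iff.1
      (continuous_id : Continuous fun p : Tot (complexBundle (realR X)).Fib => p) f))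
    refine continuous_trivialBundle_iff.2 ⟨(h 0).1, ?_⟩
    have h1 : Continuous fun p : Tot (complexBundle (realR X)).Fib =>
        (⟨fibSlice conjAction Complex.reLm p.proj p.snd,
          fibSlice conjAction Complex.imLm p.proj p.snd⟩ : ℂ) :=
      Complex.equivRealProdCLM.symm.continuous.comp
        ((h Complex.reLm).2.prodMk (h Complex.imLm).2)
    exact h1.congr fun p => (lid_eq p.snd).symm
  model := (Algebra.TensorProduct.lid ℝ ℂ).symm
  continuous_model := by
    refine continuous_to_tensor_iff.2 fun f => ?_
    have hf : Continuous f := LinearMap.continuous_of_finiteDimensional f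
    refine hf.congr fun z => ?_
    change f z = slice ℝ f ((1 : ℝ) ⊗ₜ[ℝ] z)
    rw [slice_tmul, smul_eq_mul, mul_one]
  continuous_model_symm := by
    have h1 : Continuous fun t : ℝ ⊗[ℝ] ℂ =>
        (⟨slice ℝ Complex.reLm t, slice ℝ Complex.imLm t⟩ : ℂ) :=
      Complex.equivRealProdCLM.symm.continuous.comp
        ((continuous_slice Complex.reLm).prodMk (continuous_slice Complex.imLm))
    exact h1.congr fun t => (lid_eq t).symm
  dom_le := fun _ => subset_rfl
  dom_ge := fun _ => subset_rfl
  map_chart := fun x₀ x z => by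
    change (1 : ℝ) ⊗ₜ[ℝ] (z : ℂ) = (1 : ℝ) ⊗ₜ[ℝ] (z : ℂ)
    rfl

/-- The isomorphism `GR(X) ≅ KO_G(X)`. -/
theorem nonempty_GR_equiv_KOG [T2Space X] [ParacompactSpace X] : Nonempty (GR X ≃+ KOG X) := by
  obtain ⟨f, -⟩ := exists_realForm_equiv (realRDag_isModelledOnStar X) realStarRep
  -- Over ℝ the second isomorphism concerns forms over ℝ ⊗ ℂ, while `GR X` is defined with fibre ℂ;
  -- the anti-involution is the identity on both sides.
  obtain ⟨e⟩ := exists_transfer_equiv (s := realCDag X) (t := complexDag (realRDag X)) (ε := 1)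
    (realCEquiv X) fun x z => rfl
  exact ⟨e.symm.trans f⟩

end TrivialReal

end TwistedK

end

theorem mainTheorem3 {X : Type*} [TopologicalSpace X] [T2Space X] [ParacompactSpace X]
    [MulAction TwistedK.C2 X] [ContinuousSMul TwistedK.C2 X]
    {A : Type*} [NormedRing A] [NormedAlgebra ℝ A] [CompleteSpace A] [StarRing A]
    (hA : TwistedK.IsRealCStarAlgebra A)
    (𝒜 : TwistedK.GAlgBundle TwistedK.C2 X A)
    (s : TwistedK.AntiInvolution 𝒜) (hs : s.IsModelledOnStar) :
    (∃ f : TwistedK.KR (TwistedK.plusBundle 𝒜) ≃+ TwistedK.KG 𝒜,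
      ∀ E : TwistedK.GBundle (TwistedK.plusBundle 𝒜),
        (∃ F : TwistedK.GBundle 𝒜, TwistedK.IsCorner F E) ∧
        ∀ F : TwistedK.GBundle 𝒜, TwistedK.IsCorner F E →
          f (TwistedK.KG.cls E) = TwistedK.KG.cls F) ∧
    (∃ g : TwistedK.GW (TwistedK.complexDag s) 1 ≃+ TwistedK.KG 𝒜,
      ∀ P : TwistedK.SymBundle (TwistedK.complexDag s) 1,
        (∃ F : TwistedK.GBundle 𝒜, TwistedK.IsPositiveRealForm F P) ∧
        ∀ F : TwistedK.GBundle 𝒜, TwistedK.IsPositiveRealForm F P →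
          g (TwistedK.GW.cls P) = TwistedK.KG.cls F) ∧
    Nonempty (TwistedK.GR X ≃+ TwistedK.KOG X) := by
  obtain ⟨H, _, _, _, π, h1, h2⟩ := hA
  let ρ : TwistedK.StarRep A H := ⟨π, h1, h2⟩
  exact ⟨TwistedK.exists_corner_equiv hs ρ, TwistedK.exists_realForm_equiv hs ρ,
    TwistedK.nonempty_GR_equiv_KOG X⟩
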